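/- Write $a^s=a_1^{s_1}a_2^{s_2}$ and $d^*a=\frac{da_1\,da_2}{a_1a_2}$ for $a\in\mathbb R_+^2$, $s\in\mathbb C^2$. Tempered distributions on $\mathbb R_+^2$ are defined as tempered distributions on $\mathbb R^2$ by means of the isomorphism $\exp:\mathbb R^2\to\mathbb R_+^2$. A distribution $f$ on $\mathbb R_+^2$ is absolutely tempered if $f(a)a^s$ is tempered for every $s\in\mathbb C^2$; let $\mathcal D(\mathbb R_+^2)_{\rm abs}$ be the space of these. The Mellin transform of such an $f$ is the function $F(s)=\int f(a)a^s\,d^*a$; that is, for each $\sigma\in\mathbb R^2$ the function $\tau\mapsto F(\sigma+i\tau)$ is the Fourier transform $\int f(a)a^{\sigma}a^{i\tau}d^*a$ of the tempered distribution $f(a)a^\sigma$. Let $Y_2$ be the space of positive definite quadratic forms $q$ on $\mathbb R^2$. A point $q\in Y_2$ gives the bundle $E=(\mathbb Z^2,\mathbb R^2,q)$, and $\mathrm{Bun}_2=GL_2(\mathbb Z)\backslash Y_2$. A rank one subbundle $E'\subset E$ is a primitive sublattice $\mathbb Zv\subset\mathbb Z^2$, and $\deg E'=q(v)^{-1/2}$,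 $\deg E=(\det q)^{-1/2}$, $\deg (E/E')=\deg E/\deg E'$. For $f\in\mathcal D(\mathbb R_+^2)_{\rm abs}$ the extended Hall product is the series $$\widehat *_{1,1}(f)(E)=\sum_{E'\subset E}\deg(E')^{1/2}\deg(E/E')^{-1/2}f(\deg E',\deg (E/E'))$$ of distributions on $Y_2$, each term being the pullback of a distribution under the submersion $E\mapsto(\deg E',\deg(E/E'))$; a distribution on $\mathrm{Bun}_2$ is the same as a $GL_2(\mathbb Z)$-invariant distribution on $Y_2$. Let $\zeta^*(s)=\pi^{-s/2}\Gamma(s/2)\zeta(s)$ and $\Phi(s)=\zeta^*(s)/\zeta^*(s+1)$. Let $\mathcal R_2$ be the space of entire functions $F$ on $\mathbb C^2$ that satisfy $$F(s_1,s_2)+\Phi(s_1-s_2)F(s_2,s_1)=0$$ as an identity of meromorphic functions, and that have at most polynomial growth on vertical planes, locally uniformly in the real part: for every $R$ there are $C$, $N$ such that $|F(s)|\le C(1+|\operatorname{Im}s_1|+|\operatorname{Im}s_2|)^N$ whenever $|\operatorname{Re}s_1|,|\operatorname{Re}s_2|\le R$. Then for every $f\in\mathcal D(\mathbb R_+^2)_{\rm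 abs}$ the series $\widehat *_{1,1}(f)$ converges absolutely when paired with any $h\in C_0^\infty(Y_2)$, and the Mellin transform is a linear isomorphism from $\widehat R_2=\operatorname{Ker}(\widehat *_{1,1})\subset\mathcal D(\mathbb R_+^2)_{\rm abs}$ onto $\mathcal R_2$. -/

import Mathlib

open MeasureTheory Set
open scoped SchwartzMap FourierTransform Distributions ContDiff

noncomputable section

namespace HallQuad

/-! ### Absolutely tempered distributions on `ℝ₊²` and the Mellin transform

The group isomorphism `exp : ℝ² → ℝ₊²` carries the Lebesgue measure to `d*a = da₁ da₂ / (a₁ a₂)`,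
and tempered distributions on `ℝ₊²` are by definition tempered distributions on `ℝ²`.
A distribution `f(a)` is therefore written in the logarithmic coordinate `x`, `a = exp x`;
a function `f(a)` corresponds to the functional `φ ↦ ∫ f(exp x) φ(x) dx = ∫ f(a) φ(log a) d*a`. -/

/-- The plane of logarithmic coordinates `x = (log a₁, log a₂)`. -/
abbrev LogPlane : Type := EuclideanSpace ℝ (Fin 2)

/-- The character `a^s = a₁^{s₁} a₂^{s₂}` in logarithmic coordinates. -/
def character (s : ℂ × ℂ) (x : LogPlane) : ℂ :=
  Complex.exp (s.1 * (x 0 : ℂ) + s.2 * (x 1 : ℂ))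

/-- The tempered distribution `g` is the distribution `f(a) a^s`: the two agree as distributions,
that is, on compactly supported test functions. -/
def IsTwist (f : 𝓢'(LogPlane, ℂ)) (s : ℂ × ℂ) (g : 𝓢'(LogPlane, ℂ)) : Prop :=
  ∀ φ ψ : 𝓢(LogPlane, ℂ), HasCompactSupport φ → (∀ x, ψ x = character s x * φ x) → g φ = f ψ

/-- The space `𝒟(ℝ₊²)_abs` of absolutely tempered distributions: `f(a) a^s` is tempered for every
`s ∈ ℂ²` (in particular, for `s = 0`, the distribution `f` itself). -/
def absTempered : Submodule ℂ 𝓢'(LogPlane, ℂ) where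
  carrier := {f | ∀ s : ℂ × ℂ, ∃ g, IsTwist f s g}
  zero_mem' := fun s => ⟨0, fun φ ψ _ _ => by simp⟩
  add_mem' := by
    intro f₁ f₂ h₁ h₂ s
    obtain ⟨g₁, hg₁⟩ := h₁ s
    obtain ⟨g₂, hg₂⟩ := h₂ s
    refine ⟨g₁ + g₂, fun φ ψ hφ hψ => ?_⟩
    have e₁ := hg₁ φ ψ hφ hψ
    have e₂ := hg₂ φ ψ hφ hψ
    change g₁ φ + g₂ φ = f₁ ψ + f₂ ψ
    rw [e₁, e₂]
  smul_mem' := by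
    intro c f h s
    obtain ⟨g, hg⟩ := h s
    refine ⟨c • g, fun φ ψ hφ hψ => ?_⟩
    have e := hg φ ψ hφ hψ
    change c • g φ = c • f ψ
    rw [e]

/-- `F` is the Mellin transform `F(s) = ∫ f(a) a^s d*a` of the absolutely tempered distribution `f`:
on each vertical plane `σ + iℝ²` the function `F(σ + iτ)` is the Fourier transform
`∫ f(a) a^σ a^{iτ} d*a` of the tempered distribution `f(a) a^σ`. With the kernel
`exp(-2πi⟨x, ξ⟩)` of `𝓕` this means `τ = -2πξ`. -/
def IsMellinTransform (f : 𝓢'(LogPlane, ℂ)) (F : ℂ × ℂ → ℂ) : Prop :=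
  ∀ σ : ℝ × ℝ, ∃ g : 𝓢'(LogPlane, ℂ), IsTwist f ((σ.1 : ℂ), (σ.2 : ℂ)) g ∧
    ∀ φ : 𝓢(LogPlane, ℂ), 𝓕 g φ =
      ∫ ξ : LogPlane, F ((σ.1 : ℂ) - 2 * (Real.pi : ℂ) * Complex.I * (ξ 0 : ℂ),
        (σ.2 : ℂ) - 2 * (Real.pi : ℂ) * Complex.I * (ξ 1 : ℂ)) * φ ξ

/-! ### The space of entire functions -/

/-- At most polynomial growth on vertical planes `σ + iℝ²`, locally uniformly in `σ ∈ ℝ²`. -/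
def HasVerticalPolyGrowth (F : ℂ × ℂ → ℂ) : Prop :=
  ∀ R : ℝ, ∃ (C : ℝ) (N : ℕ), ∀ s : ℂ × ℂ, |s.1.re| ≤ R → |s.2.re| ≤ R →
    ‖F s‖ ≤ C * (1 + |s.1.im| + |s.2.im|) ^ N

/-- The global Harish-Chandra function `Φ(s) = ζ*(s) / ζ*(s + 1)`, where
`ζ*(s) = π^{-s/2} Γ(s/2) ζ(s)`. -/
def Phi (s : ℂ) : ℂ := completedRiemannZeta s / completedRiemannZeta (s + 1)

/-- The points at which the formula for `Phi` has its true value: `s` and `s + 1` avoid the poles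
`0, 1` of `ζ*`, and `ζ*(s + 1) ≠ 0`. The excluded set is closed and discrete. -/
def PhiRegular (s : ℂ) : Prop :=
  s ≠ 0 ∧ s ≠ 1 ∧ s ≠ -1 ∧ completedRiemannZeta (s + 1) ≠ 0

/-- The space `ℛ₂` of entire functions `F` on `ℂ²` of at most polynomial growth on vertical planes
with `F(s₁, s₂) + Φ(s₁ - s₂) F(s₂, s₁) = 0`, an identity of meromorphic functions. -/
def functionalSolutions : Submodule ℂ (ℂ × ℂ → ℂ) where
  carrier := {F | Differentiable ℂ F ∧ HasVerticalPolyGrowth F ∧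
    ∀ s : ℂ × ℂ, PhiRegular (s.1 - s.2) → F s + Phi (s.1 - s.2) * F (s.2, s.1) = 0}
  zero_mem' := by
    refine ⟨differentiable_const 0, fun R => ⟨0, 0, fun s _ _ => by simp⟩, fun s _ => by simp⟩
  add_mem' := by
    rintro F G ⟨hF, gF, eF⟩ ⟨hG, gG, eG⟩
    refine ⟨hF.add hG, fun R => ?_, fun s hs => ?_⟩
    · obtain ⟨C, N, hC⟩ := gF R
      obtain ⟨D, M, hD⟩ := gG R
      refine ⟨|C| + |D|, max N M, fun s h₁ h₂ => ?_⟩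
      have hb : (1 : ℝ) ≤ 1 + |s.1.im| + |s.2.im| := by
        have := abs_nonneg s.1.im
        have := abs_nonneg s.2.im
        linarith
      have key : ∀ (K : ℝ) (n : ℕ), n ≤ max N M →
          K * (1 + |s.1.im| + |s.2.im|) ^ n ≤ |K| * (1 + |s.1.im| + |s.2.im|) ^ max N M := by
        intro K n hn
        have h0 : (0 : ℝ) ≤ (1 + |s.1.im| + |s.2.im|) ^ n := by positivity
        have h1 := pow_le_pow_right₀ hb hn
        calc K * (1 + |s.1.im| + |s.2.im|) ^ n
            ≤ |K| * (1 + |s.1.im| + |s.2.im|) ^ n :=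
              mul_le_mul_of_nonneg_right (le_abs_self K) h0
          _ ≤ _ := mul_le_mul_of_nonneg_left h1 (abs_nonneg K)
      calc ‖(F + G) s‖ ≤ ‖F s‖ + ‖G s‖ := norm_add_le _ _
        _ ≤ _ := add_le_add (hC s h₁ h₂) (hD s h₁ h₂)
        _ ≤ _ := add_le_add (key C N (le_max_left _ _)) (key D M (le_max_right _ _))
        _ = _ := by ring
    · have h₁ := eF s hs
      have h₂ := eG s hs
      simp only [Pi.add_apply]
      linear_combination h₁ + h₂
  smul_mem' := by
    rintro c F ⟨hF, gF, eF⟩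
    refine ⟨hF.const_smul c, fun R => ?_, fun s hs => ?_⟩
    · obtain ⟨C, N, hC⟩ := gF R
      refine ⟨‖c‖ * C, N, fun s h₁ h₂ => ?_⟩
      calc ‖(c • F) s‖ = ‖c‖ * ‖F s‖ := by simp
        _ ≤ ‖c‖ * (C * (1 + |s.1.im| + |s.2.im|) ^ N) :=
          mul_le_mul_of_nonneg_left (hC s h₁ h₂) (norm_nonneg c)
        _ = _ := by ring
    · have h₁ := eF s hs
      simp only [Pi.smul_apply, smul_eq_mul]
      linear_combination c * h₁

/-! ### Rank two bundles and their rank one subbundles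

A rank two bundle is, up to isomorphism, `(ℤ², ℝ², q)` with `q` a positive definite quadratic form,
so that `Bun₂ = GL₂(ℤ) \ Y₂` with `Y₂` the space of positive definite forms. Distributions on the
orbifold `Bun₂` are the `GL₂(ℤ)`-invariant distributions on `Y₂`. -/

/-- The point `(A, B, C)` stands for the quadratic form `q(x, y) = A x² + 2 B x y + C y²`. -/
abbrev Form : Type := ℝ × ℝ × ℝ

/-- The value `q(x, y)`. -/
def Form.eval (q : Form) (x y : ℝ) : ℝ := q.1 * x ^ 2 + 2 * q.2.1 * x * y + q.2.2 * y ^ 2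

/-- The determinant of the Gram matrix of `q`, the square of the covolume of `ℤ²`. -/
def Form.disc (q : Form) : ℝ := q.1 * q.2.2 - q.2.1 ^ 2

/-- The open cone `Y₂` of positive definite forms. -/
def posForms : TopologicalSpace.Opens Form where
  carrier := {q | 0 < q.1 ∧ 0 < q.disc}
  is_open' := by
    have h₁ : IsOpen {q : Form | 0 < q.1} := isOpen_lt continuous_const continuous_fst
    have h₂ : IsOpen {q : Form | 0 < q.disc} := by
      apply isOpen_lt continuous_const
      unfold Form.disc
      fun_prop
    exact h₁.inter h₂

theorem mem_posForms {q : Form} : q ∈ posForms ↔ 0 < q.1 ∧ 0 < q.disc := Iff.rfl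

/-- `posForms` consists exactly of the positive definite forms. -/
theorem mem_posForms_iff_posDef {q : Form} :
    q ∈ posForms ↔ ∀ x y : ℝ, (x, y) ≠ (0, 0) → 0 < q.eval x y := by
  rw [mem_posForms]
  constructor
  · rintro ⟨hA, hd⟩ x y hxy
    have e : q.1 * q.eval x y = (q.1 * x + q.2.1 * y) ^ 2 + q.disc * y ^ 2 := by
      unfold Form.eval Form.disc; ring
    have hpos : 0 < q.1 * q.eval x y := by
      rw [e]
      by_cases hy : y = 0
      · have hx : x ≠ 0 := fun hx => hxy (by rw [hx, hy])
        have : 0 < (q.1 * x) ^ 2 := by positivity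
        simpa [hy] using this
      · have := sq_nonneg (q.1 * x + q.2.1 * y)
        have : 0 < q.disc * y ^ 2 := by positivity
        linarith
    exact (mul_pos_iff_of_pos_left hA).1 hpos
  · intro h
    have hA : 0 < q.1 := by simpa [Form.eval] using h 1 0 (by simp)
    refine ⟨hA, ?_⟩
    have := h (-q.2.1) q.1 (by simp [hA.ne'])
    have e : q.eval (-q.2.1) q.1 = q.1 * q.disc := by unfold Form.eval Form.disc; ring
    rw [e] at this
    exact (mul_pos_iff_of_pos_left hA).1 this

/-- Primitive vectors of `ℤ²`. A rank one subbundle `E'` of `E = (ℤ², ℝ², q)` is the same as a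
rank one primitive sublattice of `ℤ²`, and such a sublattice has exactly two generators `± v`. -/
abbrev PrimVec : Type := {v : ℤ × ℤ // IsCoprime v.1 v.2}

/-- `deg(E')` for the subbundle `E'` spanned by `v`. -/
def degSub (q : Form) (v : PrimVec) : ℝ := 1 / √(q.eval v.1.1 v.1.2)

/-- `deg(E / E')` for the subbundle `E'` spanned by `v`: by multiplicativity it is
`deg(E) / deg(E')`, where `deg(E)` is the inverse covolume. -/
def degQuot (q : Form) (v : PrimVec) : ℝ := (1 / √q.disc) / degSub q v

/-- The quadratic form of `E / E'` is the minimum of `q` over the cosets of `V'`; its value at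
the generator of the quotient lattice is `1 / deg(E / E') ^ 2`. -/
theorem isLeast_degQuot {q : Form} (hq : q ∈ posForms) (v : PrimVec) (w : ℤ × ℤ)
    (hw : v.1.1 * w.2 - v.1.2 * w.1 = 1) :
    IsLeast (range fun t : ℝ => q.eval (w.1 + t * v.1.1) (w.2 + t * v.1.2))
      (1 / degQuot q v ^ 2) := by
  have hw' : (v.1.1 : ℝ) * w.2 - v.1.2 * w.1 = 1 := by exact_mod_cast hw
  have hv : 0 < q.eval v.1.1 v.1.2 := by
    refine mem_posForms_iff_posDef.1 hq _ _ fun h => ?_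
    simp only [Prod.mk.injEq] at h
    rw [h.1, h.2] at hw'
    simp at hw'
  have hd : 0 < q.disc := hq.2
  have e : 1 / degQuot q v ^ 2 = q.disc / q.eval v.1.1 v.1.2 := by
    unfold degQuot degSub
    have h1 : √q.disc ^ 2 = q.disc := Real.sq_sqrt hd.le
    have h2 : √(q.eval v.1.1 v.1.2) ^ 2 = q.eval v.1.1 v.1.2 := Real.sq_sqrt hv.le
    have h3 : 0 < √q.disc := Real.sqrt_pos.2 hd
    have h4 : 0 < √(q.eval v.1.1 v.1.2) := Real.sqrt_pos.2 hv
    field_simp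
    rw [h1, h2]
    ring
  rw [e]
  obtain ⟨A, B, C⟩ := q
  obtain ⟨⟨m, n⟩, hmn⟩ := v
  obtain ⟨k, l⟩ := w
  simp only [Form.eval, Form.disc] at *
  have key : ∀ t : ℝ, (A * (m : ℝ) ^ 2 + 2 * B * m * n + C * n ^ 2) *
      (A * (k + t * m) ^ 2 + 2 * B * (k + t * m) * (l + t * n) + C * (l + t * n) ^ 2) =
      (A * C - B ^ 2) + ((A * (m : ℝ) ^ 2 + 2 * B * m * n + C * n ^ 2) * t +
        (A * m * k + B * (m * l + n * k) + C * n * l)) ^ 2 := by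
    intro t
    have e2 : ((m : ℝ) * l - n * k) ^ 2 = 1 := by rw [hw']; norm_num
    linear_combination (A * C - B ^ 2) * e2
  constructor
  · refine ⟨-(A * m * k + B * (m * l + n * k) + C * n * l) /
      (A * (m : ℝ) ^ 2 + 2 * B * m * n + C * n ^ 2), ?_⟩
    rw [eq_div_iff hv.ne', mul_comm]
    beta_reduce
    rw [key, mul_div_cancel₀ _ hv.ne']
    ring
  · rintro _ ⟨t, rfl⟩
    rw [div_le_iff₀' hv]
    beta_reduce
    rw [key t]
    have := sq_nonneg ((A * (m : ℝ) ^ 2 + 2 * B * m * n + C * n ^ 2) * t +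
        (A * m * k + B * (m * l + n * k) + C * n * l))
    linarith

/-! ### The extended Hall product

For a primitive vector `v = (m, n)` the map `q ↦ (deg E', deg E/E')` is a submersion `Y₂ → ℝ₊²`.
Its fibres are lines, parametrized as follows. Let `w = (-n, m) / (m² + n²)`, so `det(v, w) = 1`.
The forms over `(a₁, a₂)` are `x v + y w ↦ a₁⁻² (x + u y)² + a₂⁻² y²`, `u ∈ ℝ`. Replacing `w` by
another vector with `det(v, w) = 1` only translates `u`. -/

/-- The form `x v + y w ↦ a₁⁻² (x + u y)² + a₂⁻² y²` in standard coordinates, `aᵢ = exp xᵢ`. -/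
def fibreForm (v : PrimVec) (y : LogPlane × ℝ) : Form :=
  let m : ℝ := v.1.1
  let n : ℝ := v.1.2
  let N : ℝ := m ^ 2 + n ^ 2
  let α : ℝ := Real.exp (-2 * y.1 0)
  let β : ℝ := Real.exp (-2 * y.1 1)
  let p : ℝ := m / N - y.2 * n
  let r : ℝ := n / N + y.2 * m
  (α * p ^ 2 + β * n ^ 2, α * p * r - β * m * n, α * r ^ 2 + β * m ^ 2)

/-- The inverse coordinates: logarithms of the two degrees, and the fibre coordinate. -/
def fibreCoord (v : PrimVec) (q : Form) : LogPlane × ℝ :=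
  let m : ℝ := v.1.1
  let n : ℝ := v.1.2
  let Q : ℝ := q.eval m n
  (!₂[-Real.log Q / 2, (Real.log Q - Real.log q.disc) / 2],
    ((-q.1 * m * n + q.2.1 * (m ^ 2 - n ^ 2) + q.2.2 * m * n) / (m ^ 2 + n ^ 2)) / Q)

theorem normSq_pos (v : PrimVec) : 0 < (v.1.1 : ℝ) ^ 2 + (v.1.2 : ℝ) ^ 2 := by
  obtain ⟨⟨m, n⟩, a, b, h⟩ := v
  simp only at h ⊢
  have h' : (a : ℝ) * m + b * n = 1 := by exact_mod_cast h
  by_contra hn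
  have hm0 : (m : ℝ) = 0 := by nlinarith [sq_nonneg (m : ℝ), sq_nonneg (n : ℝ)]
  have hn0 : (n : ℝ) = 0 := by nlinarith [sq_nonneg (m : ℝ), sq_nonneg (n : ℝ)]
  rw [hm0, hn0] at h'
  simp at h'

theorem eval_pos {q : Form} (hq : q ∈ posForms) (v : PrimVec) : 0 < q.eval v.1.1 v.1.2 := by
  refine mem_posForms_iff_posDef.1 hq _ _ fun h => ?_
  have := normSq_pos v
  simp only [Prod.mk.injEq] at h
  rw [h.1, h.2] at this
  simp at this

theorem fibreForm_eval (v : PrimVec) (y : LogPlane × ℝ) :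
    (fibreForm v y).eval v.1.1 v.1.2 = Real.exp (-2 * y.1 0) := by
  have hN := (normSq_pos v).ne'
  simp only [fibreForm, Form.eval]
  field_simp
  ring

theorem fibreForm_disc (v : PrimVec) (y : LogPlane × ℝ) :
    (fibreForm v y).disc = Real.exp (-2 * y.1 0) * Real.exp (-2 * y.1 1) := by
  have hN := (normSq_pos v).ne'
  simp only [fibreForm, Form.disc]
  field_simp
  ring

theorem fibreForm_mem (v : PrimVec) (y : LogPlane × ℝ) : fibreForm v y ∈ posForms := by
  have hd : 0 < (fibreForm v y).disc := by rw [fibreForm_disc]; positivity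
  refine ⟨?_, hd⟩
  have h0 : 0 ≤ (fibreForm v y).1 := by simp only [fibreForm]; positivity
  rcases h0.lt_or_eq with h | h
  · exact h
  · unfold Form.disc at hd
    rw [← h] at hd
    nlinarith [sq_nonneg (fibreForm v y).2.1]

theorem degSub_fibreForm (v : PrimVec) (y : LogPlane × ℝ) :
    degSub (fibreForm v y) v = Real.exp (y.1 0) := by
  unfold degSub
  rw [fibreForm_eval, Real.sqrt_eq_rpow, ← Real.exp_mul, one_div, ← Real.exp_neg]
  congr 1
  ring

theorem degQuot_fibreForm (v : PrimVec) (y : LogPlane × ℝ) :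
    degQuot (fibreForm v y) v = Real.exp (y.1 1) := by
  unfold degQuot
  rw [degSub_fibreForm, fibreForm_disc, ← Real.exp_add, Real.sqrt_eq_rpow, ← Real.exp_mul, one_div,
    ← Real.exp_neg, ← Real.exp_sub]
  congr 1
  ring

theorem fibreCoord_fibreForm (v : PrimVec) (y : LogPlane × ℝ) :
    fibreCoord v (fibreForm v y) = y := by
  have hN := (normSq_pos v).ne'
  obtain ⟨x, u⟩ := y
  have hα : Real.exp (-2 * x 0) ≠ 0 := (Real.exp_pos _).ne'
  simp only [fibreCoord, fibreForm_eval, fibreForm_disc]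
  rw [← Real.exp_add, Real.log_exp, Real.log_exp]
  refine Prod.ext ?_ ?_
  · ext i
    fin_cases i
    · simp
    · simp
  · simp only [fibreForm]
    field_simp
    ring

/-- Every positive definite form lies on exactly one of the fibres. -/
theorem fibreForm_fibreCoord (v : PrimVec) {q : Form} (hq : q ∈ posForms) :
    fibreForm v (fibreCoord v q) = q := by
  have hN := (normSq_pos v).ne'
  have hQ := eval_pos hq v
  have hd : 0 < q.disc := hq.2
  have e0 : Real.exp (-2 * (fibreCoord v q).1 0) = q.eval v.1.1 v.1.2 := by
    simp only [fibreCoord, PiLp.toLp_apply, Matrix.cons_val_zero]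
    rw [show -2 * (-Real.log (q.eval v.1.1 v.1.2) / 2) = Real.log (q.eval v.1.1 v.1.2) by ring,
      Real.exp_log hQ]
  have e1 : Real.exp (-2 * (fibreCoord v q).1 1) = q.disc / q.eval v.1.1 v.1.2 := by
    simp only [fibreCoord, PiLp.toLp_apply, Matrix.cons_val_one, Matrix.cons_val_zero]
    rw [show -2 * ((Real.log (q.eval v.1.1 v.1.2) - Real.log q.disc) / 2)
      = Real.log q.disc - Real.log (q.eval v.1.1 v.1.2) by ring, Real.exp_sub, Real.exp_log hQ,
      Real.exp_log hd]
  simp only [fibreForm, e0, e1]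
  simp only [fibreCoord]
  obtain ⟨A, B, C⟩ := q
  obtain ⟨⟨m, n⟩, hmn⟩ := v
  simp only [Form.eval, Form.disc] at *
  generalize (m : ℝ) = m at *
  generalize (n : ℝ) = n at *
  obtain ⟨Q, hQd⟩ : ∃ Q, Q = A * m ^ 2 + 2 * B * m * n + C * n ^ 2 := ⟨_, rfl⟩
  obtain ⟨N, hNd⟩ : ∃ N, N = m ^ 2 + n ^ 2 := ⟨_, rfl⟩
  rw [← hQd] at hQ
  rw [← hNd] at hN
  rw [← hQd, ← hNd]
  have hQ' := hQ.ne'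
  refine Prod.ext ?_ (Prod.ext ?_ ?_)
  all_goals
    simp only
    field_simp
    simp only [hQd, hNd]
    ring

theorem contDiff_fibreForm (v : PrimVec) : ContDiff ℝ ∞ (fibreForm v) := by
  unfold fibreForm
  fun_prop

theorem continuousOn_fibreCoord (v : PrimVec) : ContinuousOn (fibreCoord v) posForms := by
  have hc : Continuous fun q : Form => q.eval v.1.1 v.1.2 := by unfold Form.eval; fun_prop
  have hd : Continuous fun q : Form => q.disc := by unfold Form.disc; fun_prop
  have h1 : ContinuousOn (fun q : Form => Real.log (q.eval v.1.1 v.1.2)) posForms :=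
    hc.continuousOn.log fun q hq => (eval_pos hq v).ne'
  have h2 : ContinuousOn (fun q : Form => Real.log q.disc) posForms :=
    hd.continuousOn.log fun q hq => (ne_of_gt hq.2)
  unfold fibreCoord
  refine ContinuousOn.prodMk ?_ ?_
  · refine (PiLp.continuous_toLp 2 _).comp_continuousOn ?_
    rw [continuousOn_pi]
    intro i
    fin_cases i
    · exact h1.neg.div_const 2
    · exact (h1.sub h2).div_const 2
  · refine ContinuousOn.div ?_ hc.continuousOn fun q hq => (eval_pos hq v).ne'
    fun_prop

theorem hasCompactSupport_comp_fibreForm (v : PrimVec) (h : 𝓓(posForms, ℂ)) :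
    HasCompactSupport fun y => h (fibreForm v y) := by
  have hK : IsCompact (fibreCoord v '' tsupport h) :=
    h.hasCompactSupport.isCompact.image_of_continuousOn
      ((continuousOn_fibreCoord v).mono h.tsupport_subset)
  refine HasCompactSupport.intro hK fun y hy => ?_
  by_contra hne
  exact hy ⟨fibreForm v y, subset_tsupport _ hne, fibreCoord_fibreForm v y⟩

/-- The integral of the test function `h` over the fibre of `q ↦ (deg E', deg E/E')`, with the
weight `deg(E')^{1/2} deg(E/E')^{-1/2}` of the Hall product and the Jacobian `a₁⁻¹ a₂` of the
`GL₂(ℝ)`-invariant measure `dμ = a₁⁻¹ a₂ du d*a` on `Y₂`. -/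
def fibreIntegral (v : PrimVec) (h : 𝓓(posForms, ℂ)) (x : LogPlane) : ℂ :=
  (Real.exp (x 0 / 2) * Real.exp (-(x 1) / 2) : ℝ) *
    ((Real.exp (-(x 0)) * Real.exp (x 1) : ℝ) * ∫ u : ℝ, h (fibreForm v (x, u)))

theorem contDiff_fibreIntegral (v : PrimVec) (h : 𝓓(posForms, ℂ)) :
    ContDiff ℝ ∞ (fibreIntegral v h) := by
  have hG : ContDiff ℝ ∞ fun y => h (fibreForm v y) := h.contDiff.comp (contDiff_fibreForm v)
  have hS := hasCompactSupport_comp_fibreForm v h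
  have hint : ContDiff ℝ ∞ fun x : LogPlane => ∫ u : ℝ, h (fibreForm v (x, u)) := by
    have hk : IsCompact ((fun y : LogPlane × ℝ => -y.2) '' tsupport fun y => h (fibreForm v y)) :=
      hS.isCompact.image (by fun_prop)
    have key := contDiffOn_convolution_right_with_param_comp (n := (⊤ : ℕ∞)) (𝕜 := ℝ)
      (μ := (volume : Measure ℝ)) (ContinuousLinearMap.lsmul ℝ ℝ : ℝ →L[ℝ] ℂ →L[ℝ] ℂ)
      (s := (univ : Set LogPlane)) (v := fun _ => (0 : ℝ)) contDiffOn_const (f := fun _ => (1 : ℝ))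
      (g := fun x u => h (fibreForm v (x, -u))) isOpen_univ hk
      (by
        intro x u _ hu
        by_contra hne
        exact hu ⟨(x, -u), subset_tsupport (fun y => h (fibreForm v y)) hne, by simp⟩)
      (locallyIntegrable_const _)
      (by
        refine ContDiff.contDiffOn ?_
        exact hG.comp (g := fun y => h (fibreForm v y))
          (f := fun p : LogPlane × ℝ => (p.1, -p.2)) (by fun_prop))
    rw [contDiffOn_univ] at key
    simpa [convolution] using key
  unfold fibreIntegral
  refine ContDiff.mul ?_ (ContDiff.mul ?_ hint)
  · have h1 : ContDiff ℝ ∞ fun x : LogPlane => Real.exp (x 0 / 2) * Real.exp (-(x 1) / 2) := by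
      fun_prop
    exact Complex.ofRealCLM.contDiff.comp h1
  · have h2 : ContDiff ℝ ∞ fun x : LogPlane => Real.exp (-(x 0)) * Real.exp (x 1) := by
      fun_prop
    exact Complex.ofRealCLM.contDiff.comp h2

theorem hasCompactSupport_fibreIntegral (v : PrimVec) (h : 𝓓(posForms, ℂ)) :
    HasCompactSupport (fibreIntegral v h) := by
  have hS := hasCompactSupport_comp_fibreForm v h
  refine HasCompactSupport.intro (hS.isCompact.image continuous_fst) fun x hx => ?_
  have h0 : ∀ u : ℝ, h (fibreForm v (x, u)) = 0 := by
    intro u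
    by_contra hne
    exact hx ⟨(x, u), subset_tsupport (fun y => h (fibreForm v y)) hne, rfl⟩
  simp [fibreIntegral, h0]

/-- The term of the extended Hall product at the subbundle `E'` spanned by `v`, paired with a test
function `h` on `Y₂`: the distribution `deg(E')^{1/2} deg(E/E')^{-1/2} f(deg E', deg E/E')` on `Y₂`
is the pullback of a distribution along a submersion, the transpose of integration over fibres.
For a function `f` it is the integral over `Y₂`, with respect to `μ`, of the product of
`deg(E')^{1/2} deg(E/E')^{-1/2} f(deg E', deg E/E')` with `h`. -/
def hallTerm (f : 𝓢'(LogPlane, ℂ)) (h : 𝓓(posForms, ℂ)) (v : PrimVec) : ℂ :=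
  f ((hasCompactSupport_fibreIntegral v h).toSchwartzMap (contDiff_fibreIntegral v h))

/-- The extended Hall product `∑_{E' ⊂ E} deg(E')^{1/2} deg(E/E')^{-1/2} f(deg E', deg E/E')`,
a distribution on `Bun₂`, paired with a test function on `Y₂`. The factor `1/2` accounts for the
two generators `± v` of a rank one sublattice. -/
def extHall (f : 𝓢'(LogPlane, ℂ)) (h : 𝓓(posForms, ℂ)) : ℂ :=
  ∑' v : PrimVec, (1 / 2 : ℂ) * hallTerm f h v

/-- The space `R̂₂` of completed quadratic relations: the kernel of the extended Hall product on
absolutely tempered distributions (convergence of the series being included). -/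
def completedRelations : Submodule ℂ 𝓢'(LogPlane, ℂ) where
  carrier := {f | f ∈ absTempered ∧
    ∀ h : 𝓓(posForms, ℂ), Summable (hallTerm f h) ∧ extHall f h = 0}
  zero_mem' := by
    have e : ∀ h, hallTerm 0 h = 0 := fun h => funext fun v => rfl
    refine ⟨absTempered.zero_mem, fun h => ⟨?_, ?_⟩⟩
    · rw [e]; exact summable_zero
    · simp [extHall, e]
  add_mem' := by
    rintro f g ⟨hf, hf'⟩ ⟨hg, hg'⟩
    refine ⟨absTempered.add_mem hf hg, fun h => ?_⟩
    have e : hallTerm (f + g) h = fun v => hallTerm f h v + hallTerm g h v := rfl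
    obtain ⟨sf, zf⟩ := hf' h
    obtain ⟨sg, zg⟩ := hg' h
    refine ⟨by rw [e]; exact sf.add sg, ?_⟩
    unfold extHall at *
    simp only [e, mul_add]
    rw [(sf.mul_left _).tsum_add (sg.mul_left _), zf, zg, add_zero]
  smul_mem' := by
    rintro c f ⟨hf, hf'⟩
    refine ⟨absTempered.smul_mem c hf, fun h => ?_⟩
    have e : hallTerm (c • f) h = fun v => c * hallTerm f h v := rfl
    obtain ⟨sf, zf⟩ := hf' h
    refine ⟨by rw [e]; exact sf.mul_left c, ?_⟩
    unfold extHall at *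
    simp only [e, mul_left_comm _ c]
    rw [tsum_mul_left, zf, mul_zero]

end HallQuad

end

/-!
# Quadratic relations and the extended Hall product

*Mellin side.* By a Paley–Wiener argument the Mellin transform identifies the absolutely tempered
distributions with the entire functions of polynomial growth on vertical planes. In one direction,
`f(a) a^s` is, for `|Re sᵢ| < N`, the product of one tempered distribution, the sum of four twists
of `f`, with the Schwartz function `expFam N s`, which depends holomorphically on `s`
(`exists_isMellinTransform`). In the other, integrals over vertical planes do not depend on the
plane (`integral_vert_eq`), so the inverse Fourier transforms on the various planes are twists of
one distribution (`exists_isMellinTransform_of_entire`). The inversion formula is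
`IsMellinTransform.apply_eq`.

*Hall product side.* In the fibre coordinates of a primitive vector `v` the Laplace transform of a
fibre integral of a test function `h` is an integral of `h` against a power of `q(v)` times a power
of `det q` (`lap_fibreIntegral`). Hence the Hall product of `f` paired with `h` is, up to a factor,
the integral over the plane `Re s = (-1, 1)` of the Mellin transform `F` times an Eisenstein series
`primSum` averaged against `h`. It converges absolutely, since invariant differential operators on
the space of forms give rapid decay in `Im s`, uniformly in `v` (`hasSum_hallTerm`, `extHall_eq`).

*The functional equation implies the vanishing.* The averaged Eisenstein series is the Mellin
transform of an averaged theta function divided by a completed zeta function, so it continues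
meromorphically in `z = s₁ - s₂` with a functional equation under `z ↦ -z` (`eisEntire_neg`,
`eisEntire_eq`). If `F` satisfies the functional equation of `ℛ₂`, its product with the continuation
is an odd function of `z`. It is entire, because the zeros of the two zeta factors at `z` and at
`-z` are disjoint (`exists_odd_quotient`), and it decays in the strip `|Re z| ≤ 2`: the numerator by
Phragmén–Lindelöf (`exists_norm_eisGamma_decay`), while the bound for `1 / ζ(1 - z)` has a pole at
the imaginary axis, which the maximum principle removes (`norm_le_of_abs_re_mul_norm_le`). The
integral of an odd function over `Re z = -2` equals its integral over `Re z = 2` and therefore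
vanishes (`integral_eq_zero_of_odd`, `extHall_eq_zero`).

*The vanishing implies the functional equation.* For the test functions `fibreTest`, products in the
fibre coordinates of `(1, 0)` of an arbitrary function `ψ` of the degrees and a bump function whose
integral translates form a partition of unity, the Eisenstein series reduces to its constant term
`Lap ψ (s₁, s₂) + Φ(s₂ - s₁) Lap ψ (s₂, s₁)`, up to a factor (`primSum_fibreTest`). After a shift of
the first summand and an exchange of the variables in the second, both are integrals over the plane
`Re s = (1, -1)`, and the vanishing for all `ψ` is the functional equation on that plane, hence
everywhere (`functional_mirrorPlane`, `mem_functionalSolutions`).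
-/

noncomputable section

namespace HallQuad

/-! ### Tempered distributions and compactly supported test functions -/

section Density

variable {E : Type*} [NormedAddCommGroup E] [InnerProductSpace ℝ E]

/-- Continuity of a tempered distribution as an estimate by finitely many seminorms. -/
theorem exists_norm_le_sum_seminorm (f : 𝓢'(E, ℂ)) : ∃ (s : Finset (ℕ × ℕ)) (C : ℝ), 0 ≤ C ∧
    ∀ φ : 𝓢(E, ℂ), ‖f φ‖ ≤ C * ∑ m ∈ s, SchwartzMap.seminorm ℝ m.1 m.2 φ := by
  have hq : Continuous ((normSeminorm ℂ ℂ).comp (f : 𝓢(E, ℂ) →ₗ[ℂ] ℂ)) :=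
    continuous_norm.comp f.continuous
  obtain ⟨s, C, -, h⟩ := Seminorm.bound_of_continuous (schwartz_withSeminorms ℂ E ℂ) _ hq
  refine ⟨s, C, C.2, fun φ => ?_⟩
  have h1 := h φ
  refine h1.trans ?_
  change (C : ℝ) * _ ≤ _
  refine mul_le_mul_of_nonneg_left ?_ C.2
  have := Seminorm.le_def.1 (Seminorm.finset_sup_le_sum (schwartzSeminormFamily ℂ E ℂ) s) φ
  refine this.trans (le_of_eq ?_)
  rw [sum_apply]
  rfl

variable [FiniteDimensional ℝ E]

open Filter Topology in
/-- Schwartz functions of compact support are dense: cut off with `χ(x / R)`, `R → ∞`. -/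
theorem exists_seq_hasCompactSupport_tendsto (φ : 𝓢(E, ℂ)) :
    ∃ u : ℕ → 𝓢(E, ℂ), (∀ n, HasCompactSupport (u n)) ∧ Tendsto u atTop (𝓝 φ) := by
  let χ : ContDiffBump (0 : E) := ⟨1, 2, one_pos, one_lt_two⟩
  let L : ℕ → E →L[ℝ] E := fun R => ((R : ℝ) + 1)⁻¹ • ContinuousLinearMap.id ℝ E
  have hLapp : ∀ R x, L R x = ((R : ℝ) + 1)⁻¹ • x := fun R x => rfl
  have hLn : ∀ R, ‖L R‖ ≤ 1 := by
    intro R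
    refine ContinuousLinearMap.opNorm_le_bound _ zero_le_one fun x => ?_
    rw [hLapp, norm_smul, norm_inv, Real.norm_of_nonneg (by positivity)]
    gcongr
    exact inv_le_one_of_one_le₀ (by linarith [Nat.cast_nonneg (α := ℝ) R])
  have hχ : ContDiff ℝ ∞ (fun x : E => χ x) := χ.contDiff
  have hχR : ∀ R, ContDiff ℝ ∞ (fun x : E => χ (L R x)) := fun R => hχ.comp (L R).contDiff
  have hcs : ∀ R, HasCompactSupport (fun x : E => χ (L R x)) := by
    intro R
    refine HasCompactSupport.intro (isCompact_closedBall (0 : E) (((R : ℝ) + 1) * 2)) fun x hx => ?_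
    apply χ.zero_of_le_dist
    simp only [Metric.mem_closedBall, dist_zero_right, not_le] at hx
    rw [dist_zero_right, hLapp, norm_smul, norm_inv, Real.norm_of_nonneg (by positivity),
      ← div_eq_inv_mul, le_div_iff₀ (by positivity)]
    change (2 : ℝ) * _ ≤ _
    linarith
  have hsm : ∀ R, ContDiff ℝ ∞ (fun x : E => χ (L R x) • φ x) :=
    fun R => (hχR R).smul (φ.smooth ⊤)
  have hcs' : ∀ R, HasCompactSupport (fun x : E => χ (L R x) • φ x) := fun R => (hcs R).smul_right
  refine ⟨fun R => (hcs' R).toSchwartzMap (hsm R), fun R => hcs' R, ?_⟩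
  have hbd : ∀ i : ℕ, ∃ C : ℝ, 0 ≤ C ∧ ∀ R x, ‖iteratedFDeriv ℝ i (fun x : E => χ (L R x)) x‖ ≤
    C := by
    intro i
    have hc : Continuous (fun x => iteratedFDeriv ℝ i (fun x : E => χ x) x) :=
      (hχ.of_le (mod_cast le_top)).continuous_iteratedFDeriv'
    obtain ⟨C, hC⟩ := hc.bounded_above_of_compact_support (χ.hasCompactSupport.iteratedFDeriv i)
    refine ⟨C, (norm_nonneg _).trans (hC 0), fun R x => ?_⟩
    have e := (L R).iteratedFDeriv_comp_right hχ x (i := i) (mod_cast le_top)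
    change ‖iteratedFDeriv ℝ i ((fun x : E => χ x) ∘ L R) x‖ ≤ C
    rw [e]
    refine (ContinuousMultilinearMap.norm_compContinuousLinearMap_le _ _).trans ?_
    calc _ ≤ C * 1 := by
          refine mul_le_mul (hC _) ?_ (by positivity) ((norm_nonneg _).trans (hC 0))
          exact Finset.prod_le_one (fun _ _ => norm_nonneg _) fun _ _ => hLn R
      _ = C := mul_one C
  choose B hB0 hB using hbd
  rw [(schwartz_withSeminorms ℝ E ℂ).tendsto_nhds]
  rintro ⟨k, n⟩ ε hε
  set M : ℝ := SchwartzMap.seminorm ℝ (k + 1) n φ + ∑ i ∈ Finset.range (n + 1),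
    (n.choose i : ℝ) * B i * SchwartzMap.seminorm ℝ (k + 1) (n - i) φ with hM
  have hM0 : 0 ≤ M := by
    refine add_nonneg (apply_nonneg _ _) (Finset.sum_nonneg fun i _ => ?_)
    exact mul_nonneg (mul_nonneg (by positivity) (hB0 i)) (apply_nonneg _ _)
  have key : ∀ R : ℕ, SchwartzMap.seminorm ℝ k n ((hcs' R).toSchwartzMap (hsm R) - φ)
      ≤ M / ((R : ℝ) + 1) := by
    intro R
    refine SchwartzMap.seminorm_le_bound ℝ k n _ (by positivity) fun x => ?_
    have hR : (0 : ℝ) < (R : ℝ) + 1 := by positivity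
    rcases lt_or_ge ‖x‖ ((R : ℝ) + 1) with hx | hx
    · have h0 : (⇑((hcs' R).toSchwartzMap (hsm R) - φ)) =ᶠ[𝓝 x] fun _ => 0 := by
        filter_upwards [(continuous_norm.isOpen_preimage _ isOpen_Iio).mem_nhds hx] with y hy
        have : χ (L R y) = 1 := by
          apply χ.one_of_mem_closedBall
          rw [Metric.mem_closedBall, dist_zero_right, hLapp, norm_smul, norm_inv,
            Real.norm_of_nonneg (by positivity), ← div_eq_inv_mul]
          change _ ≤ (1 : ℝ)
          rw [div_le_one hR]
          exact (le_of_lt hy)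
        change χ (L R y) • φ y - φ y = 0
        rw [this, one_smul, sub_self]
      rw [(h0.iteratedFDeriv ℝ n).eq_of_nhds]
      simp only [iteratedFDeriv_fun_zero]
      simp only [Pi.zero_apply, norm_zero, mul_zero]
      positivity
    · have hsub : iteratedFDeriv ℝ n (⇑((hcs' R).toSchwartzMap (hsm R) - φ)) x
          = iteratedFDeriv ℝ n (fun x : E => χ (L R x) • φ x) x - iteratedFDeriv ℝ n φ x := by
        have := iteratedFDeriv_sub_apply (𝕜 := ℝ) (i := n) (x := x)
          ((hsm R).contDiffAt.of_le (mod_cast le_top)) (φ.contDiffAt n)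
        exact this
      rw [hsub]
      have hk : ∀ m, ‖x‖ ^ k * ‖iteratedFDeriv ℝ m φ x‖ ≤
          SchwartzMap.seminorm ℝ (k + 1) m φ / ((R : ℝ) + 1) := by
        intro m
        rw [le_div_iff₀ hR]
        refine le_trans ?_ (SchwartzMap.le_seminorm ℝ (k + 1) m φ x)
        rw [pow_succ]
        have : 0 ≤ ‖x‖ ^ k * ‖iteratedFDeriv ℝ m φ x‖ := by positivity
        nlinarith
      have h2 := norm_iteratedFDeriv_smul_le (𝕜 := ℝ) (n := n) (N := ∞) (hχR R)
        (φ.smooth ⊤) (x := x) (mod_cast le_top)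
      calc ‖x‖ ^ k * ‖iteratedFDeriv ℝ n (fun x : E => χ (L R x) • φ x) x - iteratedFDeriv ℝ n φ x‖
          ≤ ‖x‖ ^ k * (‖iteratedFDeriv ℝ n φ x‖ + ∑ i ∈ Finset.range (n + 1), (n.choose i : ℝ) *
            ‖iteratedFDeriv ℝ i (fun x : E => χ (L R x)) x‖ * ‖iteratedFDeriv ℝ (n - i) φ x‖) := by
            gcongr
            refine (norm_sub_le _ _).trans ?_
            rw [add_comm]
            exact add_le_add le_rfl h2
        _ = ‖x‖ ^ k * ‖iteratedFDeriv ℝ n φ x‖ + ∑ i ∈ Finset.range (n + 1), (n.choose i : ℝ) *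
            ‖iteratedFDeriv ℝ i (fun x : E => χ (L R x)) x‖ *
              (‖x‖ ^ k * ‖iteratedFDeriv ℝ (n - i) φ x‖) := by
            rw [mul_add, Finset.mul_sum]
            congr 1
            exact Finset.sum_congr rfl fun i _ => by ring
        _ ≤ SchwartzMap.seminorm ℝ (k + 1) n φ / ((R : ℝ) + 1) + ∑ i ∈ Finset.range (n + 1),
            (n.choose i : ℝ) * B i * (SchwartzMap.seminorm ℝ (k + 1) (n - i) φ / ((R : ℝ) + 1)) :=
              by
            have := hB0
            refine add_le_add (hk n) (Finset.sum_le_sum fun i _ => ?_)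
            refine mul_le_mul ?_ (hk _) (by positivity) (mul_nonneg (by positivity) (hB0 i))
            exact mul_le_mul_of_nonneg_left (hB i R x) (by positivity)
        _ = M / ((R : ℝ) + 1) := by
            rw [hM, add_div, Finset.sum_div]
            congr 1
            exact Finset.sum_congr rfl fun i _ => by ring
  obtain ⟨R0, hR0⟩ := exists_nat_gt (M / ε)
  filter_upwards [eventually_ge_atTop R0] with R hR
  refine (key R).trans_lt ?_
  rw [div_lt_iff₀ (by positivity)]
  rw [div_lt_iff₀ hε] at hR0
  have : (R0 : ℝ) ≤ R := by exact_mod_cast hR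
  nlinarith

/-- A tempered distribution is determined by its values on compactly supported functions. -/
theorem temperedDistribution_ext {f g : 𝓢'(E, ℂ)}
    (h : ∀ φ : 𝓢(E, ℂ), HasCompactSupport φ → f φ = g φ) : f = g := by
  ext φ
  obtain ⟨u, hu, hlim⟩ := exists_seq_hasCompactSupport_tendsto φ
  have hf := (f.continuous.tendsto φ).comp hlim
  have hg := (g.continuous.tendsto φ).comp hlim
  refine tendsto_nhds_unique hf (hg.congr fun n => ?_)
  exact (h _ (hu n)).symm

end Density

section PolyGrowth

variable {E : Type*} [NormedAddCommGroup E] [InnerProductSpace ℝ E] [FiniteDimensional ℝ E]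
  [MeasurableSpace E] [BorelSpace E]

/-- At most polynomial growth. -/
def HasPolyGrowth (K : E → ℂ) : Prop := ∃ (C : ℝ) (N : ℕ), ∀ ξ, ‖K ξ‖ ≤ C * (1 + ‖ξ‖) ^ N

theorem HasPolyGrowth.exists_bound {K : E → ℂ} (hg : HasPolyGrowth K) :
    ∃ (s : Finset (ℕ × ℕ)) (C : ℝ) (n : ℕ), 0 ≤ C ∧
      Integrable (fun ξ : E => (1 + ‖ξ‖) ^ (-(n : ℝ))) ∧ ∀ (φ : 𝓢(E, ℂ)) (ξ : E),
      ‖K ξ * φ ξ‖ ≤ (1 + ‖ξ‖) ^ (-(n : ℝ)) * (C * s.sup (schwartzSeminormFamily ℂ E ℂ) φ) := by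
  obtain ⟨C, N, hC⟩ := hg
  obtain ⟨n, hn⟩ := (inferInstance : (volume : Measure E).HasTemperateGrowth).exists_integrable
  have hC0 : 0 ≤ C := by
    have := (norm_nonneg _).trans (hC 0)
    simpa using this
  refine ⟨Finset.Iic (N + n, 0), C * 2 ^ (N + n), n, by positivity, hn, fun φ ξ => ?_⟩
  have h1 := SchwartzMap.one_add_le_sup_seminorm_apply (𝕜 := ℂ) (m := (N + n, 0)) (k := N + n)
    (n := 0) le_rfl le_rfl φ ξ
  rw [norm_iteratedFDeriv_zero] at h1
  rw [Real.rpow_neg (by positivity), Real.rpow_natCast, ← div_eq_inv_mul,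
    le_div_iff₀ (by positivity), norm_mul]
  calc ‖K ξ‖ * ‖φ ξ‖ * (1 + ‖ξ‖) ^ n ≤ C * (1 + ‖ξ‖) ^ N * ‖φ ξ‖ * (1 + ‖ξ‖) ^ n := by
        gcongr; exact hC ξ
    _ = C * ((1 + ‖ξ‖) ^ (N + n) * ‖φ ξ‖) := by rw [pow_add]; ring
    _ ≤ _ := by
        rw [mul_assoc]
        exact mul_le_mul_of_nonneg_left h1 hC0

theorem HasPolyGrowth.integrable_mul {K : E → ℂ} (hg : HasPolyGrowth K) (hc : Continuous K)
    (φ : 𝓢(E, ℂ)) : Integrable fun ξ => K ξ * φ ξ := by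
  obtain ⟨s, C, n, -, hn, h⟩ := hg.exists_bound
  exact (hn.mul_const _).mono' (hc.mul φ.continuous).aestronglyMeasurable
    (Filter.Eventually.of_forall (h φ))

/-- The tempered distribution `φ ↦ ∫ K φ` given by a continuous function of polynomial growth. -/
def polyGrowthDistribution (K : E → ℂ) (hc : Continuous K) (hg : HasPolyGrowth K) : 𝓢'(E, ℂ) :=
  ContinuousLinearMap.toPointwiseConvergenceCLM _ _ _ _ <|
    SchwartzMap.mkCLMtoNormedSpace (fun φ : 𝓢(E, ℂ) => ∫ ξ, K ξ * φ ξ)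
      (fun φ ψ => by
        rw [← integral_add (hg.integrable_mul hc φ) (hg.integrable_mul hc ψ)]
        exact integral_congr_ae (Filter.Eventually.of_forall fun x => mul_add _ _ _))
      (fun a φ => by
        rw [RingHom.id_apply, ← integral_smul]
        exact integral_congr_ae (Filter.Eventually.of_forall fun x => mul_left_comm _ _ _))
      (by
        obtain ⟨s, C, n, hC, hn, h⟩ := hg.exists_bound
        refine ⟨s, (∫ ξ : E, (1 + ‖ξ‖) ^ (-(n : ℝ))) * C, by positivity, fun φ => ?_⟩
        refine (norm_integral_le_of_norm_le (hn.mul_const _)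
          (Filter.Eventually.of_forall (h φ))).trans (le_of_eq ?_)
        rw [integral_mul_const, mul_assoc])

theorem polyGrowthDistribution_apply (K : E → ℂ) (hc : Continuous K) (hg : HasPolyGrowth K)
    (φ : 𝓢(E, ℂ)) : polyGrowthDistribution K hc hg φ = ∫ ξ, K ξ * φ ξ := rfl

/-- A continuous function of polynomial growth whose inverse Fourier transform vanishes as a
distribution is zero. -/
theorem eq_zero_of_forall_integral_mul_fourierInv {K : E → ℂ} (hc : Continuous K)
    (hg : HasPolyGrowth K)
    (h : ∀ φ : 𝓢(E, ℂ), HasCompactSupport φ → ∫ ξ, K ξ * 𝓕⁻ φ ξ = 0) : K = 0 := by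
  have h0 : 𝓕⁻ (polyGrowthDistribution K hc hg) = 0 :=
    temperedDistribution_ext fun φ hφ => h φ hφ
  have h1 : polyGrowthDistribution K hc hg = 0 := by
    have := congrArg (fun g => 𝓕 g) h0
    simpa using this
  have h2 : ∀ᵐ x, K x = 0 := by
    refine ae_eq_zero_of_integral_contDiff_smul_eq_zero hc.locallyIntegrable fun g gs gc => ?_
    have gs' : ContDiff ℝ ∞ fun x => (g x : ℂ) := Complex.ofRealCLM.contDiff.comp gs
    have gc' : HasCompactSupport fun x => (g x : ℂ) := gc.comp_left (g := Complex.ofReal) rfl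
    have := DFunLike.congr_fun h1 (gc'.toSchwartzMap gs')
    rw [polyGrowthDistribution_apply] at this
    refine Eq.trans (integral_congr_ae (Filter.Eventually.of_forall fun x => ?_)) this
    change g x • K x = K x * (g x : ℂ)
    rw [Complex.real_smul, mul_comm]
  have := Measure.eq_of_ae_eq (μ := volume) (f := K) (g := 0) h2 hc continuous_const
  exact this

end PolyGrowth

/-! ### Tempered distributions commute with integrals -/

section Interchange

open scoped BoundedContinuousFunction

variable {E : Type*} [NormedAddCommGroup E] [InnerProductSpace ℝ E]

/-- Orders `(k, n)`, points and `n`-tuples of directions, as a discrete space: the index set of the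
normalized derivatives of a Schwartz function. -/
def JetPoint (E : Type*) : Type _ := Σ m : ℕ × ℕ, E × (Fin m.2 → E)

instance : TopologicalSpace (JetPoint E) := ⊥

instance : DiscreteTopology (JetPoint E) := ⟨rfl⟩

open Classical in
/-- The normalized derivative `‖x‖ ^ k D ^ n φ(x)(v) / ∏ ‖v i‖` for the orders `(k, n)` in `s`. -/
def jetValue (s : Finset (ℕ × ℕ)) (φ : 𝓢(E, ℂ)) (p : JetPoint E) : ℂ :=
  if p.1 ∈ s then ((‖p.2.1‖ ^ p.1.1 / ∏ i, ‖p.2.2 i‖ : ℝ) : ℂ) *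
    iteratedFDeriv ℝ p.1.2 φ p.2.1 p.2.2 else 0

theorem norm_jetValue_le_seminorm {s : Finset (ℕ × ℕ)} (φ : 𝓢(E, ℂ)) {p : JetPoint E}
    (hp : p.1 ∈ s) : ‖jetValue s φ p‖ ≤ SchwartzMap.seminorm ℝ p.1.1 p.1.2 φ := by
  rw [jetValue, if_pos hp, norm_mul, Complex.norm_real, Real.norm_of_nonneg (by positivity)]
  have h1 := (iteratedFDeriv ℝ p.1.2 φ p.2.1).le_opNorm p.2.2
  have h2 := SchwartzMap.le_seminorm ℝ p.1.1 p.1.2 φ p.2.1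
  have h3 : 0 ≤ ∏ i, ‖p.2.2 i‖ := Finset.prod_nonneg fun _ _ => norm_nonneg _
  rcases h3.eq_or_lt with h0 | h0
  · rw [← h0, div_zero, zero_mul]
    exact apply_nonneg _ _
  · refine le_trans ?_ h2
    rw [div_mul_eq_mul_div, div_le_iff₀ h0, mul_assoc]
    gcongr

theorem norm_jetValue_le (s : Finset (ℕ × ℕ)) (φ : 𝓢(E, ℂ)) (p : JetPoint E) :
    ‖jetValue s φ p‖ ≤ ∑ m ∈ s, SchwartzMap.seminorm ℝ m.1 m.2 φ := by
  by_cases hp : p.1 ∈ s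
  · exact (norm_jetValue_le_seminorm φ hp).trans (Finset.single_le_sum
      (f := fun m : ℕ × ℕ => SchwartzMap.seminorm ℝ m.1 m.2 φ) (fun m _ => apply_nonneg _ _) hp)
  · rw [jetValue, if_neg hp, norm_zero]
    exact Finset.sum_nonneg fun m _ => apply_nonneg _ _

/-- The map from the Schwartz space to a Banach space which is continuous for, and bounds, the
finitely many seminorms in `s`. -/
def jet (s : Finset (ℕ × ℕ)) : 𝓢(E, ℂ) →L[ℂ] (JetPoint E →ᵇ ℂ) :=
  SchwartzMap.mkCLMtoNormedSpace
    (fun φ => BoundedContinuousFunction.ofNormedAddCommGroupDiscrete (jetValue s φ) _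
      (norm_jetValue_le s φ))
    (fun φ ψ => by
      ext1 p
      change jetValue s (φ + ψ) p = jetValue s φ p + jetValue s ψ p
      unfold jetValue
      split_ifs
      · have := iteratedFDeriv_add_apply (𝕜 := ℝ) (i := p.1.2) (x := p.2.1)
          (φ.contDiffAt p.1.2) (ψ.contDiffAt p.1.2)
        change _ * iteratedFDeriv ℝ p.1.2 ((φ : E → ℂ) + (ψ : E → ℂ)) p.2.1 p.2.2 = _
        rw [this, add_apply, mul_add]
      · simp)
    (fun a φ => by
      ext1 p
      change jetValue s (a • φ) p = a • jetValue s φ p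
      unfold jetValue
      split_ifs
      · have := iteratedFDeriv_const_smul_apply (𝕜 := ℝ) (a := a) (i := p.1.2) (x := p.2.1)
          (φ.contDiffAt p.1.2)
        change _ * iteratedFDeriv ℝ p.1.2 (a • (φ : E → ℂ)) p.2.1 p.2.2 = _
        rw [this, smul_apply, smul_eq_mul, smul_eq_mul]
        ring
      · simp)
    ⟨s, 1, zero_le_one, fun φ => by
      rw [one_mul]
      refine (BoundedContinuousFunction.norm_le (apply_nonneg _ _)).2 fun p => ?_
      change ‖jetValue s φ p‖ ≤ _
      by_cases hp : p.1 ∈ s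
      · exact (norm_jetValue_le_seminorm φ hp).trans
          (Seminorm.le_finset_sup_apply (p := schwartzSeminormFamily ℂ E ℂ) (x := φ) hp)
      · rw [jetValue, if_neg hp, norm_zero]
        exact apply_nonneg _ _⟩

theorem jet_apply (s : Finset (ℕ × ℕ)) (φ : 𝓢(E, ℂ)) (p : JetPoint E) :
    jet s φ p = jetValue s φ p := rfl

theorem seminorm_le_norm_jet {s : Finset (ℕ × ℕ)} {m : ℕ × ℕ} (hm : m ∈ s) (φ : 𝓢(E, ℂ)) :
    SchwartzMap.seminorm ℝ m.1 m.2 φ ≤ ‖jet s φ‖ := by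
  refine SchwartzMap.seminorm_le_bound ℝ _ _ φ (norm_nonneg _) fun x => ?_
  have e : ‖x‖ ^ m.1 * ‖iteratedFDeriv ℝ m.2 φ x‖ = ‖‖x‖ ^ m.1 • iteratedFDeriv ℝ m.2 φ x‖ := by
    rw [norm_smul, Real.norm_of_nonneg (by positivity)]
  rw [e]
  refine ContinuousMultilinearMap.opNorm_le_bound (norm_nonneg _) fun v => ?_
  rw [smul_apply, norm_smul, Real.norm_of_nonneg (by positivity)]
  by_cases h0 : ∏ i, ‖v i‖ = 0
  · obtain ⟨i, -, hi⟩ := Finset.prod_eq_zero_iff.1 h0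
    rw [(iteratedFDeriv ℝ m.2 φ x).map_coord_zero i (norm_eq_zero.1 hi), norm_zero, mul_zero]
    positivity
  · have hpos : 0 < ∏ i, ‖v i‖ :=
      lt_of_le_of_ne (Finset.prod_nonneg fun _ _ => norm_nonneg _) (Ne.symm h0)
    let p : JetPoint E := ⟨m, x, v⟩
    have := (jet s φ).norm_coe_le_norm p
    rw [jet_apply, jetValue, if_pos hm, norm_mul, Complex.norm_real,
      Real.norm_of_nonneg (by positivity), div_mul_eq_mul_div, div_le_iff₀ hpos] at this
    exact this

/-- A tempered distribution is a bounded functional on finitely many weighted derivatives. -/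
theorem exists_factor_jet (f : 𝓢'(E, ℂ)) : ∃ (s : Finset (ℕ × ℕ))
    (L : (JetPoint E →ᵇ ℂ) →L[ℂ] ℂ), ∀ φ, f φ = L (jet s φ) := by
  obtain ⟨s, C, hC, h⟩ := exists_norm_le_sum_seminorm f
  let J : 𝓢(E, ℂ) →ₗ[ℂ] (JetPoint E →ᵇ ℂ) := (jet s).toLinearMap
  let f' : 𝓢(E, ℂ) →ₗ[ℂ] ℂ := f
  have hbound : ∀ φ, ‖f φ‖ ≤ C * s.card * ‖J φ‖ := by
    intro φ
    refine (h φ).trans ?_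
    rw [mul_assoc]
    refine mul_le_mul_of_nonneg_left ?_ hC
    rw [← nsmul_eq_mul]
    exact Finset.sum_le_card_nsmul _ _ _ fun m hm => seminorm_le_norm_jet hm φ
  have hker : LinearMap.ker J ≤ LinearMap.ker f' := by
    intro φ hφ
    rw [LinearMap.mem_ker] at hφ ⊢
    have := hbound φ
    rw [hφ, norm_zero, mul_zero] at this
    exact norm_le_zero_iff.1 this
  let g : LinearMap.range J →ₗ[ℂ] ℂ :=
    ((LinearMap.ker J).liftQ f' hker).comp J.quotKerEquivRange.symm.toLinearMap
  have hg : ∀ φ, g ⟨J φ, LinearMap.mem_range_self J φ⟩ = f φ := by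
    intro φ
    have e : J.quotKerEquivRange.symm ⟨J φ, LinearMap.mem_range_self J φ⟩
        = (LinearMap.ker J).mkQ φ := by
      rw [LinearEquiv.symm_apply_eq]
      rfl
    change ((LinearMap.ker J).liftQ f' hker) (J.quotKerEquivRange.symm _) = _
    rw [e]
    rfl
  let g' : StrongDual ℂ (LinearMap.range J) := g.mkContinuous (C * s.card) (by
    rintro ⟨_, φ, rfl⟩
    rw [hg]
    exact hbound φ)
  obtain ⟨L, hL, -⟩ := exists_extension_norm_eq (𝕜 := ℂ) (LinearMap.range J) g'
  refine ⟨s, L, fun φ => ?_⟩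
  rw [← hg φ]
  exact (hL ⟨J φ, LinearMap.mem_range_self J φ⟩).symm

variable {Y : Type*} [TopologicalSpace Y] [MeasurableSpace Y] [OpensMeasurableSpace Y]

/-- Derivatives of an integral of a family of Schwartz functions. -/
theorem iteratedFDeriv_integral_schwartz {μ : Measure Y} {u : Y → 𝓢(E, ℂ)} (hu : Continuous u)
    (hb : ∀ n, ∃ B : Y → ℝ, Integrable B μ ∧ ∀ y, SchwartzMap.seminorm ℝ 0 n (u y) ≤ B y)
    {U : 𝓢(E, ℂ)} (hU : ∀ x, U x = ∫ y, u y x ∂μ) (n : ℕ) (x : E) (v : Fin n → E) :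
    iteratedFDeriv ℝ n U x v = ∫ y, iteratedFDeriv ℝ n (u y) x v ∂μ := by
  have hcont : ∀ n (x : E) (v : Fin n → E), Continuous fun y => iteratedFDeriv ℝ n (u y) x v := by
    intro n x v
    have h1 : Continuous fun y => jet {((0 : ℕ), n)} (u y) := (jet _).continuous.comp hu
    let p : JetPoint E := ⟨(0, n), x, v⟩
    have h3 : Continuous fun y => jet {((0 : ℕ), n)} (u y) p :=
      (BoundedContinuousFunction.evalCLM ℝ p).continuous.comp h1
    by_cases h0 : ∏ i, ‖v i‖ = 0
    · obtain ⟨i, -, hi⟩ := Finset.prod_eq_zero_iff.1 h0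
      have : ∀ y, iteratedFDeriv ℝ n (u y) x v = 0 := fun y =>
        (iteratedFDeriv ℝ n (u y) x).map_coord_zero i (norm_eq_zero.1 hi)
      simp only [this]
      exact continuous_const
    · have h4 := h3.const_mul ((∏ i, ‖v i‖ : ℝ) : ℂ)
      refine h4.congr fun y => ?_
      rw [jet_apply, jetValue, if_pos (Finset.mem_singleton_self _)]
      change ((∏ i, ‖v i‖ : ℝ) : ℂ) * (((‖x‖ ^ 0 / ∏ i, ‖v i‖ : ℝ) : ℂ) *
        iteratedFDeriv ℝ n (u y) x v) = _
      rw [← mul_assoc, ← Complex.ofReal_mul, pow_zero, mul_one_div_cancel h0, Complex.ofReal_one,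
        one_mul]
  have hle : ∀ n y (x : E) (v : Fin n → E), ‖iteratedFDeriv ℝ n (u y) x v‖ ≤
      SchwartzMap.seminorm ℝ 0 n (u y) * ∏ i, ‖v i‖ := fun n y x v =>
    ((iteratedFDeriv ℝ n (u y) x).le_opNorm v).trans (mul_le_mul_of_nonneg_right
      (SchwartzMap.norm_iteratedFDeriv_le_seminorm ℝ (u y) n x)
      (Finset.prod_nonneg fun _ _ => norm_nonneg _))
  have hint : ∀ n (x : E) (v : Fin n → E),
      Integrable (fun y => iteratedFDeriv ℝ n (u y) x v) μ := by
    intro n x v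
    obtain ⟨B, hB, hBu⟩ := hb n
    refine (hB.mul_const (∏ i, ‖v i‖)).mono' (hcont n x v).aestronglyMeasurable
      (Filter.Eventually.of_forall fun y => (hle n y x v).trans ?_)
    exact mul_le_mul_of_nonneg_right (hBu y) (Finset.prod_nonneg fun _ _ => norm_nonneg _)
  -- the derivative along a line of a derivative of a Schwartz function
  have hline : ∀ (φ : 𝓢(E, ℂ)) n (x : E) (v : Fin (n + 1) → E) (t : ℝ),
      HasDerivAt (fun t : ℝ => iteratedFDeriv ℝ n φ (x + t • v 0) (Fin.tail v))
        (iteratedFDeriv ℝ (n + 1) φ (x + t • v 0) v) t := by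
    intro φ n x v t
    have h1 : HasFDerivAt (iteratedFDeriv ℝ n φ)
        (fderiv ℝ (iteratedFDeriv ℝ n φ) (x + t • v 0)) (x + t • v 0) :=
      ((φ.smooth (n + 1 : ℕ)).differentiable_iteratedFDeriv
        (by exact_mod_cast Nat.lt_succ_self n) _).hasFDerivAt
    have h2 : HasDerivAt (fun t : ℝ => x + t • v 0) (v 0) t := by
      simpa using ((hasDerivAt_id t).smul_const (v 0)).const_add x
    have h3 := h1.comp_hasDerivAt t h2
    have h4 := (ContinuousMultilinearMap.apply ℝ (fun _ : Fin n => E) ℂ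
      (Fin.tail v)).hasFDerivAt.comp_hasDerivAt t h3
    rw [iteratedFDeriv_succ_apply_left]
    exact h4
  induction n generalizing x with
  | zero => simpa using hU x
  | succ n ih =>
    obtain ⟨B, hB, hBu⟩ := hb (n + 1)
    have hder := hasDerivAt_integral_of_dominated_loc_of_deriv_le (μ := μ) (𝕜 := ℝ)
      (F := fun t y => iteratedFDeriv ℝ n (u y) (x + t • v 0) (Fin.tail v))
      (F' := fun t y => iteratedFDeriv ℝ (n + 1) (u y) (x + t • v 0) v) (x₀ := 0) (s := univ)
      (bound := fun y => B y * ∏ i, ‖v i‖)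
      Filter.univ_mem
      (Filter.Eventually.of_forall fun t => (hcont n _ _).aestronglyMeasurable)
      (hint n _ _) (hcont (n + 1) _ _).aestronglyMeasurable
      (Filter.Eventually.of_forall fun y t _ => (hle _ y _ v).trans
        (mul_le_mul_of_nonneg_right (hBu y) (Finset.prod_nonneg fun _ _ => norm_nonneg _)))
      (hB.mul_const _)
      (Filter.Eventually.of_forall fun y t _ => hline (u y) n x v t)
    have h1 := hline U n x v 0
    have e : (fun t : ℝ => iteratedFDeriv ℝ n U (x + t • v 0) (Fin.tail v)) =
        fun t : ℝ => ∫ y, iteratedFDeriv ℝ n (u y) (x + t • v 0) (Fin.tail v) ∂μ :=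
      funext fun t => ih _ _
    rw [e] at h1
    simpa using h1.unique hder.2

/-- A tempered distribution commutes with the integral of a dominated family of Schwartz
functions. -/
theorem apply_integral_schwartz [SecondCountableTopology Y] (f : 𝓢'(E, ℂ)) {μ : Measure Y}
    {u : Y → 𝓢(E, ℂ)}
    (hu : Continuous u)
    (hb : ∀ k n, ∃ B : Y → ℝ, Integrable B μ ∧ ∀ y, SchwartzMap.seminorm ℝ k n (u y) ≤ B y)
    {U : 𝓢(E, ℂ)} (hU : ∀ x, U x = ∫ y, u y x ∂μ) : f U = ∫ y, f (u y) ∂μ := by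
  obtain ⟨s, L, hL⟩ := exists_factor_jet f
  have hcont : Continuous fun y => jet s (u y) := (jet s).continuous.comp hu
  choose B hB hBu using hb
  have hint : Integrable (fun y => jet s (u y)) μ := by
    refine (integrable_finsetSum s fun m _ => hB m.1 m.2).mono' hcont.aestronglyMeasurable
      (Filter.Eventually.of_forall fun y => ?_)
    have hnn : ∀ m : ℕ × ℕ, 0 ≤ B m.1 m.2 y := fun m => (apply_nonneg _ _).trans (hBu m.1 m.2 y)
    refine (BoundedContinuousFunction.norm_le (Finset.sum_nonneg fun m _ => hnn m)).2 fun p => ?_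
    exact (norm_jetValue_le s (u y) p).trans (Finset.sum_le_sum fun m _ => hBu m.1 m.2 y)
  have key : jet s U = ∫ y, jet s (u y) ∂μ := by
    ext1 p
    have h1 := (BoundedContinuousFunction.evalCLM ℂ p).integral_comp_comm hint
    change jet s U p = BoundedContinuousFunction.evalCLM ℂ p (∫ y, jet s (u y) ∂μ)
    rw [← h1]
    change jetValue s U p = ∫ y, jetValue s (u y) p ∂μ
    unfold jetValue
    split_ifs
    · rw [iteratedFDeriv_integral_schwartz hu (fun n => ⟨B 0 n, hB 0 n, hBu 0 n⟩) hU p.1.2,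
        integral_const_mul]
    · simp
  simp_rw [hL]
  rw [key, L.integral_comp_comm hint]

end Interchange

/-! ### Exponentials with a rapidly decreasing weight -/

section ExpRem

/-- The Taylor remainder `exp z - ∑_{i < j} z ^ i / i!`. -/
def expRem (j : ℕ) (z : ℂ) : ℂ := Complex.exp z - ∑ i ∈ Finset.range j, z ^ i / (i.factorial : ℂ)

theorem expRem_zero (z : ℂ) : expRem 0 z = Complex.exp z := by simp [expRem]

theorem expRem_succ (j : ℕ) (z : ℂ) : expRem (j + 1) z = expRem j z - z ^ j / (j.factorial : ℂ) :=
    by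
  unfold expRem
  rw [Finset.sum_range_succ]
  ring

theorem norm_expRem_le (j : ℕ) (z : ℂ) : ‖expRem j z‖ ≤ ‖z‖ ^ j * Real.exp ‖z‖ :=
  Complex.norm_exp_sub_sum_le_norm_mul_exp z j

theorem contDiff_expRem (j : ℕ) : ContDiff ℝ ∞ (expRem j) := by
  unfold expRem
  refine (Complex.contDiff_exp (𝕜 := ℝ)).sub ?_
  fun_prop

theorem hasDerivAt_expRem (j : ℕ) (z : ℂ) : HasDerivAt (expRem j) (expRem (j - 1) z) z := by
  induction j with
  | zero =>
    have e : expRem 0 = Complex.exp := funext expRem_zero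
    rw [e]
    exact Complex.hasDerivAt_exp z
  | succ j ih =>
    have e : expRem (j + 1) = fun z => expRem j z - z ^ j / (j.factorial : ℂ) :=
      funext (expRem_succ j)
    rw [e]
    have h := ih.sub ((hasDerivAt_pow j z).div_const (j.factorial : ℂ))
    refine h.congr_deriv ?_
    rcases j with _ | j
    · simp
    · rw [Nat.add_sub_cancel, Nat.add_sub_cancel, expRem_succ, Nat.factorial_succ]
      push_cast
      have : ((j : ℂ) + 1) ≠ 0 := Nat.cast_add_one_ne_zero j
      have : ((j.factorial : ℕ) : ℂ) ≠ 0 := Nat.cast_ne_zero.2 j.factorial_ne_zero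
      field_simp

variable {E : Type*} [NormedAddCommGroup E] [NormedSpace ℝ E]

/-- One derivative of `g ∘ ℓ`, with `ℓ` linear, costs a factor `‖ℓ‖`. -/
theorem norm_iteratedFDeriv_succ_comp_clm_le {g g' : ℂ → ℂ} (hg : ∀ z, HasDerivAt g (g' z) z)
    (hg' : ContDiff ℝ ∞ g') (ℓ : E →L[ℝ] ℂ) (n : ℕ) (x : E) :
    ‖iteratedFDeriv ℝ (n + 1) (fun x => g (ℓ x)) x‖ ≤
      ‖ℓ‖ * ‖iteratedFDeriv ℝ n (fun x => g' (ℓ x)) x‖ := by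
  let L : ℂ →L[ℝ] (E →L[ℝ] ℂ) := (ContinuousLinearMap.lsmul ℝ ℂ).flip ℓ
  have hL : ‖L‖ ≤ ‖ℓ‖ := by
    refine ContinuousLinearMap.opNorm_le_bound _ (norm_nonneg _) fun c => ?_
    change ‖c • ℓ‖ ≤ _
    rw [norm_smul, mul_comm]
  have hfd : fderiv ℝ (fun x => g (ℓ x)) = L ∘ fun x => g' (ℓ x) := by
    funext x
    have h := ((hg (ℓ x)).hasFDerivAt.restrictScalars ℝ).comp x ℓ.hasFDerivAt
    have h2 : HasFDerivAt (fun x => g (ℓ x)) (L (g' (ℓ x))) x := by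
      refine h.congr_fderiv ?_
      ext v
      change ℓ v • g' (ℓ x) = g' (ℓ x) • ℓ v
      simp [mul_comm]
    exact h2.fderiv
  rw [← norm_iteratedFDeriv_fderiv, hfd]
  refine (L.norm_iteratedFDeriv_comp_left (N := ∞)
    (hg'.comp ℓ.contDiff).contDiffAt (mod_cast le_top)).trans ?_
  exact mul_le_mul_of_nonneg_right hL (norm_nonneg _)

theorem norm_iteratedFDeriv_exp_clm_le (ℓ : E →L[ℝ] ℂ) (n : ℕ) (x : E) :
    ‖iteratedFDeriv ℝ n (fun x => Complex.exp (ℓ x)) x‖ ≤ ‖ℓ‖ ^ n * ‖Complex.exp (ℓ x)‖ := by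
  induction n with
  | zero => simp
  | succ n ih =>
    refine (norm_iteratedFDeriv_succ_comp_clm_le Complex.hasDerivAt_exp
      Complex.contDiff_exp ℓ n x).trans ?_
    rw [pow_succ', mul_assoc]
    exact mul_le_mul_of_nonneg_left ih (norm_nonneg _)

theorem norm_iteratedFDeriv_expRem_clm_le {ℓ : E →L[ℝ] ℂ} (hℓ : ‖ℓ‖ ≤ 1) (j n : ℕ) (x : E) :
    ‖iteratedFDeriv ℝ n (fun x => expRem j (ℓ x)) x‖ ≤
      ‖ℓ‖ ^ j * (1 + ‖x‖) ^ j * Real.exp (‖ℓ‖ * ‖x‖) := by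
  induction n generalizing j with
  | zero =>
    rw [norm_iteratedFDeriv_zero]
    have h1 : ‖ℓ x‖ ≤ ‖ℓ‖ * ‖x‖ := ℓ.le_opNorm x
    calc ‖expRem j (ℓ x)‖ ≤ ‖ℓ x‖ ^ j * Real.exp ‖ℓ x‖ := norm_expRem_le _ _
      _ ≤ (‖ℓ‖ * (1 + ‖x‖)) ^ j * Real.exp (‖ℓ‖ * ‖x‖) := by
        gcongr
        exact h1.trans (mul_le_mul_of_nonneg_left (by linarith) (norm_nonneg _))
      _ = _ := by rw [mul_pow]
  | succ n ih =>
    refine (norm_iteratedFDeriv_succ_comp_clm_le (hasDerivAt_expRem j)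
      (contDiff_expRem _) ℓ n x).trans ?_
    refine (mul_le_mul_of_nonneg_left (ih (j - 1)) (norm_nonneg _)).trans ?_
    rcases j with _ | j
    · simp only [Nat.zero_sub, pow_zero, one_mul]
      exact mul_le_of_le_one_left (Real.exp_pos _).le hℓ
    · rw [Nat.add_sub_cancel, ← mul_assoc, ← mul_assoc, ← pow_succ']
      gcongr
      · linarith [norm_nonneg x]
      · exact Nat.le_succ j

/-- If every derivative of `c` is dominated by `c`, then every derivative of `1 / c` is dominated
by `1 / c`. -/
theorem exists_norm_iteratedFDeriv_inv_le {c : E → ℂ} (hc : ContDiff ℝ ∞ c) (h0 : ∀ x, c x ≠ 0)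
    (hb : ∀ n, ∃ C : ℝ, 0 ≤ C ∧ ∀ x, ‖iteratedFDeriv ℝ n c x‖ ≤ C * ‖c x‖) (n : ℕ) :
    ∃ C : ℝ, 0 ≤ C ∧ ∀ x, ‖iteratedFDeriv ℝ n (fun x => (c x)⁻¹) x‖ ≤ C * ‖(c x)⁻¹‖ := by
  choose B hB0 hB using hb
  have hi : ContDiff ℝ ∞ fun x => (c x)⁻¹ := hc.inv h0
  induction n using Nat.strong_induction_on with
  | _ n ih =>
    rcases n with _ | n
    · exact ⟨1, zero_le_one, fun x => by simp⟩
    · choose A hA0 hA using ih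
      -- the bound for a derivative of order `i ≤ n` of `1 / c`, and `0` beyond
      let A' : ℕ → ℝ := fun i => if h : i < n + 1 then A i h else 0
      have hA'0 : ∀ i, 0 ≤ A' i := fun i => by
        unfold A'; split_ifs <;> [exact hA0 _ _; exact le_rfl]
      have hA' : ∀ i ≤ n, ∀ x, ‖iteratedFDeriv ℝ i (fun x => (c x)⁻¹) x‖ ≤ A' i * ‖(c x)⁻¹‖ := by
        intro i hi x
        have h : i < n + 1 := Nat.lt_succ_of_le hi
        simp only [A', dif_pos h]
        exact hA i h x
      have hfd : fderiv ℝ (fun x => (c x)⁻¹) = fun x => (-((c x)⁻¹ * (c x)⁻¹)) • fderiv ℝ c x := by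
        funext x
        have hd := (hc.differentiable (by simp) x).hasFDerivAt
        have h1 := ((hasDerivAt_inv (h0 x)).hasFDerivAt.restrictScalars ℝ).comp x hd
        have h2 : HasFDerivAt (fun x => (c x)⁻¹) ((-((c x)⁻¹ * (c x)⁻¹)) • fderiv ℝ c x) x := by
          refine h1.congr_fderiv ?_
          ext v
          change (fderiv ℝ c x v) • (-(c x ^ 2)⁻¹) = (-((c x)⁻¹ * (c x)⁻¹)) • (fderiv ℝ c x v)
          rw [smul_eq_mul, smul_eq_mul, pow_two, mul_inv]
          ring
        exact h2.fderiv
      refine ⟨∑ i ∈ Finset.range (n + 1), (n.choose i : ℝ) * (∑ k ∈ Finset.range (i + 1),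
        (i.choose k : ℝ) * A' k * A' (i - k)) * B (n - i + 1), ?_, fun x => ?_⟩
      · exact Finset.sum_nonneg fun i _ => mul_nonneg (mul_nonneg (by positivity)
          (Finset.sum_nonneg fun k _ => mul_nonneg (mul_nonneg (by positivity) (hA'0 _)) (hA'0 _)))
          (hB0 _)
      · have hcx : 0 < ‖c x‖ := norm_pos_iff.2 (h0 x)
        rw [← norm_iteratedFDeriv_fderiv, hfd]
        have hcd : ContDiff ℝ ∞ (fderiv ℝ c) := hc.fderiv_right (by simp)
        refine (norm_iteratedFDeriv_smul_le (N := ∞) (hi.mul hi).neg hcd x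
          (mod_cast le_top)).trans ?_
        rw [Finset.sum_mul]
        refine Finset.sum_le_sum fun i hin => ?_
        have hin' : i ≤ n := Nat.lt_succ_iff.1 (Finset.mem_range.1 hin)
        have e1 : ‖iteratedFDeriv ℝ i (fun x => -((c x)⁻¹ * (c x)⁻¹)) x‖ ≤
            (∑ k ∈ Finset.range (i + 1), (i.choose k : ℝ) * A' k * A' (i - k)) *
              (‖(c x)⁻¹‖ * ‖(c x)⁻¹‖) := by
          have : (fun x => -((c x)⁻¹ * (c x)⁻¹)) = -fun x => (c x)⁻¹ * (c x)⁻¹ := rfl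
          rw [this, iteratedFDeriv_neg_apply, norm_neg]
          refine (norm_iteratedFDeriv_mul_le (N := ∞) hi hi x (mod_cast le_top)).trans ?_
          rw [Finset.sum_mul]
          refine Finset.sum_le_sum fun k hk => ?_
          have hk' : k ≤ i := Nat.lt_succ_iff.1 (Finset.mem_range.1 hk)
          calc _ ≤ (i.choose k : ℝ) * (A' k * ‖(c x)⁻¹‖) * (A' (i - k) * ‖(c x)⁻¹‖) := by
                refine mul_le_mul (mul_le_mul_of_nonneg_left (hA' k (hk'.trans hin') x)
                  (by positivity)) (hA' _ ((Nat.sub_le _ _).trans hin') x) (norm_nonneg _) ?_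
                exact mul_nonneg (by positivity) (mul_nonneg (hA'0 _) (norm_nonneg _))
            _ = _ := by ring
        have e2 : ‖iteratedFDeriv ℝ (n - i) (fderiv ℝ c) x‖ ≤ B (n - i + 1) * ‖c x‖ := by
          rw [norm_iteratedFDeriv_fderiv]
          exact hB _ x
        calc _ ≤ (n.choose i : ℝ) * ((∑ k ∈ Finset.range (i + 1), (i.choose k : ℝ) * A' k *
              A' (i - k)) * (‖(c x)⁻¹‖ * ‖(c x)⁻¹‖)) * (B (n - i + 1) * ‖c x‖) := by
              refine mul_le_mul (mul_le_mul_of_nonneg_left e1 (by positivity)) e2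
                (norm_nonneg _) ?_
              exact mul_nonneg (by positivity) ((norm_nonneg _).trans e1)
          _ = _ := by
              rw [norm_inv]
              field_simp

end ExpRem

section Weight

/-- The linear form `x ↦ s₁ x₁ + s₂ x₂`. -/
def charLin (s : ℂ × ℂ) : LogPlane →L[ℝ] ℂ :=
  s.1 • (Complex.ofRealCLM.comp (EuclideanSpace.proj 0)) +
    s.2 • (Complex.ofRealCLM.comp (EuclideanSpace.proj 1))

theorem charLin_apply (s : ℂ × ℂ) (x : LogPlane) : charLin s x = s.1 * (x 0 : ℂ) + s.2 *
    (x 1 : ℂ) :=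
  rfl

theorem character_add (s t : ℂ × ℂ) (x : LogPlane) :
    character (s + t) x = character s x * character t x := by
  simp only [character, ← Complex.exp_add, Prod.fst_add, Prod.snd_add]
  ring_nf

theorem character_zero (x : LogPlane) : character 0 x = 1 := by simp [character]

theorem norm_character (s : ℂ × ℂ) (x : LogPlane) :
    ‖character s x‖ = Real.exp (s.1.re * x 0 + s.2.re * x 1) := by
  simp [character, Complex.norm_exp]

theorem contDiff_character (s : ℂ × ℂ) : ContDiff ℝ ∞ (character s) :=
  Complex.contDiff_exp.comp (charLin s).contDiff

theorem abs_coord_le (x : LogPlane) (i : Fin 2) : |x i| ≤ ‖x‖ := by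
  simpa using PiLp.norm_apply_le x i

theorem norm_le_abs_add_abs (x : LogPlane) : ‖x‖ ≤ |x 0| + |x 1| := by
  rw [EuclideanSpace.norm_eq, Fin.sum_univ_two]
  refine Real.sqrt_le_iff.2 ⟨by positivity, ?_⟩
  simp only [Real.norm_eq_abs]
  nlinarith [abs_nonneg (x 0), abs_nonneg (x 1)]

theorem norm_charLin_le (s : ℂ × ℂ) : ‖charLin s‖ ≤ ‖s.1‖ + ‖s.2‖ := by
  refine ContinuousLinearMap.opNorm_le_bound _ (by positivity) fun x => ?_
  rw [charLin_apply, add_mul]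
  refine (norm_add_le _ _).trans ?_
  rw [norm_mul, norm_mul, Complex.norm_real, Complex.norm_real]
  gcongr
  · exact abs_coord_le x 0
  · exact abs_coord_le x 1

/-- The four vertices `(± N, ± N)`. -/
def vertex (N : ℝ) (ε : Bool × Bool) : ℝ × ℝ := (if ε.1 then N else -N, if ε.2 then N else -N)

/-- A sum of four exponentials that dominates `a ^ s` when `|Re sᵢ| ≤ N`. -/
def coshSum (N : ℝ) (x : LogPlane) : ℂ :=
  ∑ ε : Bool × Bool, character ((vertex N ε).1, (vertex N ε).2) x

theorem coshSum_eq (N : ℝ) (x : LogPlane) : coshSum N x =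
    (((Real.exp (N * x 0) + Real.exp (-N * x 0)) * (Real.exp (N * x 1) + Real.exp (-N * x 1)) : ℝ)
      : ℂ)
    := by
  have e : ∀ a b : ℝ, character ((a : ℂ), (b : ℂ)) x =
    ((Real.exp (a * x 0) * Real.exp (b * x 1) : ℝ) : ℂ) := by
    intro a b
    rw [← Real.exp_add]
    simp [character]
  simp only [coshSum, Fintype.sum_prod_type, Fintype.sum_bool, vertex, e]
  push_cast
  simp
  ring

theorem exp_le_norm_coshSum (N : ℝ) (x : LogPlane) :
    Real.exp (N * (|x 0| + |x 1|)) ≤ ‖coshSum N x‖ := by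
  have h : ∀ t : ℝ, Real.exp (N * |t|) ≤ Real.exp (N * t) + Real.exp (-N * t) := by
    intro t
    rcases abs_cases t with ⟨h, -⟩ | ⟨h, -⟩ <;> rw [h]
    · linarith [Real.exp_pos (-N * t)]
    · rw [mul_neg, ← neg_mul]
      linarith [Real.exp_pos (N * t)]
  rw [coshSum_eq, Complex.norm_real, Real.norm_of_nonneg (by positivity), mul_add, Real.exp_add]
  exact mul_le_mul (h _) (h _) (Real.exp_pos _).le (by positivity)

theorem coshSum_ne_zero (N : ℝ) (x : LogPlane) : coshSum N x ≠ 0 := by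
  rw [coshSum_eq]
  exact Complex.ofReal_ne_zero.2 (by positivity)

theorem norm_character_vertex_le (N : ℝ) (ε : Bool × Bool) (x : LogPlane) :
    ‖character ((vertex N ε).1, (vertex N ε).2) x‖ ≤ ‖coshSum N x‖ := by
  have e : ∀ ε, character (((vertex N ε).1 : ℂ), ((vertex N ε).2 : ℂ)) x =
      ((‖character (((vertex N ε).1 : ℂ), ((vertex N ε).2 : ℂ)) x‖ : ℝ) : ℂ) := by
    intro ε
    rw [norm_character]
    simp [character]
  have : coshSum N x = ((∑ ε, ‖character (((vertex N ε).1 : ℂ), ((vertex N ε).2 : ℂ)) x‖ : ℝ) :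
    ℂ) := by
    rw [Complex.ofReal_sum]
    exact Finset.sum_congr rfl fun ε _ => e ε
  rw [this, Complex.norm_real, Real.norm_of_nonneg (Finset.sum_nonneg fun _ _ => norm_nonneg _)]
  exact Finset.single_le_sum (f := fun ε => ‖character (((vertex N ε).1 : ℂ), ((vertex N ε).2 : ℂ))
    x‖)
    (fun _ _ => norm_nonneg _) (Finset.mem_univ ε)

theorem contDiff_coshSum (N : ℝ) : ContDiff ℝ ∞ (coshSum N) := by
  unfold coshSum
  exact ContDiff.sum fun ε _ => contDiff_character _

theorem exists_norm_iteratedFDeriv_coshSum_le (N : ℝ) (n : ℕ) :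
    ∃ C : ℝ, 0 ≤ C ∧ ∀ x, ‖iteratedFDeriv ℝ n (coshSum N) x‖ ≤ C * ‖coshSum N x‖ := by
  refine ⟨∑ ε : Bool × Bool, ‖charLin ((vertex N ε).1, (vertex N ε).2)‖ ^ n,
    Finset.sum_nonneg fun _ _ => by positivity, fun x => ?_⟩
  have h : iteratedFDeriv ℝ n (coshSum N) = _ :=
    iteratedFDeriv_sum (𝕜 := ℝ) (i := n) (u := (Finset.univ : Finset (Bool × Bool)))
    (f := fun ε => character ((vertex N ε).1, (vertex N ε).2))
    fun ε _ => (contDiff_character _).of_le (mod_cast le_top)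
  rw [h, Finset.sum_apply, Finset.sum_mul]
  refine (norm_sum_le _ _).trans (Finset.sum_le_sum fun ε _ => ?_)
  refine (norm_iteratedFDeriv_exp_clm_le (charLin _) n x).trans ?_
  refine mul_le_mul_of_nonneg_left ?_ (by positivity)
  exact norm_character_vertex_le N ε x

/-- The basic estimate: all Schwartz seminorms of `expRem j (h · x) exp (s · x) / coshSum N x`,
uniformly for `|Re sᵢ| ≤ R < N` and small `h`. -/
theorem exists_bound_expRem_mul {N R : ℝ} (hR : R < N) (j k n : ℕ) :
    ∃ C : ℝ, 0 ≤ C ∧ ∀ s h : ℂ × ℂ, |s.1.re| ≤ R → |s.2.re| ≤ R → ‖charLin h‖ ≤ 1 →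
      ‖charLin h‖ ≤ (N - R) / 2 → ∀ x : LogPlane,
      ‖x‖ ^ k * ‖iteratedFDeriv ℝ n
        (fun x => expRem j (charLin h x) * (character s x * (coshSum N x)⁻¹)) x‖ ≤
      C * ‖charLin h‖ ^ j * (1 + ‖charLin s‖) ^ n := by
  choose B hB0 hB using exists_norm_iteratedFDeriv_inv_le (contDiff_coshSum N) (coshSum_ne_zero N)
    (exists_norm_iteratedFDeriv_coshSum_le N)
  set δ := (N - R) / 2 with hδ
  have hδ0 : 0 < δ := by rw [hδ]; linarith
  -- the weight beats every power
  obtain ⟨A, hA⟩ : ∃ A : ℝ, ∀ t : ℝ, 0 ≤ t → (1 + t) ^ (k + j) * Real.exp (-δ * t) ≤ A := by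
    refine ⟨((k + j).factorial : ℝ) * (1 / δ) ^ (k + j) * Real.exp δ, fun t ht => ?_⟩
    have h2 := Real.pow_div_factorial_le_exp (δ * (1 + t)) (by positivity) (k + j)
    have hf : (0 : ℝ) < (k + j).factorial := by positivity
    rw [div_le_iff₀ hf, mul_pow] at h2
    calc (1 + t) ^ (k + j) * Real.exp (-δ * t)
        = (1 / δ) ^ (k + j) * (δ ^ (k + j) * (1 + t) ^ (k + j)) * Real.exp (-δ * t) := by
          rw [← mul_assoc, ← mul_pow, one_div_mul_cancel hδ0.ne', one_pow, one_mul]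
      _ ≤ (1 / δ) ^ (k + j) * (Real.exp (δ * (1 + t)) * (k + j).factorial) * Real.exp (-δ * t) := by
          gcongr
      _ = ((k + j).factorial : ℝ) * (1 / δ) ^ (k + j) *
        (Real.exp (δ * (1 + t)) * Real.exp (-δ * t)) := by
          ring
      _ = _ := by
          rw [← Real.exp_add]
          ring_nf
  have hA0 : 0 ≤ A := le_trans (by positivity) (hA 0 le_rfl)
  let C1 : ℕ → ℝ := fun i => ∑ l ∈ Finset.range (i + 1), (i.choose l : ℝ) * B (i - l)
  have hC1 : ∀ i, 0 ≤ C1 i := fun i =>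
    Finset.sum_nonneg fun l _ => mul_nonneg (by positivity) (hB0 _)
  refine ⟨(∑ i ∈ Finset.range (n + 1), (n.choose i : ℝ) * C1 (n - i)) * A,
    mul_nonneg (Finset.sum_nonneg fun i _ => mul_nonneg (by positivity) (hC1 _)) hA0,
    fun s h h1 h2 h3 h4 x => ?_⟩
  have hsm1 : ContDiff ℝ ∞ fun x => expRem j (charLin h x) :=
    (contDiff_expRem j).comp (charLin h).contDiff
  have hsm2 : ContDiff ℝ ∞ fun x => (coshSum N x)⁻¹ :=
    (contDiff_coshSum N).inv (coshSum_ne_zero N)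
  have hs1 : (1 : ℝ) ≤ 1 + ‖charLin s‖ := by linarith [norm_nonneg (charLin s)]
  have hw : ‖character s x‖ * ‖(coshSum N x)⁻¹‖ ≤ Real.exp (-(2 * δ) * ‖x‖) := by
    rw [norm_inv, ← div_eq_mul_inv, div_le_iff₀ (norm_pos_iff.2 (coshSum_ne_zero N x)),
      norm_character]
    refine le_trans ?_ (mul_le_mul_of_nonneg_left (exp_le_norm_coshSum N x) (Real.exp_pos _).le)
    rw [← Real.exp_add, Real.exp_le_exp]
    have t1 : s.1.re * x 0 ≤ R * |x 0| := (le_abs_self _).trans (by rw [abs_mul]; gcongr)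
    have t2 : s.2.re * x 1 ≤ R * |x 1| := (le_abs_self _).trans (by rw [abs_mul]; gcongr)
    have t3 := mul_le_mul_of_nonneg_left (norm_le_abs_add_abs x) (by linarith : 0 ≤ 2 * δ)
    have : N = R + 2 * δ := by rw [hδ]; ring
    rw [this]
    nlinarith
  have hin : ∀ i, ‖iteratedFDeriv ℝ i (fun x => character s x * (coshSum N x)⁻¹) x‖ ≤
      C1 i * (1 + ‖charLin s‖) ^ i * Real.exp (-(2 * δ) * ‖x‖) := by
    intro i
    refine (norm_iteratedFDeriv_mul_le (N := ∞) (contDiff_character s) hsm2 x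
      (mod_cast le_top)).trans ?_
    rw [Finset.sum_mul, Finset.sum_mul]
    refine Finset.sum_le_sum fun l hl => ?_
    have hl' : l ≤ i := Nat.lt_succ_iff.1 (Finset.mem_range.1 hl)
    calc _ ≤ (i.choose l : ℝ) * (‖charLin s‖ ^ l * ‖character s x‖) *
          (B (i - l) * ‖(coshSum N x)⁻¹‖) := by
          refine mul_le_mul (mul_le_mul_of_nonneg_left
            (norm_iteratedFDeriv_exp_clm_le (charLin s) l x) (by positivity)) (hB _ x)
            (norm_nonneg _) (by positivity)
      _ = (i.choose l : ℝ) * B (i - l) * ‖charLin s‖ ^ l *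
          (‖character s x‖ * ‖(coshSum N x)⁻¹‖) := by ring
      _ ≤ (i.choose l : ℝ) * B (i - l) * (1 + ‖charLin s‖) ^ i * Real.exp (-(2 * δ) * ‖x‖) := by
          refine mul_le_mul (mul_le_mul_of_nonneg_left ?_ (mul_nonneg (by positivity) (hB0 _))) hw
            (by positivity) (mul_nonneg (mul_nonneg (by positivity) (hB0 _)) (by positivity))
          exact (pow_le_pow_left₀ (norm_nonneg _) (by linarith) l).trans
            (pow_le_pow_right₀ hs1 hl')
  have hx0 : 0 ≤ ‖x‖ := norm_nonneg x
  have hbase : ‖x‖ ^ k * ((1 + ‖x‖) ^ j * Real.exp (‖charLin h‖ * ‖x‖) * Real.exp (-(2 * δ) * ‖x‖))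
      ≤ A := by
    refine le_trans ?_ (hA ‖x‖ hx0)
    rw [mul_assoc, ← Real.exp_add, pow_add, mul_assoc]
    refine mul_le_mul (pow_le_pow_left₀ hx0 (by linarith) k) ?_ (by positivity) (by positivity)
    refine mul_le_mul_of_nonneg_left (Real.exp_le_exp.2 ?_) (by positivity)
    nlinarith
  calc ‖x‖ ^ k * ‖iteratedFDeriv ℝ n
        (fun x => expRem j (charLin h x) * (character s x * (coshSum N x)⁻¹)) x‖
      ≤ ‖x‖ ^ k * ∑ i ∈ Finset.range (n + 1), (n.choose i : ℝ) *
        (‖charLin h‖ ^ j * (1 + ‖x‖) ^ j * Real.exp (‖charLin h‖ * ‖x‖)) *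
        (C1 (n - i) * (1 + ‖charLin s‖) ^ n * Real.exp (-(2 * δ) * ‖x‖)) := by
        refine mul_le_mul_of_nonneg_left ?_ (by positivity)
        refine (norm_iteratedFDeriv_mul_le (N := ∞) hsm1 ((contDiff_character s).mul hsm2) x
          (mod_cast le_top)).trans (Finset.sum_le_sum fun i hi => ?_)
        refine mul_le_mul (mul_le_mul_of_nonneg_left
          (norm_iteratedFDeriv_expRem_clm_le h3 j i x) (by positivity)) ?_ (norm_nonneg _)
          (by positivity)
        refine (hin (n - i)).trans ?_
        have := pow_le_pow_right₀ hs1 (Nat.sub_le n i)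
        have := hC1 (n - i)
        gcongr
    _ = (∑ i ∈ Finset.range (n + 1), (n.choose i : ℝ) * C1 (n - i)) *
        (‖x‖ ^ k * ((1 + ‖x‖) ^ j * Real.exp (‖charLin h‖ * ‖x‖) * Real.exp (-(2 * δ) * ‖x‖))) *
        ‖charLin h‖ ^ j * (1 + ‖charLin s‖) ^ n := by
        rw [Finset.mul_sum, Finset.sum_mul, Finset.sum_mul, Finset.sum_mul]
        exact Finset.sum_congr rfl fun i _ => by ring
    _ ≤ _ := by
        have : 0 ≤ ∑ i ∈ Finset.range (n + 1), (n.choose i : ℝ) * C1 (n - i) :=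
          Finset.sum_nonneg fun i _ => mul_nonneg (by positivity) (hC1 _)
        gcongr

end Weight

/-! ### The Mellin transform of an absolutely tempered distribution -/

/-- The point `s - 2πiξ` of the vertical plane through `s`. -/
def vert (s : ℂ × ℂ) (ξ : LogPlane) : ℂ × ℂ :=
  (s.1 - 2 * (Real.pi : ℂ) * Complex.I * (ξ 0 : ℂ), s.2 - 2 * (Real.pi : ℂ) * Complex.I * (ξ 1 : ℂ))

/-- The strip around the plane `i ℝ²` of half-width `N`. -/
def InStrip (N : ℝ) (s : ℂ × ℂ) : Prop := |s.1.re| < N ∧ |s.2.re| < N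

theorem vert_re (s : ℂ × ℂ) (ξ : LogPlane) :
    (vert s ξ).1.re = s.1.re ∧ (vert s ξ).2.re = s.2.re := by
  constructor <;> simp [vert]

theorem vert_im (s : ℂ × ℂ) (ξ : LogPlane) : (vert s ξ).1.im = s.1.im - 2 * Real.pi * ξ 0 ∧
    (vert s ξ).2.im = s.2.im - 2 * Real.pi * ξ 1 := by
  constructor <;> simp [vert]

theorem inStrip_vert {N : ℝ} {s : ℂ × ℂ} (ξ : LogPlane) :
    InStrip N (vert s ξ) ↔ InStrip N s := by
  unfold InStrip
  rw [(vert_re s ξ).1, (vert_re s ξ).2]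

theorem continuous_vert (s : ℂ × ℂ) : Continuous (vert s) := by
  unfold vert
  fun_prop

open scoped RealInnerProductSpace in
theorem character_vert (s : ℂ × ℂ) (ξ x : LogPlane) : character (vert s ξ) x =
    character s x * Complex.exp (((-2 * Real.pi * ⟪ξ, x⟫ : ℝ) : ℂ) * Complex.I) := by
  simp only [character, vert, ← Complex.exp_add, PiLp.inner_apply, Fin.sum_univ_two]
  congr 1
  simp
  ring

theorem exists_norm_charLin_vert_le (s : ℂ × ℂ) :
    ∃ A : ℝ, 0 ≤ A ∧ ∀ ξ, 1 + ‖charLin (vert s ξ)‖ ≤ A * (1 + ‖ξ‖) := by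
  refine ⟨1 + ‖s.1‖ + ‖s.2‖ + 4 * Real.pi, by positivity, fun ξ => ?_⟩
  have h : ∀ (c : ℂ) (i : Fin 2), ‖c - 2 * (Real.pi : ℂ) * Complex.I * (ξ i : ℂ)‖ ≤
      ‖c‖ + 2 * Real.pi * ‖ξ‖ := by
    intro c i
    refine (norm_sub_le _ _).trans ?_
    simp only [norm_mul, Complex.norm_I, Complex.norm_real, Real.norm_eq_abs, Complex.norm_ofNat,
      mul_one, abs_of_pos Real.pi_pos]
    have := abs_coord_le ξ i
    have := Real.pi_pos
    gcongr
  have h1 := norm_charLin_le (vert s ξ)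
  have h2 := h s.1 0
  have h3 := h s.2 1
  have h4 : ‖(vert s ξ).1‖ ≤ ‖s.1‖ + 2 * Real.pi * ‖ξ‖ := h2
  have h5 : ‖(vert s ξ).2‖ ≤ ‖s.2‖ + 2 * Real.pi * ‖ξ‖ := h3
  have : 0 ≤ (1 + ‖s.1‖ + ‖s.2‖) * ‖ξ‖ := by positivity
  nlinarith [Real.pi_pos, norm_nonneg ξ]

section ExpFam

theorem charLin_zero : charLin 0 = 0 := by
  ext x
  simp [charLin_apply]

theorem exists_bound_character_mul {N : ℝ} {s : ℂ × ℂ} (hs : InStrip N s) (k n : ℕ) :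
    ∃ C : ℝ, ∀ x, ‖x‖ ^ k * ‖iteratedFDeriv ℝ n (fun x => character s x * (coshSum N x)⁻¹) x‖ ≤
      C := by
  obtain ⟨C, -, h⟩ := exists_bound_expRem_mul (max_lt hs.1 hs.2) 0 k n
  refine ⟨_, fun x => le_trans (le_of_eq ?_) (h s 0 (le_max_left _ _) (le_max_right _ _)
    (by rw [charLin_zero, norm_zero]; exact zero_le_one)
    (by rw [charLin_zero, norm_zero]; linarith [max_lt hs.1 hs.2]) x)⟩
  simp [expRem_zero, charLin_zero]

open Classical in
/-- The Schwartz function `exp(s · x) / coshSum N x`, for `|Re sᵢ| < N`. -/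
def expFam (N : ℝ) (s : ℂ × ℂ) : 𝓢(LogPlane, ℂ) :=
  if hs : InStrip N s then
    { toFun := fun x => character s x * (coshSum N x)⁻¹
      smooth' := (contDiff_character s).mul ((contDiff_coshSum N).inv (coshSum_ne_zero N))
      decay' := exists_bound_character_mul hs }
  else 0

theorem expFam_coe {N : ℝ} {s : ℂ × ℂ} (hs : InStrip N s) :
    ⇑(expFam N s) = fun x => character s x * (coshSum N x)⁻¹ := by
  rw [expFam, dif_pos hs]
  rfl

theorem exists_seminorm_expFam_le {N R : ℝ} (hR : R < N) (k n : ℕ) :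
    ∃ C : ℝ, 0 ≤ C ∧ ∀ s : ℂ × ℂ, |s.1.re| ≤ R → |s.2.re| ≤ R →
      SchwartzMap.seminorm ℝ k n (expFam N s) ≤ C * (1 + ‖charLin s‖) ^ n := by
  obtain ⟨C, hC, h⟩ := exists_bound_expRem_mul hR 0 k n
  refine ⟨C, hC, fun s h1 h2 => ?_⟩
  refine SchwartzMap.seminorm_le_bound ℝ k n _ (by positivity) fun x => ?_
  rw [expFam_coe ⟨h1.trans_lt hR, h2.trans_lt hR⟩]
  refine le_trans (le_of_eq ?_) ((h s 0 h1 h2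
    (by rw [charLin_zero, norm_zero]; exact zero_le_one)
    (by rw [charLin_zero, norm_zero]; linarith) x).trans (le_of_eq ?_))
  · simp [expRem_zero, charLin_zero]
  · simp

theorem exists_seminorm_expFam_sub_le {N R : ℝ} (hR : R < N) (k n : ℕ) :
    ∃ C : ℝ, 0 ≤ C ∧ ∀ s h : ℂ × ℂ, |s.1.re| ≤ R → |s.2.re| ≤ R → InStrip N (s + h) →
      ‖charLin h‖ ≤ 1 → ‖charLin h‖ ≤ (N - R) / 2 →
      SchwartzMap.seminorm ℝ k n (expFam N (s + h) - expFam N s) ≤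
        C * ‖charLin h‖ * (1 + ‖charLin s‖) ^ n := by
  obtain ⟨C, hC, H⟩ := exists_bound_expRem_mul hR 1 k n
  refine ⟨C, hC, fun s h h1 h2 h3 h4 h5 => ?_⟩
  refine SchwartzMap.seminorm_le_bound ℝ k n _ (by positivity) fun x => ?_
  refine le_trans (le_of_eq ?_) ((H s h h1 h2 h4 h5 x).trans (by rw [pow_one]))
  congr 3
  funext x
  change expFam N (s + h) x - expFam N s x = _
  rw [expFam_coe ⟨h1.trans_lt hR, h2.trans_lt hR⟩, expFam_coe h3]
  simp only [character_add]
  simp only [expRem_succ, expRem_zero]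
  rw [show Complex.exp (charLin h x) = character h x from rfl]
  simp
  ring

/-- Multiplication by a coordinate. -/
def coordMul (i : Fin 2) : 𝓢(LogPlane, ℂ) →L[ℂ] 𝓢(LogPlane, ℂ) :=
  SchwartzMap.smulLeftCLM ℂ (fun x : LogPlane => ((x i : ℝ) : ℂ))

theorem coordMul_apply (i : Fin 2) (φ : 𝓢(LogPlane, ℂ)) (x : LogPlane) :
    coordMul i φ x = (x i : ℂ) * φ x := by
  have h : Function.HasTemperateGrowth (fun x : LogPlane => ((x i : ℝ) : ℂ)) :=
    (Complex.ofRealCLM.comp (EuclideanSpace.proj (𝕜 := ℝ) i)).hasTemperateGrowth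
  rw [coordMul, SchwartzMap.smulLeftCLM_apply_apply h]
  rfl

theorem exists_seminorm_expFam_sub_sub_le {N R : ℝ} (hR : R < N) (k n : ℕ) :
    ∃ C : ℝ, 0 ≤ C ∧ ∀ s h : ℂ × ℂ, |s.1.re| ≤ R → |s.2.re| ≤ R → InStrip N (s + h) →
      ‖charLin h‖ ≤ 1 → ‖charLin h‖ ≤ (N - R) / 2 →
      SchwartzMap.seminorm ℝ k n (expFam N (s + h) - expFam N s -
        (h.1 • coordMul 0 (expFam N s) + h.2 • coordMul 1 (expFam N s))) ≤
        C * ‖charLin h‖ ^ 2 * (1 + ‖charLin s‖) ^ n := by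
  obtain ⟨C, hC, H⟩ := exists_bound_expRem_mul hR 2 k n
  refine ⟨C, hC, fun s h h1 h2 h3 h4 h5 => ?_⟩
  refine SchwartzMap.seminorm_le_bound ℝ k n _ (by positivity) fun x => ?_
  refine le_trans (le_of_eq ?_) (H s h h1 h2 h4 h5 x)
  congr 3
  funext x
  change expFam N (s + h) x - expFam N s x - (h.1 * coordMul 0 (expFam N s) x +
    h.2 * coordMul 1 (expFam N s) x) = _
  rw [coordMul_apply, coordMul_apply, expFam_coe ⟨h1.trans_lt hR, h2.trans_lt hR⟩, expFam_coe h3]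
  simp only [character_add]
  simp only [expRem_succ, expRem_zero]
  rw [show Complex.exp (charLin h x) = character h x from rfl, charLin_apply]
  simp
  ring

/-- The Mellin transform of `G / coshSum N`. -/
def stripMellin (N : ℝ) (G : 𝓢'(LogPlane, ℂ)) (s : ℂ × ℂ) : ℂ := G (expFam N s)

theorem exists_norm_stripMellin_le {N R : ℝ} (hR : R < N) (G : 𝓢'(LogPlane, ℂ)) :
    ∃ (C : ℝ) (M : ℕ), 0 ≤ C ∧ ∀ s : ℂ × ℂ, |s.1.re| ≤ R → |s.2.re| ≤ R →
      ‖stripMellin N G s‖ ≤ C * (1 + ‖charLin s‖) ^ M := by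
  obtain ⟨t, C, hC, h⟩ := exists_norm_le_sum_seminorm G
  choose A hA0 hA using fun m : ℕ × ℕ => exists_seminorm_expFam_le hR m.1 m.2
  refine ⟨C * ∑ m ∈ t, A m, t.sup Prod.snd, mul_nonneg hC (Finset.sum_nonneg fun m _ => hA0 m),
    fun s h1 h2 => (h _).trans ?_⟩
  rw [mul_assoc, Finset.sum_mul]
  refine mul_le_mul_of_nonneg_left (Finset.sum_le_sum fun m hm => ?_) hC
  refine (hA m s h1 h2).trans (mul_le_mul_of_nonneg_left ?_ (hA0 m))
  exact pow_le_pow_right₀ (by linarith [norm_nonneg (charLin s)]) (Finset.le_sup (f := Prod.snd) hm)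

theorem norm_charLin_le_two_mul (s : ℂ × ℂ) : ‖charLin s‖ ≤ 2 * ‖s‖ := by
  refine (norm_charLin_le s).trans ?_
  have := norm_fst_le s
  have := norm_snd_le s
  linarith

open Filter Topology in
/-- Small increments stay in the strip and are controlled by `charLin`. -/
theorem eventually_small {N R : ℝ} (hR : R < N) {s : ℂ × ℂ} (h1 : |s.1.re| ≤ R)
    (h2 : |s.2.re| ≤ R) : ∀ᶠ h in 𝓝 (0 : ℂ × ℂ), InStrip N (s + h) ∧ ‖charLin h‖ ≤ 1 ∧
      ‖charLin h‖ ≤ (N - R) / 2 := by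
  have hδ : 0 < min (1 / 2) ((N - R) / 4) := lt_min (by norm_num) (by linarith)
  filter_upwards [Metric.ball_mem_nhds (0 : ℂ × ℂ) hδ] with h hh
  rw [mem_ball_zero_iff, lt_min_iff] at hh
  have h3 := norm_charLin_le_two_mul h
  have h4 := (Complex.abs_re_le_norm h.1).trans (norm_fst_le h)
  have h5 := (Complex.abs_re_le_norm h.2).trans (norm_snd_le h)
  refine ⟨⟨?_, ?_⟩, by linarith, by linarith⟩
  · rw [Prod.fst_add, Complex.add_re]
    exact (abs_add_le _ _).trans_lt (by linarith)
  · rw [Prod.snd_add, Complex.add_re]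
    exact (abs_add_le _ _).trans_lt (by linarith)

open Filter Topology in
theorem continuousAt_expFam {N : ℝ} {s : ℂ × ℂ} (hs : InStrip N s) :
    ContinuousAt (expFam N) s := by
  have hR : max |s.1.re| |s.2.re| < N := max_lt hs.1 hs.2
  unfold ContinuousAt
  rw [(schwartz_withSeminorms ℝ LogPlane ℂ).tendsto_nhds]
  rintro ⟨k, n⟩ ε hε
  obtain ⟨C, hC, h⟩ := exists_seminorm_expFam_sub_le hR k n
  have h0 : Tendsto (fun t : ℂ × ℂ => C * (2 * ‖t - s‖) * (1 + ‖charLin s‖) ^ n) (𝓝 s) (𝓝 0) := by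
    have : Continuous fun t : ℂ × ℂ => C * (2 * ‖t - s‖) * (1 + ‖charLin s‖) ^ n := by fun_prop
    simpa using this.tendsto s
  have hsub : Tendsto (fun t : ℂ × ℂ => t - s) (𝓝 s) (𝓝 0) := by
    have : Continuous fun t : ℂ × ℂ => t - s := by fun_prop
    simpa using this.tendsto s
  filter_upwards [hsub.eventually (eventually_small hR (le_max_left _ _) (le_max_right _ _)),
    h0.eventually (gt_mem_nhds hε)] with t ht ht2
  refine lt_of_le_of_lt ?_ ht2
  have := h s (t - s) (le_max_left _ _) (le_max_right _ _) ht.1 ht.2.1 ht.2.2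
  rw [add_sub_cancel] at this
  refine this.trans ?_
  have := norm_charLin_le_two_mul (t - s)
  gcongr

open Filter Topology Asymptotics in
theorem differentiableAt_stripMellin {N : ℝ} (G : 𝓢'(LogPlane, ℂ)) {s : ℂ × ℂ}
    (hs : InStrip N s) : DifferentiableAt ℂ (stripMellin N G) s := by
  have hR : max |s.1.re| |s.2.re| < N := max_lt hs.1 hs.2
  obtain ⟨t, C, hC, h⟩ := exists_norm_le_sum_seminorm G
  choose A hA0 hA using fun m : ℕ × ℕ => exists_seminorm_expFam_sub_sub_le hR m.1 m.2
  let D : ℂ × ℂ →L[ℂ] ℂ := G (coordMul 0 (expFam N s)) • ContinuousLinearMap.fst ℂ ℂ ℂ +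
    G (coordMul 1 (expFam N s)) • ContinuousLinearMap.snd ℂ ℂ ℂ
  suffices HasFDerivAt (stripMellin N G) D s from this.differentiableAt
  rw [hasFDerivAt_iff_isLittleO_nhds_zero]
  have hO : (fun h : ℂ × ℂ => stripMellin N G (s + h) - stripMellin N G s - D h) =O[𝓝 0]
      fun h => ‖h‖ ^ 2 := by
    refine IsBigO.of_bound (C * ∑ m ∈ t, A m * 4 * (1 + ‖charLin s‖) ^ m.2) ?_
    filter_upwards [eventually_small hR (s := s) (le_max_left _ _) (le_max_right _ _)] with u hu
    have e : stripMellin N G (s + u) - stripMellin N G s - D u = G (expFam N (s + u) - expFam N s -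
        (u.1 • coordMul 0 (expFam N s) + u.2 • coordMul 1 (expFam N s))) := by
      rw [map_sub, map_sub, map_add, map_smul, map_smul]
      simp only [stripMellin, D]
      simp
      ring
    rw [e]
    refine (h _).trans ?_
    rw [norm_pow, norm_norm, mul_assoc, Finset.sum_mul]
    refine mul_le_mul_of_nonneg_left (Finset.sum_le_sum fun m _ => ?_) hC
    refine (hA m s u (le_max_left _ _) (le_max_right _ _) hu.1 hu.2.1 hu.2.2).trans ?_
    have h1 : ‖charLin u‖ ^ 2 ≤ 4 * ‖u‖ ^ 2 := by
      have := norm_charLin_le_two_mul u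
      have := norm_nonneg (charLin u)
      nlinarith
    calc A m * ‖charLin u‖ ^ 2 * (1 + ‖charLin s‖) ^ m.2
        ≤ A m * (4 * ‖u‖ ^ 2) * (1 + ‖charLin s‖) ^ m.2 := by
          have := hA0 m
          gcongr
      _ = _ := by ring
  refine hO.trans_isLittleO ?_
  have : (fun h : ℂ × ℂ => ‖h‖ ^ 2) =o[𝓝 0] fun h => h := by
    simpa using (isLittleO_norm_pow_id (E' := ℂ × ℂ) one_lt_two)
  exact this

theorem hasPolyGrowth_stripMellin_vert {N : ℝ} (G : 𝓢'(LogPlane, ℂ)) {s : ℂ × ℂ}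
    (hs : InStrip N s) : HasPolyGrowth fun ξ => stripMellin N G (vert s ξ) := by
  obtain ⟨C, M, hC, h⟩ := exists_norm_stripMellin_le (max_lt hs.1 hs.2) G
  obtain ⟨A, hA0, hA⟩ := exists_norm_charLin_vert_le s
  refine ⟨C * A ^ M, M, fun ξ => ?_⟩
  refine (h (vert s ξ) ?_ ?_).trans ?_
  · rw [(vert_re s ξ).1]; exact le_max_left _ _
  · rw [(vert_re s ξ).2]; exact le_max_right _ _
  · rw [mul_assoc, ← mul_pow]
    exact mul_le_mul_of_nonneg_left (pow_le_pow_left₀ (by positivity) (hA ξ) M) hC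

theorem continuous_stripMellin_vert {N : ℝ} (G : 𝓢'(LogPlane, ℂ)) {s : ℂ × ℂ}
    (hs : InStrip N s) : Continuous fun ξ => stripMellin N G (vert s ξ) :=
  continuous_iff_continuousAt.2 fun ξ => ContinuousAt.comp (g := stripMellin N G)
    (differentiableAt_stripMellin G ((inStrip_vert ξ).2 hs)).continuousAt
    (continuous_vert s).continuousAt

theorem seminorm_smul_complex (k n : ℕ) (c : ℂ) (φ : 𝓢(LogPlane, ℂ)) :
    SchwartzMap.seminorm ℝ k n (c • φ) = ‖c‖ * SchwartzMap.seminorm ℝ k n φ :=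
  map_smul_eq_mul (SchwartzMap.seminorm ℂ k n) c φ

/-- On a vertical plane, `stripMellin` is a Fourier transform. -/
theorem fourier_smulLeft_expFam {N : ℝ} (G : 𝓢'(LogPlane, ℂ)) {s : ℂ × ℂ} (hs : InStrip N s)
    (φ : 𝓢(LogPlane, ℂ)) : 𝓕 (TemperedDistribution.smulLeftCLM ℂ (expFam N s) G) φ =
      ∫ ξ, stripMellin N G (vert s ξ) * φ ξ := by
  rw [TemperedDistribution.fourier_apply, TemperedDistribution.smulLeftCLM_apply_apply]
  have hcont : Continuous fun ξ => expFam N (vert s ξ) :=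
    continuous_iff_continuousAt.2 fun ξ => ContinuousAt.comp
      (continuousAt_expFam ((inStrip_vert ξ).2 hs)) (continuous_vert s).continuousAt
  have hR : max |s.1.re| |s.2.re| < N := max_lt hs.1 hs.2
  rw [apply_integral_schwartz G (μ := volume) (u := fun ξ => φ ξ • expFam N (vert s ξ))
    (φ.continuous.smul hcont)]
  · refine integral_congr_ae (Filter.Eventually.of_forall fun ξ => ?_)
    change G (φ ξ • expFam N (vert s ξ)) = G (expFam N (vert s ξ)) * φ ξ
    rw [map_smul, smul_eq_mul, mul_comm]
  · intro k n
    obtain ⟨C, hC, h⟩ := exists_seminorm_expFam_le hR k n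
    obtain ⟨A, hA0, hA⟩ := exists_norm_charLin_vert_le s
    have hK : HasPolyGrowth fun ξ : LogPlane => (((C * A ^ n) * (1 + ‖ξ‖) ^ n : ℝ) : ℂ) :=
      ⟨C * A ^ n, n, fun ξ => by
        rw [Complex.norm_real, Real.norm_of_nonneg (by positivity)]⟩
    refine ⟨_, (hK.integrable_mul (by fun_prop) φ).norm, fun ξ => ?_⟩
    rw [seminorm_smul_complex, norm_mul, Complex.norm_real, Real.norm_of_nonneg (by positivity),
      mul_comm]
    refine mul_le_mul_of_nonneg_right ?_ (norm_nonneg _)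
    refine (h (vert s ξ) ?_ ?_).trans ?_
    · rw [(vert_re s ξ).1]; exact le_max_left _ _
    · rw [(vert_re s ξ).2]; exact le_max_right _ _
    · rw [mul_assoc, ← mul_pow]
      exact mul_le_mul_of_nonneg_left (pow_le_pow_left₀ (by positivity) (hA ξ) n) hC
  · intro x
    rw [SchwartzMap.smulLeftCLM_apply_apply (expFam N s).hasTemperateGrowth,
      SchwartzMap.fourier_coe,
      Real.fourier_eq', expFam_coe hs, smul_eq_mul, ← integral_const_mul]
    refine integral_congr_ae (Filter.Eventually.of_forall fun ξ => ?_)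
    change _ = φ ξ * expFam N (vert s ξ) x
    rw [expFam_coe ((inStrip_vert ξ).2 hs)]
    simp only [character_vert, smul_eq_mul]
    ring

end ExpFam

theorem HasCompactSupport.character_mul {φ : LogPlane → ℂ} (hφ : HasCompactSupport φ) (s : ℂ × ℂ) :
    HasCompactSupport fun x => character s x * φ x := hφ.mul_left

/-- Two distributions that represent the same `f(a) a^s` agree. -/
theorem IsTwist.unique {f g₁ g₂ : 𝓢'(LogPlane, ℂ)} {s : ℂ × ℂ} (h₁ : IsTwist f s g₁)
    (h₂ : IsTwist f s g₂) : g₁ = g₂ := by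
  refine temperedDistribution_ext fun φ hφ => ?_
  have hs : ContDiff ℝ ∞ fun x => character s x * φ x := (contDiff_character s).mul (φ.smooth ⊤)
  let ψ := (HasCompactSupport.character_mul hφ s).toSchwartzMap hs
  rw [h₁ φ ψ hφ fun x => rfl, h₂ φ ψ hφ fun x => rfl]

/-- The function on a vertical plane which is the Fourier transform of `f(a) a^σ` is unique. -/
theorem eq_of_fourier_isTwist {f g₁ g₂ : 𝓢'(LogPlane, ℂ)} {s : ℂ × ℂ} (h₁ : IsTwist f s g₁)
    (h₂ : IsTwist f s g₂) {K₁ K₂ : LogPlane → ℂ} (c₁ : Continuous K₁) (c₂ : Continuous K₂)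
    (p₁ : HasPolyGrowth K₁) (p₂ : HasPolyGrowth K₂)
    (e₁ : ∀ φ, 𝓕 g₁ φ = ∫ ξ, K₁ ξ * φ ξ) (e₂ : ∀ φ, 𝓕 g₂ φ = ∫ ξ, K₂ ξ * φ ξ) : K₁ = K₂ := by
  have hp : HasPolyGrowth fun ξ => K₁ ξ - K₂ ξ := by
    obtain ⟨C₁, N₁, H₁⟩ := p₁
    obtain ⟨C₂, N₂, H₂⟩ := p₂
    refine ⟨|C₁| + |C₂|, max N₁ N₂, fun ξ => (norm_sub_le _ _).trans ?_⟩
    have hb : 1 ≤ 1 + ‖ξ‖ := by linarith [norm_nonneg ξ]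
    rw [add_mul]
    refine add_le_add ((H₁ ξ).trans ?_) ((H₂ ξ).trans ?_)
    · exact mul_le_mul (le_abs_self _) (pow_le_pow_right₀ hb (le_max_left _ _)) (by positivity)
        (abs_nonneg _)
    · exact mul_le_mul (le_abs_self _) (pow_le_pow_right₀ hb (le_max_right _ _)) (by positivity)
        (abs_nonneg _)
  have h0 := eq_zero_of_forall_integral_mul_fourierInv (c₁.sub c₂) hp fun φ _ => by
    have hu := h₁.unique h₂
    rw [← hu] at e₂
    have := (e₁ (𝓕⁻ φ)).symm.trans (e₂ (𝓕⁻ φ))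
    change ∫ ξ, (K₁ ξ - K₂ ξ) * 𝓕⁻ φ ξ = 0
    simp only [sub_mul]
    rw [integral_sub (p₁.integrable_mul c₁ _) (p₂.integrable_mul c₂ _), this, sub_self]
  funext ξ
  exact sub_eq_zero.1 (congrFun h0 ξ)

/-- An absolutely tempered distribution has a Mellin transform in every strip. -/
theorem exists_stripMellin {f : 𝓢'(LogPlane, ℂ)} (hf : f ∈ absTempered) (N : ℝ) :
    ∃ G : 𝓢'(LogPlane, ℂ), ∀ s, InStrip N s →
      IsTwist f s (TemperedDistribution.smulLeftCLM ℂ (expFam N s) G) := by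
  choose g hg using hf
  refine ⟨∑ ε : Bool × Bool, g ((vertex N ε).1, (vertex N ε).2), fun s hs φ ψ hφ hψ => ?_⟩
  rw [TemperedDistribution.smulLeftCLM_apply_apply]
  set θ := SchwartzMap.smulLeftCLM ℂ (expFam N s) φ with hθ
  have hθx : ∀ x, θ x = character s x * (coshSum N x)⁻¹ * φ x := fun x => by
    rw [hθ, SchwartzMap.smulLeftCLM_apply_apply (expFam N s).hasTemperateGrowth, expFam_coe hs]
    rfl
  have hθc : HasCompactSupport θ := by
    have : (θ : LogPlane → ℂ) = fun x => (character s x * (coshSum N x)⁻¹) * φ x := funext hθx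
    rw [this]
    exact hφ.mul_left
  let ψ' : Bool × Bool → 𝓢(LogPlane, ℂ) := fun ε =>
    (HasCompactSupport.character_mul hθc ((vertex N ε).1, (vertex N ε).2)).toSchwartzMap
      ((contDiff_character _).mul (θ.smooth ⊤))
  have e : ∀ ε, g ((vertex N ε).1, (vertex N ε).2) θ = f (ψ' ε) := fun ε =>
    hg _ θ (ψ' ε) hθc fun x => rfl
  have h1 : (∑ ε : Bool × Bool, g (((vertex N ε).1 : ℂ), ((vertex N ε).2 : ℂ))) θ
      = ∑ ε : Bool × Bool, g (((vertex N ε).1 : ℂ), ((vertex N ε).2 : ℂ)) θ := by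
    rw [sum_apply]
  rw [h1]
  simp only [e]
  rw [← map_sum]
  congr 1
  ext x
  rw [sum_apply, hψ]
  change ∑ ε, character _ x * θ x = _
  rw [← Finset.sum_mul, hθx]
  change coshSum N x * _ = _
  have := coshSum_ne_zero N x
  field_simp

theorem norm_charLin_le_im {R : ℝ} {s : ℂ × ℂ} (h1 : |s.1.re| ≤ R) (h2 : |s.2.re| ≤ R) :
    1 + ‖charLin s‖ ≤ (1 + 2 * R) * (1 + |s.1.im| + |s.2.im|) := by
  have h := norm_charLin_le s
  have h3 := Complex.norm_le_abs_re_add_abs_im s.1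
  have h4 := Complex.norm_le_abs_re_add_abs_im s.2
  have hR : 0 ≤ R := (abs_nonneg _).trans h1
  have : 0 ≤ R * (|s.1.im| + |s.2.im|) := by positivity
  nlinarith [abs_nonneg s.1.im, abs_nonneg s.2.im]

/-- The restriction of a function of polynomial growth to a vertical plane. -/
theorem HasVerticalPolyGrowth.hasPolyGrowth_vert {F : ℂ × ℂ → ℂ} (hF : HasVerticalPolyGrowth F)
    (s : ℂ × ℂ) : HasPolyGrowth fun ξ => F (vert s ξ) := by
  obtain ⟨C, N, h⟩ := hF (max |s.1.re| |s.2.re|)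
  refine ⟨|C| * (1 + |s.1.im| + |s.2.im| + 4 * Real.pi) ^ N, N, fun ξ => ?_⟩
  refine (h (vert s ξ) ?_ ?_).trans ?_
  · rw [(vert_re s ξ).1]; exact le_max_left _ _
  · rw [(vert_re s ξ).2]; exact le_max_right _ _
  · rw [mul_assoc, ← mul_pow, (vert_im s ξ).1, (vert_im s ξ).2]
    refine mul_le_mul (le_abs_self C) (pow_le_pow_left₀ (by positivity) ?_ N) (by positivity)
      (abs_nonneg _)
    have h1 : ∀ (c : ℝ) i, |c - 2 * Real.pi * ξ i| ≤ |c| + 2 * Real.pi * ‖ξ‖ := fun c i => by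
      refine (abs_sub _ _).trans ?_
      rw [abs_mul, abs_of_pos (by positivity : 0 < 2 * Real.pi)]
      have := abs_coord_le ξ i
      have := Real.pi_pos
      gcongr
    have h2 := h1 s.1.im 0
    have h3 := h1 s.2.im 1
    have : 0 ≤ (1 + |s.1.im| + |s.2.im|) * ‖ξ‖ := by positivity
    nlinarith [Real.pi_pos, norm_nonneg ξ]

/-- The Mellin transform exists: it is entire, of polynomial growth on vertical planes. -/
theorem exists_isMellinTransform {f : 𝓢'(LogPlane, ℂ)} (hf : f ∈ absTempered) :
    ∃ F : ℂ × ℂ → ℂ, Differentiable ℂ F ∧ HasVerticalPolyGrowth F ∧ IsMellinTransform f F := by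
  choose G hG using fun n : ℕ => exists_stripMellin hf ((n : ℝ) + 1)
  have hagree : ∀ (m n : ℕ) s, InStrip ((m : ℝ) + 1) s → InStrip ((n : ℝ) + 1) s →
      stripMellin (m + 1) (G m) s = stripMellin (n + 1) (G n) s := by
    intro m n s hm hn
    have := eq_of_fourier_isTwist (hG m s hm) (hG n s hn)
      (continuous_stripMellin_vert (G m) hm) (continuous_stripMellin_vert (G n) hn)
      (hasPolyGrowth_stripMellin_vert (G m) hm) (hasPolyGrowth_stripMellin_vert (G n) hn)
      (fourier_smulLeft_expFam (G m) hm) (fourier_smulLeft_expFam (G n) hn)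
    have := congrFun this 0
    simpa [vert] using this
  let ν : ℂ × ℂ → ℕ := fun s => ⌈max |s.1.re| |s.2.re|⌉₊
  have hν : ∀ s, InStrip ((ν s : ℝ) + 1) s := fun s => by
    have := Nat.le_ceil (max |s.1.re| |s.2.re|)
    have h1 := le_max_left |s.1.re| |s.2.re|
    have h2 := le_max_right |s.1.re| |s.2.re|
    constructor <;> simp only [ν] <;> linarith
  let F : ℂ × ℂ → ℂ := fun s => stripMellin (ν s + 1) (G (ν s)) s
  have hF : ∀ (n : ℕ) s, InStrip ((n : ℝ) + 1) s → F s = stripMellin (n + 1) (G n) s :=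
    fun n s hs => hagree _ _ s (hν s) hs
  refine ⟨F, fun s => ?_, fun R => ?_, fun σ => ?_⟩
  · have hopen : IsOpen {t : ℂ × ℂ | InStrip ((ν s : ℝ) + 1) t} := by
      refine IsOpen.and ?_ ?_
      · exact isOpen_lt (by fun_prop) continuous_const
      · exact isOpen_lt (by fun_prop) continuous_const
    refine (differentiableAt_stripMellin (G (ν s)) (hν s)).congr_of_eventuallyEq ?_
    filter_upwards [hopen.mem_nhds (hν s)] with t ht using hF _ t ht
  · have hR : R < (⌈R⌉₊ : ℝ) + 1 := by linarith [Nat.le_ceil R]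
    obtain ⟨C, M, hC, h⟩ := exists_norm_stripMellin_le hR (G ⌈R⌉₊)
    refine ⟨C * (1 + 2 * R) ^ M, M, fun s h1 h2 => ?_⟩
    rw [hF ⌈R⌉₊ s ⟨h1.trans_lt hR, h2.trans_lt hR⟩, mul_assoc, ← mul_pow]
    refine (h s h1 h2).trans (mul_le_mul_of_nonneg_left ?_ hC)
    exact pow_le_pow_left₀ (by positivity) (norm_charLin_le_im h1 h2) M
  · let s : ℂ × ℂ := (σ.1, σ.2)
    refine ⟨_, hG (ν s) s (hν s), fun φ => ?_⟩
    rw [fourier_smulLeft_expFam (G (ν s)) (hν s)]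
    refine integral_congr_ae (Filter.Eventually.of_forall fun ξ => ?_)
    change _ = F (vert s ξ) * φ ξ
    rw [hF (ν s) (vert s ξ) ((inStrip_vert ξ).2 (hν s))]

/-- The Mellin transform is unique. -/
theorem IsMellinTransform.unique {f : 𝓢'(LogPlane, ℂ)} {F₁ F₂ : ℂ × ℂ → ℂ}
    (h₁ : IsMellinTransform f F₁) (h₂ : IsMellinTransform f F₂) (c₁ : Continuous F₁)
    (c₂ : Continuous F₂) (p₁ : HasVerticalPolyGrowth F₁) (p₂ : HasVerticalPolyGrowth F₂) :
    F₁ = F₂ := by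
  funext s
  obtain ⟨g₁, t₁, e₁⟩ := h₁ (s.1.re, s.2.re)
  obtain ⟨g₂, t₂, e₂⟩ := h₂ (s.1.re, s.2.re)
  have := eq_of_fourier_isTwist t₁ t₂
    (K₁ := fun ξ => F₁ (vert ((s.1.re : ℂ), (s.2.re : ℂ)) ξ))
    (K₂ := fun ξ => F₂ (vert ((s.1.re : ℂ), (s.2.re : ℂ)) ξ))
    (c₁.comp (continuous_vert _)) (c₂.comp (continuous_vert _)) (p₁.hasPolyGrowth_vert _)
      (p₂.hasPolyGrowth_vert _) e₁ e₂
  have h := congrFun this (!₂[-s.1.im / (2 * Real.pi), -s.2.im / (2 * Real.pi)])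
  have e : vert ((s.1.re : ℂ), (s.2.re : ℂ)) (!₂[-s.1.im / (2 * Real.pi), -s.2.im / (2 * Real.pi)])
    = s := by
    have hpi : (Real.pi : ℂ) ≠ 0 := Complex.ofReal_ne_zero.2 Real.pi_ne_zero
    refine Prod.ext ?_ ?_
    · simp only [vert, Matrix.cons_val_zero]
      push_cast
      field_simp
      rw [sub_neg_eq_add, mul_comm Complex.I]
      exact Complex.re_add_im _
    · simp only [vert, Matrix.cons_val_one, Matrix.cons_val_zero]
      push_cast
      field_simp
      rw [sub_neg_eq_add, mul_comm Complex.I]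
      exact Complex.re_add_im _
  simp only [e] at h
  exact h

/-! ### Holomorphic integrals and shifts of vertical planes -/

open Filter Topology in
/-- An integral of holomorphic functions with an integrable majorant is holomorphic. -/
theorem differentiableOn_integral_of_dominated {X : Type*} [MeasurableSpace X] {μ : Measure X}
    {U : Set ℂ} (hU : IsOpen U) {k : ℂ → X → ℂ} {B : X → ℝ}
    (hd : ∀ x, DifferentiableOn ℂ (fun t => k t x) U)
    (hm : ∀ t ∈ U, AEStronglyMeasurable (k t) μ) (hB : Integrable B μ)
    (hb : ∀ t ∈ U, ∀ x, ‖k t x‖ ≤ B x) : DifferentiableOn ℂ (fun t => ∫ x, k t x ∂μ) U := by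
  intro t₀ ht₀
  obtain ⟨r, hr, hrU⟩ := Metric.isOpen_iff.1 hU t₀ ht₀
  have hda : ∀ x, ∀ t ∈ U, DifferentiableAt ℂ (fun t => k t x) t := fun x t ht =>
    (hd x).differentiableAt (hU.mem_nhds ht)
  have hr3 : 0 < r / 3 := by linarith
  have hsub : ∀ t ∈ Metric.ball t₀ (r / 3), Metric.closedBall t (r / 3) ⊆ U := by
    intro t ht u hu
    refine hrU ?_
    rw [Metric.mem_ball] at ht ⊢
    rw [Metric.mem_closedBall] at hu
    linarith [dist_triangle u t t₀]
  refine (hasDerivAt_integral_of_dominated_loc_of_deriv_le (μ := μ) (F := k)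
    (F' := fun t x => deriv (fun t => k t x) t) (bound := fun x => B x / (r / 3))
    (Metric.ball_mem_nhds t₀ hr3) ?_ (hB.mono' (hm t₀ ht₀) (Eventually.of_forall (hb t₀ ht₀))) ?_
    (Eventually.of_forall fun x t ht => ?_) (hB.div_const _)
    (Eventually.of_forall fun x t ht => (hda x t ?_).hasDerivAt)
    ).2.differentiableAt.differentiableWithinAt
  · filter_upwards [hU.mem_nhds ht₀] with t ht using hm t ht
  · -- the derivative is the limit of a sequence of difference quotients
    have hlim : Tendsto (fun n : ℕ => (r / 3 / ((n : ℝ) + 2) : ℂ)) atTop (𝓝[≠] 0) := by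
      rw [tendsto_nhdsWithin_iff]
      constructor
      · have h1 : Tendsto (fun n : ℕ => (r / 3 / ((n : ℝ) + 2) : ℝ)) atTop (𝓝 0) :=
          Tendsto.const_div_atTop (tendsto_atTop_add_const_right _ _
            tendsto_natCast_atTop_atTop) _
        have h2 := (Complex.continuous_ofReal.tendsto 0).comp h1
        rw [Complex.ofReal_zero] at h2
        refine h2.congr fun n => ?_
        simp
      · refine Eventually.of_forall fun n => ?_
        have : (r / 3 / ((n : ℝ) + 2) : ℝ) ≠ 0 := by positivity
        have := Complex.ofReal_ne_zero.2 this
        push_cast at this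
        simpa using this
    have hmem : ∀ n : ℕ, t₀ + (r / 3 / ((n : ℝ) + 2) : ℂ) ∈ U := by
      intro n
      refine hrU ?_
      rw [Metric.mem_ball, dist_eq_norm, add_sub_cancel_left]
      have e : (r / 3 / ((n : ℝ) + 2) : ℂ) = ((r / 3 / ((n : ℝ) + 2) : ℝ) : ℂ) := by push_cast; rfl
      rw [e, Complex.norm_real, Real.norm_of_nonneg (by positivity)]
      rw [div_lt_iff₀ (by positivity)]
      have : (0 : ℝ) ≤ n := n.cast_nonneg
      nlinarith
    refine aestronglyMeasurable_of_tendsto_ae atTop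
      (f := fun (n : ℕ) x => (r / 3 / ((n : ℝ) + 2) : ℂ)⁻¹ •
        (k (t₀ + (r / 3 / ((n : ℝ) + 2) : ℂ)) x - k t₀ x))
      (fun n => ((hm _ (hmem n)).sub (hm t₀ ht₀)).const_smul
        (r / 3 / ((n : ℝ) + 2) : ℂ)⁻¹) ?_
    refine Eventually.of_forall fun x => ?_
    exact (hasDerivAt_iff_tendsto_slope_zero.1 (hda x t₀ ht₀).hasDerivAt).comp hlim
  · refine Complex.norm_deriv_le_of_forall_mem_sphere_norm_le hr3 ?_ fun u hu => ?_
    · exact ((hd x).mono (hsub t ht)).diffContOnCl_ball subset_rfl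
    · exact hb u (hsub t ht (Metric.sphere_subset_closedBall hu)) x
  · exact hsub t ht (Metric.mem_closedBall_self hr3.le)

/-- A holomorphic function on a vertical strip which is invariant under vertical translations is
constant. -/
theorem eq_of_vertical_invariant {a b : ℝ} {I : ℂ → ℂ}
    (hI : DifferentiableOn ℂ I {t | a < t.re ∧ t.re < b})
    (hinv : ∀ (t : ℂ) (y : ℝ), I (t + y * Complex.I) = I t) {t₁ t₂ : ℂ}
    (h₁ : a < t₁.re ∧ t₁.re < b) (h₂ : a < t₂.re ∧ t₂.re < b) : I t₁ = I t₂ := by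
  set U := {t : ℂ | a < t.re ∧ t.re < b}
  have hU : IsOpen U := (isOpen_lt continuous_const Complex.continuous_re).inter
    (isOpen_lt Complex.continuous_re continuous_const)
  have hc : Convex ℝ U := (convex_halfSpace_re_gt a).inter (convex_halfSpace_re_lt b)
  refine hU.is_const_of_deriv_eq_zero hc.isPreconnected hI (fun t ht => ?_) h₁ h₂
  have hd := (hI.differentiableAt (hU.mem_nhds ht)).hasDerivAt
  have hline : HasDerivAt (fun y : ℝ => t + y * Complex.I) Complex.I 0 := by
    simpa using ((Complex.ofRealCLM.hasDerivAt (x := (0 : ℝ))).mul_const Complex.I).const_add t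
  have h3 : HasDerivAt (fun y : ℝ => I (t + y * Complex.I)) (Complex.I • deriv I t) 0 := by
    refine HasDerivAt.scomp (g₁ := I) (h := fun y : ℝ => t + y * Complex.I) 0 ?_ hline
    simpa using hd
  have h4 : HasDerivAt (fun y : ℝ => I (t + y * Complex.I)) 0 0 := by
    simp only [hinv]
    exact hasDerivAt_const _ _
  have h5 := h3.unique h4
  simpa using h5

/-- The size of the imaginary part of `s`. -/
def imSize (s : ℂ × ℂ) : ℝ := 1 + s.1.im ^ 2 + s.2.im ^ 2

theorem one_le_imSize (s : ℂ × ℂ) : 1 ≤ imSize s := by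
  unfold imSize
  nlinarith [sq_nonneg s.1.im, sq_nonneg s.2.im]

theorem imSize_pos (s : ℂ × ℂ) : 0 < imSize s := zero_lt_one.trans_le (one_le_imSize s)

theorem one_add_norm_sq_le_imSize_vert {A : ℝ} {s : ℂ × ℂ} (h1 : |s.1.im| ≤ A)
    (h2 : |s.2.im| ≤ A) (ξ : LogPlane) :
    1 + ‖ξ‖ ^ 2 ≤ (1 + 2 * A ^ 2) * imSize (vert s ξ) := by
  have key : ∀ c x : ℝ, |c| ≤ A → x ^ 2 ≤ A ^ 2 + (c - 2 * Real.pi * x) ^ 2 := by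
    intro c x hc
    have hc2 : c ^ 2 ≤ A ^ 2 := sq_le_sq' (abs_le.1 hc).1 (abs_le.1 hc).2
    have hpi : 2 ≤ 2 * Real.pi ^ 2 := by nlinarith [Real.pi_gt_three]
    nlinarith [sq_nonneg (c + (c - 2 * Real.pi * x)), mul_nonneg (sub_nonneg.2 hpi) (sq_nonneg x),
      sq_nonneg (2 * c - 2 * Real.pi * x)]
  have k1 := key _ (ξ 0) h1
  have k2 := key _ (ξ 1) h2
  rw [EuclideanSpace.norm_sq_eq, Fin.sum_univ_two, Real.norm_eq_abs, Real.norm_eq_abs, sq_abs,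
    sq_abs, imSize, (vert_im s ξ).1, (vert_im s ξ).2]
  nlinarith [sq_nonneg A, mul_nonneg (sq_nonneg A) (sq_nonneg (s.1.im - 2 * Real.pi * ξ 0)),
    mul_nonneg (sq_nonneg A) (sq_nonneg (s.2.im - 2 * Real.pi * ξ 1))]

theorem integrable_one_add_norm_sq_inv_sq :
    Integrable fun ξ : LogPlane => ((1 + ‖ξ‖ ^ 2) ^ 2)⁻¹ := by
  have h := integrable_rpow_neg_one_add_norm_sq (E := LogPlane) (μ := volume) (r := 4)
    (by simp; norm_num)
  refine h.congr (Filter.Eventually.of_forall fun ξ => ?_)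
  have : (0 : ℝ) ≤ 1 + ‖ξ‖ ^ 2 := by positivity
  change (1 + ‖ξ‖ ^ 2) ^ (-(4 : ℝ) / 2) = ((1 + ‖ξ‖ ^ 2) ^ 2)⁻¹
  rw [show (-(4 : ℝ) / 2) = -((2 : ℕ) : ℝ) by norm_num, Real.rpow_neg this, Real.rpow_natCast]

theorem integral_vert_add_im (H : ℂ × ℂ → ℂ) (s : ℂ × ℂ) (b : ℝ × ℝ) :
    ∫ ξ, H (vert (s + (b.1 * Complex.I, b.2 * Complex.I)) ξ) = ∫ ξ, H (vert s ξ) := by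
  rw [← integral_sub_right_eq_self (fun ξ => H (vert s ξ))
    (!₂[b.1 / (2 * Real.pi), b.2 / (2 * Real.pi)] : LogPlane)]
  have hpi : (Real.pi : ℂ) ≠ 0 := Complex.ofReal_ne_zero.2 Real.pi_ne_zero
  refine integral_congr_ae (Filter.Eventually.of_forall fun ξ => congrArg H ?_)
  refine Prod.ext ?_ ?_
  · simp [vert]
    field_simp
    ring
  · simp [vert]
    field_simp
    ring

/-- The integral over a vertical plane does not depend on the plane. -/
theorem integral_vert_eq {H : ℂ × ℂ → ℂ} (hH : Differentiable ℂ H)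
    (hb : ∀ R : ℝ, ∃ C, 0 ≤ C ∧ ∀ s, |s.1.re| ≤ R → |s.2.re| ≤ R → ‖H s‖ ≤ C * (imSize s ^ 2)⁻¹)
    (s s' : ℂ × ℂ) : ∫ ξ, H (vert s ξ) = ∫ ξ, H (vert s' ξ) := by
  -- a translation in the plane reduces to a real displacement
  set d : ℂ × ℂ := ((s'.1.re - s.1.re : ℝ), (s'.2.re - s.2.re : ℝ)) with hd
  let I : ℂ → ℂ := fun t => ∫ ξ, H (vert (s + t • d) ξ)
  have hline : ∀ ξ, Differentiable ℂ fun t : ℂ => vert (s + t • d) ξ := fun ξ => by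
    unfold vert
    fun_prop
  have hI : Differentiable ℂ I := by
    intro t₀
    have hK := isCompact_closedBall t₀ 1
    have hbound : ∀ g : ℂ → ℝ, Continuous g → ∃ A, ∀ t ∈ Metric.closedBall t₀ 1, |g t| ≤ A :=
      fun g hg => hK.exists_bound_of_continuousOn hg.continuousOn
    obtain ⟨A1, hA1⟩ := hbound (fun t => (s + t • d).1.re) (by fun_prop)
    obtain ⟨A2, hA2⟩ := hbound (fun t => (s + t • d).2.re) (by fun_prop)
    obtain ⟨A3, hA3⟩ := hbound (fun t => (s + t • d).1.im) (by fun_prop)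
    obtain ⟨A4, hA4⟩ := hbound (fun t => (s + t • d).2.im) (by fun_prop)
    obtain ⟨C, hC, hCH⟩ := hb (max A1 A2)
    set A := max A3 A4
    refine (differentiableOn_integral_of_dominated (Metric.isOpen_ball (x := t₀) (ε := 1))
      (B := fun ξ : LogPlane => C * (1 + 2 * A ^ 2) ^ 2 * ((1 + ‖ξ‖ ^ 2) ^ 2)⁻¹)
      (k := fun t ξ => H (vert (s + t • d) ξ)) (fun ξ => (hH.comp (hline ξ)).differentiableOn)
      (fun t _ => (hH.continuous.comp (continuous_vert _)).aestronglyMeasurable)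
      (integrable_one_add_norm_sq_inv_sq.const_mul _) fun t ht ξ => ?_).differentiableAt
      (Metric.ball_mem_nhds t₀ one_pos)
    have ht' := Metric.ball_subset_closedBall ht
    refine (hCH _ ?_ ?_).trans ?_
    · rw [(vert_re _ ξ).1]; exact (hA1 t ht').trans (le_max_left _ _)
    · rw [(vert_re _ ξ).2]; exact (hA2 t ht').trans (le_max_right _ _)
    · rw [mul_assoc]
      refine mul_le_mul_of_nonneg_left ?_ hC
      have h0 := one_add_norm_sq_le_imSize_vert ((hA3 t ht').trans (le_max_left _ A4))
        ((hA4 t ht').trans (le_max_right A3 _)) ξ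
      have h1 := imSize_pos (vert (s + t • d) ξ)
      rw [← div_eq_mul_inv, inv_le_comm₀ (by positivity) (by positivity), inv_div,
        div_le_iff₀ (by positivity), ← mul_pow]
      exact pow_le_pow_left₀ (by positivity) (by linarith) 2
  have hinv : ∀ (t : ℂ) (y : ℝ), I (t + y * Complex.I) = I t := by
    intro t y
    have := integral_vert_add_im H (s + t • d) (y * (s'.1.re - s.1.re), y * (s'.2.re - s.2.re))
    refine Eq.trans ?_ this
    refine integral_congr_ae (Filter.Eventually.of_forall fun ξ => ?_)
    change H (vert _ ξ) = H (vert _ ξ)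
    congr 2
    refine Prod.ext ?_ ?_
    · simp [hd]; ring
    · simp [hd]; ring
  have := eq_of_vertical_invariant (a := -1) (b := 2) (I := I) hI.differentiableOn hinv
    (t₁ := 0) (t₂ := 1) (by norm_num) (by norm_num)
  have h0 : I 0 = ∫ ξ, H (vert s ξ) := by simp [I]
  have h1 : I 1 = ∫ ξ, H (vert s' ξ) := by
    change ∫ ξ, H (vert (s + (1 : ℂ) • d) ξ) = _
    rw [← integral_vert_add_im H (s + (1 : ℂ) • d) (s'.1.im - s.1.im, s'.2.im - s.2.im)]
    refine integral_congr_ae (Filter.Eventually.of_forall fun ξ => ?_)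
    change H (vert _ ξ) = H (vert _ ξ)
    congr 2
    refine Prod.ext (Complex.ext ?_ ?_) (Complex.ext ?_ ?_) <;> simp [hd]
  rw [← h0, ← h1, this]

/-! ### The bilateral Laplace transform of a test function -/

/-- Integration by parts against a compactly supported function. -/
theorem integral_fderiv_mul_eq_neg {E : Type*} [NormedAddCommGroup E] [NormedSpace ℝ E]
    [FiniteDimensional ℝ E] [MeasurableSpace E] [BorelSpace E] {μ : Measure E} [μ.IsAddHaarMeasure]
    {φ g : E → ℂ} {U : Set E} (hU : IsOpen U) (hφ : ContDiff ℝ 1 φ) (hc : HasCompactSupport φ)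
    (hsub : tsupport φ ⊆ U) (hg : ContDiffOn ℝ 1 g U) (v : E) :
    ∫ x, fderiv ℝ φ x v * g x ∂μ = -∫ x, φ x * fderiv ℝ g x v ∂μ := by
  have hsub' : tsupport (fun x => fderiv ℝ φ x v) ⊆ tsupport φ :=
    tsupport_fderiv_apply_subset ℝ v
  have hc' : HasCompactSupport fun x => fderiv ℝ φ x v :=
    HasCompactSupport.fderiv_apply ℝ hc v
  have hφ' : Continuous fun x => fderiv ℝ φ x v := (hφ.continuous_fderiv one_ne_zero).clm_apply
    continuous_const
  have hg' : ContinuousOn (fun x => fderiv ℝ g x v) U :=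
    (hg.continuousOn_fderiv_of_isOpen hU le_rfl).clm_apply continuousOn_const
  have aux : ∀ a b : E → ℂ, Continuous a → HasCompactSupport a → tsupport a ⊆ U →
      ContinuousOn b U → Integrable (fun x => a x * b x) μ := by
    intro a b ha hac hau hb
    refine Continuous.integrable_of_hasCompactSupport ?_ hac.mul_right
    exact continuous_of_tsupport fun x hx => by
      have hx' : x ∈ tsupport a := tsupport_mul_subset_left hx
      exact ha.continuousAt.mul (hb.continuousAt (hU.mem_nhds (hau hx')))
  rw [eq_comm, neg_eq_iff_eq_neg]
  refine integral_mul_fderiv_eq_neg_fderiv_mul_of_integrable (aux _ _ hφ' hc' (hsub'.trans hsub)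
    hg.continuousOn) (aux _ _ hφ.continuous hc hsub hg') (aux _ _ hφ.continuous hc hsub
    hg.continuousOn) (fun x _ => hφ.differentiable one_ne_zero x) fun x hx => ?_
  exact (hg.differentiableOn one_ne_zero).differentiableAt (hU.mem_nhds (hsub hx))

/-- The bilateral Laplace transform `∫ φ(x) exp(-s · x) dx`. -/
def Lap (φ : LogPlane → ℂ) (s : ℂ × ℂ) : ℂ := ∫ x, φ x * character (-s) x

theorem fderiv_character (s : ℂ × ℂ) (x : LogPlane) (v : LogPlane) :
    fderiv ℝ (character s) x v = charLin s v * character s x := by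
  have h : HasFDerivAt (character s) (Complex.exp (charLin s x) • charLin s) x := by
    have := (charLin s).hasFDerivAt (x := x).cexp
    exact this
  rw [h.fderiv, mul_comm]
  rfl

/-- The coordinate derivative of a function on the plane. -/
def partialDeriv (i : Fin 2) (φ : LogPlane → ℂ) (x : LogPlane) : ℂ :=
  fderiv ℝ φ x (EuclideanSpace.single i 1)

theorem contDiff_partialDeriv {φ : LogPlane → ℂ} (hφ : ContDiff ℝ ∞ φ) (i : Fin 2) :
    ContDiff ℝ ∞ (partialDeriv i φ) :=
  (hφ.fderiv_right (m := ∞) (by simp)).clm_apply contDiff_const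

theorem hasCompactSupport_partialDeriv {φ : LogPlane → ℂ} (hφ : HasCompactSupport φ) (i : Fin 2) :
    HasCompactSupport (partialDeriv i φ) := HasCompactSupport.fderiv_apply ℝ hφ _

theorem integrable_mul_character {φ : LogPlane → ℂ} (hφ : Continuous φ) (hc : HasCompactSupport φ)
    (s : ℂ × ℂ) : Integrable fun x => φ x * character s x :=
  (hφ.mul (contDiff_character s).continuous).integrable_of_hasCompactSupport hc.mul_right

theorem lap_partialDeriv {φ : LogPlane → ℂ} (hφ : ContDiff ℝ ∞ φ) (hc : HasCompactSupport φ)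
    (s : ℂ × ℂ) : Lap (partialDeriv 0 φ) s = s.1 * Lap φ s ∧
      Lap (partialDeriv 1 φ) s = s.2 * Lap φ s := by
  have key : ∀ i, Lap (partialDeriv i φ) s = charLin s (EuclideanSpace.single i 1) * Lap φ s := by
    intro i
    unfold Lap partialDeriv
    rw [integral_fderiv_mul_eq_neg isOpen_univ (hφ.of_le (by simp)) hc (subset_univ _)
      ((contDiff_character (-s)).of_le (by simp)).contDiffOn, ← integral_neg,
      ← integral_const_mul]
    refine integral_congr_ae (Filter.Eventually.of_forall fun x => ?_)
    simp only [fderiv_character, charLin_apply]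
    simp
    ring
  constructor
  · rw [key, charLin_apply]; simp
  · rw [key, charLin_apply]; simp

/-- The elliptic operator `∂₀² + ∂₁² - c`. -/
def ellipticOp (c : ℝ) (φ : LogPlane → ℂ) : LogPlane → ℂ := fun x =>
  partialDeriv 0 (partialDeriv 0 φ) x + partialDeriv 1 (partialDeriv 1 φ) x - c * φ x

theorem ellipticOp_contDiff {c : ℝ} {φ : LogPlane → ℂ} (hφ : ContDiff ℝ ∞ φ) :
    ContDiff ℝ ∞ (ellipticOp c φ) :=
  ((contDiff_partialDeriv (contDiff_partialDeriv hφ 0) 0).add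
    (contDiff_partialDeriv (contDiff_partialDeriv hφ 1) 1)).sub (contDiff_const.mul hφ)

theorem ellipticOp_hasCompactSupport {c : ℝ} {φ : LogPlane → ℂ} (hφ : HasCompactSupport φ) :
    HasCompactSupport (ellipticOp c φ) :=
  ((hasCompactSupport_partialDeriv (hasCompactSupport_partialDeriv hφ 0) 0).add
    (hasCompactSupport_partialDeriv (hasCompactSupport_partialDeriv hφ 1) 1)).sub
    (hφ.mul_left (f := fun _ => (c : ℂ)))

theorem lap_ellipticOp {c : ℝ} {φ : LogPlane → ℂ} (hφ : ContDiff ℝ ∞ φ) (hc : HasCompactSupport φ)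
    (s : ℂ × ℂ) : Lap (ellipticOp c φ) s = (s.1 ^ 2 + s.2 ^ 2 - c) * Lap φ s := by
  have h : ∀ i, ContDiff ℝ ∞ (partialDeriv i φ) := contDiff_partialDeriv hφ
  have hcs : ∀ i, HasCompactSupport (partialDeriv i φ) := hasCompactSupport_partialDeriv hc
  have e : Lap (ellipticOp c φ) s = Lap (partialDeriv 0 (partialDeriv 0 φ)) s +
      Lap (partialDeriv 1 (partialDeriv 1 φ)) s - c * Lap φ s := by
    have i0 := integrable_mul_character (contDiff_partialDeriv (h 0) 0).continuous
      (hasCompactSupport_partialDeriv (hcs 0) 0) (-s)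
    have i1 := integrable_mul_character (contDiff_partialDeriv (h 1) 1).continuous
      (hasCompactSupport_partialDeriv (hcs 1) 1) (-s)
    have i2 := (integrable_mul_character hφ.continuous hc (-s)).const_mul (c : ℂ)
    unfold Lap
    rw [← integral_add i0 i1, ← integral_const_mul]
    refine Eq.trans ?_ (integral_sub (i0.add i1) i2)
    refine integral_congr_ae (Filter.Eventually.of_forall fun x => ?_)
    simp only [ellipticOp]
    ring
  rw [e, (lap_partialDeriv (h 0) (hcs 0) s).1, (lap_partialDeriv (h 1) (hcs 1) s).2,
    (lap_partialDeriv hφ hc s).1, (lap_partialDeriv hφ hc s).2]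
  ring

/-- The symbol of the elliptic operator is at least `1 + |Im s|²`. -/
theorem imSize_le_norm_symbol {R c : ℝ} (hc : 1 + 2 * R ^ 2 ≤ c) {s : ℂ × ℂ} (h1 : |s.1.re| ≤ R)
    (h2 : |s.2.re| ≤ R) : imSize s ≤ ‖s.1 ^ 2 + s.2 ^ 2 - (c : ℂ)‖ := by
  have h3 : s.1.re ^ 2 ≤ R ^ 2 := sq_le_sq' (abs_le.1 h1).1 (abs_le.1 h1).2
  have h4 : s.2.re ^ 2 ≤ R ^ 2 := sq_le_sq' (abs_le.1 h2).1 (abs_le.1 h2).2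
  refine le_trans ?_ (Complex.abs_re_le_norm _)
  have e : (s.1 ^ 2 + s.2 ^ 2 - (c : ℂ)).re = s.1.re ^ 2 - s.1.im ^ 2 +
    (s.2.re ^ 2 - s.2.im ^ 2) - c := by
    simp [pow_two]
  rw [e, abs_of_nonpos (by nlinarith [sq_nonneg s.1.im, sq_nonneg s.2.im]), imSize]
  linarith

theorem exists_norm_lap_le {φ : LogPlane → ℂ} (hφ : Continuous φ) (hc : HasCompactSupport φ)
    (R : ℝ) : ∃ C, 0 ≤ C ∧ ∀ s : ℂ × ℂ, |s.1.re| ≤ R → |s.2.re| ≤ R → ‖Lap φ s‖ ≤ C := by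
  obtain ⟨A, hA⟩ := hc.isCompact.isBounded.exists_norm_le
  refine ⟨∫ x, ‖φ x‖ * Real.exp (2 * R * A), integral_nonneg fun x => by positivity,
    fun s h1 h2 => ?_⟩
  refine norm_integral_le_of_norm_le
    ((hφ.integrable_of_hasCompactSupport hc).norm.mul_const _) (Filter.Eventually.of_forall
    fun x => ?_)
  rw [norm_mul]
  by_cases hx : x ∈ tsupport φ
  · refine mul_le_mul_of_nonneg_left ?_ (norm_nonneg _)
    have h3 := hA x hx
    have hA0 : 0 ≤ A := (norm_nonneg _).trans h3
    have hR : 0 ≤ R := (abs_nonneg _).trans h1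
    rw [norm_character, Real.exp_le_exp]
    have k : ∀ (r : ℝ) i, |r| ≤ R → (-r) * x i ≤ R * A := fun r i hr => by
      refine (le_abs_self _).trans ?_
      rw [abs_mul, abs_neg]
      exact mul_le_mul hr ((abs_coord_le x i).trans h3) (abs_nonneg _) hR
    have := k _ 0 h1
    have := k _ 1 h2
    simp only [Prod.fst_neg, Prod.snd_neg, Complex.neg_re]
    linarith
  · rw [image_eq_zero_of_notMem_tsupport hx]
    simp

/-- The Laplace transform of a test function decays rapidly on vertical planes, locally uniformly
in the real part. -/
theorem exists_norm_lap_decay {φ : LogPlane → ℂ} (hφ : ContDiff ℝ ∞ φ) (hc : HasCompactSupport φ)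
    (R : ℝ) (k : ℕ) : ∃ C, 0 ≤ C ∧ ∀ s : ℂ × ℂ, |s.1.re| ≤ R → |s.2.re| ≤ R →
      imSize s ^ k * ‖Lap φ s‖ ≤ C := by
  induction k generalizing φ with
  | zero => simpa using exists_norm_lap_le hφ.continuous hc R
  | succ k ih =>
    obtain ⟨C, hC, h⟩ := ih (ellipticOp_contDiff (c := 1 + 2 * R ^ 2) hφ)
      (ellipticOp_hasCompactSupport hc)
    refine ⟨C, hC, fun s h1 h2 => le_trans ?_ (h s h1 h2)⟩
    rw [lap_ellipticOp hφ hc, norm_mul, pow_succ, mul_assoc]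
    have := imSize_pos s
    exact mul_le_mul_of_nonneg_left (mul_le_mul_of_nonneg_right
      (imSize_le_norm_symbol le_rfl h1 h2) (norm_nonneg _)) (by positivity)

/-- The test function `exp(-s · x) φ(x)`. -/
def twistTest (s : ℂ × ℂ) {φ : LogPlane → ℂ} (hφ : ContDiff ℝ ∞ φ) (hc : HasCompactSupport φ) :
    𝓢(LogPlane, ℂ) :=
  (HasCompactSupport.character_mul hc (-s)).toSchwartzMap ((contDiff_character (-s)).mul hφ)

theorem lap_vert {φ : LogPlane → ℂ} (hφ : ContDiff ℝ ∞ φ) (hc : HasCompactSupport φ)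
    (s : ℂ × ℂ) (ξ : LogPlane) : Lap φ (vert s ξ) = 𝓕⁻ (twistTest s hφ hc) ξ := by
  rw [SchwartzMap.fourierInv_coe, Real.fourierInv_eq']
  refine integral_congr_ae (Filter.Eventually.of_forall fun x => ?_)
  change φ x * character (-vert s ξ) x = _ • (character (-s) x * φ x)
  have e : -vert s ξ = vert (-s) (-ξ) := by
    refine Prod.ext ?_ ?_ <;> simp [vert] <;> ring
  rw [e, character_vert, smul_eq_mul, inner_neg_left, real_inner_comm]
  push_cast
  ring_nf

theorem differentiable_lap {φ : LogPlane → ℂ} (hφ : Continuous φ) (hc : HasCompactSupport φ) :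
    Differentiable ℂ (Lap φ) := by
  intro s
  set N : ℝ := max |s.1.re| |s.2.re| + 1
  have hN : ∀ᶠ t in nhds s, InStrip N (-t) := by
    have hopen : IsOpen {t : ℂ × ℂ | InStrip N (-t)} :=
      IsOpen.and (isOpen_lt (by fun_prop) continuous_const)
        (isOpen_lt (by fun_prop) continuous_const)
    refine hopen.mem_nhds ⟨?_, ?_⟩
    · simpa using (le_max_left |s.1.re| |s.2.re|).trans_lt (lt_add_one _)
    · simpa using (le_max_right |s.1.re| |s.2.re|).trans_lt (lt_add_one _)
  have hK : Continuous fun x => φ x * coshSum N x := hφ.mul (contDiff_coshSum N).continuous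
  have hKc : HasCompactSupport fun x => φ x * coshSum N x := hc.mul_right
  obtain ⟨C, hC⟩ := hKc.exists_bound_of_continuous hK
  let G := polyGrowthDistribution _ hK ⟨C, 0, fun x => by simpa using hC x⟩
  have e : Lap φ =ᶠ[nhds s] fun t => stripMellin N G (-t) := by
    filter_upwards [hN] with t ht
    change _ = ∫ x, (φ x * coshSum N x) * expFam N (-t) x
    rw [expFam_coe ht]
    refine integral_congr_ae (Filter.Eventually.of_forall fun x => ?_)
    have := coshSum_ne_zero N x
    simp only
    field_simp
  refine DifferentiableAt.congr_of_eventuallyEq ?_ e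
  exact (differentiableAt_stripMellin G hN.self_of_nhds).comp s differentiableAt_id.neg

theorem HasVerticalPolyGrowth.exists_imSize {F : ℂ × ℂ → ℂ} (hF : HasVerticalPolyGrowth F)
    (R : ℝ) : ∃ (C : ℝ) (N : ℕ), 0 ≤ C ∧ ∀ s : ℂ × ℂ, |s.1.re| ≤ R → |s.2.re| ≤ R →
      ‖F s‖ ≤ C * imSize s ^ N := by
  obtain ⟨C, N, h⟩ := hF R
  refine ⟨|C| * 2 ^ N, N, by positivity, fun s h1 h2 => (h s h1 h2).trans ?_⟩
  rw [mul_assoc, ← mul_pow]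
  refine mul_le_mul (le_abs_self C) (pow_le_pow_left₀ (by positivity) ?_ N) (by positivity)
    (abs_nonneg C)
  unfold imSize
  nlinarith [sq_nonneg (|s.1.im| - 1), sq_nonneg (|s.2.im| - 1), sq_abs s.1.im, sq_abs s.2.im]

theorem exists_norm_mul_lap_le {F : ℂ × ℂ → ℂ} (hF : HasVerticalPolyGrowth F) {φ : LogPlane → ℂ}
    (hφ : ContDiff ℝ ∞ φ) (hc : HasCompactSupport φ) (R : ℝ) : ∃ C, 0 ≤ C ∧ ∀ s : ℂ × ℂ,
      |s.1.re| ≤ R → |s.2.re| ≤ R → ‖F s * Lap φ s‖ ≤ C * (imSize s ^ 2)⁻¹ := by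
  obtain ⟨C, N, hC, h⟩ := hF.exists_imSize R
  obtain ⟨D, hD, h'⟩ := exists_norm_lap_decay hφ hc R (N + 2)
  refine ⟨C * D, by positivity, fun s h1 h2 => ?_⟩
  have := imSize_pos s
  rw [norm_mul, ← div_eq_mul_inv, le_div_iff₀ (by positivity)]
  calc ‖F s‖ * ‖Lap φ s‖ * imSize s ^ 2 ≤ C * imSize s ^ N * ‖Lap φ s‖ * imSize s ^ 2 := by
        have := h s h1 h2
        gcongr
    _ = C * (imSize s ^ (N + 2) * ‖Lap φ s‖) := by ring
    _ ≤ C * D := mul_le_mul_of_nonneg_left (h' s h1 h2) hC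

/-! ### Inversion of the Mellin transform -/

/-- A Mellin transform determines the distribution: the inversion formula. -/
theorem IsMellinTransform.apply_eq {f : 𝓢'(LogPlane, ℂ)} {F : ℂ × ℂ → ℂ}
    (hF : IsMellinTransform f F) (σ : ℝ × ℝ) (φ : 𝓢(LogPlane, ℂ)) (hc : HasCompactSupport φ) :
    f φ = ∫ ξ, F (vert ((σ.1 : ℂ), (σ.2 : ℂ)) ξ) * Lap φ (vert ((σ.1 : ℂ), (σ.2 : ℂ)) ξ) := by
  obtain ⟨g, hg, h⟩ := hF σ
  set s : ℂ × ℂ := ((σ.1 : ℂ), (σ.2 : ℂ))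
  have hφ : ContDiff ℝ ∞ φ := φ.smooth ⊤
  have e1 : g (twistTest s hφ hc) = f φ := hg _ _ (HasCompactSupport.character_mul hc (-s))
    fun x => by
      change φ x = character s x * (character (-s) x * φ x)
      rw [← mul_assoc, ← character_add, add_neg_cancel, character_zero, one_mul]
  have e2 := h (𝓕⁻ (twistTest s hφ hc))
  rw [TemperedDistribution.fourier_apply] at e2
  rw [← e1]
  simp only [lap_vert hφ hc]
  rw [FourierTransform.fourier_fourierInv_eq] at e2
  exact e2

/-- An entire function of polynomial growth on vertical planes is a Mellin transform. -/
theorem exists_isMellinTransform_of_entire {F : ℂ × ℂ → ℂ} (hF : Differentiable ℂ F)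
    (hg : HasVerticalPolyGrowth F) : ∃ f ∈ absTempered, IsMellinTransform f F := by
  let g : ℂ × ℂ → 𝓢'(LogPlane, ℂ) := fun s => 𝓕⁻ (polyGrowthDistribution (fun ξ => F (vert s ξ))
    (hF.continuous.comp (continuous_vert s)) (hg.hasPolyGrowth_vert s))
  have hgs : ∀ s, IsTwist (g 0) s (g s) := by
    intro s φ ψ hc hψ
    have hψc : HasCompactSupport ψ := by
      have : (ψ : LogPlane → ℂ) = fun x => character s x * φ x := funext hψ
      rw [this]
      exact HasCompactSupport.character_mul hc s
    have hψs : ContDiff ℝ ∞ ψ := ψ.smooth ⊤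
    have e1 : twistTest s hψs hψc = φ := by
      ext x
      change character (-s) x * ψ x = φ x
      rw [hψ, ← mul_assoc, ← character_add, neg_add_cancel, character_zero, one_mul]
    have e0 : twistTest 0 hψs hψc = ψ := by
      ext x
      change character (-0) x * ψ x = ψ x
      rw [neg_zero, character_zero, one_mul]
    change ∫ ξ, F (vert s ξ) * 𝓕⁻ φ ξ = ∫ ξ, F (vert 0 ξ) * 𝓕⁻ ψ ξ
    conv_lhs => rw [← e1]
    conv_rhs => rw [← e0]
    simp only [← lap_vert]
    exact integral_vert_eq (H := fun s => F s * Lap ψ s)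
      (hF.mul (differentiable_lap hψs.continuous hψc))
      (exists_norm_mul_lap_le hg hψs hψc) s 0
  refine ⟨g 0, fun s => ⟨g s, hgs s⟩, fun σ => ⟨_, hgs _, fun φ => ?_⟩⟩
  simp only [g, FourierTransform.fourier_fourierInv_eq]
  rfl

/-! ### The zeta kernel on the cone of positive definite forms -/

/-- Test functions on the cone of positive definite forms. -/
structure IsTest (h : Form → ℂ) : Prop where
  contDiff : ContDiff ℝ ∞ h
  hasCompactSupport : HasCompactSupport h
  tsupport_subset : tsupport h ⊆ posForms

/-- The exponent `w` of `q(v)⁻¹`. -/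
def expVal (s : ℂ × ℂ) : ℂ := (1 - (s.1 - s.2)) / 2

/-- The exponent of the determinant. -/
def expDisc (s : ℂ × ℂ) : ℂ := s.2 / 2 - 5 / 4

/-- The kernel `det(q)^(s₂/2 - 5/4) q(m, n)^(-w)`, `w = (1 - (s₁ - s₂))/2`. -/
def zetaKernel (m n : ℝ) (s : ℂ × ℂ) (q : Form) : ℂ :=
  Complex.exp (expDisc s * Real.log q.disc - expVal s * Real.log (q.eval m n))

/-- The integral of a test function against the kernel `zetaKernel`. -/
def formInt (m n : ℝ) (h : Form → ℂ) (s : ℂ × ℂ) : ℂ := ∫ q, h q * zetaKernel m n s q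

instance : (volume : Measure Form).IsAddHaarMeasure := by
  have : (volume : Measure (ℝ × ℝ)).IsAddHaarMeasure :=
    inferInstanceAs ((volume : Measure ℝ).prod (volume : Measure ℝ)).IsAddHaarMeasure
  exact inferInstanceAs ((volume : Measure ℝ).prod (volume : Measure (ℝ × ℝ))).IsAddHaarMeasure

theorem contDiff_disc : ContDiff ℝ ∞ Form.disc := by unfold Form.disc; fun_prop

theorem contDiff_eval (m n : ℝ) : ContDiff ℝ ∞ fun q : Form => q.eval m n := by
  unfold Form.eval; fun_prop

theorem eval_pos_of_ne {q : Form} (hq : q ∈ posForms) {m n : ℝ} (hv : (m, n) ≠ (0, 0)) :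
    0 < q.eval m n := mem_posForms_iff_posDef.1 hq m n hv

theorem contDiffOn_zetaKernel {m n : ℝ} (hv : (m, n) ≠ (0, 0)) (s : ℂ × ℂ) :
    ContDiffOn ℝ ∞ (zetaKernel m n s) posForms := by
  have h1 : ContDiffOn ℝ ∞ (fun q : Form => (Real.log q.disc : ℂ)) posForms :=
    Complex.ofRealCLM.contDiff.comp_contDiffOn
      (contDiff_disc.contDiffOn.log fun q hq => (ne_of_gt hq.2))
  have h2 : ContDiffOn ℝ ∞ (fun q : Form => (Real.log (q.eval m n) : ℂ)) posForms :=
    Complex.ofRealCLM.contDiff.comp_contDiffOn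
      ((contDiff_eval m n).contDiffOn.log fun q hq => (eval_pos_of_ne hq hv).ne')
  exact ((contDiffOn_const.mul h1).sub (contDiffOn_const.mul h2)).cexp

theorem IsTest.integrable_mul {h : Form → ℂ} (hh : IsTest h) {g : Form → ℂ}
    (hg : ContinuousOn g posForms) : Integrable fun q => h q * g q := by
  refine Continuous.integrable_of_hasCompactSupport ?_ hh.hasCompactSupport.mul_right
  exact continuous_of_tsupport fun x hx => by
    have hx' : x ∈ tsupport h := tsupport_mul_subset_left hx
    exact hh.contDiff.continuous.continuousAt.mul
      (hg.continuousAt (posForms.isOpen.mem_nhds (hh.tsupport_subset hx')))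

theorem IsTest.mul {h : Form → ℂ} (hh : IsTest h) {g : Form → ℂ} (hg : ContDiff ℝ ∞ g) :
    IsTest fun q => g q * h q :=
  ⟨hg.mul hh.contDiff, hh.hasCompactSupport.mul_left,
    (tsupport_mul_subset_right (f := g) (g := h)).trans hh.tsupport_subset⟩

theorem IsTest.add {h g : Form → ℂ} (hh : IsTest h) (hg : IsTest g) : IsTest fun q => h q + g q :=
  ⟨hh.contDiff.add hg.contDiff, hh.hasCompactSupport.add hg.hasCompactSupport,
    (tsupport_add h g).trans (union_subset hh.tsupport_subset hg.tsupport_subset)⟩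

theorem IsTest.fderiv {h : Form → ℂ} (hh : IsTest h) (v : Form) :
    IsTest fun q => fderiv ℝ h q v :=
  ⟨(hh.contDiff.fderiv_right (m := ∞) (by simp)).clm_apply contDiff_const,
    HasCompactSupport.fderiv_apply ℝ hh.hasCompactSupport v,
    (tsupport_fderiv_apply_subset ℝ v).trans hh.tsupport_subset⟩

theorem IsTest.integral_fderiv_mul {h : Form → ℂ} (hh : IsTest h) {g : Form → ℂ}
    (hg : ContDiffOn ℝ 1 g posForms) (v : Form) :
    ∫ q, _root_.fderiv ℝ h q v * g q = -∫ q, h q * _root_.fderiv ℝ g q v :=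
  integral_fderiv_mul_eq_neg posForms.isOpen (hh.contDiff.of_le (by simp)) hh.hasCompactSupport
    hh.tsupport_subset hg v

/-- The directional derivative computed on a line. -/
theorem fderiv_eq_of_hasDerivAt_line {g : Form → ℂ} {q v : Form} {d : ℂ}
    (hg : DifferentiableAt ℝ g q) (h : HasDerivAt (fun t : ℝ => g (q + t • v)) d 0) :
    _root_.fderiv ℝ g q v = d := by
  rw [← hg.lineDeriv_eq_fderiv]
  exact HasLineDerivAt.lineDeriv h

theorem IsTest.integral_congr {h : Form → ℂ} (hh : IsTest h) {g₁ g₂ : Form → ℂ}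
    (hg : ∀ q ∈ posForms, g₁ q = g₂ q) : ∫ q, h q * g₁ q = ∫ q, h q * g₂ q := by
  refine integral_congr_ae (Filter.Eventually.of_forall fun q => ?_)
  by_cases hq : q ∈ posForms
  · simp only [hg q hq]
  · have : h q = 0 := image_eq_zero_of_notMem_tsupport fun hx => hq (hh.tsupport_subset hx)
    simp [this]

/-- The polarization of the determinant. -/
def Form.polar (q v : Form) : ℝ := v.1 * q.2.2 + q.1 * v.2.2 - 2 * q.2.1 * v.2.1

/-- The logarithmic derivative of the kernel in the direction `v`. -/
def logDerivKernel (m n : ℝ) (s : ℂ × ℂ) (v q : Form) : ℂ :=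
  expDisc s * (q.polar v : ℂ) / (q.disc : ℂ) - expVal s * (v.eval m n : ℂ) / (q.eval m n : ℂ)

theorem hasDerivAt_disc_line (q v : Form) :
    HasDerivAt (fun t : ℝ => (q + t • v).disc) (q.polar v) 0 := by
  have hA : HasDerivAt (fun t : ℝ => q.1 + t * v.1) v.1 0 := by
    simpa using ((hasDerivAt_id (0 : ℝ)).mul_const v.1).const_add q.1
  have hB : HasDerivAt (fun t : ℝ => q.2.1 + t * v.2.1) v.2.1 0 := by
    simpa using ((hasDerivAt_id (0 : ℝ)).mul_const v.2.1).const_add q.2.1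
  have hC : HasDerivAt (fun t : ℝ => q.2.2 + t * v.2.2) v.2.2 0 := by
    simpa using ((hasDerivAt_id (0 : ℝ)).mul_const v.2.2).const_add q.2.2
  have := (hA.mul hC).sub (hB.pow 2)
  simp only [zero_mul, add_zero] at this
  convert! this using 1
  simp [Form.polar]

theorem hasDerivAt_eval_line (m n : ℝ) (q v : Form) :
    HasDerivAt (fun t : ℝ => (q + t • v).eval m n) (v.eval m n) 0 := by
  have e : (fun t : ℝ => (q + t • v).eval m n) = fun t => q.eval m n + t * v.eval m n := by
    funext t
    simp only [Form.eval, Prod.fst_add, Prod.snd_add, Prod.smul_fst, Prod.smul_snd, smul_eq_mul]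
    ring
  rw [e]
  simpa using ((hasDerivAt_id (0 : ℝ)).mul_const (v.eval m n)).const_add (q.eval m n)

theorem hasDerivAt_polar_line (q v w : Form) :
    HasDerivAt (fun t : ℝ => (q + t • w).polar v) (w.polar v) 0 := by
  have e : (fun t : ℝ => (q + t • w).polar v) = fun t => q.polar v + t * w.polar v := by
    funext t
    simp only [Form.polar, Prod.fst_add, Prod.snd_add, Prod.smul_fst, Prod.smul_snd, smul_eq_mul]
    ring
  rw [e]
  simpa using ((hasDerivAt_id (0 : ℝ)).mul_const (w.polar v)).const_add (q.polar v)

theorem hasDerivAt_zetaKernel_line {m n : ℝ} (hv : (m, n) ≠ (0, 0)) (s : ℂ × ℂ) {q : Form}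
    (hq : q ∈ posForms) (v : Form) : HasDerivAt (fun t : ℝ => zetaKernel m n s (q + t • v))
      (zetaKernel m n s q * logDerivKernel m n s v q) 0 := by
  have hD : q.disc ≠ 0 := ne_of_gt hq.2
  have hQ : q.eval m n ≠ 0 := (eval_pos_of_ne hq hv).ne'
  have h3 := ((hasDerivAt_disc_line q v).log
    (by simpa using hD)).ofReal_comp.const_mul (expDisc s)
  have h4 := ((hasDerivAt_eval_line m n q v).log
    (by simpa using hQ)).ofReal_comp.const_mul (expVal s)
  convert! (h3.sub h4).cexp using 1
  simp [zetaKernel, logDerivKernel]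
  ring_nf

theorem fderiv_zetaKernel {m n : ℝ} (hv : (m, n) ≠ (0, 0)) (s : ℂ × ℂ) {q : Form}
    (hq : q ∈ posForms) (v : Form) : _root_.fderiv ℝ (zetaKernel m n s) q v =
      zetaKernel m n s q * logDerivKernel m n s v q :=
  fderiv_eq_of_hasDerivAt_line ((contDiffOn_zetaKernel hv s).differentiableOn
    (by simp) |>.differentiableAt
    (posForms.isOpen.mem_nhds hq)) (hasDerivAt_zetaKernel_line hv s hq v)

theorem contDiffOn_logDerivKernel {m n : ℝ} (hv : (m, n) ≠ (0, 0)) (s : ℂ × ℂ) (v : Form) :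
    ContDiffOn ℝ ∞ (logDerivKernel m n s v) posForms := by
  have hp : ContDiff ℝ ∞ fun q : Form => q.polar v := by unfold Form.polar; fun_prop
  have h1 := Complex.ofRealCLM.contDiff.comp hp
  have h2 := Complex.ofRealCLM.contDiff.comp contDiff_disc
  have h3 := Complex.ofRealCLM.contDiff.comp (contDiff_eval m n)
  unfold logDerivKernel
  simp only [div_eq_mul_inv]
  refine ((contDiff_const.mul h1).contDiffOn.mul (h2.contDiffOn.inv fun q hq => ?_)).sub
    (contDiffOn_const.mul (h3.contDiffOn.inv fun q hq => ?_))
  · exact Complex.ofReal_ne_zero.2 (ne_of_gt hq.2)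
  · exact Complex.ofReal_ne_zero.2 (eval_pos_of_ne hq hv).ne'

/-- Second derivatives of the kernel. -/
theorem fderiv_zetaKernel_mul {m n : ℝ} (hv : (m, n) ≠ (0, 0)) (s : ℂ × ℂ) {q : Form}
    (hq : q ∈ posForms) (v w : Form) :
    _root_.fderiv ℝ (fun q => zetaKernel m n s q * logDerivKernel m n s v q) q w =
      zetaKernel m n s q * (logDerivKernel m n s w q * logDerivKernel m n s v q +
        (expDisc s * ((w.polar v : ℂ) / (q.disc : ℂ) -
          (q.polar v : ℂ) * (q.polar w : ℂ) / (q.disc : ℂ) ^ 2) +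
        expVal s * (v.eval m n : ℂ) * (w.eval m n : ℂ) / (q.eval m n : ℂ) ^ 2)) := by
  have hD : (q.disc : ℂ) ≠ 0 := Complex.ofReal_ne_zero.2 (ne_of_gt hq.2)
  have hQ : (q.eval m n : ℂ) ≠ 0 := Complex.ofReal_ne_zero.2 (eval_pos_of_ne hq hv).ne'
  have hd := (((contDiffOn_zetaKernel hv s).mul (contDiffOn_logDerivKernel hv s v)).differentiableOn
    (by simp)).differentiableAt (posForms.isOpen.mem_nhds hq)
  refine fderiv_eq_of_hasDerivAt_line hd ?_
  have h1 := ((hasDerivAt_polar_line q v w).ofReal_comp.const_mul (expDisc s)).div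
    (hasDerivAt_disc_line q w).ofReal_comp (by simpa using hD)
  have h2 := (hasDerivAt_const (0 : ℝ) (expVal s * (v.eval m n : ℂ))).div
    (hasDerivAt_eval_line m n q w).ofReal_comp (by simpa using hQ)
  convert! (hasDerivAt_zetaKernel_line hv s hq w).mul (h1.sub h2) using 1
  simp only [zero_smul, add_zero, logDerivKernel, Pi.div_apply, Pi.sub_apply]
  field_simp
  ring

theorem formInt_fderiv {h : Form → ℂ} (hh : IsTest h) {m n : ℝ} (hv : (m, n) ≠ (0, 0))
    (s : ℂ × ℂ) (v : Form) : formInt m n (fun q => _root_.fderiv ℝ h q v) s =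
      -∫ q, h q * (zetaKernel m n s q * logDerivKernel m n s v q) := by
  unfold formInt
  rw [hh.integral_fderiv_mul ((contDiffOn_zetaKernel hv s).of_le (by simp)) v]
  congr 1
  exact hh.integral_congr fun q hq => fderiv_zetaKernel hv s hq v

theorem formInt_fderiv_fderiv {h : Form → ℂ} (hh : IsTest h) {m n : ℝ} (hv : (m, n) ≠ (0, 0))
    (s : ℂ × ℂ) (v w : Form) :
    formInt m n (fun q => _root_.fderiv ℝ (fun q => _root_.fderiv ℝ h q w) q v) s =
      ∫ q, h q * (zetaKernel m n s q * (logDerivKernel m n s w q * logDerivKernel m n s v q +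
        (expDisc s * ((w.polar v : ℂ) / (q.disc : ℂ) -
          (q.polar v : ℂ) * (q.polar w : ℂ) / (q.disc : ℂ) ^ 2) +
        expVal s * (v.eval m n : ℂ) * (w.eval m n : ℂ) / (q.eval m n : ℂ) ^ 2))) := by
  rw [formInt_fderiv (hh.fderiv w) hv]
  have hc := (contDiffOn_zetaKernel hv s).mul (contDiffOn_logDerivKernel hv s v)
  rw [hh.integral_fderiv_mul (hc.of_le (by simp)) w, neg_neg]
  exact hh.integral_congr fun q hq => fderiv_zetaKernel_mul hv s hq v w

/-- The Euler operator `-2 (∂_A A + ∂_B B + ∂_C C) + 6`. -/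
def eulerOp (h : Form → ℂ) (q : Form) : ℂ :=
  (-2) * (fderiv ℝ (fun q => (q.1 : ℂ) * h q) q (1, 0, 0) +
    fderiv ℝ (fun q => (q.2.1 : ℂ) * h q) q (0, 1, 0) +
    fderiv ℝ (fun q => (q.2.2 : ℂ) * h q) q (0, 0, 1)) + 6 * h q

/-- The operator `4 (∂_A ∂_C - ∂_B² / 4) det(q)`. -/
def boxOp (h : Form → ℂ) (q : Form) : ℂ :=
  4 * fderiv ℝ (fun q => fderiv ℝ (fun q => (q.disc : ℂ) * h q) q (0, 0, 1)) q (1, 0, 0) -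
    fderiv ℝ (fun q => fderiv ℝ (fun q => (q.disc : ℂ) * h q) q (0, 1, 0)) q (0, 1, 0)

theorem IsTest.const_mul {h : Form → ℂ} (hh : IsTest h) (c : ℂ) : IsTest fun q => c * h q :=
  hh.mul contDiff_const

theorem IsTest.mul_fst {h : Form → ℂ} (hh : IsTest h) : IsTest fun q => (q.1 : ℂ) * h q :=
  hh.mul (Complex.ofRealCLM.contDiff.comp contDiff_fst)

theorem IsTest.mul_mid {h : Form → ℂ} (hh : IsTest h) : IsTest fun q => (q.2.1 : ℂ) * h q :=
  hh.mul (Complex.ofRealCLM.contDiff.comp (contDiff_fst.comp contDiff_snd))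

theorem IsTest.mul_snd {h : Form → ℂ} (hh : IsTest h) : IsTest fun q => (q.2.2 : ℂ) * h q :=
  hh.mul (Complex.ofRealCLM.contDiff.comp (contDiff_snd.comp contDiff_snd))

theorem IsTest.mul_disc {h : Form → ℂ} (hh : IsTest h) : IsTest fun q => (q.disc : ℂ) * h q :=
  hh.mul (Complex.ofRealCLM.contDiff.comp contDiff_disc)

theorem IsTest.eulerOp {h : Form → ℂ} (hh : IsTest h) : IsTest (eulerOp h) :=
  ((((hh.mul_fst.fderiv _).add (hh.mul_mid.fderiv _)).add (hh.mul_snd.fderiv _)).const_mul (-2)).add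
    (hh.const_mul 6)

theorem IsTest.boxOp {h : Form → ℂ} (hh : IsTest h) : IsTest (boxOp h) := by
  have := (((hh.mul_disc.fderiv (0, 0, 1)).fderiv (1, 0, 0)).const_mul 4).add
    (((hh.mul_disc.fderiv (0, 1, 0)).fderiv (0, 1, 0)).const_mul (-1))
  convert! this using 1
  funext q
  simp [HallQuad.boxOp]
  ring

theorem formInt_add {h g : Form → ℂ} (hh : IsTest h) (hg : IsTest g) {m n : ℝ}
    (hv : (m, n) ≠ (0, 0)) (s : ℂ × ℂ) :
    formInt m n (fun q => h q + g q) s = formInt m n h s + formInt m n g s := by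
  unfold formInt
  simp only [add_mul]
  exact integral_add (hh.integrable_mul (contDiffOn_zetaKernel hv s).continuousOn)
    (hg.integrable_mul (contDiffOn_zetaKernel hv s).continuousOn)

theorem formInt_const_mul (h : Form → ℂ) (c : ℂ) (m n : ℝ) (s : ℂ × ℂ) :
    formInt m n (fun q => c * h q) s = c * formInt m n h s := by
  unfold formInt
  rw [← integral_const_mul]
  simp only [mul_assoc]

/-- The kernels are homogeneous in the form, and the Euler operator reads off the degree. -/
theorem formInt_eulerOp {h : Form → ℂ} (hh : IsTest h) {m n : ℝ} (hv : (m, n) ≠ (0, 0))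
    (s : ℂ × ℂ) : formInt m n (eulerOp h) s = (s.1 + s.2) * formInt m n h s := by
  have hk := (contDiffOn_zetaKernel hv s).continuousOn
  have hl : ∀ v, ContinuousOn (fun q => zetaKernel m n s q * logDerivKernel m n s v q) posForms :=
    fun v => hk.mul (contDiffOn_logDerivKernel hv s v).continuousOn
  unfold eulerOp
  rw [formInt_add ((((hh.mul_fst.fderiv _).add (hh.mul_mid.fderiv _)).add
    (hh.mul_snd.fderiv _)).const_mul (-2)) (hh.const_mul 6) hv, formInt_const_mul,
      formInt_const_mul,
    formInt_add ((hh.mul_fst.fderiv _).add (hh.mul_mid.fderiv _)) (hh.mul_snd.fderiv _) hv,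
    formInt_add (hh.mul_fst.fderiv _) (hh.mul_mid.fderiv _) hv, formInt_fderiv hh.mul_fst hv,
    formInt_fderiv hh.mul_mid hv, formInt_fderiv hh.mul_snd hv]
  have i1 := hh.mul_fst.integrable_mul (hl (1, 0, 0))
  have i2 := hh.mul_mid.integrable_mul (hl (0, 1, 0))
  have i3 := hh.mul_snd.integrable_mul (hl (0, 0, 1))
  rw [← neg_add, ← neg_add, ← integral_add i1 i2]
  have e := (integral_add (i1.add i2) i3).symm
  simp only [Pi.add_apply] at e
  rw [e]
  have key : ∫ q : Form, (q.1 : ℂ) * h q * (zetaKernel m n s q * logDerivKernel m n s (1, 0, 0) q) +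
      (q.2.1 : ℂ) * h q * (zetaKernel m n s q * logDerivKernel m n s (0, 1, 0) q) +
      (q.2.2 : ℂ) * h q * (zetaKernel m n s q * logDerivKernel m n s (0, 0, 1) q) =
      ∫ q : Form, h q * ((2 * expDisc s - expVal s) * zetaKernel m n s q) := by
    rw [← hh.integral_congr (g₁ := fun q : Form =>
      (q.1 : ℂ) * (zetaKernel m n s q * logDerivKernel m n s (1, 0, 0) q) +
      (q.2.1 : ℂ) * (zetaKernel m n s q * logDerivKernel m n s (0, 1, 0) q) +
      (q.2.2 : ℂ) * (zetaKernel m n s q * logDerivKernel m n s (0, 0, 1) q)) fun q hq => ?_]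
    · refine integral_congr_ae (Filter.Eventually.of_forall fun q => ?_)
      simp only
      ring
    · have hD : (q.disc : ℂ) ≠ 0 := Complex.ofReal_ne_zero.2 (ne_of_gt hq.2)
      have hQ : (q.eval m n : ℂ) ≠ 0 := Complex.ofReal_ne_zero.2 (eval_pos_of_ne hq hv).ne'
      simp only [logDerivKernel, Form.polar]
      field_simp
      simp only [Form.eval, Form.disc]
      push_cast
      ring
  rw [key]
  unfold formInt
  simp only [mul_left_comm (h _) (2 * expDisc s - expVal s)]
  rw [integral_const_mul]
  simp only [expDisc, expVal]
  ring

/-- The kernels are also eigenfunctions of a second order operator, with an eigenvalue that does not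
depend on the vector `(m, n)`. -/
theorem formInt_boxOp {h : Form → ℂ} (hh : IsTest h) {m n : ℝ} (hv : (m, n) ≠ (0, 0))
    (s : ℂ × ℂ) :
    formInt m n (boxOp h) s = (s.1 - 5 / 2) * (s.2 - 5 / 2) * formInt m n h s := by
  have hk := (contDiffOn_zetaKernel hv s).continuousOn
  have e : boxOp h = fun q =>
      4 * fderiv ℝ (fun q => fderiv ℝ (fun q => (q.disc : ℂ) * h q) q (0, 0, 1)) q (1, 0, 0) +
      (-1) * fderiv ℝ (fun q => fderiv ℝ (fun q => (q.disc : ℂ) * h q) q (0, 1, 0)) q (0, 1, 0) :=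
        by
    funext q
    simp [HallQuad.boxOp]
    ring
  have hl := fun v => (contDiffOn_logDerivKernel hv s v).continuousOn
  have hD : ContinuousOn (fun q : Form => (q.disc : ℂ)) posForms :=
    (Complex.continuous_ofReal.comp contDiff_disc.continuous).continuousOn
  have hQ : ContinuousOn (fun q : Form => (q.eval m n : ℂ)) posForms :=
    (Complex.continuous_ofReal.comp (contDiff_eval m n).continuous).continuousOn
  have hp : ∀ v, ContinuousOn (fun q : Form => (q.polar v : ℂ)) posForms := fun v => by
    unfold Form.polar; fun_prop
  have hD0 : ∀ q ∈ posForms, (q.disc : ℂ) ≠ 0 := fun q hq =>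
    Complex.ofReal_ne_zero.2 (ne_of_gt hq.2)
  have hQ0 : ∀ q ∈ posForms, (q.eval m n : ℂ) ≠ 0 := fun q hq =>
    Complex.ofReal_ne_zero.2 (eval_pos_of_ne hq hv).ne'
  have hi : ∀ v w : Form, ContinuousOn (fun q : Form => zetaKernel m n s q *
      (logDerivKernel m n s w q * logDerivKernel m n s v q +
        (expDisc s * ((w.polar v : ℂ) / (q.disc : ℂ) -
          (q.polar v : ℂ) * (q.polar w : ℂ) / (q.disc : ℂ) ^ 2) +
        expVal s * (v.eval m n : ℂ) * (w.eval m n : ℂ) / (q.eval m n : ℂ) ^ 2))) posForms := by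
    intro v w
    refine hk.mul (((hl w).mul (hl v)).add (ContinuousOn.add (continuousOn_const.mul
      (ContinuousOn.sub (continuousOn_const.div hD hD0) (((hp v).mul (hp w)).div (hD.pow 2)
      fun q hq => pow_ne_zero 2 (hD0 q hq)))) (continuousOn_const.div (hQ.pow 2)
      fun q hq => pow_ne_zero 2 (hQ0 q hq))))
  rw [e, formInt_add (((hh.mul_disc.fderiv _).fderiv _).const_mul _)
    (((hh.mul_disc.fderiv _).fderiv _).const_mul _) hv, formInt_const_mul, formInt_const_mul,
    formInt_fderiv_fderiv hh.mul_disc hv, formInt_fderiv_fderiv hh.mul_disc hv,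
    ← integral_const_mul, ← integral_const_mul, ← integral_add
      ((hh.mul_disc.integrable_mul (hi _ _)).const_mul _)
      ((hh.mul_disc.integrable_mul (hi _ _)).const_mul _)]
  unfold formInt
  rw [← integral_const_mul]
  have key := hh.integral_congr (g₁ := fun q : Form => 4 * ((q.disc : ℂ) * (zetaKernel m n s q *
      (logDerivKernel m n s (0, 0, 1) q * logDerivKernel m n s (1, 0, 0) q +
        (expDisc s * ((Form.polar (0, 0, 1) (1, 0, 0) : ℂ) / (q.disc : ℂ) -
          (q.polar (1, 0, 0) : ℂ) * (q.polar (0, 0, 1) : ℂ) / (q.disc : ℂ) ^ 2) +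
        expVal s * (Form.eval (1, 0, 0) m n : ℂ) * (Form.eval (0, 0, 1) m n : ℂ) /
          (q.eval m n : ℂ) ^ 2)))) +
      -1 * ((q.disc : ℂ) * (zetaKernel m n s q *
      (logDerivKernel m n s (0, 1, 0) q * logDerivKernel m n s (0, 1, 0) q +
        (expDisc s * ((Form.polar (0, 1, 0) (0, 1, 0) : ℂ) / (q.disc : ℂ) -
          (q.polar (0, 1, 0) : ℂ) * (q.polar (0, 1, 0) : ℂ) / (q.disc : ℂ) ^ 2) +
        expVal s * (Form.eval (0, 1, 0) m n : ℂ) * (Form.eval (0, 1, 0) m n : ℂ) /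
          (q.eval m n : ℂ) ^ 2)))))
    (g₂ := fun q => (s.1 - 5 / 2) * (s.2 - 5 / 2) * zetaKernel m n s q) fun q hq => by
      have h1 := hD0 q hq
      have h2 := hQ0 q hq
      have hw : s.1 = 2 * (expDisc s - expVal s) + 7 / 2 := by simp only [expDisc, expVal]; ring
      have hw2 : s.2 = 2 * expDisc s + 5 / 2 := by simp only [expDisc]; ring
      rw [hw, hw2]
      simp only [logDerivKernel, Form.polar]
      generalize expDisc s = a
      generalize expVal s = b
      field_simp
      simp only [Form.eval, Form.disc]
      push_cast
      ring
  refine Eq.trans (integral_congr_ae (Filter.Eventually.of_forall fun q => ?_)) (key.trans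
    (integral_congr_ae (Filter.Eventually.of_forall fun q => ?_)))
  · simp only
    ring
  · simp only
    ring

/-- An operator with symbol `s₁² + s₂² - c` with respect to all the kernels `zetaKernel`. -/
def casimirOp (c : ℝ) (h : Form → ℂ) (q : Form) : ℂ :=
  eulerOp (eulerOp h) q + (-5) * eulerOp h q + (-2) * boxOp h q + (25 / 2 - c) * h q

theorem IsTest.casimirOp {h : Form → ℂ} (hh : IsTest h) (c : ℝ) : IsTest (casimirOp c h) :=
  ((hh.eulerOp.eulerOp.add (hh.eulerOp.const_mul _)).add (hh.boxOp.const_mul _)).add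
    (hh.const_mul _)

theorem formInt_casimirOp {h : Form → ℂ} (hh : IsTest h) (c : ℝ) {m n : ℝ}
    (hv : (m, n) ≠ (0, 0)) (s : ℂ × ℂ) :
    formInt m n (casimirOp c h) s = (s.1 ^ 2 + s.2 ^ 2 - c) * formInt m n h s := by
  unfold casimirOp
  rw [formInt_add ((hh.eulerOp.eulerOp.add (hh.eulerOp.const_mul _)).add (hh.boxOp.const_mul _))
    (hh.const_mul _) hv, formInt_add (hh.eulerOp.eulerOp.add (hh.eulerOp.const_mul _))
    (hh.boxOp.const_mul _) hv, formInt_add hh.eulerOp.eulerOp (hh.eulerOp.const_mul _) hv,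
    formInt_const_mul, formInt_const_mul, formInt_const_mul, formInt_eulerOp hh.eulerOp hv,
    formInt_eulerOp hh hv, formInt_boxOp hh hv]
  ring

/-! ### Integration in fibre coordinates -/

/-- Forms as vectors of coefficients. -/
def formEquiv : Form ≃ₗ[ℝ] (Fin 3 → ℝ) where
  toFun q := ![q.1, q.2.1, q.2.2]
  invFun x := (x 0, x 1, x 2)
  map_add' p q := by ext i; fin_cases i <;> rfl
  map_smul' c q := by ext i; fin_cases i <;> rfl
  left_inv q := rfl
  right_inv x := by ext i; fin_cases i <;> rfl

theorem formEquiv_apply (q : Form) : formEquiv q = ![q.1, q.2.1, q.2.2] := rfl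

theorem det_form (L : Form →L[ℝ] Form) : L.det =
    Matrix.det !![(L (1, 0, 0)).1, (L (0, 1, 0)).1, (L (0, 0, 1)).1;
      (L (1, 0, 0)).2.1, (L (0, 1, 0)).2.1, (L (0, 0, 1)).2.1;
      (L (1, 0, 0)).2.2, (L (0, 1, 0)).2.2, (L (0, 0, 1)).2.2] := by
  have h := LinearMap.det_toMatrix (Module.Basis.ofEquivFun formEquiv) (L : Form →ₗ[ℝ] Form)
  rw [ContinuousLinearMap.det, ← h]
  congr 1
  ext i j
  rw [LinearMap.toMatrix_apply]
  have h0 : formEquiv.symm (Pi.single 0 1) = ((1, 0, 0) : Form) := by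
    rw [LinearEquiv.symm_apply_eq]; ext i; fin_cases i <;> simp [formEquiv_apply]
  have h1 : formEquiv.symm (Pi.single 1 1) = ((0, 1, 0) : Form) := by
    rw [LinearEquiv.symm_apply_eq]; ext i; fin_cases i <;> simp [formEquiv_apply]
  have h2 : formEquiv.symm (Pi.single 2 1) = ((0, 0, 1) : Form) := by
    rw [LinearEquiv.symm_apply_eq]; ext i; fin_cases i <;> simp [formEquiv_apply]
  fin_cases i <;> fin_cases j <;> simp [h0, h1, h2, formEquiv_apply]

/-- The fibre coordinates as a map of `ℝ³`. -/
def fibreParam (v : PrimVec) (p : ℝ × ℝ × ℝ) : Form := fibreForm v (!₂[p.1, p.2.1], p.2.2)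

theorem contDiff_fibreParam (v : PrimVec) : ContDiff ℝ ∞ (fibreParam v) := by
  unfold fibreParam fibreForm
  simp only [Matrix.cons_val_zero, Matrix.cons_val_one]
  fun_prop

theorem image_fibreParam (v : PrimVec) : fibreParam v '' univ = posForms := by
  ext q
  constructor
  · rintro ⟨p, -, rfl⟩
    exact fibreForm_mem v _
  · intro hq
    refine ⟨((fibreCoord v q).1 0, (fibreCoord v q).1 1, (fibreCoord v q).2), mem_univ _, ?_⟩
    rw [fibreParam]
    convert fibreForm_fibreCoord v hq using 2
    refine Prod.ext ?_ rfl
    ext i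
    fin_cases i <;> rfl

theorem injective_fibreParam (v : PrimVec) : Function.Injective (fibreParam v) := by
  intro p p' h
  have h2 := congrArg (fibreCoord v) h
  simp only [fibreParam, fibreCoord_fibreForm, Prod.mk.injEq] at h2
  have e0 := congrFun (congrArg WithLp.ofLp h2.1) 0
  have e1 := congrFun (congrArg WithLp.ofLp h2.1) 1
  simp at e0 e1
  exact Prod.ext e0 (Prod.ext e1 h2.2)

theorem det_fderiv_fibreParam (v : PrimVec) (p : ℝ × ℝ × ℝ) :
    |(fderiv ℝ (fibreParam v) p).det| = 4 * Real.exp (-4 * p.1 - 2 * p.2.1) := by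
  have hd := (contDiff_fibreParam v).differentiable (by simp) p
  have hN := (normSq_pos v).ne'
  have hline : ∀ w d : Form, HasDerivAt (fun t : ℝ => fibreParam v (p + t • w)) d 0 →
      fderiv ℝ (fibreParam v) p w = d := by
    intro w d h
    rw [← hd.lineDeriv_eq_fderiv]
    exact HasLineDerivAt.lineDeriv h
  obtain ⟨x, y, u⟩ := p
  generalize hm : (v.1.1 : ℝ) = m at *
  generalize hn : (v.1.2 : ℝ) = n at *
  obtain ⟨P, hP⟩ : ∃ P : ℝ, P = m / (m ^ 2 + n ^ 2) - u * n := ⟨_, rfl⟩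
  obtain ⟨r, hr⟩ : ∃ r : ℝ, r = n / (m ^ 2 + n ^ 2) + u * m := ⟨_, rfl⟩
  have hexp : ∀ z : ℝ, HasDerivAt (fun t : ℝ => Real.exp (-2 * (z + t))) (-2 * Real.exp (-2 * z))
    0 := by
    intro z
    have := (((hasDerivAt_id (0 : ℝ)).const_add z).const_mul (-2)).exp
    simpa [mul_comm] using this
  have hPd : HasDerivAt (fun t : ℝ => m / (m ^ 2 + n ^ 2) - (u + t) * n) (-n) 0 := by
    simpa using (((hasDerivAt_id (0 : ℝ)).const_add u).mul_const n).const_sub (m / (m ^ 2 + n ^ 2))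
  have hrd : HasDerivAt (fun t : ℝ => n / (m ^ 2 + n ^ 2) + (u + t) * m) m 0 := by
    simpa using (((hasDerivAt_id (0 : ℝ)).const_add u).mul_const m).const_add (n / (m ^ 2 + n ^ 2))
  have d0 : fderiv ℝ (fibreParam v) (x, y, u) (1, 0, 0) =
      (-2 * Real.exp (-2 * x) * P ^ 2, -2 * Real.exp (-2 * x) * P * r,
        -2 * Real.exp (-2 * x) * r ^ 2) := by
    refine hline _ _ ?_
    have h1 := ((hexp x).mul_const (P ^ 2)).add_const (Real.exp (-2 * y) * n ^ 2)
    have h2 := (((hexp x).mul_const P).mul_const r).sub_const (Real.exp (-2 * y) * m * n)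
    have h3 := ((hexp x).mul_const (r ^ 2)).add_const (Real.exp (-2 * y) * m ^ 2)
    convert! h1.prodMk (h2.prodMk h3) using 1
    funext t
    simp [fibreParam, fibreForm, hm, hn, hP, hr]
  have d1 : fderiv ℝ (fibreParam v) (x, y, u) (0, 1, 0) =
      (-2 * Real.exp (-2 * y) * n ^ 2, 2 * Real.exp (-2 * y) * m * n,
        -2 * Real.exp (-2 * y) * m ^ 2) := by
    refine hline _ _ ?_
    have h1 := ((hexp y).mul_const (n ^ 2)).const_add (Real.exp (-2 * x) * P ^ 2)
    have h2 := (((hexp y).mul_const m).mul_const n).const_sub (Real.exp (-2 * x) * P * r)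
    have h3 := ((hexp y).mul_const (m ^ 2)).const_add (Real.exp (-2 * x) * r ^ 2)
    convert! h1.prodMk (h2.prodMk h3) using 1
    · funext t
      simp [fibreParam, fibreForm, hm, hn, hP, hr]
    · simp
  have d2 : fderiv ℝ (fibreParam v) (x, y, u) (0, 0, 1) =
      (Real.exp (-2 * x) * (-2 * P * n), Real.exp (-2 * x) * (-n * r + P * m),
        Real.exp (-2 * x) * (2 * r * m)) := by
    refine hline _ _ ?_
    have h1 := ((hPd.pow 2).const_mul (Real.exp (-2 * x))).add_const (Real.exp (-2 * y) * n ^ 2)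
    have h2 := ((hPd.mul hrd).const_mul (Real.exp (-2 * x))).sub_const (Real.exp (-2 * y) * m * n)
    have h3 := ((hrd.pow 2).const_mul (Real.exp (-2 * x))).add_const (Real.exp (-2 * y) * m ^ 2)
    convert! h1.prodMk (h2.prodMk h3) using 1
    · funext t
      simp [fibreParam, fibreForm, hm, hn, mul_assoc]
    · simp [hP, hr]
  have hrel : P * m + r * n = 1 := by
    rw [hP, hr]
    field_simp
    ring
  rw [det_form, d0, d1, d2, Matrix.det_fin_three]
  simp only [Matrix.of_apply, Matrix.cons_val]
  have e : Real.exp (-4 * x - 2 * y) = Real.exp (-2 * x) ^ 2 * Real.exp (-2 * y) := by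
    rw [← Real.exp_nat_mul, ← Real.exp_add]
    congr 1
    push_cast
    ring
  rw [e]
  have ha := Real.exp_pos (-2 * x)
  have hb := Real.exp_pos (-2 * y)
  trans |-(4 * (Real.exp (-2 * x) ^ 2 * Real.exp (-2 * y))) * (P * m + r * n) ^ 3|
  · congr 1
    ring
  · rw [hrel, one_pow, mul_one, abs_neg, abs_of_pos (by positivity)]

theorem integral_logPlane (G : LogPlane → ℂ) : ∫ x, G x = ∫ p : ℝ × ℝ, G !₂[p.1, p.2] := by
  have h1 := (EuclideanSpace.volume_preserving_symm_measurableEquiv_toLp (Fin 2)).symm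
  have h2 := (volume_preserving_finTwoArrow ℝ).symm
  have := (h2.trans h1).integral_comp' G
  rw [← this]
  refine integral_congr_ae (Filter.Eventually.of_forall fun p => ?_)
  rfl

/-- Change of variables to the fibre coordinates of `v`. -/
theorem setIntegral_posForms (v : PrimVec) (g : Form → ℂ) : ∫ q in posForms, g q =
    ∫ p : ℝ × ℝ × ℝ, (4 * Real.exp (-4 * p.1 - 2 * p.2.1)) • g (fibreParam v p) := by
  have h := integral_image_eq_integral_abs_det_fderiv_smul volume MeasurableSet.univ
    (fun p _ => ((contDiff_fibreParam v).differentiable (by simp) p).hasFDerivAt.hasFDerivWithinAt)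
    (injective_fibreParam v).injOn g
  rw [image_fibreParam, Measure.restrict_univ] at h
  rw [h]
  simp only [det_fderiv_fibreParam]

theorem IsTest.setIntegral {h : Form → ℂ} (hh : IsTest h) (g : Form → ℂ) :
    ∫ q in posForms, h q * g q = ∫ q, h q * g q :=
  setIntegral_eq_integral_of_forall_compl_eq_zero fun q hq => by
    have : h q = 0 := image_eq_zero_of_notMem_tsupport fun hx => hq (hh.tsupport_subset hx)
    simp [this]

theorem zetaKernel_fibreParam (v : PrimVec) (s : ℂ × ℂ) (p : ℝ × ℝ × ℝ) :
    zetaKernel v.1.1 v.1.2 s (fibreParam v p) = Complex.exp (expDisc s * (-2 * p.1 - 2 * p.2.1) +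
      expVal s * (2 * p.1)) := by
  rw [zetaKernel, fibreParam, fibreForm_eval, fibreForm_disc, ← Real.exp_add, Real.log_exp,
    Real.log_exp]
  congr 1
  push_cast
  ring

theorem isTest_testFunction (h : 𝓓(posForms, ℂ)) : IsTest h :=
  ⟨h.contDiff, h.hasCompactSupport, h.tsupport_subset⟩

/-- The Laplace transform of a fibre integral, as an integral over the space of forms. -/
theorem lap_fibreIntegral (v : PrimVec) (h : 𝓓(posForms, ℂ)) (s : ℂ × ℂ) :
    Lap (fibreIntegral v h) s = 1 / 4 * formInt v.1.1 v.1.2 h s := by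
  have hh := isTest_testFunction h
  rw [formInt, ← hh.setIntegral, setIntegral_posForms v, Lap, integral_logPlane]
  let W : (ℝ × ℝ) × ℝ → ℂ := fun y =>
    Complex.exp ((-1 / 2 - s.1) * y.1.1 + (1 / 2 - s.2) * y.1.2) *
      h (fibreForm v (!₂[y.1.1, y.1.2], y.2))
  have hWc : Continuous W := by
    refine Continuous.mul (by fun_prop) (h.contDiff.continuous.comp
      ((contDiff_fibreForm v).continuous.comp ?_))
    refine Continuous.prodMk ((PiLp.continuous_toLp 2 _).comp ?_) continuous_snd
    refine continuous_pi fun i => ?_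
    fin_cases i
    · exact continuous_fst.fst
    · exact continuous_fst.snd
  have hWs : HasCompactSupport W := by
    have hS := hasCompactSupport_comp_fibreForm v h
    refine HasCompactSupport.intro (hS.isCompact.image
      (f := fun y : LogPlane × ℝ => ((y.1 0, y.1 1), y.2)) (by fun_prop)) fun y hy => ?_
    have : h (fibreForm v (!₂[y.1.1, y.1.2], y.2)) = 0 := by
      by_contra hne
      exact hy ⟨(!₂[y.1.1, y.1.2], y.2), subset_tsupport (fun y => h (fibreForm v y)) hne, rfl⟩
    simp [W, this]
  have hWi : Integrable W := hWc.integrable_of_hasCompactSupport hWs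
  have e1 : ∫ p : ℝ × ℝ, fibreIntegral v h !₂[p.1, p.2] * character (-s) !₂[p.1, p.2] =
      ∫ y, W y := by
    refine Eq.trans ?_ (integral_prod W hWi).symm
    refine integral_congr_ae (Filter.Eventually.of_forall fun p => ?_)
    simp only [W, fibreIntegral, character]
    rw [integral_const_mul]
    generalize ∫ u : ℝ, h (fibreForm v (!₂[p.1, p.2], u)) = J
    simp only [Matrix.cons_val_zero, Matrix.cons_val_one]
    push_cast
    rw [show ∀ a b c d e : ℂ, a * b * (c * d * J) * e = a * b * c * d * e * J by intros; ring]
    congr 1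
    simp only [← Complex.exp_add]
    congr 1
    simp
    ring
  rw [e1, ← (volume_preserving_prodAssoc (α₁ := ℝ) (β₁ := ℝ) (γ₁ := ℝ)).symm.integral_comp' W,
    ← integral_const_mul]
  refine integral_congr_ae (Filter.Eventually.of_forall fun p => ?_)
  simp only [zetaKernel_fibreParam, W, Complex.real_smul]
  change _ * h (fibreParam v p) = _
  push_cast
  rw [mul_left_comm _ (h _) _, mul_left_comm _ (h _) _, mul_comm _ (h _)]
  congr 1
  rw [mul_assoc, ← mul_assoc (1 / 4 : ℂ), one_div_mul_cancel (by norm_num), one_mul,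
    ← Complex.exp_add]
  congr 1
  simp only [expDisc, expVal]
  change _ * (p.1 : ℂ) + _ * (p.2.1 : ℂ) = _
  ring

/-! ### Convergence of the extended Hall product -/

/-- The smallest eigenvalue of `q` is at least `det q / tr q`. -/
theorem disc_div_mul_le_eval {q : Form} (hq : q ∈ posForms) (m n : ℝ) :
    q.disc / (q.1 + q.2.2) * (m ^ 2 + n ^ 2) ≤ q.eval m n := by
  have hC : 0 < q.2.2 := by
    have := hq.2
    unfold Form.disc at this
    have h1 : 0 < q.1 * q.2.2 := by nlinarith [sq_nonneg q.2.1]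
    exact (mul_pos_iff_of_pos_left hq.1).1 h1
  have ht : 0 < q.1 + q.2.2 := add_pos hq.1 hC
  rw [div_mul_eq_mul_div, div_le_iff₀ ht]
  unfold Form.disc Form.eval
  nlinarith [sq_nonneg (q.1 * m + q.2.1 * n), sq_nonneg (q.2.1 * m + q.2.2 * n)]

theorem trace_pos {q : Form} (hq : q ∈ posForms) : 0 < q.1 + q.2.2 := by
  have := hq.2
  unfold Form.disc at this
  have h1 : 0 < q.1 * q.2.2 := by nlinarith [sq_nonneg q.2.1]
  exact add_pos hq.1 ((mul_pos_iff_of_pos_left hq.1).1 h1)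

theorem sq_add_sq_pos {m n : ℝ} (hv : (m, n) ≠ (0, 0)) : 0 < m ^ 2 + n ^ 2 := by
  rcases eq_or_ne m 0 with hm | hm
  · have hn : n ≠ 0 := fun hn => hv (by rw [hm, hn])
    positivity
  · positivity

theorem exists_integral_norm_le {h : Form → ℂ} (hh : IsTest h) (a : ℝ) {b : ℝ} (hb : 0 ≤ b) :
    ∃ C, 0 ≤ C ∧ ∀ s, (expDisc s).re = a → (expVal s).re = b → ∀ m n : ℝ, (m, n) ≠ (0, 0) →
      ∫ q, ‖h q * zetaKernel m n s q‖ ≤ C * (m ^ 2 + n ^ 2) ^ (-b) := by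
  let B : Form → ℝ := fun q => Real.exp (a * Real.log q.disc) * (q.disc / (q.1 + q.2.2)) ^ (-b)
  have hBc : ContinuousOn (fun q => (B q : ℂ)) posForms := by
    refine Complex.continuous_ofReal.comp_continuousOn ?_
    refine ContinuousOn.mul (Real.continuous_exp.comp_continuousOn (continuousOn_const.mul
      (contDiff_disc.continuous.continuousOn.log fun q hq => ne_of_gt hq.2))) ?_
    refine ContinuousOn.rpow_const (contDiff_disc.continuous.continuousOn.div (by fun_prop)
      fun q hq => (trace_pos hq).ne') fun q hq => Or.inl (div_pos hq.2 (trace_pos hq)).ne'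
  have hi := (hh.integrable_mul hBc).norm
  refine ⟨∫ q, ‖h q * (B q : ℂ)‖, integral_nonneg fun q => norm_nonneg _,
    fun s h1 h2 m n hv => ?_⟩
  rw [← integral_mul_const]
  refine integral_mono_of_nonneg (Filter.Eventually.of_forall fun q => norm_nonneg _)
    (hi.mul_const _) (Filter.Eventually.of_forall fun q => ?_)
  beta_reduce
  by_cases hq : q ∈ posForms
  · rw [norm_mul, norm_mul, mul_assoc]
    refine mul_le_mul_of_nonneg_left ?_ (norm_nonneg _)
    have hQ := eval_pos_of_ne hq hv
    have hN := sq_add_sq_pos hv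
    have hl : 0 < q.disc / (q.1 + q.2.2) := div_pos hq.2 (trace_pos hq)
    have e : ‖zetaKernel m n s q‖ = Real.exp (a * Real.log q.disc) * q.eval m n ^ (-b) := by
      rw [zetaKernel, Complex.norm_exp, Real.rpow_def_of_pos hQ, ← Real.exp_add, Complex.sub_re,
        Complex.re_mul_ofReal, Complex.re_mul_ofReal, h1, h2]
      congr 1
      ring
    rw [e, Complex.norm_real, Real.norm_of_nonneg (by positivity), mul_assoc]
    refine mul_le_mul_of_nonneg_left ?_ (Real.exp_pos _).le
    rw [← Real.mul_rpow hl.le hN.le]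
    exact Real.rpow_le_rpow_of_nonpos (by positivity) (disc_div_mul_le_eval hq m n) (by linarith)
  · have : h q = 0 := image_eq_zero_of_notMem_tsupport fun hx => hq (hh.tsupport_subset hx)
    simp [this]

theorem exists_norm_formInt_le {h : Form → ℂ} (hh : IsTest h) (a : ℝ) {b : ℝ} (hb : 0 ≤ b) :
    ∃ C, 0 ≤ C ∧ ∀ s, (expDisc s).re = a → (expVal s).re = b → ∀ m n : ℝ, (m, n) ≠ (0, 0) →
      ‖formInt m n h s‖ ≤ C * (m ^ 2 + n ^ 2) ^ (-b) := by
  obtain ⟨C, hC, H⟩ := exists_integral_norm_le hh a hb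
  exact ⟨C, hC, fun s h1 h2 m n hv => (norm_integral_le_integral_norm _).trans (H s h1 h2 m n hv)⟩

/-- The plane `Re s = (-1, 1)`, on which the sum over primitive vectors converges absolutely. -/
def convPlane (ξ : LogPlane) : ℂ × ℂ := vert (((-1 : ℝ) : ℂ), ((1 : ℝ) : ℂ)) ξ

theorem convPlane_re (ξ : LogPlane) : (convPlane ξ).1.re = -1 ∧ (convPlane ξ).2.re = 1 := by
  have := vert_re (((-1 : ℝ) : ℂ), ((1 : ℝ) : ℂ)) ξ
  simpa [convPlane] using this

/-- Rapid decay of the form integrals on the plane `Re s = (-1, 1)`, with a bound summable over the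
lattice: `casimirOp` multiplies them by the same symbol for all vectors. -/
theorem exists_norm_formInt_decay {h : Form → ℂ} (hh : IsTest h) (k : ℕ) :
    ∃ C, 0 ≤ C ∧ ∀ s : ℂ × ℂ, s.1.re = -1 → s.2.re = 1 → ∀ m n : ℝ, (m, n) ≠ (0, 0) →
      imSize s ^ k * ‖formInt m n h s‖ ≤ C * (m ^ 2 + n ^ 2) ^ (-(3 / 2) : ℝ) := by
  induction k generalizing h with
  | zero =>
    obtain ⟨C, hC, H⟩ := exists_norm_formInt_le hh (-3 / 4) (b := 3 / 2) (by norm_num)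
    refine ⟨C, hC, fun s h1 h2 m n hv => ?_⟩
    rw [pow_zero, one_mul]
    refine H s ?_ ?_ m n hv
    · simp [expDisc, h2]; norm_num
    · simp [expVal, h1, h2]; norm_num
  | succ k ih =>
    obtain ⟨C, hC, H⟩ := ih (hh.casimirOp 3)
    refine ⟨C, hC, fun s h1 h2 m n hv => le_trans ?_ (H s h1 h2 m n hv)⟩
    rw [formInt_casimirOp hh 3 hv, norm_mul, pow_succ, mul_assoc]
    have := imSize_pos s
    refine mul_le_mul_of_nonneg_left (mul_le_mul_of_nonneg_right
      (imSize_le_norm_symbol (R := 1) (by norm_num) ?_ ?_) (norm_nonneg _)) (by positivity)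
    · rw [h1]; norm_num
    · rw [h2]; norm_num

theorem summable_sq_add_sq_rpow {b : ℝ} (hb : 1 < b) :
    Summable fun v : ℤ × ℤ => ((v.1 : ℝ) ^ 2 + (v.2 : ℝ) ^ 2) ^ (-b) := by
  have h := EisensteinSeries.summable_one_div_norm_rpow (k := 2 * b) (by linarith)
  have h' := (finTwoArrowEquiv ℤ).symm.summable_iff.2 h
  refine Summable.of_nonneg_of_le (fun v => by positivity) (fun v => ?_) h'
  obtain ⟨m, n⟩ := v
  simp only [Function.comp_apply, finTwoArrowEquiv_symm_apply]
  rcases eq_or_ne (m, n) (0, 0) with h0 | h0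
  · have e1 : m = 0 := congrArg Prod.fst h0
    have e2 : n = 0 := congrArg Prod.snd h0
    subst e1 e2
    have e3 : (![0, 0] : Fin 2 → ℤ) = 0 := by ext i; fin_cases i <;> rfl
    rw [e3, norm_zero]
    norm_num
    rw [Real.zero_rpow (by linarith), Real.zero_rpow (by linarith)]
  · have hle : ‖(![m, n] : Fin 2 → ℤ)‖ ^ 2 ≤ (m : ℝ) ^ 2 + (n : ℝ) ^ 2 := by
      have : ‖(![m, n] : Fin 2 → ℤ)‖ ≤ √((m : ℝ) ^ 2 + (n : ℝ) ^ 2) := by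
        refine (pi_norm_le_iff_of_nonneg (Real.sqrt_nonneg _)).2 fun i => ?_
        refine Real.le_sqrt_of_sq_le ?_
        fin_cases i
        · simp [Int.norm_eq_abs, sq_nonneg]
        · simp [Int.norm_eq_abs, sq_nonneg]
      calc _ ≤ √((m : ℝ) ^ 2 + (n : ℝ) ^ 2) ^ 2 := pow_le_pow_left₀ (norm_nonneg _) this 2
        _ = _ := Real.sq_sqrt (by positivity)
    have hpos : 0 < ‖(![m, n] : Fin 2 → ℤ)‖ := by
      refine norm_pos_iff.2 fun h => h0 ?_
      have e0 := congrFun h 0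
      have e1 := congrFun h 1
      simp at e0 e1
      rw [e0, e1]
    calc ((m : ℝ) ^ 2 + (n : ℝ) ^ 2) ^ (-b) ≤ (‖(![m, n] : Fin 2 → ℤ)‖ ^ 2) ^ (-b) :=
          Real.rpow_le_rpow_of_nonpos (by positivity) hle (by linarith)
      _ = _ := by
          rw [← Real.rpow_natCast, ← Real.rpow_mul hpos.le]
          congr 1
          push_cast
          ring

theorem PrimVec.ne_zero (v : PrimVec) : ((v.1.1 : ℝ), (v.1.2 : ℝ)) ≠ (0, 0) := by
  intro h
  have := normSq_pos v
  simp only [Prod.mk.injEq] at h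
  rw [h.1, h.2] at this
  simp at this

theorem continuous_formInt_vert (v : PrimVec) (h : 𝓓(posForms, ℂ)) (s : ℂ × ℂ) :
    Continuous fun ξ => formInt v.1.1 v.1.2 h (vert s ξ) := by
  have e : (fun ξ => formInt v.1.1 v.1.2 h (vert s ξ)) =
      fun ξ => 4 * Lap (fibreIntegral v h) (vert s ξ) := by
    funext ξ
    rw [lap_fibreIntegral]
    ring
  rw [e]
  exact continuous_const.mul ((differentiable_lap (contDiff_fibreIntegral v h).continuous
    (hasCompactSupport_fibreIntegral v h)).continuous.comp (continuous_vert s))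

/-- Mellin inversion of a term of the Hall product. -/
theorem hallTerm_eq {f : 𝓢'(LogPlane, ℂ)} {F : ℂ × ℂ → ℂ} (hF : IsMellinTransform f F)
    (h : 𝓓(posForms, ℂ)) (v : PrimVec) :
    hallTerm f h v = ∫ ξ, F (convPlane ξ) * (1 / 4 * formInt v.1.1 v.1.2 h (convPlane ξ)) := by
  have e := hF.apply_eq (-1, 1) ((hasCompactSupport_fibreIntegral v h).toSchwartzMap
    (contDiff_fibreIntegral v h)) (hasCompactSupport_fibreIntegral v h)
  refine e.trans (integral_congr_ae (Filter.Eventually.of_forall fun ξ => ?_))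
  change F (convPlane ξ) * Lap (fibreIntegral v h) (convPlane ξ) = _
  simp only [lap_fibreIntegral]

theorem exists_norm_mul_formInt_le {F : ℂ × ℂ → ℂ} (hg : HasVerticalPolyGrowth F)
    {h : Form → ℂ} (hh : IsTest h) : ∃ C, 0 ≤ C ∧ ∀ (ξ : LogPlane) (m n : ℝ), (m, n) ≠ (0, 0) →
      ‖F (convPlane ξ) * (1 / 4 * formInt m n h (convPlane ξ))‖ ≤
        C * ((1 + ‖ξ‖ ^ 2) ^ 2)⁻¹ * (m ^ 2 + n ^ 2) ^ (-(3 / 2) : ℝ) := by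
  obtain ⟨C, N, hC, H⟩ := hg.exists_imSize 1
  obtain ⟨D, hD, H'⟩ := exists_norm_formInt_decay hh (N + 2)
  refine ⟨C * D, by positivity, fun ξ m n hv => ?_⟩
  obtain ⟨h1, h2⟩ := convPlane_re ξ
  have hs := imSize_pos (convPlane ξ)
  have hN := sq_add_sq_pos hv
  have b1 := H (convPlane ξ) (by rw [h1]; norm_num) (by rw [h2]; norm_num)
  have b2 := H' (convPlane ξ) h1 h2 m n hv
  have b3 : 1 + ‖ξ‖ ^ 2 ≤ imSize (convPlane ξ) := by
    have := one_add_norm_sq_le_imSize_vert (A := 0) (s := (((-1 : ℝ) : ℂ), ((1 : ℝ) : ℂ)))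
      (by simp) (by simp) ξ
    simpa [convPlane] using this
  have b4 : (1 + ‖ξ‖ ^ 2) ^ 2 ≤ imSize (convPlane ξ) ^ 2 := pow_le_pow_left₀ (by positivity) b3 2
  rw [mul_right_comm, ← div_eq_mul_inv, le_div_iff₀ (by positivity), norm_mul, norm_mul]
  have h4 : ‖(1 / 4 : ℂ)‖ ≤ 1 := by norm_num
  calc ‖F (convPlane ξ)‖ * (‖(1 / 4 : ℂ)‖ * ‖formInt m n h (convPlane ξ)‖) * (1 + ‖ξ‖ ^ 2) ^ 2
      ≤ (C * imSize (convPlane ξ) ^ N) * (1 * ‖formInt m n h (convPlane ξ)‖) *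
        imSize (convPlane ξ) ^ 2 := by gcongr
    _ = C * (imSize (convPlane ξ) ^ (N + 2) * ‖formInt m n h (convPlane ξ)‖) := by ring
    _ ≤ C * (D * (m ^ 2 + n ^ 2) ^ (-(3 / 2) : ℝ)) := mul_le_mul_of_nonneg_left b2 hC
    _ = _ := by ring

theorem summable_primVec {b : ℝ} (hb : 1 < b) :
    Summable fun v : PrimVec => ((v.1.1 : ℝ) ^ 2 + (v.1.2 : ℝ) ^ 2) ^ (-b) :=
  (summable_sq_add_sq_rpow hb).comp_injective Subtype.val_injective

/-- The sum of the form integrals over all primitive vectors. -/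
def primSum (h : Form → ℂ) (s : ℂ × ℂ) : ℂ := ∑' v : PrimVec, formInt v.1.1 v.1.2 h s

/-- The extended Hall product converges absolutely, and its value is an integral over the plane
`Re s = (-1, 1)`. -/
theorem hasSum_hallTerm {f : 𝓢'(LogPlane, ℂ)} {F : ℂ × ℂ → ℂ} (hF : IsMellinTransform f F)
    (hc : Continuous F) (hg : HasVerticalPolyGrowth F) (h : 𝓓(posForms, ℂ)) :
    HasSum (hallTerm f h) (∫ ξ, F (convPlane ξ) * (1 / 4 * primSum h (convPlane ξ))) := by
  obtain ⟨C, hC, H⟩ := exists_norm_mul_formInt_le hg (isTest_testFunction h)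
  have hs := summable_primVec (b := 3 / 2) (by norm_num)
  have hm : ∀ v : PrimVec, Continuous fun ξ =>
      F (convPlane ξ) * (1 / 4 * formInt v.1.1 v.1.2 h (convPlane ξ)) := fun v =>
    (hc.comp (continuous_vert _)).mul (continuous_const.mul (continuous_formInt_vert v h _))
  have hi : ∀ v : PrimVec, Integrable fun ξ =>
      F (convPlane ξ) * (1 / 4 * formInt v.1.1 v.1.2 h (convPlane ξ)) := fun v =>
    ((integrable_one_add_norm_sq_inv_sq.const_mul C).mul_const _).mono' (hm v).aestronglyMeasurable
      (Filter.Eventually.of_forall fun ξ => H ξ _ _ v.ne_zero)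
  have hsum : Summable fun v : PrimVec =>
      ∫ ξ, ‖F (convPlane ξ) * (1 / 4 * formInt v.1.1 v.1.2 h (convPlane ξ))‖ := by
    refine Summable.of_nonneg_of_le (fun v => integral_nonneg fun ξ => norm_nonneg _) (fun v => ?_)
      (hs.mul_left (∫ ξ : LogPlane, C * ((1 + ‖ξ‖ ^ 2) ^ 2)⁻¹))
    rw [← integral_mul_const]
    exact integral_mono (hi v).norm ((integrable_one_add_norm_sq_inv_sq.const_mul C).mul_const _)
      fun ξ => H ξ _ _ v.ne_zero
  have := hasSum_integral_of_summable_integral_norm hi hsum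
  have e1 : (fun v : PrimVec => ∫ ξ, F (convPlane ξ) *
      (1 / 4 * formInt v.1.1 v.1.2 h (convPlane ξ))) = hallTerm f h :=
    funext fun v => (hallTerm_eq hF h v).symm
  rw [e1] at this
  simp only [tsum_mul_left] at this
  exact this

theorem extHall_eq {f : 𝓢'(LogPlane, ℂ)} {F : ℂ × ℂ → ℂ} (hF : IsMellinTransform f F)
    (hc : Continuous F) (hg : HasVerticalPolyGrowth F) (h : 𝓓(posForms, ℂ)) :
    extHall f h = 1 / 8 * ∫ ξ, F (convPlane ξ) * primSum h (convPlane ξ) := by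
  rw [extHall, tsum_mul_left, (hasSum_hallTerm hF hc hg h).tsum_eq]
  have e : ∫ ξ, F (convPlane ξ) * (1 / 4 * primSum h (convPlane ξ)) =
      ∫ ξ, 1 / 4 * (F (convPlane ξ) * primSum h (convPlane ξ)) := by
    congr 1
    funext ξ
    ring
  rw [e, integral_const_mul (μ := volume) (1 / 4 : ℂ)]
  ring

/-! ### Theta functions of binary quadratic forms -/

/-- The value of `q` normalized to determinant one. -/
def Form.normEval (q : Form) (m n : ℝ) : ℝ := q.eval m n / √q.disc

/-- The theta function `∑ exp(-π t q(m, n) / √det q)`. -/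
def gaussSum (q : Form) (t : ℝ) : ℝ :=
  ∑' v : ℤ × ℤ, Real.exp (-Real.pi * t * q.normEval v.1 v.2)

theorem exp_neg_le_rpow {r x : ℝ} (hr : 0 < r) (hx : 0 < x) :
    Real.exp (-x) ≤ r ^ r * x ^ (-r) := by
  have h1 : x / r ≤ Real.exp (x / r) := by linarith [Real.add_one_le_exp (x / r)]
  have h2 : (x / r) ^ r ≤ Real.exp x := by
    calc (x / r) ^ r ≤ Real.exp (x / r) ^ r := Real.rpow_le_rpow (by positivity) h1 hr.le
      _ = Real.exp x := by
        rw [← Real.exp_mul]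
        congr 1
        field_simp
  rw [Real.div_rpow hx.le hr.le, div_le_iff₀ (by positivity)] at h2
  rw [Real.exp_neg, Real.rpow_neg hx.le, ← div_eq_mul_inv, le_div_iff₀ (by positivity),
    inv_mul_le_iff₀ (Real.exp_pos x)]
  linarith

/-- A lower bound for the normalized form on unit vectors. -/
def Form.gap (q : Form) : ℝ := √q.disc / (q.1 + q.2.2)

theorem gap_pos {q : Form} (hq : q ∈ posForms) : 0 < q.gap :=
  div_pos (Real.sqrt_pos.2 hq.2) (trace_pos hq)

theorem gap_mul_le_normEval {q : Form} (hq : q ∈ posForms) (m n : ℝ) :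
    q.gap * (m ^ 2 + n ^ 2) ≤ q.normEval m n := by
  have h := disc_div_mul_le_eval hq m n
  have hs : 0 < √q.disc := Real.sqrt_pos.2 hq.2
  rw [Form.normEval, le_div_iff₀ hs, Form.gap]
  refine le_trans (le_of_eq ?_) h
  have := Real.mul_self_sqrt hq.2.le
  rw [div_mul_eq_mul_div, div_mul_eq_mul_div, div_mul_eq_mul_div]
  congr 1
  linear_combination (m ^ 2 + n ^ 2) * this

theorem normEval_pos {q : Form} (hq : q ∈ posForms) {m n : ℝ} (hv : (m, n) ≠ (0, 0)) :
    0 < q.normEval m n := div_pos (eval_pos_of_ne hq hv) (Real.sqrt_pos.2 hq.2)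

theorem intCast_ne_zero {v : ℤ × ℤ} (hv : v ≠ 0) : ((v.1 : ℝ), (v.2 : ℝ)) ≠ (0, 0) := by
  intro h
  simp only [Prod.mk.injEq, Int.cast_eq_zero] at h
  exact hv (Prod.ext h.1 h.2)

theorem gaussTerm_le {q : Form} (hq : q ∈ posForms) {t r : ℝ} (ht : 0 < t) (hr : 0 < r) {v : ℤ × ℤ}
    (hv : v ≠ 0) : Real.exp (-Real.pi * t * q.normEval v.1 v.2) ≤
      r ^ r * (Real.pi * t * q.gap) ^ (-r) * ((v.1 : ℝ) ^ 2 + (v.2 : ℝ) ^ 2) ^ (-r) := by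
  have hN := sq_add_sq_pos (intCast_ne_zero hv)
  have hg := gap_pos hq
  have hpi := Real.pi_pos
  have h1 := gap_mul_le_normEval hq v.1 v.2
  have h2 : Real.exp (-Real.pi * t * q.normEval v.1 v.2) ≤
      Real.exp (-(Real.pi * t * q.gap * ((v.1 : ℝ) ^ 2 + (v.2 : ℝ) ^ 2))) := by
    rw [Real.exp_le_exp]
    have := mul_le_mul_of_nonneg_left h1 (by positivity : 0 ≤ Real.pi * t)
    linarith
  refine h2.trans ((exp_neg_le_rpow hr (by positivity)).trans (le_of_eq ?_))
  rw [Real.mul_rpow (by positivity) hN.le, ← mul_assoc]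

theorem summable_gaussTerm {q : Form} (hq : q ∈ posForms) {t : ℝ} (ht : 0 < t) :
    Summable fun v : ℤ × ℤ => Real.exp (-Real.pi * t * q.normEval v.1 v.2) := by
  refine Summable.of_norm_bounded_eventually (g := fun v : ℤ × ℤ =>
    (2 : ℝ) ^ (2 : ℝ) * (Real.pi * t * q.gap) ^ (-2 : ℝ) *
      ((v.1 : ℝ) ^ 2 + (v.2 : ℝ) ^ 2) ^ (-2 : ℝ))
    ((summable_sq_add_sq_rpow (by norm_num)).mul_left _) ?_
  refine Filter.Eventually.mono (Filter.eventually_cofinite_ne (0 : ℤ × ℤ)) fun v hv => ?_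
  rw [Real.norm_of_nonneg (Real.exp_pos _).le]
  exact gaussTerm_le hq ht two_pos hv

theorem hasSum_gaussTail {q : Form} (hq : q ∈ posForms) {t : ℝ} (ht : 0 < t) :
    HasSum (fun v : {v : ℤ × ℤ // v ≠ 0} => Real.exp (-Real.pi * t * q.normEval v.1.1 v.1.2))
      (gaussSum q t - 1) := by
  have h := (summable_gaussTerm hq ht).hasSum
  have h0 : (fun v : ℤ × ℤ => Real.exp (-Real.pi * t * q.normEval v.1 v.2)) 0 = 1 := by
    simp [Form.normEval, Form.eval]
  have h1 := hasSum_ite_sub_hasSum h 0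
  rw [show Real.exp (-Real.pi * t * q.normEval ((0 : ℤ × ℤ).1 : ℤ) ((0 : ℤ × ℤ).2 : ℤ)) = 1
    from h0] at h1
  refine (hasSum_subtype_iff_indicator (s := {v : ℤ × ℤ | v ≠ 0})
    (f := fun v : ℤ × ℤ => Real.exp (-Real.pi * t * q.normEval v.1 v.2))).2 ?_
  convert! h1 using 1
  funext v
  by_cases hv : v = 0 <;> simp [hv]

theorem gaussTail_nonneg {q : Form} (hq : q ∈ posForms) {t : ℝ} (ht : 0 < t) :
    0 ≤ gaussSum q t - 1 := (hasSum_gaussTail hq ht).nonneg fun _ => (Real.exp_pos _).le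

/-- The theta function is close to its constant term, uniformly in the form. -/
theorem exists_gaussTail_le {r : ℝ} (hr : 1 < r) : ∃ C, 0 ≤ C ∧ ∀ q ∈ posForms, ∀ t : ℝ, 0 < t →
    gaussSum q t - 1 ≤ C * q.gap ^ (-r) * t ^ (-r) := by
  have hs := (summable_sq_add_sq_rpow hr).subtype {v : ℤ × ℤ | v ≠ 0}
  refine ⟨r ^ r * Real.pi ^ (-r) * ∑' v : {v : ℤ × ℤ | v ≠ 0},
    ((v.1.1 : ℝ) ^ 2 + (v.1.2 : ℝ) ^ 2) ^ (-r), ?_, fun q hq t ht => ?_⟩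
  · have : 0 ≤ ∑' v : {v : ℤ × ℤ | v ≠ 0}, ((v.1.1 : ℝ) ^ 2 + (v.1.2 : ℝ) ^ 2) ^ (-r) :=
      tsum_nonneg fun v => by positivity
    have := Real.pi_pos
    positivity
  · have hg := gap_pos hq
    have hpi := Real.pi_pos
    refine (hasSum_le (fun v => gaussTerm_le hq ht (by linarith : 0 < r) v.2)
      (hasSum_gaussTail hq ht)
      (hs.hasSum.mul_left _)).trans (le_of_eq ?_)
    rw [Real.mul_rpow (by positivity) hg.le, Real.mul_rpow hpi.le ht.le]
    have : ∀ a b c d S : ℝ, a * (b * c * d) * S = a * b * S * d * c := by intros; ring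
    exact this _ _ _ _ _

theorem measurable_gaussSum : Measurable fun p : Form × ℝ => gaussSum p.1 p.2 := by
  refine Measurable.tsum fun v => ?_
  unfold Form.normEval Form.eval Form.disc
  fun_prop

/-- One-dimensional Poisson summation in the real form used below. -/
theorem tsum_exp_quadratic {a : ℝ} (ha : 0 < a) (b : ℂ) :
    ∑' n : ℤ, Complex.exp (-Real.pi * a * n ^ 2 + 2 * Real.pi * b * n) =
      ((√a)⁻¹ : ℝ) * ∑' n : ℤ, Complex.exp (-Real.pi / a * (n + Complex.I * b) ^ 2) := by
  have h := Complex.tsum_exp_neg_quadratic (a := (a : ℂ)) (by simpa using ha) b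
  rw [h]
  congr 1
  rw [Real.sqrt_eq_rpow, Complex.ofReal_inv, Complex.ofReal_cpow ha.le]
  simp

/-- The functional equation of the theta function: Poisson summation in both variables. -/
theorem gaussSum_inv {q : Form} (hq : q ∈ posForms) {t : ℝ} (ht : 0 < t) :
    gaussSum q (1 / t) = t * gaussSum q t := by
  have hs : 0 < √q.disc := Real.sqrt_pos.2 hq.2
  obtain ⟨A, hA⟩ : ∃ A, A = q.1 / √q.disc := ⟨_, rfl⟩
  obtain ⟨B, hB⟩ : ∃ B, B = q.2.1 / √q.disc := ⟨_, rfl⟩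
  obtain ⟨C, hC⟩ : ∃ C, C = q.2.2 / √q.disc := ⟨_, rfl⟩
  have hAp : 0 < A := hA ▸ div_pos hq.1 hs
  have hdet : A * C - B ^ 2 = 1 := by
    have := Real.mul_self_sqrt hq.2.le
    rw [hA, hB, hC]
    field_simp
    rw [Real.sq_sqrt hq.2.le]
    rfl
  have hne : ∀ m n : ℝ, q.normEval m n = A * m ^ 2 + 2 * B * m * n + C * n ^ 2 := by
    intro m n
    rw [hA, hB, hC, Form.normEval, Form.eval]
    field_simp
  have hAc : (A : ℂ) ≠ 0 := Complex.ofReal_ne_zero.2 hAp.ne'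
  have htc : (t : ℂ) ≠ 0 := Complex.ofReal_ne_zero.2 ht.ne'
  have hdetc : (A : ℂ) * C - B ^ 2 = 1 := by exact_mod_cast hdet
  have hCc : (C : ℂ) = (1 + B ^ 2) / A := by
    rw [eq_div_iff hAc]
    linear_combination hdetc
  let T : ℝ → ℤ → ℤ → ℂ := fun t m n => Complex.exp (-Real.pi * t *
    (A * m ^ 2 + 2 * B * m * n + C * n ^ 2))
  have hT : ∀ t, 0 < t → Summable (fun v : ℤ × ℤ => T t v.1 v.2) ∧
      (gaussSum q t : ℂ) = ∑' v : ℤ × ℤ, T t v.1 v.2 := by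
    intro t ht
    have e : (fun v : ℤ × ℤ => T t v.1 v.2) =
        fun v => ((Real.exp (-Real.pi * t * q.normEval v.1 v.2) : ℝ) : ℂ) := by
      funext v
      simp only [T, hne]
      push_cast
      rfl
    rw [e, gaussSum, Complex.ofReal_tsum]
    exact ⟨Complex.summable_ofReal.2 (summable_gaussTerm hq ht), rfl⟩
  -- the intermediate sum, after Poisson summation in the first variable
  let M : ℤ → ℤ → ℂ := fun n m => Complex.exp (-Real.pi * (t / A : ℝ) * n ^ 2 +
    2 * Real.pi * (Complex.I * m * B / A) * n) * Complex.exp (-Real.pi / (t * A : ℝ) * m ^ 2)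
  have h1 : ∀ n : ℤ, ∑' m : ℤ, T t m n = ((√(t * A))⁻¹ : ℝ) * ∑' m : ℤ, M n m := by
    intro n
    have h := tsum_exp_quadratic (mul_pos ht hAp) (-t * B * n)
    have e1 : ∑' m : ℤ, T t m n = Complex.exp (-Real.pi * t * C * n ^ 2) *
        ∑' m : ℤ, Complex.exp (-Real.pi * (t * A : ℝ) * m ^ 2 + 2 * Real.pi * (-t * B * n) * m) :=
          by
      rw [← tsum_mul_left]
      refine tsum_congr fun m => ?_
      simp only [T]
      rw [← Complex.exp_add]
      congr 1
      push_cast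
      ring
    rw [e1, h, mul_left_comm, ← tsum_mul_left]
    congr 1
    refine tsum_congr fun m => ?_
    simp only [M]
    rw [← Complex.exp_add, ← Complex.exp_add]
    congr 1
    rw [hCc, show ((m : ℂ) + Complex.I * (-t * B * n)) ^ 2 =
      m ^ 2 - 2 * Complex.I * t * B * m * n - t ^ 2 * B ^ 2 * n ^ 2 by
        linear_combination (t ^ 2 * B ^ 2 * n ^ 2 : ℂ) * Complex.I_sq]
    push_cast
    field_simp
    ring
  have h2 : ∀ m : ℤ, ∑' n : ℤ, M n m = ((√(t / A))⁻¹ : ℝ) * ∑' n : ℤ, T (1 / t) n (-m) := by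
    intro m
    have h := tsum_exp_quadratic (div_pos ht hAp) (Complex.I * m * B / A)
    simp only [M]
    rw [tsum_mul_right, h, mul_assoc, ← tsum_mul_right]
    congr 1
    refine tsum_congr fun n => ?_
    simp only [T]
    rw [← Complex.exp_add]
    congr 1
    rw [hCc, show Complex.I * (Complex.I * m * B / A) = -(m * B / A) by
      linear_combination (m * B / A : ℂ) * Complex.I_sq]
    push_cast
    field_simp
    ring
  have hM : Summable fun p : ℤ × ℤ => M p.1 p.2 := by
    have hq' : ((t / A, 0, 1 / (t * A)) : Form) ∈ posForms := by
      refine ⟨by positivity, ?_⟩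
      simp only [Form.disc]
      have : 0 < t / A * (1 / (t * A)) := by positivity
      linarith
    have hd' : √(Form.disc (t / A, 0, 1 / (t * A))) = 1 / A := by
      rw [show Form.disc (t / A, 0, 1 / (t * A)) = (1 / A) ^ 2 by
        simp only [Form.disc]; field_simp; ring]
      exact Real.sqrt_sq (by positivity)
    refine Summable.of_norm_bounded (summable_gaussTerm hq' (t := 1 / A) (by positivity))
      fun p => le_of_eq ?_
    simp only [M]
    rw [norm_mul, Complex.norm_exp, Complex.norm_exp, ← Real.exp_add, Form.normEval, hd', Form.eval]
    congr 1
    have r1 : (-(Real.pi : ℂ) * (t / A : ℝ) * p.1 ^ 2 +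
        2 * Real.pi * (Complex.I * p.2 * B / A) * p.1).re = -Real.pi * (t / A) * p.1 ^ 2 := by
      rw [show (-(Real.pi : ℂ) * (t / A : ℝ) * p.1 ^ 2 +
        2 * Real.pi * (Complex.I * p.2 * B / A) * p.1) =
          ((-Real.pi * (t / A) * p.1 ^ 2 : ℝ) : ℂ) +
            ((2 * Real.pi * (p.2 * B / A) * p.1 : ℝ) : ℂ) * Complex.I by push_cast; ring]
      simp only [Complex.add_re, Complex.ofReal_re, Complex.re_ofReal_mul, Complex.I_re, mul_zero,
        add_zero]
    have r2 : (-(Real.pi : ℂ) / (t * A : ℝ) * p.2 ^ 2).re = -Real.pi / (t * A) * p.2 ^ 2 := by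
      rw [show (-(Real.pi : ℂ) / (t * A : ℝ) * p.2 ^ 2) =
        ((-Real.pi / (t * A) * p.2 ^ 2 : ℝ) : ℂ) by push_cast; ring]
      exact Complex.ofReal_re _
    rw [r1, r2]
    field_simp
    ring
  have ht' : 0 < 1 / t := by positivity
  have hc : ((√(t * A))⁻¹ : ℝ) * ((√(t / A))⁻¹ : ℝ) = 1 / t := by
    rw [← mul_inv, ← Real.sqrt_mul (by positivity), show t * A * (t / A) = t ^ 2 by field_simp,
      Real.sqrt_sq ht.le, one_div]
  have e1 : (gaussSum q t : ℂ) = ∑' n : ℤ, ∑' m : ℤ, T t m n := by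
    rw [(hT t ht).2, (hT t ht).1.tsum_prod]
    exact ((hT t ht).1.tsum_comm (f := fun m n => T t m n)).symm
  have e2 : (gaussSum q (1 / t) : ℂ) = ∑' m : ℤ, ∑' n : ℤ, T (1 / t) n (-m) := by
    rw [(hT _ ht').2, (hT _ ht').1.tsum_prod]
    refine ((hT _ ht').1.tsum_comm (f := fun m n => T (1 / t) m n)).symm.trans ?_
    exact ((Equiv.neg ℤ).tsum_eq fun m : ℤ => ∑' n : ℤ, T (1 / t) n m).symm
  have e3 : (gaussSum q t : ℂ) = ((1 / t : ℝ) : ℂ) * gaussSum q (1 / t) := by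
    rw [e1, tsum_congr h1, tsum_mul_left, ← hM.tsum_comm (f := fun n m => M n m), tsum_congr h2,
      tsum_mul_left, ← e2, ← mul_assoc, ← Complex.ofReal_mul, hc]
  have e4 : gaussSum q t = 1 / t * gaussSum q (1 / t) := by exact_mod_cast e3
  rw [e4]
  field_simp

/-! ### The completed Epstein zeta integral -/

/-- The power of the determinant in the kernel that remains after normalizing the form. -/
def discWeight (κ : ℂ) (q : Form) : ℂ := Complex.exp ((κ / 4 - 3 / 2) * Real.log q.disc)

/-- The theta function integrated against a test function on the space of forms. -/
def thetaInt (h : Form → ℂ) (κ : ℂ) (t : ℝ) : ℂ := ∫ q, h q * discWeight κ q * gaussSum q t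

/-- The constant term of `thetaInt`. -/
def massInt (h : Form → ℂ) (κ : ℂ) : ℂ := ∫ q, h q * discWeight κ q

theorem continuousOn_discWeight (κ : ℂ) : ContinuousOn (discWeight κ) posForms :=
  Complex.continuous_exp.comp_continuousOn (continuousOn_const.mul
    (Complex.continuous_ofReal.comp_continuousOn
      (contDiff_disc.continuous.continuousOn.log fun _ hq => ne_of_gt hq.2)))

theorem measurable_discWeight (κ : ℂ) : Measurable (discWeight κ) := by
  unfold discWeight Form.disc
  fun_prop

theorem continuousOn_gap_rpow (r : ℝ) : ContinuousOn (fun q : Form => q.gap ^ r) posForms := by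
  unfold Form.gap
  refine ContinuousOn.rpow_const (ContinuousOn.div
    (Real.continuous_sqrt.comp contDiff_disc.continuous).continuousOn (by fun_prop)
    fun q hq => (trace_pos hq).ne') fun q hq => Or.inl (gap_pos hq).ne'

section

variable {h : Form → ℂ} (hh : IsTest h) (κ : ℂ)
include hh

theorem IsTest.eq_zero {q : Form} (hq : q ∉ posForms) : h q = 0 :=
  image_eq_zero_of_notMem_tsupport fun hx => hq (hh.tsupport_subset hx)

theorem integrable_weight : Integrable fun q => h q * discWeight κ q :=
  hh.integrable_mul (continuousOn_discWeight κ)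

theorem integrable_weight_gap (r : ℝ) : Integrable fun q => ‖h q * discWeight κ q‖ * q.gap ^ r := by
  have := (hh.integrable_mul ((continuousOn_discWeight κ).mul
    (Complex.continuous_ofReal.comp_continuousOn (continuousOn_gap_rpow r)))).norm
  refine this.congr (Filter.Eventually.of_forall fun q => ?_)
  by_cases hq : q ∈ posForms
  · have := gap_pos hq
    simp only [Pi.mul_apply, Function.comp_apply, norm_mul, Complex.norm_real]
    rw [Real.norm_of_nonneg (by positivity), mul_assoc]
  · simp [hh.eq_zero hq]

theorem exists_norm_weight_tail_le {r : ℝ} (hr : 1 < r) : ∃ C, 0 ≤ C ∧ ∀ (q : Form) (t : ℝ), 0 < t →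
    ‖h q * discWeight κ q * ((gaussSum q t - 1 : ℝ) : ℂ)‖ ≤
      C * (‖h q * discWeight κ q‖ * q.gap ^ (-r)) * t ^ (-r) := by
  obtain ⟨C, hC, H⟩ := exists_gaussTail_le hr
  refine ⟨C, hC, fun q t ht => ?_⟩
  by_cases hq : q ∈ posForms
  · rw [norm_mul, Complex.norm_real, Real.norm_of_nonneg (gaussTail_nonneg hq ht)]
    refine (mul_le_mul_of_nonneg_left (H q hq t ht) (norm_nonneg _)).trans (le_of_eq ?_)
    ring
  · simp [hh.eq_zero hq]

theorem measurable_weight : Measurable fun q => h q * discWeight κ q :=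
  hh.contDiff.continuous.measurable.mul (measurable_discWeight κ)

theorem integrable_weight_tail {t : ℝ} (ht : 0 < t) :
    Integrable fun q => h q * discWeight κ q * ((gaussSum q t - 1 : ℝ) : ℂ) := by
  obtain ⟨C, -, H⟩ := exists_norm_weight_tail_le hh κ one_lt_two
  refine (((integrable_weight_gap hh κ (-2)).const_mul C).mul_const _).mono' ?_
    (Filter.Eventually.of_forall fun q => H q t ht)
  refine ((measurable_weight hh κ).mul (Complex.measurable_ofReal.comp ?_)).aestronglyMeasurable
  exact (measurable_gaussSum.comp (measurable_id.prodMk measurable_const)).sub_const 1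

theorem thetaInt_sub_mass {t : ℝ} (ht : 0 < t) : thetaInt h κ t - massInt h κ =
    ∫ q, h q * discWeight κ q * ((gaussSum q t - 1 : ℝ) : ℂ) := by
  rw [sub_eq_iff_eq_add, massInt, ← integral_add (integrable_weight_tail hh κ ht)
    (integrable_weight hh κ), thetaInt]
  congr 1
  funext q
  push_cast
  ring

theorem exists_norm_thetaInt_sub_le {r : ℝ} (hr : 1 < r) : ∃ C, 0 ≤ C ∧ ∀ t : ℝ, 0 < t →
    ‖thetaInt h κ t - massInt h κ‖ ≤ C * t ^ (-r) := by
  obtain ⟨C, hC, H⟩ := exists_norm_weight_tail_le hh κ hr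
  have hi := (integrable_weight_gap hh κ (-r)).const_mul C
  refine ⟨|∫ q, C * (‖h q * discWeight κ q‖ * q.gap ^ (-r))|, abs_nonneg _, fun t ht => ?_⟩
  rw [thetaInt_sub_mass hh κ ht]
  refine (norm_integral_le_of_norm_le (hi.mul_const _) (Filter.Eventually.of_forall fun q =>
    H q t ht)).trans ?_
  rw [integral_mul_const]
  exact mul_le_mul_of_nonneg_right (le_abs_self _) (by positivity)

/-- The functional equation of the theta function survives the integration, since it does not
involve the form. -/
theorem thetaInt_inv {t : ℝ} (ht : 0 < t) : thetaInt h κ (1 / t) = t * thetaInt h κ t := by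
  rw [thetaInt, thetaInt, ← integral_const_mul]
  congr 1
  funext q
  by_cases hq : q ∈ posForms
  · rw [gaussSum_inv hq ht]
    push_cast
    ring
  · simp [hh.eq_zero hq]

theorem measurable_joint : Measurable fun p : ℝ × Form =>
    h p.2 * discWeight κ p.2 * ((gaussSum p.2 p.1 - 1 : ℝ) : ℂ) :=
  ((measurable_weight hh κ).comp measurable_snd).mul (Complex.measurable_ofReal.comp
    ((measurable_gaussSum.comp (measurable_snd.prodMk measurable_fst)).sub_const 1))

theorem locallyIntegrableOn_thetaInt : LocallyIntegrableOn (thetaInt h κ) (Ioi 0) := by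
  rw [locallyIntegrableOn_iff isLocallyClosed_Ioi]
  intro k hk hkc
  obtain ⟨C, hC, H⟩ := exists_norm_thetaInt_sub_le hh κ one_lt_two
  have hm : StronglyMeasurable (thetaInt h κ) := by
    have h1 : Measurable fun p : ℝ × Form => h p.2 * discWeight κ p.2 * (gaussSum p.2 p.1 : ℂ) :=
      ((measurable_weight hh κ).comp measurable_snd).mul (Complex.measurable_ofReal.comp
        (measurable_gaussSum.comp (measurable_snd.prodMk measurable_fst)))
    exact h1.stronglyMeasurable.integral_prod_right
  have hcont : ContinuousOn (fun t : ℝ => ‖massInt h κ‖ + C * t ^ (-2 : ℝ)) k :=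
    continuousOn_const.add (continuousOn_const.mul
      (continuousOn_id.rpow_const fun t ht => Or.inl (ne_of_gt (hk ht))))
  refine (hcont.integrableOn_compact hkc).mono' hm.aestronglyMeasurable ?_
  refine (ae_restrict_iff' hkc.measurableSet).2 (Filter.Eventually.of_forall fun t ht => ?_)
  have := H t (hk ht)
  calc ‖thetaInt h κ t‖ = ‖massInt h κ + (thetaInt h κ t - massInt h κ)‖ := by congr 1; ring
    _ ≤ ‖massInt h κ‖ + ‖thetaInt h κ t - massInt h κ‖ := norm_add_le _ _
    _ ≤ _ := by gcongr

theorem isBigO_thetaInt (r : ℝ) :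
    (fun t => thetaInt h κ t - massInt h κ) =O[Filter.atTop] fun t : ℝ => t ^ r := by
  obtain ⟨C, hC, H⟩ := exists_norm_thetaInt_sub_le hh κ (r := max 2 (-r)) (by simp)
  refine Asymptotics.IsBigO.of_bound C ?_
  filter_upwards [Filter.eventually_ge_atTop 1] with t ht
  refine (H t (by linarith)).trans (mul_le_mul_of_nonneg_left ?_ hC)
  rw [Real.norm_of_nonneg (by positivity)]
  exact Real.rpow_le_rpow_of_exponent_le ht (by linarith [le_max_right 2 (-r)])

/-- The theta integral satisfies the hypotheses for a functional equation. -/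
def thetaPair : WeakFEPair ℂ where
  f := thetaInt h κ
  g := thetaInt h κ
  k := 1
  ε := 1
  f₀ := massInt h κ
  g₀ := massInt h κ
  hf_int := locallyIntegrableOn_thetaInt hh κ
  hg_int := locallyIntegrableOn_thetaInt hh κ
  hk := one_pos
  hε := one_ne_zero
  h_feq := fun t ht => by simpa using thetaInt_inv hh κ ht
  hf_top := isBigO_thetaInt hh κ
  hg_top := isBigO_thetaInt hh κ

end

theorem hasSum_mellin_gaussTail {q : Form} (hq : q ∈ posForms) {w : ℂ} (hw : 1 < w.re) :
    HasSum (fun v : {v : ℤ × ℤ // v ≠ 0} => Complex.Gamma w * 1 /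
      ((Real.pi * q.normEval v.1.1 v.1.2 : ℝ) : ℂ) ^ w)
      (mellin (fun t => ((gaussSum q t - 1 : ℝ) : ℂ)) w) := by
  have hg := gap_pos hq
  have hpi := Real.pi_pos
  refine hasSum_mellin (a := fun _ => 1) (fun v => Or.inr (mul_pos hpi (normEval_pos hq
    (intCast_ne_zero v.2)))) (by linarith) (fun t ht => ?_) ?_
  · have := Complex.hasSum_ofReal.2 (hasSum_gaussTail hq ht)
    convert! this using 1
    funext v
    rw [one_mul]
    congr 2
    ring
  · refine Summable.of_nonneg_of_le (fun v => ?_) (fun v => ?_)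
      (((summable_sq_add_sq_rpow hw).subtype {v : ℤ × ℤ | v ≠ 0}).mul_left
        ((Real.pi * q.gap) ^ (-w.re)))
    · have := normEval_pos hq (intCast_ne_zero v.2)
      positivity
    · have h1 := gap_mul_le_normEval hq v.1.1 v.1.2
      have h2 := normEval_pos hq (intCast_ne_zero v.2)
      have h3 := sq_add_sq_pos (intCast_ne_zero v.2)
      simp only [norm_one, Function.comp_apply]
      rw [one_div, ← Real.rpow_neg (by positivity), ← Real.mul_rpow (by positivity) h3.le]
      refine Real.rpow_le_rpow_of_nonpos (by positivity) ?_ (by linarith)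
      rw [mul_assoc]
      exact mul_le_mul_of_nonneg_left h1 hpi.le

theorem discWeight_mul_cpow {q : Form} (hq : q ∈ posForms) (s : ℂ × ℂ) {m n : ℝ}
    (hv : (m, n) ≠ (0, 0)) : discWeight (s.1 + s.2) q *
      (Complex.Gamma (expVal s) * 1 / ((Real.pi * q.normEval m n : ℝ) : ℂ) ^ expVal s) =
      (Real.pi : ℂ) ^ (-expVal s) * Complex.Gamma (expVal s) * zetaKernel m n s q := by
  have hQ := eval_pos_of_ne hq hv
  have hD := hq.2
  have hN := normEval_pos hq hv
  rw [Complex.ofReal_mul, Complex.mul_cpow_ofReal_nonneg Real.pi_pos.le hN.le, mul_one,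
    Complex.cpow_neg]
  have hpi : (Real.pi : ℂ) ^ expVal s ≠ 0 := by
    rw [Ne, Complex.cpow_eq_zero_iff]
    simp [Real.pi_ne_zero]
  have e : discWeight (s.1 + s.2) q = zetaKernel m n s q * (q.normEval m n : ℂ) ^ expVal s := by
    rw [Complex.cpow_def_of_ne_zero (Complex.ofReal_ne_zero.2 hN.ne'), discWeight, zetaKernel,
      ← Complex.exp_add, ← Complex.ofReal_log hN.le, Form.normEval,
      Real.log_div hQ.ne' (Real.sqrt_pos.2 hD).ne', Real.log_sqrt hD.le]
    congr 1
    push_cast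
    simp only [expDisc, expVal]
    ring
  have hNe : (q.normEval m n : ℂ) ^ expVal s ≠ 0 := by
    rw [Ne, Complex.cpow_eq_zero_iff]
    simp [hN.ne']
  rw [e]
  field_simp

/-- In the domain of absolute convergence the completed zeta integral is a sum over the lattice. -/
theorem thetaPair_Λ {h : Form → ℂ} (hh : IsTest h) (s : ℂ × ℂ) (hs : 1 < (expVal s).re) :
    (thetaPair hh (s.1 + s.2)).Λ (expVal s) = (Real.pi : ℂ) ^ (-expVal s) *
      Complex.Gamma (expVal s) * ∑' v : {v : ℤ × ℤ // v ≠ 0}, formInt v.1.1 v.1.2 h s := by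
  set κ := s.1 + s.2 with hκ
  set w := expVal s with hw
  have e1 := ((thetaPair hh κ).hasMellin (s := w) hs).2
  rw [← e1]
  set b := w.re
  obtain ⟨r, hr1, hrb⟩ := exists_between hs
  obtain ⟨C₁, hC₁, H₁⟩ := exists_norm_weight_tail_le hh κ hr1
  obtain ⟨C₂, hC₂, H₂⟩ := exists_norm_weight_tail_le hh κ (r := b + 1) (by linarith)
  have hint : Integrable (Function.uncurry fun (t : ℝ) (q : Form) => (t : ℂ) ^ (w - 1) *
      (h q * discWeight κ q * ((gaussSum q t - 1 : ℝ) : ℂ)))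
      ((volume.restrict (Ioi 0)).prod volume) := by
    let G : ℝ → ℝ := fun t => (Ioc (0 : ℝ) 1).indicator (fun t => t ^ (b - 1 - r)) t +
      (Ioi (1 : ℝ)).indicator (fun t => t ^ (-2 : ℝ)) t
    let K : Form → ℝ := fun q => C₁ * (‖h q * discWeight κ q‖ * q.gap ^ (-r)) +
      C₂ * (‖h q * discWeight κ q‖ * q.gap ^ (-(b + 1)))
    have hG : Integrable G (volume.restrict (Ioi 0)) := by
      refine Integrable.integrableOn (Integrable.add ?_ ?_)
      · refine (integrable_indicator_iff measurableSet_Ioc).2 ?_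
        rw [← intervalIntegrable_iff_integrableOn_Ioc_of_le zero_le_one]
        exact intervalIntegral.intervalIntegrable_rpow' (by linarith)
      · exact (integrable_indicator_iff measurableSet_Ioi).2
          (integrableOn_Ioi_rpow_of_lt (by norm_num) one_pos)
    have hK : Integrable K := ((integrable_weight_gap hh κ (-r)).const_mul C₁).add
      ((integrable_weight_gap hh κ (-(b + 1))).const_mul C₂)
    refine (hG.mul_prod hK).mono' ?_ ?_
    · have h1 : Measurable fun p : ℝ × Form => (p.1 : ℂ) ^ (w - 1) := by fun_prop
      exact (h1.mul (measurable_joint hh κ)).aestronglyMeasurable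
    · rw [← Measure.restrict_univ (μ := (volume : Measure Form)), Measure.prod_restrict]
      refine (ae_restrict_iff' (measurableSet_Ioi.prod MeasurableSet.univ)).2
        (Filter.Eventually.of_forall ?_)
      rintro ⟨t, q⟩ ⟨ht, -⟩
      have ht : 0 < t := ht
      have hX : ∀ r : ℝ, 0 ≤ ‖h q * discWeight κ q‖ * q.gap ^ (-r) := fun r => by
        by_cases hq : q ∈ posForms
        · have := gap_pos hq
          positivity
        · simp [hh.eq_zero hq]
      have hA := mul_nonneg hC₁ (hX r)
      have hB := mul_nonneg hC₂ (hX (b + 1))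
      simp only [Function.uncurry_apply_pair]
      rw [norm_mul, Complex.norm_cpow_eq_rpow_re_of_pos ht]
      have e : (w - 1).re = b - 1 := by simp [b]
      rw [e]
      rcases le_or_gt t 1 with h1 | h1
      · have hGt : G t = t ^ (b - 1) * t ^ (-r) := by
          have : t ∉ Ioi (1 : ℝ) := not_lt.2 h1
          have hmem : t ∈ Ioc (0 : ℝ) 1 := ⟨ht, h1⟩
          simp only [G]
          rw [indicator_of_mem hmem, indicator_of_notMem this, add_zero,
            ← Real.rpow_add ht, ← sub_eq_add_neg]
        rw [hGt, mul_assoc (t ^ (b - 1)) (t ^ (-r)) (K q)]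
        refine mul_le_mul_of_nonneg_left ((H₁ q t ht).trans ?_) (Real.rpow_nonneg ht.le _)
        rw [mul_comm]
        exact mul_le_mul_of_nonneg_left (le_add_of_nonneg_right hB) (Real.rpow_nonneg ht.le _)
      · have hGt : G t = t ^ (b - 1) * t ^ (-(b + 1)) := by
          have : t ∉ Ioc (0 : ℝ) 1 := fun h => h1.not_ge h.2
          simp only [G]
          rw [indicator_of_mem (show t ∈ Ioi (1 : ℝ) from h1), indicator_of_notMem this, zero_add,
            ← Real.rpow_add ht]
          congr 1
          ring
        rw [hGt, mul_assoc (t ^ (b - 1)) (t ^ (-(b + 1))) (K q)]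
        refine mul_le_mul_of_nonneg_left ((H₂ q t ht).trans ?_) (Real.rpow_nonneg ht.le _)
        rw [mul_comm]
        exact mul_le_mul_of_nonneg_left (le_add_of_nonneg_left hA) (Real.rpow_nonneg ht.le _)
  calc mellin (fun t => thetaInt h κ t - massInt h κ) w
      = ∫ t in Ioi (0 : ℝ), ∫ q, (t : ℂ) ^ (w - 1) *
          (h q * discWeight κ q * ((gaussSum q t - 1 : ℝ) : ℂ)) := by
        refine setIntegral_congr_fun measurableSet_Ioi fun t ht => ?_
        simp only
        rw [thetaInt_sub_mass hh κ ht, smul_eq_mul, integral_const_mul]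
    _ = ∫ q, ∫ t in Ioi (0 : ℝ), (t : ℂ) ^ (w - 1) *
          (h q * discWeight κ q * ((gaussSum q t - 1 : ℝ) : ℂ)) :=
        integral_integral_swap hint
    _ = ∫ q, ∑' v : {v : ℤ × ℤ // v ≠ 0}, (Real.pi : ℂ) ^ (-w) * Complex.Gamma w *
          (h q * zetaKernel v.1.1 v.1.2 s q) := by
        congr 1
        funext q
        by_cases hq : q ∈ posForms
        · have h1 := (hasSum_mellin_gaussTail hq hs).mul_left (h q * discWeight κ q)
          have h2 : ∫ t in Ioi (0 : ℝ), (t : ℂ) ^ (w - 1) *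
              (h q * discWeight κ q * ((gaussSum q t - 1 : ℝ) : ℂ)) =
              h q * discWeight κ q * mellin (fun t => ((gaussSum q t - 1 : ℝ) : ℂ)) w := by
            rw [mellin, ← integral_const_mul]
            congr 1
            funext t
            rw [smul_eq_mul]
            ring
          rw [h2, ← h1.tsum_eq]
          refine tsum_congr fun v => ?_
          rw [mul_assoc, discWeight_mul_cpow hq s (intCast_ne_zero v.2)]
          ring
        · simp [hh.eq_zero hq]
    _ = ∑' v : {v : ℤ × ℤ // v ≠ 0}, ∫ q, (Real.pi : ℂ) ^ (-w) * Complex.Gamma w *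
          (h q * zetaKernel v.1.1 v.1.2 s q) := by
        obtain ⟨C, hC, H⟩ := exists_integral_norm_le hh (expDisc s).re (b := b) (by linarith)
        refine (integral_tsum_of_summable_integral_norm (fun v => (hh.integrable_mul
          (contDiffOn_zetaKernel (intCast_ne_zero v.2) s).continuousOn).const_mul _) ?_).symm
        refine Summable.of_nonneg_of_le (fun v => integral_nonneg fun q => norm_nonneg _)
          (fun v => ?_) (((summable_sq_add_sq_rpow hs).subtype {v : ℤ × ℤ | v ≠ 0}).mul_left
          (‖(Real.pi : ℂ) ^ (-w) * Complex.Gamma w‖ * C))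
        simp only [norm_mul _ (h _ * _), integral_const_mul]
        rw [mul_assoc]
        exact mul_le_mul_of_nonneg_left (H s rfl rfl _ _ (intCast_ne_zero v.2)) (norm_nonneg _)
    _ = _ := by
        simp only [integral_const_mul]
        rw [tsum_mul_left]
        rfl

/-! ### Continuation of the sum over primitive vectors -/

/-- The entire part of a completed `L`-function is bounded on vertical strips. -/
theorem exists_norm_mellin_le (P : WeakFEPair ℂ) (a b : ℝ) :
    ∃ C, ∀ s : ℂ, a ≤ s.re → s.re ≤ b → ‖P.Λ₀ s‖ ≤ C := by
  have hS := P.isStrongFEPair_toStrongFEPair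
  have hc : ∀ σ : ℝ, IntegrableOn (fun t : ℝ => t ^ (σ - 1) * ‖P.f_modif t‖) (Ioi 0) := fun σ => by
    have := mellinConvergent_of_isBigO_rpow (s := (σ : ℂ)) P.toStrongFEPair.hf_int
      (hS.hf_top (-(σ + 1))) (by simp) (hS.hf_zero (-(σ - 1))) (by simp)
    refine IntegrableOn.congr_fun this.norm (fun t ht => ?_) measurableSet_Ioi
    have ht : 0 < t := ht
    simp only [norm_smul, Complex.norm_cpow_eq_rpow_re_of_pos ht]
    simp [WeakFEPair.toStrongFEPair]
  refine ⟨∫ t in Ioi (0 : ℝ), (t ^ (a - 1) * ‖P.f_modif t‖ + t ^ (b - 1) * ‖P.f_modif t‖),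
    fun s h1 h2 => ?_⟩
  rw [WeakFEPair.Λ₀, mellin]
  refine norm_integral_le_of_norm_le ((hc a).add (hc b)) ?_
  refine (ae_restrict_iff' measurableSet_Ioi).2 (Filter.Eventually.of_forall fun t ht => ?_)
  have ht : 0 < t := ht
  rw [norm_smul, Complex.norm_cpow_eq_rpow_re_of_pos ht, ← add_mul]
  refine mul_le_mul_of_nonneg_right ?_ (norm_nonneg _)
  have e : (s - 1).re = s.re - 1 := by simp
  have ha := Real.rpow_nonneg ht.le (a - 1)
  have hb := Real.rpow_nonneg ht.le (b - 1)
  rw [e]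
  rcases le_total 1 t with h | h
  · have := Real.rpow_le_rpow_of_exponent_le h (show s.re - 1 ≤ b - 1 by linarith)
    linarith
  · have := Real.rpow_le_rpow_of_exponent_ge ht h (show a - 1 ≤ s.re - 1 by linarith)
    linarith

theorem formInt_smul {h : Form → ℂ} (hh : IsTest h) {d : ℝ} (hd : 0 < d) {m n : ℝ}
    (hv : (m, n) ≠ (0, 0)) (s : ℂ × ℂ) : formInt (d * m) (d * n) h s =
      ((d : ℂ) ^ (2 * expVal s))⁻¹ * formInt m n h s := by
  rw [formInt, formInt, ← integral_const_mul]
  congr 1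
  funext q
  by_cases hq : q ∈ posForms
  · have hQ := eval_pos_of_ne hq hv
    have e : q.eval (d * m) (d * n) = d ^ 2 * q.eval m n := by
      unfold Form.eval
      ring
    rw [zetaKernel, zetaKernel, e, Real.log_mul (by positivity) hQ.ne', Real.log_pow,
      Complex.cpow_def_of_ne_zero (Complex.ofReal_ne_zero.2 hd.ne'), ← Complex.ofReal_log hd.le,
      ← Complex.exp_neg, mul_left_comm, ← Complex.exp_add]
    congr 2
    push_cast
    ring
  · simp [hh.eq_zero hq]

/-- Every nonzero vector of `ℤ²` is uniquely a positive multiple of a primitive vector. -/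
def latticeMap (p : ℕ+ × PrimVec) : {v : ℤ × ℤ // v ≠ 0} :=
  ⟨((p.1 : ℤ) * p.2.1.1, (p.1 : ℤ) * p.2.1.2), fun h => by
    have hd : (p.1 : ℤ) ≠ 0 := by exact_mod_cast p.1.ne_zero
    simp only [Prod.mk_eq_zero, mul_eq_zero, hd, false_or] at h
    have hc : IsCoprime p.2.1.1 p.2.1.2 := p.2.2
    rw [h.1, h.2] at hc
    exact not_isCoprime_zero_zero hc⟩

theorem bijective_latticeMap : Function.Bijective latticeMap := by
  constructor
  · rintro ⟨d, ⟨⟨m, n⟩, hv⟩⟩ ⟨d', ⟨⟨m', n'⟩, hv'⟩⟩ h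
    simp only [latticeMap, Subtype.mk.injEq, Prod.mk.injEq] at h
    have g : ∀ (d : ℕ+) (m n : ℤ), IsCoprime m n → Int.gcd (d * m) (d * n) = d := by
      intro d m n hv
      rw [Int.gcd_mul_left, Int.isCoprime_iff_gcd_eq_one.1 hv]
      simp
    have e := g d m n hv
    rw [h.1, h.2, g d' m' n' hv'] at e
    have e : d' = d := PNat.coe_inj.1 e
    subst e
    have hd : (d' : ℤ) ≠ 0 := by exact_mod_cast d'.ne_zero
    have h1 := mul_left_cancel₀ hd h.1
    have h2 := mul_left_cancel₀ hd h.2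
    subst h1 h2
    rfl
  · rintro ⟨⟨m, n⟩, hv⟩
    have hg : 0 < Int.gcd m n := by
      rw [Int.gcd_pos_iff]
      by_contra! hc
      exact hv (Prod.ext hc.1 hc.2)
    obtain ⟨m', n', h1, h2, h3⟩ := Int.exists_gcd_one hg
    refine ⟨(⟨Int.gcd m n, hg⟩, ⟨(m', n'), Int.isCoprime_iff_gcd_eq_one.2 h1⟩), ?_⟩
    simp only [latticeMap, PNat.mk_coe, Subtype.mk.injEq, Prod.mk.injEq]
    constructor
    · rw [mul_comm, ← h2]
    · rw [mul_comm, ← h3]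

theorem summable_formInt {h : Form → ℂ} (hh : IsTest h) (s : ℂ × ℂ) (hs : 1 < (expVal s).re) :
    Summable fun v : PrimVec => ‖formInt v.1.1 v.1.2 h s‖ := by
  obtain ⟨C, hC, H⟩ := exists_norm_formInt_le hh (expDisc s).re (b := (expVal s).re) (by linarith)
  exact Summable.of_nonneg_of_le (fun v => norm_nonneg _) (fun v => H s rfl rfl _ _ v.ne_zero)
    ((summable_primVec hs).mul_left C)

/-- Grouping nonzero vectors by their content produces a zeta factor. -/
theorem tsum_lattice {h : Form → ℂ} (hh : IsTest h) (s : ℂ × ℂ) (hs : 1 < (expVal s).re) :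
    ∑' v : {v : ℤ × ℤ // v ≠ 0}, formInt v.1.1 v.1.2 h s =
      riemannZeta (2 * expVal s) * primSum h s := by
  have hs2 : 1 < (2 * expVal s).re := by
    have : (2 * expVal s).re = 2 * (expVal s).re := by simp
    linarith
  have hz : Summable fun n : ℕ => 1 / (n : ℂ) ^ (2 * expVal s) :=
    Complex.summable_one_div_nat_cpow.2 hs2
  have hz' : Summable fun d : ℕ+ => ‖((d : ℂ) ^ (2 * expVal s))⁻¹‖ := by
    have := hz.norm.comp_injective PNat.coe_injective
    simpa [Function.comp_def] using this
  have e1 : riemannZeta (2 * expVal s) = ∑' d : ℕ+, ((d : ℂ) ^ (2 * expVal s))⁻¹ := by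
    rw [zeta_eq_tsum_one_div_nat_cpow hs2, ← tsum_zero_pnat_eq_tsum_nat hz]
    have h0 : 2 * expVal s ≠ 0 := fun h => by
      rw [h] at hs2
      norm_num at hs2
    simp [Complex.zero_cpow h0]
  rw [e1, primSum, tsum_mul_tsum_of_summable_norm hz' (summable_formInt hh s hs),
    ← (Equiv.ofBijective _ bijective_latticeMap).tsum_eq]
  refine tsum_congr fun p => ?_
  have := formInt_smul hh (d := p.1) (by exact_mod_cast p.1.pos) p.2.ne_zero s
  simpa [latticeMap] using this

theorem ne_of_re_ne {z w : ℂ} (h : z.re ≠ w.re) : z ≠ w := fun e => h (congrArg Complex.re e)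

theorem completedRiemannZeta_one_sub_eq {z : ℂ} (hz : z.re < 1) : completedRiemannZeta (1 - z) =
    (Real.pi : ℂ) ^ (-((1 - z) / 2)) * Complex.Gamma ((1 - z) / 2) * riemannZeta (1 - z) := by
  have hz1 : 1 - z ≠ 0 := sub_ne_zero.2 (ne_of_re_ne (by simp; linarith))
  rw [riemannZeta_def_of_ne_zero hz1, Complex.Gammaℝ, neg_div, mul_div_cancel₀]
  refine mul_ne_zero ?_ (Complex.Gamma_ne_zero_of_re_pos ?_)
  · rw [Ne, Complex.cpow_eq_zero_iff]
    simp [Real.pi_ne_zero]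
  · have e : ((1 - z) / 2).re = (1 - z.re) / 2 := by simp
    rw [e]
    linarith

/-- The point with `s₁ + s₂ = κ` and `s₁ - s₂ = z`. -/
def spec (κ z : ℂ) : ℂ × ℂ := ((κ + z) / 2, (κ - z) / 2)

theorem spec_add (κ z : ℂ) : (spec κ z).1 + (spec κ z).2 = κ := by
  simp only [spec]
  ring

theorem spec_sub (κ z : ℂ) : (spec κ z).1 - (spec κ z).2 = z := by
  simp only [spec]
  ring

theorem expVal_spec (κ z : ℂ) : expVal (spec κ z) = (1 - z) / 2 := by
  rw [expVal, spec_sub]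

theorem differentiable_spec (κ : ℂ) : Differentiable ℂ (spec κ) := by
  unfold spec
  fun_prop

section

variable {h : Form → ℂ} (hh : IsTest h) (κ : ℂ)

/-- The completed zeta integral multiplied by `1 - z²`, an entire even function of `z`. -/
def eisEntire (z : ℂ) : ℂ := (1 - z ^ 2) * (thetaPair hh κ).Λ₀ ((1 - z) / 2) - 4 * massInt h κ

theorem differentiable_eisEntire : Differentiable ℂ (eisEntire hh κ) := by
  have h1 : Differentiable ℂ fun z : ℂ => (thetaPair hh κ).Λ₀ ((1 - z) / 2) :=
    (thetaPair hh κ).differentiable_Λ₀.comp (by fun_prop)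
  unfold eisEntire
  exact (((differentiable_const _).sub (differentiable_pow 2)).mul h1).sub_const _

theorem eisEntire_neg (z : ℂ) : eisEntire hh κ (-z) = eisEntire hh κ z := by
  have := (thetaPair hh κ).functional_equation₀ ((1 - z) / 2)
  have e : (((thetaPair hh κ).k : ℂ) - (1 - z) / 2) = (1 - -z) / 2 := by
    simp only [thetaPair, Complex.ofReal_one]
    ring
  have e2 : (thetaPair hh κ).ε • (thetaPair hh κ).symm.Λ₀ ((1 - z) / 2) =
      (thetaPair hh κ).Λ₀ ((1 - z) / 2) := by
    have : (thetaPair hh κ).symm = thetaPair hh κ := by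
      simp [WeakFEPair.symm, thetaPair]
    rw [this]
    simp [thetaPair]
  rw [e, e2] at this
  rw [eisEntire, eisEntire, this, neg_sq]

theorem exists_norm_eisEntire_le (R : ℝ) :
    ∃ C, ∀ z : ℂ, |z.re| ≤ R → ‖eisEntire hh κ z‖ ≤ C * (1 + ‖z‖) ^ 2 := by
  obtain ⟨C, H⟩ := exists_norm_mellin_le (thetaPair hh κ) ((1 - R) / 2) ((1 + R) / 2)
  refine ⟨|C| + 4 * ‖massInt h κ‖, fun z hz => ?_⟩
  obtain ⟨h1, h2⟩ := abs_le.1 hz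
  have e : ((1 - z) / 2).re = (1 - z.re) / 2 := by simp
  have hb := (H ((1 - z) / 2) (by rw [e]; linarith) (by rw [e]; linarith)).trans (le_abs_self C)
  have hn := norm_nonneg z
  have hm := norm_nonneg (massInt h κ)
  have e1 : ‖1 - z ^ 2‖ ≤ (1 + ‖z‖) ^ 2 := by
    refine (norm_sub_le _ _).trans ?_
    rw [norm_one, norm_pow]
    nlinarith
  have e2 : (1 : ℝ) ≤ (1 + ‖z‖) ^ 2 := by nlinarith
  calc ‖eisEntire hh κ z‖ ≤ ‖1 - z ^ 2‖ * ‖(thetaPair hh κ).Λ₀ ((1 - z) / 2)‖ +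
        4 * ‖massInt h κ‖ := by
        refine (norm_sub_le _ _).trans (le_of_eq ?_)
        rw [norm_mul, norm_mul]
        norm_num
    _ ≤ (1 + ‖z‖) ^ 2 * |C| + 4 * ‖massInt h κ‖ * (1 + ‖z‖) ^ 2 := by
        refine add_le_add ?_ (le_mul_of_one_le_right (by positivity) e2)
        exact mul_le_mul e1 hb (norm_nonneg _) (by positivity)
    _ = _ := by ring

/-- In the domain of absolute convergence `eisEntire` is the sum over primitive vectors times a
completed zeta factor, which gives the meromorphic continuation of that sum. -/
theorem eisEntire_eq {z : ℂ} (hz : z.re < -1) : eisEntire hh κ z =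
    (1 - z ^ 2) * completedRiemannZeta (1 - z) * primSum h (spec κ z) := by
  have hw : 1 < (expVal (spec κ z)).re := by
    rw [expVal_spec]
    have e : ((1 - z) / 2).re = (1 - z.re) / 2 := by simp
    rw [e]
    linarith
  have h1 := thetaPair_Λ hh (spec κ z) hw
  rw [tsum_lattice hh _ hw, spec_add, expVal_spec] at h1
  have hz1 : 1 - z ≠ 0 := sub_ne_zero.2 (ne_of_re_ne (by simp; linarith))
  have hz2 : 1 + z ≠ 0 := fun hc => by
    have := congrArg Complex.re hc
    simp at this
    linarith
  rw [mul_div_cancel₀ _ (two_ne_zero' ℂ)] at h1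
  rw [completedRiemannZeta_one_sub_eq (by linarith)]
  have e3 : (1 - z ^ 2) * (thetaPair hh κ).Λ ((1 - z) / 2) = eisEntire hh κ z := by
    rw [eisEntire, WeakFEPair.Λ]
    simp only [thetaPair, smul_eq_mul, Complex.ofReal_one]
    have e4 : 1 - (1 - z) / 2 = (1 + z) / 2 := by ring
    rw [e4]
    field_simp
    ring
  rw [← e3, h1]
  ring

theorem primSum_casimirOp {h : Form → ℂ} (hh : IsTest h) (c : ℝ) {s : ℂ × ℂ} :
    primSum (casimirOp c h) s = (s.1 ^ 2 + s.2 ^ 2 - c) * primSum h s := by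
  rw [primSum, primSum, ← tsum_mul_left]
  exact tsum_congr fun v => formInt_casimirOp hh c v.ne_zero s

/-- The multiplier of `casimirOp` on the continuation, by uniqueness of continuation. -/
theorem eisEntire_casimirOp (c : ℝ) (z : ℂ) : eisEntire (hh.casimirOp c) κ z =
    ((κ ^ 2 + z ^ 2) / 2 - c) * eisEntire hh κ z := by
  have h1 : AnalyticOnNhd ℂ (eisEntire (hh.casimirOp c) κ) univ :=
    (differentiable_eisEntire _ κ).differentiableOn.analyticOnNhd isOpen_univ
  have h2 : AnalyticOnNhd ℂ (fun z => ((κ ^ 2 + z ^ 2) / 2 - c) * eisEntire hh κ z) univ := by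
    have : Differentiable ℂ fun z => ((κ ^ 2 + z ^ 2) / 2 - c) * eisEntire hh κ z :=
      Differentiable.mul (by fun_prop) (differentiable_eisEntire hh κ)
    exact this.differentiableOn.analyticOnNhd isOpen_univ
  have ho : {z : ℂ | z.re < -1} ∈ nhds (-2 : ℂ) :=
    (isOpen_lt Complex.continuous_re continuous_const).mem_nhds (by simp)
  refine congrFun (h1.eq_of_eventuallyEq (z₀ := -2) h2 ?_) z
  filter_upwards [ho] with z hz
  have hz : z.re < -1 := hz
  rw [eisEntire_eq _ κ hz, eisEntire_eq hh κ hz, primSum_casimirOp hh]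
  simp only [spec]
  ring

end

/-! ### Bounds for the zeta and Gamma functions -/

/-- The entire function `z (z - 1) ζ*(z)`. -/
def xiFun (z : ℂ) : ℂ := z * (z - 1) * completedRiemannZeta₀ z + 1

theorem differentiable_xiFun : Differentiable ℂ xiFun :=
  (Differentiable.mul (by fun_prop) differentiable_completedZeta₀).add_const 1

theorem xiFun_one_sub (z : ℂ) : xiFun (1 - z) = xiFun z := by
  rw [xiFun, xiFun, completedRiemannZeta₀_one_sub]
  ring

theorem xiFun_eq {z : ℂ} (h0 : z ≠ 0) (h1 : z ≠ 1) :
    xiFun z = z * (z - 1) * completedRiemannZeta z := by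
  have : 1 - z ≠ 0 := sub_ne_zero.2 h1.symm
  rw [xiFun, completedRiemannZeta_eq]
  field_simp
  ring

theorem xiFun_ne_zero_of_one_le_re {z : ℂ} (hz : 1 ≤ z.re) : xiFun z ≠ 0 := by
  have h0 : z ≠ 0 := ne_of_re_ne (by simp; linarith)
  rcases eq_or_ne z 1 with rfl | h1
  · simp [xiFun]
  · have hζ := riemannZeta_ne_zero_of_one_le_re hz
    rw [riemannZeta_def_of_ne_zero h0] at hζ
    rw [xiFun_eq h0 h1]
    exact mul_ne_zero (mul_ne_zero h0 (sub_ne_zero.2 h1)) (div_ne_zero_iff.1 hζ).1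

theorem xiFun_ne_zero_of_re_nonpos {z : ℂ} (hz : z.re ≤ 0) : xiFun z ≠ 0 := by
  rw [← xiFun_one_sub]
  exact xiFun_ne_zero_of_one_le_re (by simp; linarith)

theorem summable_rpow_neg {σ : ℝ} (hσ : 1 < σ) : Summable fun n : ℕ => 1 / (n : ℝ) ^ σ :=
  Real.summable_one_div_nat_rpow.2 hσ

theorem norm_one_div_cpow (n : ℕ) {s : ℂ} (hs : 1 < s.re) :
    ‖1 / (n : ℂ) ^ s‖ = 1 / (n : ℝ) ^ s.re := by
  rcases Nat.eq_zero_or_pos n with rfl | hn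
  · have h1 : s ≠ 0 := ne_of_re_ne (by simp; linarith)
    have h2 : s.re ≠ 0 := by linarith
    simp [Complex.zero_cpow h1, Real.zero_rpow h2]
  · rw [norm_div, norm_one, Complex.norm_natCast_cpow_of_pos hn]

theorem norm_riemannZeta_le {s : ℂ} (hs : 1 < s.re) :
    ‖riemannZeta s‖ ≤ ∑' n : ℕ, 1 / (n : ℝ) ^ s.re := by
  rw [zeta_eq_tsum_one_div_nat_cpow hs]
  exact tsum_of_norm_bounded (summable_rpow_neg hs).hasSum fun n => (norm_one_div_cpow n hs).le

/-- The Dirichlet series of `1 / ζ` has coefficients `μ(n)`, of absolute value at most `1`. -/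
theorem norm_inv_riemannZeta_le {s : ℂ} (hs : 1 < s.re) :
    ‖(riemannZeta s)⁻¹‖ ≤ ∑' n : ℕ, 1 / (n : ℝ) ^ s.re := by
  have e := LSeries_one_mul_Lseries_moebius hs
  rw [LSeries_one_eq_riemannZeta hs] at e
  rw [← eq_inv_of_mul_eq_one_right e, LSeries]
  refine tsum_of_norm_bounded (summable_rpow_neg hs).hasSum fun n => ?_
  rw [← norm_one_div_cpow n hs, LSeries.term_def]
  split_ifs with hn
  · simp
  · rw [norm_div, norm_div, norm_one]
    refine div_le_div_of_nonneg_right ?_ (norm_nonneg _)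
    have := ArithmeticFunction.abs_moebius_le_one (n := n)
    rw [Complex.norm_intCast]
    exact_mod_cast this

/-- The simple pole of the zeta function at `1`. -/
theorem exists_tsum_rpow_le (b : ℝ) : ∃ C, 0 ≤ C ∧ ∀ σ : ℝ, 1 < σ → σ ≤ b →
    (σ - 1) * ∑' n : ℕ, 1 / (n : ℝ) ^ σ ≤ C := by
  have hc : ContinuousOn (fun σ : ℝ => xiFun σ * (Complex.Gammaℝ σ)⁻¹ / σ) (Icc 1 b) := by
    refine ContinuousOn.div ?_ (by fun_prop) fun σ hσ => ?_
    · exact ((differentiable_xiFun.continuous.comp Complex.continuous_ofReal).mul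
        (Complex.differentiable_Gammaℝ_inv.continuous.comp Complex.continuous_ofReal)).continuousOn
    · have := hσ.1
      exact Complex.ofReal_ne_zero.2 (by linarith)
  obtain ⟨C, hC⟩ := isCompact_Icc.exists_bound_of_continuousOn hc
  refine ⟨|C|, abs_nonneg _, fun σ h1 h2 => ?_⟩
  refine le_trans ?_ ((hC σ ⟨h1.le, h2⟩).trans (le_abs_self C))
  have h0 : (σ : ℂ) ≠ 0 := Complex.ofReal_ne_zero.2 (by linarith)
  have h1' : (σ : ℂ) ≠ 1 := by
    rw [Ne, Complex.ofReal_eq_one]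
    linarith
  have hG : Complex.Gammaℝ σ ≠ 0 := Complex.Gammaℝ_ne_zero_of_re_pos (by simp; linarith)
  have e : xiFun σ * (Complex.Gammaℝ σ)⁻¹ / σ = (σ - 1) * riemannZeta σ := by
    rw [xiFun_eq h0 h1', riemannZeta_def_of_ne_zero h0]
    field_simp
  have e2 : riemannZeta σ = ((∑' n : ℕ, 1 / (n : ℝ) ^ σ : ℝ) : ℂ) := by
    rw [zeta_eq_tsum_one_div_nat_cpow (by simpa using h1), Complex.ofReal_tsum]
    refine tsum_congr fun n => ?_
    rw [Complex.ofReal_div, Complex.ofReal_cpow (Nat.cast_nonneg n)]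
    simp
  rw [e, e2, ← Complex.ofReal_one, ← Complex.ofReal_sub, ← Complex.ofReal_mul, Complex.norm_real]
  exact Real.le_norm_self _

theorem norm_Gamma_le_of_re_pos {s : ℂ} (hs : 0 < s.re) : ‖Complex.Gamma s‖ ≤ Real.Gamma s.re := by
  rw [Complex.Gamma_eq_integral hs, Real.Gamma_eq_integral hs, Complex.GammaIntegral]
  refine norm_integral_le_of_norm_le (Real.GammaIntegral_convergent hs) ?_
  refine (ae_restrict_iff' measurableSet_Ioi).2 (Filter.Eventually.of_forall fun t ht => ?_)
  rw [norm_mul, Complex.norm_cpow_eq_rpow_re_of_pos ht, Complex.norm_real,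
    Real.norm_of_nonneg (Real.exp_pos _).le]
  simp

theorem norm_sin_le_exp (z : ℂ) : ‖Complex.sin z‖ ≤ Real.exp |z.im| := by
  rw [Complex.sin, norm_div, norm_mul, Complex.norm_I, mul_one, Complex.norm_ofNat]
  have h1 : ‖Complex.exp (-z * Complex.I)‖ ≤ Real.exp |z.im| := by
    rw [Complex.norm_exp]
    exact Real.exp_le_exp.2 (by simpa using le_abs_self z.im)
  have h2 : ‖Complex.exp (z * Complex.I)‖ ≤ Real.exp |z.im| := by
    rw [Complex.norm_exp]
    exact Real.exp_le_exp.2 (by simpa using neg_le_abs z.im)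
  have := norm_sub_le (Complex.exp (-z * Complex.I)) (Complex.exp (z * Complex.I))
  linarith

/-- At most exponential growth of `1 / Γ` on a vertical strip. -/
theorem exists_norm_inv_Gamma_le : ∃ C, 0 ≤ C ∧ ∀ w : ℂ, -(1 / 2) ≤ w.re → w.re ≤ 3 / 2 →
    1 / 2 ≤ |w.im| → ‖(Complex.Gamma w)⁻¹‖ ≤ C * Real.exp (Real.pi * |w.im|) := by
  have hc : ContinuousOn Real.Gamma (Icc (1 / 2) (5 / 2)) := fun x hx =>
    (Real.differentiableAt_Gamma fun m => by
      have := hx.1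
      have := m.cast_nonneg (α := ℝ)
      linarith).continuousAt.continuousWithinAt
  obtain ⟨C, hC⟩ := isCompact_Icc.exists_bound_of_continuousOn hc
  refine ⟨2 * |C|, by positivity, fun w h1 h2 h3 => ?_⟩
  have hpi := Real.pi_pos
  have hw : w - 1 ≠ 0 := fun hc => by
    have : w.im = 0 := by simpa using congrArg Complex.im hc
    rw [this, abs_zero] at h3
    norm_num at h3
  have e1 : (Complex.Gamma w)⁻¹ = (w - 1)⁻¹ * (Complex.Gamma (w - 1))⁻¹ := by
    rw [Complex.one_div_Gamma_eq_self_mul_one_div_Gamma_add_one (w - 1), sub_add_cancel,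
      inv_mul_cancel_left₀ hw]
  have hsin : Complex.sin (Real.pi * (w - 1)) ≠ 0 := by
    rw [Ne, Complex.sin_eq_zero_iff]
    rintro ⟨k, hk⟩
    have : Real.pi * w.im = 0 := by simpa using congrArg Complex.im hk
    have h0 : w.im = 0 := (mul_eq_zero.1 this).resolve_left hpi.ne'
    rw [h0, abs_zero] at h3
    norm_num at h3
  have e2 : (Complex.Gamma (w - 1))⁻¹ =
      Complex.Gamma (2 - w) * Complex.sin (Real.pi * (w - 1)) * (Real.pi : ℂ)⁻¹ := by
    have := Complex.Gamma_mul_Gamma_one_sub (w - 1)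
    rw [show 1 - (w - 1) = 2 - w by ring] at this
    have hG : Complex.Gamma (w - 1) ≠ 0 := fun h0 => by
      rw [h0, zero_mul] at this
      exact div_ne_zero (Complex.ofReal_ne_zero.2 hpi.ne') hsin this.symm
    have hp : (Real.pi : ℂ) ≠ 0 := Complex.ofReal_ne_zero.2 hpi.ne'
    generalize Complex.sin (Real.pi * (w - 1)) = S at this hsin ⊢
    rw [eq_div_iff hsin] at this
    rw [← div_eq_mul_inv, eq_div_iff hp, ← this]
    field_simp
  have b1 : ‖(w - 1)⁻¹‖ ≤ 2 := by
    rw [norm_inv]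
    refine inv_le_of_inv_le₀ (by norm_num) ?_
    have := Complex.abs_im_le_norm (w - 1)
    rw [Complex.sub_im, Complex.one_im, sub_zero] at this
    linarith
  have b2 : ‖Complex.Gamma (2 - w)‖ ≤ |C| := by
    have e : (2 - w).re = 2 - w.re := by simp
    refine (norm_Gamma_le_of_re_pos (by rw [e]; linarith)).trans ?_
    exact (Real.le_norm_self _).trans ((hC _ (by rw [e]; constructor <;> linarith)).trans
      (le_abs_self C))
  have b3 : ‖Complex.sin (Real.pi * (w - 1))‖ ≤ Real.exp (Real.pi * |w.im|) := by
    refine (norm_sin_le_exp _).trans (le_of_eq ?_)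
    congr 1
    simp [abs_mul, abs_of_pos hpi]
  have b4 : ‖(Real.pi : ℂ)⁻¹‖ ≤ 1 := by
    rw [norm_inv, Complex.norm_real, Real.norm_of_nonneg hpi.le]
    exact inv_le_one_of_one_le₀ (by linarith [Real.pi_gt_three])
  rw [e1, e2, norm_mul, norm_mul, norm_mul]
  calc _ ≤ 2 * (|C| * Real.exp (Real.pi * |w.im|) * 1) := by gcongr
    _ = _ := by ring

/-! ### Odd entire functions -/

/-- A quotient `A / X` with `A(z) X(-z)` odd is entire if `X(z)` and `X(-z)` have no common zero: at
the zeros of `X` it is given by `-A(-z) / X(-z)`. -/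
theorem exists_odd_quotient {A X : ℂ → ℂ} (hA : Differentiable ℂ A) (hX : Differentiable ℂ X)
    (h : ∀ z, A z * X (-z) = -(A (-z) * X z)) (hne : ∀ z, X z ≠ 0 ∨ X (-z) ≠ 0) :
    ∃ G : ℂ → ℂ, Differentiable ℂ G ∧ (∀ z, G (-z) = -G z) ∧ ∀ z, G z * X z = A z := by
  classical
  let G : ℂ → ℂ := fun z => if X z ≠ 0 then A z / X z else -(A (-z) / X (-z))
  have h1 : ∀ z, X z ≠ 0 → G z = A z / X z := fun z hz => if_pos hz
  have h2 : ∀ z, X (-z) ≠ 0 → G z = -(A (-z) / X (-z)) := fun z hz => by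
    by_cases hz' : X z = 0
    · exact if_neg (not_not.2 hz')
    · rw [h1 z hz']
      field_simp
      linear_combination h z
  refine ⟨G, fun z => ?_, fun z => ?_, fun z => ?_⟩
  · rcases hne z with hz | hz
    · have : G =ᶠ[nhds z] fun z => A z / X z := by
        filter_upwards [(hX.continuous.isOpen_preimage _ isOpen_compl_singleton).mem_nhds
          (show z ∈ X ⁻¹' {0}ᶜ from hz)] with y hy
        exact h1 y hy
      exact ((hA z).div (hX z) hz).congr_of_eventuallyEq this
    · have hX' : Differentiable ℂ fun z => X (-z) := hX.comp differentiable_neg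
      have hA' : Differentiable ℂ fun z => A (-z) := hA.comp differentiable_neg
      have : G =ᶠ[nhds z] fun z => -(A (-z) / X (-z)) := by
        filter_upwards [(hX'.continuous.isOpen_preimage _ isOpen_compl_singleton).mem_nhds
          (show z ∈ (fun z => X (-z)) ⁻¹' {0}ᶜ from hz)] with y hy
        exact h2 y hy
      exact ((hA' z).div (hX' z) hz).neg.congr_of_eventuallyEq this
  · rcases hne z with hz | hz
    · rw [h1 z hz, h2 (-z) (by rwa [neg_neg]), neg_neg]
    · rw [h2 z hz, h1 (-z) hz, neg_neg]
  · by_cases hz : X z = 0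
    · have hz' := (hne z).resolve_left (not_not.2 hz)
      have := h z
      rw [hz, mul_zero, neg_zero, mul_eq_zero] at this
      rw [hz, mul_zero, this.resolve_right hz']
    · rw [h1 z hz, div_mul_cancel₀ _ hz]

/-- A bound that is singular on the imaginary axis holds, for an entire function, without the
singularity: multiply by a polynomial that vanishes where the unit circle about a point of the axis
meets the axis, and apply the maximum principle. -/
theorem norm_le_of_abs_re_mul_norm_le {G : ℂ → ℂ} (hG : Differentiable ℂ G) {K y : ℝ}
    (h : ∀ z : ℂ, |z.re| ≤ 1 → |z.im - y| ≤ 1 → |z.re| * ‖G z‖ ≤ K) {z : ℂ}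
    (hz : |z.re| ≤ 1 / 2) (hy : z.im = y) : ‖G z‖ ≤ 3 * K := by
  set c : ℂ := y * Complex.I
  let H : ℂ → ℂ := fun u => G u * ((u - c) ^ 2 + 1)
  have hH : Differentiable ℂ H := hG.mul (by fun_prop)
  have hzc : z - c = (z.re : ℂ) := by
    refine Complex.ext ?_ ?_ <;> simp [c, hy]
  have hz' := abs_le.1 hz
  have key : ‖H z‖ ≤ 2 * K := by
    refine Complex.norm_le_of_forall_mem_frontier_norm_le (U := Metric.ball c 1)
      Metric.isBounded_ball hH.diffContOnCl (fun u hu => ?_) (subset_closure ?_)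
    · rw [frontier_ball _ one_ne_zero, mem_sphere_iff_norm] at hu
      have hn : (u.re) ^ 2 + (u.im - y) ^ 2 = 1 := by
        have e := Complex.sq_norm (u - c)
        rw [hu, Complex.normSq_apply] at e
        simp only [c, Complex.sub_re, Complex.sub_im, Complex.mul_re, Complex.mul_im,
          Complex.ofReal_re, Complex.ofReal_im, Complex.I_re, Complex.I_im] at e
        nlinarith
      have h1 : |u.re| ≤ 1 := abs_le_one_iff_mul_self_le_one.2 (by nlinarith [sq_nonneg (u.im - y)])
      have h2 : |u.im - y| ≤ 1 := abs_le_one_iff_mul_self_le_one.2 (by nlinarith [sq_nonneg u.re])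
      have e : (u - c) ^ 2 + 1 = 2 * (u.re : ℂ) * (u - c) := by
        refine Complex.ext ?_ ?_
        · simp [c, pow_two]
          linarith
        · simp [c, pow_two]
          ring
      have b := h u h1 h2
      simp only [H]
      rw [e, norm_mul, norm_mul, norm_mul, hu, Complex.norm_real, Complex.norm_ofNat,
        Real.norm_eq_abs]
      linarith
    · rw [mem_ball_iff_norm, hzc, Complex.norm_real, Real.norm_eq_abs]
      linarith
  simp only [H] at key
  rw [hzc, norm_mul] at key
  have e : ((z.re : ℂ) ^ 2 + 1) = ((z.re ^ 2 + 1 : ℝ) : ℂ) := by push_cast; ring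
  rw [e, Complex.norm_real, Real.norm_of_nonneg (by positivity)] at key
  have := norm_nonneg (G z)
  nlinarith [sq_nonneg z.re, mul_nonneg this (sq_nonneg z.re)]

/-- The same on a whole strip: a decay estimate singular on the imaginary axis implies one without
the singularity. -/
theorem exists_norm_le_of_abs_re_mul_norm_le {G : ℂ → ℂ} (hG : Differentiable ℂ G) {K : ℝ}
    (h : ∀ z : ℂ, |z.re| ≤ 2 → 1 ≤ |z.im| → |z.re| * ‖G z‖ ≤ K / (1 + z.im ^ 2)) :
    ∃ C, 0 ≤ C ∧ ∀ z : ℂ, |z.re| ≤ 2 → ‖G z‖ ≤ C / (1 + z.im ^ 2) := by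
  have hK : 0 ≤ K := by
    have := h (Complex.I) (by simp) (by simp)
    simp at this
    linarith
  obtain ⟨B, hB⟩ := ((isCompact_Icc (a := (-2 : ℝ)) (b := 2)).reProdIm
    (isCompact_Icc (a := (-2 : ℝ)) (b := 2))).exists_bound_of_continuousOn
      hG.continuous.continuousOn
  refine ⟨5 * |B| + 9 * K, by positivity, fun z hz => ?_⟩
  have hp : 0 < 1 + z.im ^ 2 := by positivity
  rw [le_div_iff₀ hp]
  rcases le_or_gt |z.im| 2 with h2 | h2
  · have b := (hB z ⟨abs_le.1 hz, abs_le.1 h2⟩).trans (le_abs_self B)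
    have : z.im ^ 2 ≤ 4 := by
      rw [← sq_abs]
      nlinarith [abs_nonneg z.im]
    have := abs_nonneg B
    nlinarith [norm_nonneg (G z)]
  · rcases le_or_gt (1 / 2) |z.re| with h1 | h1
    · have b := h z hz (by linarith)
      rw [le_div_iff₀ hp] at b
      have := mul_le_mul_of_nonneg_right h1 (mul_nonneg (norm_nonneg (G z)) hp.le)
      have := abs_nonneg B
      nlinarith
    · have b := norm_le_of_abs_re_mul_norm_le hG (K := 3 * K / (1 + z.im ^ 2)) (y := z.im)
        (fun u h3 h4 => ?_) h1.le rfl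
      · rw [← le_div_iff₀ hp]
        refine b.trans ?_
        rw [← mul_div_assoc]
        refine div_le_div_of_nonneg_right ?_ hp.le
        have := abs_nonneg B
        linarith
      · have h5 : |z.im| ≤ |u.im| + |u.im - z.im| := by
          have := abs_sub_abs_le_abs_sub z.im u.im
          rw [abs_sub_comm] at this
          linarith
        refine (h u (by linarith) (by linarith)).trans ?_
        rw [div_le_div_iff₀ (by positivity) hp]
        have h6 := sq_abs (u.im - z.im)
        have : z.im ^ 2 ≤ 2 * u.im ^ 2 + 2 * (u.im - z.im) ^ 2 := by
          nlinarith [sq_nonneg (2 * u.im - z.im)]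
        have h7 : (u.im - z.im) ^ 2 ≤ 1 := by
          rw [← h6]
          nlinarith [abs_nonneg (u.im - z.im)]
        nlinarith

/-- The integral of a decaying odd entire function over a vertical line vanishes. -/
theorem integral_eq_zero_of_odd {G : ℂ → ℂ} (hG : Differentiable ℂ G) (ho : ∀ z, G (-z) = -G z)
    {C : ℝ} (hC : ∀ z : ℂ, |z.re| ≤ 2 → ‖G z‖ ≤ C / (1 + z.im ^ 2)) :
    ∫ y : ℝ, G (-2 + y * Complex.I) = 0 := by
  have hi : Integrable fun y : ℝ => G (-2 + y * Complex.I) := by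
    refine (integrable_inv_one_add_sq.const_mul C).mono'
      (hG.continuous.comp (by fun_prop)).aestronglyMeasurable
      (Filter.Eventually.of_forall fun y => ?_)
    have := hC (-2 + y * Complex.I) (by simp)
    simpa [div_eq_mul_inv] using this
  have hlim := intervalIntegral_tendsto_integral hi Filter.tendsto_neg_atTop_atBot Filter.tendsto_id
  refine tendsto_nhds_unique hlim ?_
  have hrect : ∀ T : ℝ, ∫ y in (-T)..T, G (-2 + y * Complex.I) =
      Complex.I * ∫ x in (-2 : ℝ)..2, G (x + T * Complex.I) := by
    intro T
    have e := Complex.integral_boundary_rect_eq_zero_of_differentiableOn G (-2 - T * Complex.I)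
      (2 + T * Complex.I) hG.differentiableOn
    have r1 : (-2 - T * Complex.I : ℂ).re = -2 := by simp
    have r2 : (-2 - T * Complex.I : ℂ).im = -T := by simp
    have r3 : (2 + T * Complex.I : ℂ).re = 2 := by simp
    have r4 : (2 + T * Complex.I : ℂ).im = T := by simp
    rw [r1, r2, r3, r4] at e
    have s1 : ∫ x in (-2 : ℝ)..2, G (x + ((-T : ℝ) : ℂ) * Complex.I) =
        -∫ x in (-2 : ℝ)..2, G (x + T * Complex.I) := by
      have := intervalIntegral.integral_comp_neg (a := (-2 : ℝ)) (b := 2)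
        fun x : ℝ => G (x + ((-T : ℝ) : ℂ) * Complex.I)
      rw [neg_neg] at this
      rw [← this, ← intervalIntegral.integral_neg]
      congr 1
      funext x
      rw [← ho]
      congr 1
      push_cast
      ring
    have s2 : ∫ y in (-T)..T, G (((2 : ℝ) : ℂ) + y * Complex.I) =
        -∫ y in (-T)..T, G (-2 + y * Complex.I) := by
      have := intervalIntegral.integral_comp_neg (a := -T) (b := T)
        fun y : ℝ => G (((2 : ℝ) : ℂ) + y * Complex.I)
      rw [neg_neg] at this
      rw [← this, ← intervalIntegral.integral_neg]
      congr 1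
      funext x
      rw [← ho]
      congr 1
      push_cast
      ring
    rw [s1, s2] at e
    simp only [smul_eq_mul, Complex.ofReal_neg, Complex.ofReal_ofNat] at e
    have hI := Complex.I_mul_I
    linear_combination (Complex.I / 2) * e + (∫ y in (-T)..T, G (-2 + y * Complex.I)) * hI
  simp only [id_eq]
  rw [show (fun T : ℝ => ∫ y in (-T)..T, G (-2 + y * Complex.I)) = _ from funext hrect]
  refine squeeze_zero_norm (a := fun T : ℝ => 4 * |C| * (1 + T ^ 2)⁻¹) (fun T => ?_) ?_
  · rw [norm_mul, Complex.norm_I, one_mul]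
    refine (intervalIntegral.norm_integral_le_of_norm_le_const (C := |C| * (1 + T ^ 2)⁻¹)
      fun x hx => ?_).trans (le_of_eq ?_)
    · rw [uIoc_of_le (by norm_num)] at hx
      have := hC (x + T * Complex.I) (by
        simp only [Complex.add_re, Complex.ofReal_re, Complex.mul_re, Complex.I_re, mul_zero,
          Complex.ofReal_im, Complex.I_im, mul_one, sub_self, add_zero]
        exact abs_le.2 ⟨by linarith [hx.1], hx.2⟩)
      refine this.trans ?_
      simp only [Complex.add_im, Complex.ofReal_im, Complex.mul_im, Complex.ofReal_re, Complex.I_im,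
        mul_one, Complex.I_re, mul_zero, add_zero, zero_add, div_eq_mul_inv]
      exact mul_le_mul_of_nonneg_right (le_abs_self C) (by positivity)
    · norm_num
      ring
  · have h1 : Filter.Tendsto (fun T : ℝ => (1 + T ^ 2)⁻¹) Filter.atTop (nhds 0) :=
      (Filter.tendsto_atTop_add_const_left _ _
        (Filter.tendsto_pow_atTop two_ne_zero)).inv_tendsto_atTop
    simpa using h1.const_mul (4 * |C|)

/-! ### Decay of the zeta integral in a vertical strip -/

theorem exists_norm_primSum_decay {h : Form → ℂ} (hh : IsTest h) (k : ℕ) :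
    ∃ C, 0 ≤ C ∧ ∀ s : ℂ × ℂ, s.1.re = -1 → s.2.re = 1 → imSize s ^ k * ‖primSum h s‖ ≤ C := by
  obtain ⟨C, hC, H⟩ := exists_norm_formInt_decay hh k
  have hs := summable_primVec (b := 3 / 2) (by norm_num)
  refine ⟨C * ∑' v : PrimVec, ((v.1.1 : ℝ) ^ 2 + (v.1.2 : ℝ) ^ 2) ^ (-(3 / 2) : ℝ),
    mul_nonneg hC (tsum_nonneg fun v => by positivity), fun s h1 h2 => ?_⟩
  have hI := imSize_pos s
  have e : imSize s ^ k * ‖primSum h s‖ =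
      ‖∑' v : PrimVec, (imSize s ^ k : ℂ) * formInt v.1.1 v.1.2 h s‖ := by
    rw [tsum_mul_left, norm_mul, primSum]
    congr 1
    rw [norm_pow, Complex.norm_real, Real.norm_of_nonneg hI.le]
  rw [e]
  refine tsum_of_norm_bounded (hs.hasSum.mul_left C) fun v => ?_
  rw [norm_mul, norm_pow, Complex.norm_real, Real.norm_of_nonneg hI.le]
  exact H s h1 h2 _ _ v.ne_zero

theorem spec_re {κ : ℂ} (hκ : κ.re = 0) {z : ℂ} (hz : z.re = -2) :
    (spec κ z).1.re = -1 ∧ (spec κ z).2.re = 1 := by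
  simp only [spec, Complex.div_ofNat_re, Complex.add_re, Complex.sub_re, hκ, hz]
  norm_num

theorem imSize_spec (κ z : ℂ) : imSize (spec κ z) = 1 + (κ.im ^ 2 + z.im ^ 2) / 2 := by
  simp only [imSize, spec, Complex.div_ofNat_im, Complex.add_im, Complex.sub_im]
  ring

section

variable {h : Form → ℂ} (hh : IsTest h) {κ : ℂ}

/-- The quotient of the zeta integral by its Gamma factor. -/
def eisGamma (κ z : ℂ) : ℂ := eisEntire hh κ z * (Complex.Gamma ((1 - z) / 2))⁻¹

theorem differentiable_eisGamma (κ : ℂ) : Differentiable ℂ (eisGamma hh κ) :=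
  (differentiable_eisEntire hh κ).mul (Complex.differentiable_one_div_Gamma.comp
    (f := fun z : ℂ => (1 - z) / 2) (by fun_prop))

/-- The left edge of the strip lies in the domain of absolute convergence. -/
theorem exists_norm_eisGamma_left (hκ : κ.re = 0) :
    ∃ C, ∀ z : ℂ, z.re = -2 → imSize (spec κ z) * ‖eisGamma hh κ z‖ ≤ C := by
  obtain ⟨D, hD, H⟩ := exists_norm_primSum_decay hh 2
  refine ⟨10 * (∑' n : ℕ, 1 / (n : ℝ) ^ (3 : ℝ)) * D, fun z hz => ?_⟩
  obtain ⟨h1, h2⟩ := spec_re hκ hz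
  have hI := imSize_pos (spec κ z)
  have e1 : (1 - z).re = 3 := by simp [hz]; norm_num
  have e2 : ((1 - z) / 2).re = 3 / 2 := by simp [hz]; norm_num
  have hΓ : Complex.Gamma ((1 - z) / 2) ≠ 0 :=
    Complex.Gamma_ne_zero_of_re_pos (by rw [e2]; norm_num)
  have e : eisGamma hh κ z = (1 - z ^ 2) * (Real.pi : ℂ) ^ (-((1 - z) / 2)) *
      riemannZeta (1 - z) * primSum h (spec κ z) := by
    rw [eisGamma, eisEntire_eq hh κ (by rw [hz]; norm_num),
      completedRiemannZeta_one_sub_eq (by rw [hz]; norm_num)]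
    field_simp
  have b1 : ‖1 - z ^ 2‖ ≤ 10 * imSize (spec κ z) := by
    have : ‖z‖ ^ 2 = 4 + z.im ^ 2 := by
      rw [Complex.sq_norm, Complex.normSq_apply, hz]
      ring
    refine (norm_sub_le _ _).trans ?_
    rw [norm_one, norm_pow, this, imSize_spec]
    nlinarith [sq_nonneg κ.im, sq_nonneg z.im]
  have b2 : ‖(Real.pi : ℂ) ^ (-((1 - z) / 2))‖ ≤ 1 := by
    rw [Complex.norm_cpow_eq_rpow_re_of_pos Real.pi_pos, Complex.neg_re, e2]
    exact Real.rpow_le_one_of_one_le_of_nonpos (by linarith [Real.pi_gt_three]) (by norm_num)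
  have b3 := norm_riemannZeta_le (s := 1 - z) (by rw [e1]; norm_num)
  rw [e1] at b3
  have b0 : (0 : ℝ) ≤ ∑' n : ℕ, 1 / (n : ℝ) ^ (3 : ℝ) := (norm_nonneg _).trans b3
  rw [e, norm_mul, norm_mul, norm_mul]
  calc imSize (spec κ z) * (‖1 - z ^ 2‖ * ‖(Real.pi : ℂ) ^ (-((1 - z) / 2))‖ *
        ‖riemannZeta (1 - z)‖ * ‖primSum h (spec κ z)‖)
      ≤ imSize (spec κ z) * (10 * imSize (spec κ z) * 1 * (∑' n : ℕ, 1 / (n : ℝ) ^ (3 : ℝ)) *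
        ‖primSum h (spec κ z)‖) := by gcongr
    _ = 10 * (∑' n : ℕ, 1 / (n : ℝ) ^ (3 : ℝ)) *
        (imSize (spec κ z) ^ 2 * ‖primSum h (spec κ z)‖) := by ring
    _ ≤ _ := mul_le_mul_of_nonneg_left (H _ h1 h2) (by positivity)

/-- On the line `Re z = 2` the functional equation exchanges `Γ(a)` for `Γ(ā + 2)`. -/
theorem norm_eisGamma_right (κ : ℂ) {z : ℂ} (hz : z.re = 2) :
    ‖eisGamma hh κ z‖ ≤ imSize (spec κ (-z)) * ‖eisGamma hh κ (-z)‖ := by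
  set a : ℂ := (1 - z) / 2 with ha
  have ra : a.re = -(1 / 2) := by simp [ha, hz]; norm_num
  have ia : a.im = -z.im / 2 := by simp [ha]
  have ha0 : a ≠ 0 := ne_of_re_ne (by rw [ra]; norm_num)
  have ha1 : a + 1 ≠ 0 := ne_of_re_ne (by rw [Complex.add_re, ra]; norm_num)
  have e1 : (1 - -z) / 2 = (starRingEnd ℂ) (a + 1 + 1) := by
    refine Complex.ext ?_ ?_
    · simp [ra, hz]; norm_num
    · simp [ia]; ring
  have e2 : Complex.Gamma (a + 1 + 1) = (a + 1) * (a * Complex.Gamma a) := by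
    rw [Complex.Gamma_add_one _ ha1, Complex.Gamma_add_one _ ha0]
  have e3 : ‖Complex.Gamma ((1 - -z) / 2)‖ = ‖a + 1‖ * ‖a‖ * ‖Complex.Gamma a‖ := by
    rw [e1, Complex.Gamma_conj, Complex.norm_conj, e2, norm_mul, norm_mul, mul_assoc]
  have n1 : ‖a‖ ^ 2 = (1 + z.im ^ 2) / 4 := by
    rw [Complex.sq_norm, Complex.normSq_apply, ra, ia]
    ring
  have n2 : ‖a + 1‖ ^ 2 = (1 + z.im ^ 2) / 4 := by
    rw [Complex.sq_norm, Complex.normSq_apply, Complex.add_re, Complex.add_im, ra, ia,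
      Complex.one_re, Complex.one_im]
    ring
  have b : ‖a + 1‖ * ‖a‖ ≤ imSize (spec κ (-z)) := by
    rw [imSize_spec, Complex.neg_im]
    nlinarith [sq_nonneg (‖a + 1‖ - ‖a‖), sq_nonneg κ.im, sq_nonneg z.im]
  have hΓ : Complex.Gamma ((1 - -z) / 2) ≠ 0 :=
    Complex.Gamma_ne_zero_of_re_pos (by simp [hz]; norm_num)
  have hΓa : Complex.Gamma a ≠ 0 := fun h0 => by
    rw [h0, norm_zero, mul_zero, norm_eq_zero] at e3
    exact hΓ e3
  have : ‖eisGamma hh κ z‖ = ‖a + 1‖ * ‖a‖ * ‖eisGamma hh κ (-z)‖ := by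
    have hn1 := norm_pos_iff.2 ha0
    have hn2 := norm_pos_iff.2 ha1
    have hn3 := norm_pos_iff.2 hΓa
    rw [eisGamma, eisGamma, norm_mul, norm_mul, norm_inv, norm_inv, e3, eisEntire_neg, ← ha]
    field_simp
  rw [this]
  exact mul_le_mul_of_nonneg_right b (norm_nonneg _)

theorem one_add_sq_le_exp (x : ℝ) (hx : 0 ≤ x) : (1 + (2 + x)) ^ 2 ≤ 9 * Real.exp (2 * x) := by
  have := Real.add_one_le_exp x
  rw [two_mul, Real.exp_add]
  nlinarith

/-- Phragmén–Lindelöf between the two edges of the strip. -/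
theorem exists_norm_eisGamma_le (hκ : κ.re = 0) :
    ∃ C, ∀ z : ℂ, |z.re| ≤ 2 → ‖eisGamma hh κ z‖ ≤ C := by
  obtain ⟨C, hC⟩ := exists_norm_eisGamma_left hh hκ
  refine ⟨C, fun z hz => ?_⟩
  have hpi := Real.pi_pos
  refine PhragmenLindelof.vertical_strip (a := -2) (b := 2)
    (differentiable_eisGamma hh κ).diffContOnCl ⟨1 / 2, ?_, 8, ?_⟩ (fun z hz => ?_)
    (fun z hz => ?_) (abs_le.1 hz).1 (abs_le.1 hz).2
  · rw [lt_div_iff₀ (by norm_num)]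
    linarith [Real.pi_gt_three]
  · obtain ⟨C₁, H₁⟩ := exists_norm_eisEntire_le hh κ 2
    obtain ⟨C₂, hC₂, H₂⟩ := exists_norm_inv_Gamma_le
    refine Asymptotics.IsBigO.of_bound (|C₁| * 9 * C₂) ?_
    have h1 : ∀ᶠ z : ℂ in Filter.comap (_root_.abs ∘ Complex.im) Filter.atTop, 1 ≤ |z.im| :=
      (Filter.eventually_ge_atTop (1 : ℝ)).comap _
    have h2 : ∀ᶠ z : ℂ in Filter.principal (Complex.re ⁻¹' Ioo (-2) 2), z.re ∈ Ioo (-2 : ℝ) 2 :=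
      Filter.eventually_principal.2 fun z hz => hz
    filter_upwards [h1.filter_mono inf_le_left, h2.filter_mono inf_le_right] with z hi hr
    have hr' : |z.re| ≤ 2 := abs_le.2 ⟨hr.1.le, hr.2.le⟩
    have hzn : ‖z‖ ≤ 2 + |z.im| := (Complex.norm_le_abs_re_add_abs_im z).trans (by linarith)
    have b1 : ‖eisEntire hh κ z‖ ≤ |C₁| * (9 * Real.exp (2 * |z.im|)) := by
      refine (H₁ z hr').trans ((mul_le_mul_of_nonneg_right (le_abs_self C₁) (by positivity)).trans
        (mul_le_mul_of_nonneg_left ?_ (abs_nonneg _)))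
      refine le_trans ?_ (one_add_sq_le_exp _ (abs_nonneg _))
      exact pow_le_pow_left₀ (by positivity) (by linarith) 2
    have e1 : ((1 - z) / 2).re = (1 - z.re) / 2 := by simp
    have e2 : |((1 - z) / 2).im| = |z.im| / 2 := by simp [abs_div]
    have b2 := H₂ ((1 - z) / 2) (by rw [e1]; linarith [hr.2]) (by rw [e1]; linarith [hr.1])
      (by rw [e2]; linarith)
    rw [e2] at b2
    rw [eisGamma, norm_mul, Real.norm_of_nonneg (Real.exp_pos _).le]
    have b3 : Real.exp (2 * |z.im|) * Real.exp (Real.pi * (|z.im| / 2)) ≤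
        Real.exp (8 * Real.exp (1 / 2 * |z.im|)) := by
      rw [← Real.exp_add]
      refine Real.exp_le_exp.2 ?_
      have := Real.add_one_le_exp (1 / 2 * |z.im|)
      nlinarith [Real.pi_lt_four]
    calc _ ≤ |C₁| * (9 * Real.exp (2 * |z.im|)) * (C₂ * Real.exp (Real.pi * (|z.im| / 2))) :=
          mul_le_mul b1 b2 (norm_nonneg _) (by positivity)
      _ = |C₁| * 9 * C₂ * (Real.exp (2 * |z.im|) * Real.exp (Real.pi * (|z.im| / 2))) := by ring
      _ ≤ _ := mul_le_mul_of_nonneg_left b3 (by positivity)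
  · exact (le_mul_of_one_le_left (norm_nonneg _) (one_le_imSize _)).trans (hC z hz)
  · exact (norm_eisGamma_right hh κ hz).trans (hC (-z) (by rw [Complex.neg_re, hz]))

/-- Rapid decay: `casimirOp` multiplies `eisGamma` by a symbol that grows quadratically. -/
theorem exists_norm_eisGamma_decay (hκ : κ.re = 0) (k : ℕ) :
    ∃ C, ∀ z : ℂ, |z.re| ≤ 2 → (1 + z.im ^ 2) ^ k * ‖eisGamma hh κ z‖ ≤ C := by
  induction k generalizing h with
  | zero =>
    obtain ⟨C, hC⟩ := exists_norm_eisGamma_le hh hκ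
    exact ⟨C, fun z hz => by simpa using hC z hz⟩
  | succ k ih =>
    obtain ⟨C, hC⟩ := ih (hh.casimirOp 3)
    refine ⟨2 * C, fun z hz => ?_⟩
    have := hC z hz
    have e : eisGamma (hh.casimirOp 3) κ z = ((κ ^ 2 + z ^ 2) / 2 - 3) * eisGamma hh κ z := by
      rw [eisGamma, eisGamma, eisEntire_casimirOp hh, Complex.ofReal_ofNat]
      ring
    have b : (1 + z.im ^ 2) / 2 ≤ ‖(κ ^ 2 + z ^ 2) / 2 - 3‖ := by
      have h1 := Complex.abs_re_le_norm ((κ ^ 2 + z ^ 2) / 2 - 3)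
      have h2 : ((κ ^ 2 + z ^ 2) / 2 - 3).re = (-κ.im ^ 2 + z.re ^ 2 - z.im ^ 2) / 2 - 3 := by
        simp [pow_two, hκ]
        ring
      have h3 : z.re ^ 2 ≤ 4 := by
        rw [← sq_abs]
        nlinarith [abs_nonneg z.re]
      have h4 := neg_le_abs ((κ ^ 2 + z ^ 2) / 2 - 3).re
      rw [h2] at h1 h4
      nlinarith [sq_nonneg κ.im]
    rw [e, norm_mul] at this
    have h5 : (1 + z.im ^ 2) ^ k * ((1 + z.im ^ 2) / 2 * ‖eisGamma hh κ z‖) ≤ C :=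
      le_trans (by gcongr) this
    calc _ = 2 * ((1 + z.im ^ 2) ^ k * ((1 + z.im ^ 2) / 2 * ‖eisGamma hh κ z‖)) := by ring
      _ ≤ _ := by linarith

/-! ### Functional equations and the extended Hall product -/

theorem phiRegular_of_one_lt_re {z : ℂ} (hz : 1 < z.re) : PhiRegular z := by
  have z3 : z + 1 ≠ 0 := ne_of_re_ne (by simp; linarith)
  have z4 : z + 1 ≠ 1 := ne_of_re_ne (by simp; linarith)
  have hx : xiFun (z + 1) ≠ 0 := xiFun_ne_zero_of_one_le_re (by simp; linarith)
  refine ⟨ne_of_re_ne (by simp; linarith), ne_of_re_ne (by simp; linarith),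
    ne_of_re_ne (by simp; linarith), fun h0 => hx ?_⟩
  rw [xiFun_eq z3 z4, h0, mul_zero]

/-- The functional equation with denominators cleared. -/
theorem xiFun_relation {z : ℂ} (hz : PhiRegular z) (a b : ℂ) :
    (z - 1) * xiFun (-z) * a + (z + 1) * xiFun z * b =
      (z - 1) * (z + 1) * z * completedRiemannZeta (z + 1) * (a + Phi z * b) := by
  obtain ⟨z0, z1, z2, hζ⟩ := hz
  have z3 : z + 1 ≠ 0 := fun h0 => z2 (eq_neg_of_add_eq_zero_left h0)
  have z4 : z + 1 ≠ 1 := fun h0 => z0 (by simpa using h0)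
  have e1 : xiFun (-z) = xiFun (z + 1) := by
    rw [← xiFun_one_sub (-z), sub_neg_eq_add, add_comm]
  rw [e1, xiFun_eq z3 z4, xiFun_eq z0 z1, Phi]
  field_simp
  ring

/-- The cleared functional equation on the complex lines `s₁ + s₂ = κ`, at all points. -/
theorem functionalSolutions_spec {F : ℂ × ℂ → ℂ} (hF : F ∈ functionalSolutions) (κ z : ℂ) :
    (z - 1) * xiFun (-z) * F (spec κ z) + (z + 1) * xiFun z * F (spec κ (-z)) = 0 := by
  obtain ⟨hd, -, he⟩ := hF
  have hs : Differentiable ℂ fun z => F (spec κ z) := hd.comp (differentiable_spec κ)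
  have hs' : Differentiable ℂ fun z => F (spec κ (-z)) := hs.comp differentiable_neg
  have hx' : Differentiable ℂ fun z => xiFun (-z) := differentiable_xiFun.comp differentiable_neg
  have hL : Differentiable ℂ fun z => (z - 1) * xiFun (-z) * F (spec κ z) +
      (z + 1) * xiFun z * F (spec κ (-z)) :=
    (((differentiable_id.sub_const 1).mul hx').mul hs).add
      (((differentiable_id.add_const 1).mul differentiable_xiFun).mul hs')
  have ho : {z : ℂ | 1 < z.re} ∈ nhds (2 : ℂ) :=
    (isOpen_lt continuous_const Complex.continuous_re).mem_nhds (by simp)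
  refine congrFun ((hL.differentiableOn.analyticOnNhd isOpen_univ).eq_of_eventuallyEq (z₀ := 2)
    (g := fun _ => (0 : ℂ)) analyticOnNhd_const ?_) z
  filter_upwards [ho] with z hz
  have hz : 1 < z.re := hz
  have hp := phiRegular_of_one_lt_re hz
  have := he (spec κ z) (by rwa [spec_sub])
  rw [spec_sub] at this
  have e4 : ((spec κ z).2, (spec κ z).1) = spec κ (-z) := by
    simp only [spec, sub_eq_add_neg, neg_neg]
  rw [e4] at this
  change (z - 1) * xiFun (-z) * F (spec κ z) + (z + 1) * xiFun z * F (spec κ (-z)) = 0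
  rw [xiFun_relation hp, this, mul_zero]

/-- For fixed `s₁ + s₂ ∈ iℝ` the product of a solution of the functional equation with the sum over
primitive vectors is an odd entire function of `s₁ - s₂`, decaying in the strip. -/
theorem integral_mul_primSum_eq_zero {h : Form → ℂ} (hh : IsTest h) {κ : ℂ} {F : ℂ × ℂ → ℂ}
    (hF : F ∈ functionalSolutions)
    (hκ : κ.re = 0) : ∫ y : ℝ, F (spec κ (-2 + y * Complex.I)) *
      primSum h (spec κ (-2 + y * Complex.I)) = 0 := by
  have hrel := functionalSolutions_spec hF κ
  obtain ⟨hd, hg, -⟩ := hF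
  set F₀ : ℂ → ℂ := fun z => F (spec κ z) with hF₀
  have hs : Differentiable ℂ F₀ := hd.comp (differentiable_spec κ)
  have hzero : F₀ (-1) = 0 := by
    have := hrel 1
    simp only [sub_self, zero_mul, zero_add, mul_eq_zero] at this
    rcases this with (h0 | h0) | h0
    · norm_num at h0
    · exact absurd h0 (xiFun_ne_zero_of_one_le_re (by simp))
    · exact h0
  -- `F₀` vanishes at `-1`, which cancels the zero at `-1` of the factor `1 - z ^ 2` of `eisEntire`
  set Q : ℂ → ℂ := dslope F₀ (-1) with hQ
  have hQd : Differentiable ℂ Q := by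
    rw [← differentiableOn_univ] at hs ⊢
    exact (Complex.differentiableOn_dslope Filter.univ_mem).2 hs
  have hFQ : ∀ z, F₀ z = (z + 1) * Q z := fun z => by
    have := sub_smul_dslope F₀ (-1) z
    rw [hzero, sub_zero, sub_neg_eq_add, smul_eq_mul] at this
    exact this.symm
  have hx' : Differentiable ℂ fun z => xiFun (-z) := differentiable_xiFun.comp differentiable_neg
  have hQ' : Differentiable ℂ fun z => Q (-z) := hQd.comp differentiable_neg
  have hQrel : ∀ z, xiFun (-z) * Q z = xiFun z * Q (-z) := by
    intro z
    refine congrFun (((hx'.mul hQd).differentiableOn.analyticOnNhd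
      isOpen_univ).eq_of_eventuallyEq (z₀ := 2)
      ((differentiable_xiFun.mul hQ').differentiableOn.analyticOnNhd isOpen_univ) ?_) z
    have ho : {z : ℂ | 1 < z.re} ∈ nhds (2 : ℂ) :=
      (isOpen_lt continuous_const Complex.continuous_re).mem_nhds (by simp)
    filter_upwards [ho] with z hz
    have hz : 1 < z.re := hz
    have z1 : z - 1 ≠ 0 := sub_ne_zero.2 (ne_of_re_ne (by simp; linarith))
    have z3 : z + 1 ≠ 0 := ne_of_re_ne (by simp; linarith)
    have e := hrel z
    have e1 : F (spec κ z) = (z + 1) * Q z := hFQ z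
    have e2 : F (spec κ (-z)) = (-z + 1) * Q (-z) := hFQ (-z)
    rw [e1, e2] at e
    change xiFun (-z) * Q z = xiFun z * Q (-z)
    refine mul_left_cancel₀ (mul_ne_zero z1 z3) ?_
    linear_combination e
  obtain ⟨G, hGd, hGo, hGX⟩ := exists_odd_quotient
    (A := fun z => -(z * Q z * eisEntire hh κ z)) (X := xiFun)
    ((differentiable_id.mul hQd).mul (differentiable_eisEntire hh κ)).neg differentiable_xiFun
    (fun z => by
      rw [eisEntire_neg]
      linear_combination -z * eisEntire hh κ z * hQrel z)
    (fun z => by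
      rcases le_total z.re 0 with hz | hz
      · exact Or.inl (xiFun_ne_zero_of_re_nonpos hz)
      · exact Or.inr (xiFun_ne_zero_of_re_nonpos (by simpa using hz)))
  have hGF : ∀ z : ℂ, z.re < -1 → G z = F₀ z * primSum h (spec κ z) := fun z hz => by
    have hx := xiFun_ne_zero_of_re_nonpos (z := z) (by linarith)
    refine mul_right_cancel₀ hx ?_
    rw [hGX, eisEntire_eq hh κ hz, hFQ, completedRiemannZeta_one_sub,
      xiFun_eq (ne_of_re_ne (by simp; linarith)) (ne_of_re_ne (by simp; linarith))]
    ring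
  obtain ⟨C₁, N, H₁⟩ := hg 1
  obtain ⟨C₂, H₂⟩ := exists_norm_eisGamma_decay hh hκ (N + 1)
  obtain ⟨C₃, hC₃, H₃⟩ := exists_tsum_rpow_le 3
  have hF₁ : ∀ z : ℂ, |z.re| ≤ 2 → ‖F₀ z‖ ≤ |C₁| * (1 + |κ.im| + |z.im|) ^ N := fun z hz => by
    obtain ⟨h1, h2⟩ := abs_le.1 hz
    have r1 : (spec κ z).1.re = z.re / 2 := by simp [spec, hκ]
    have r2 : (spec κ z).2.re = -(z.re / 2) := by simp [spec, hκ]; ring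
    have i1 : |(spec κ z).1.im| ≤ (|κ.im| + |z.im|) / 2 := by
      simp only [spec, Complex.div_ofNat_im, Complex.add_im, abs_div, Nat.abs_ofNat]
      linarith [abs_add_le κ.im z.im]
    have i2 : |(spec κ z).2.im| ≤ (|κ.im| + |z.im|) / 2 := by
      simp only [spec, Complex.div_ofNat_im, Complex.sub_im, abs_div, Nat.abs_ofNat]
      linarith [abs_sub κ.im z.im]
    refine (H₁ (spec κ z) (by rw [r1, abs_le]; constructor <;> linarith)
      (by rw [r2, abs_le]; constructor <;> linarith)).trans ?_
    refine (mul_le_mul_of_nonneg_right (le_abs_self C₁) (by positivity)).trans ?_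
    exact mul_le_mul_of_nonneg_left (pow_le_pow_left₀ (by positivity) (by linarith) N)
      (abs_nonneg _)
  -- the factor `|z.re|` absorbs the pole of the bound for `1 / ζ(1 - z)` at the imaginary axis
  have hleft : ∀ z : ℂ, z.re < 0 → -2 ≤ z.re → 1 ≤ |z.im| →
      |z.re| * ‖G z‖ ≤ |C₁| * (2 + |κ.im|) ^ N * 2 ^ N * |C₂| * Real.pi ^ (3 / 2 : ℝ) * C₃ /
        (1 + z.im ^ 2) := by
    intro z h1 h2 h3
    have hz2 : |z.re| ≤ 2 := abs_le.2 ⟨h2, by linarith⟩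
    have hx := xiFun_ne_zero_of_re_nonpos (z := z) h1.le
    have z0 : z ≠ 0 := ne_of_re_ne (by simp; linarith)
    have z1 : z ≠ 1 := ne_of_re_ne (by simp; linarith)
    have him : z.im ≠ 0 := fun h0 => by
      rw [h0, abs_zero] at h3
      norm_num at h3
    have z2 : z + 1 ≠ 0 := fun h0 => him (by simpa using congrArg Complex.im h0)
    have z3 : z - 1 ≠ 0 := sub_ne_zero.2 z1
    have hΓ : Complex.Gamma ((1 - z) / 2) ≠ 0 := Complex.Gamma_ne_zero_of_re_pos (by
      have e : ((1 - z) / 2).re = (1 - z.re) / 2 := by simp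
      rw [e]
      linarith)
    have hζ : riemannZeta (1 - z) ≠ 0 := riemannZeta_ne_zero_of_one_le_re (by simp; linarith)
    have hp : (Real.pi : ℂ) ^ ((1 - z) / 2) ≠ 0 := by
      rw [Ne, Complex.cpow_eq_zero_iff]
      simp [Real.pi_ne_zero]
    have e : G z = F₀ z * eisGamma hh κ z * (Real.pi : ℂ) ^ ((1 - z) / 2) *
        (riemannZeta (1 - z))⁻¹ * (((z - 1) * (z + 1))⁻¹ * -1) := by
      refine mul_right_cancel₀ hx ?_
      rw [hGX, hFQ, xiFun_eq z0 z1, ← completedRiemannZeta_one_sub,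
        completedRiemannZeta_one_sub_eq (by linarith), eisGamma, Complex.cpow_neg]
      field_simp
    have b1 := hF₁ z hz2
    have b2 := (H₂ z hz2).trans (le_abs_self C₂)
    have b3 : ‖(Real.pi : ℂ) ^ ((1 - z) / 2)‖ ≤ Real.pi ^ (3 / 2 : ℝ) := by
      rw [Complex.norm_cpow_eq_rpow_re_of_pos Real.pi_pos]
      refine Real.rpow_le_rpow_of_exponent_le (by linarith [Real.pi_gt_three]) ?_
      have e : ((1 - z) / 2).re = (1 - z.re) / 2 := by simp
      rw [e]
      linarith
    have b4 : |z.re| * ‖(riemannZeta (1 - z))⁻¹‖ ≤ C₃ := by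
      have r : (1 - z).re = 1 - z.re := by simp
      have := norm_inv_riemannZeta_le (s := 1 - z) (by rw [r]; linarith)
      rw [r] at this
      have h4 := H₃ (1 - z.re) (by linarith) (by linarith)
      rw [abs_of_neg h1]
      have e5 : (1 - z.re - 1) = -z.re := by ring
      rw [e5] at h4
      exact (mul_le_mul_of_nonneg_left this (by linarith)).trans h4
    have b5 : ‖((z - 1) * (z + 1))⁻¹ * -1‖ ≤ 1 := by
      rw [norm_mul, norm_neg, norm_one, mul_one, norm_inv, norm_mul]
      refine inv_le_one_of_one_le₀ ?_
      have h5 := Complex.abs_im_le_norm (z - 1)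
      have h6 := Complex.abs_im_le_norm (z + 1)
      simp only [Complex.sub_im, Complex.add_im, Complex.one_im, sub_zero, add_zero] at h5 h6
      nlinarith
    have b6 : (1 + |κ.im| + |z.im|) ^ N ≤ (2 + |κ.im|) ^ N * 2 ^ N * (1 + z.im ^ 2) ^ N := by
      rw [← mul_pow, ← mul_pow]
      refine pow_le_pow_left₀ (by positivity) ?_ N
      have := abs_nonneg κ.im
      rw [← sq_abs z.im]
      nlinarith [sq_nonneg (|z.im| - 1), mul_nonneg this (sq_nonneg |z.im|)]
    rw [le_div_iff₀ (by positivity), e, norm_mul, norm_mul, norm_mul, norm_mul]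
    calc |z.re| * (‖F₀ z‖ * ‖eisGamma hh κ z‖ * ‖(Real.pi : ℂ) ^ ((1 - z) / 2)‖ *
          ‖(riemannZeta (1 - z))⁻¹‖ * ‖((z - 1) * (z + 1))⁻¹ * -1‖) * (1 + z.im ^ 2)
        = ‖F₀ z‖ * ((1 + z.im ^ 2) * ‖eisGamma hh κ z‖) * ‖(Real.pi : ℂ) ^ ((1 - z) / 2)‖ *
          (|z.re| * ‖(riemannZeta (1 - z))⁻¹‖) * ‖((z - 1) * (z + 1))⁻¹ * -1‖ := by ring
      _ ≤ |C₁| * ((2 + |κ.im|) ^ N * 2 ^ N * (1 + z.im ^ 2) ^ N) *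
          ((1 + z.im ^ 2) * ‖eisGamma hh κ z‖) * Real.pi ^ (3 / 2 : ℝ) * C₃ * 1 := by
          have b1' := b1.trans (mul_le_mul_of_nonneg_left b6 (abs_nonneg C₁))
          gcongr
      _ = |C₁| * (2 + |κ.im|) ^ N * 2 ^ N * ((1 + z.im ^ 2) ^ (N + 1) * ‖eisGamma hh κ z‖) *
          Real.pi ^ (3 / 2 : ℝ) * C₃ := by ring
      _ ≤ _ := by gcongr
  obtain ⟨C, hC, HC⟩ := exists_norm_le_of_abs_re_mul_norm_le hGd
    (K := |C₁| * (2 + |κ.im|) ^ N * 2 ^ N * |C₂| * Real.pi ^ (3 / 2 : ℝ) * C₃) (fun z h1 h2 => by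
      obtain ⟨h3, h4⟩ := abs_le.1 h1
      rcases lt_trichotomy z.re 0 with h0 | h0 | h0
      · exact hleft z h0 h3 h2
      · rw [h0, abs_zero, zero_mul]
        positivity
      · have := hleft (-z) (by simpa using h0) (by simpa using h4) (by simpa using h2)
        simpa [hGo] using this)
  have := integral_eq_zero_of_odd hGd hGo HC
  rw [← this]
  congr 1
  funext y
  exact (hGF _ (by simp)).symm

end

theorem integrable_comp_logPlane {G : LogPlane → ℂ} (hG : Integrable G) :
    Integrable fun p : ℝ × ℝ => G !₂[p.1, p.2] := by
  have h1 := (EuclideanSpace.volume_preserving_symm_measurableEquiv_toLp (Fin 2)).symm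
  have h2 := (volume_preserving_finTwoArrow ℝ).symm
  exact ((h2.trans h1).integrable_comp hG.aestronglyMeasurable).2 hG

theorem one_add_norm_sq_le_imSize_convPlane (ξ : LogPlane) :
    1 + ‖ξ‖ ^ 2 ≤ imSize (convPlane ξ) := by
  have := one_add_norm_sq_le_imSize_vert (A := 0) (s := (((-1 : ℝ) : ℂ), ((1 : ℝ) : ℂ)))
    (by simp) (by simp) ξ
  simpa [convPlane] using this

theorem continuous_primSum_convPlane (h : 𝓓(posForms, ℂ)) :
    Continuous fun ξ => primSum h (convPlane ξ) := by
  obtain ⟨C, hC, H⟩ := exists_norm_formInt_decay (isTest_testFunction h) 0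
  refine continuous_tsum (fun v => continuous_formInt_vert v h _)
    ((summable_primVec (b := 3 / 2) (by norm_num)).mul_left C) fun v ξ => ?_
  obtain ⟨h1, h2⟩ := convPlane_re ξ
  have := H _ h1 h2 _ _ v.ne_zero
  rwa [pow_zero, one_mul] at this

theorem integrable_mul_primSum {F : ℂ × ℂ → ℂ} (hc : Continuous F) (hg : HasVerticalPolyGrowth F)
    (h : 𝓓(posForms, ℂ)) : Integrable fun ξ => F (convPlane ξ) * primSum h (convPlane ξ) := by
  obtain ⟨C, N, hC, H⟩ := hg.exists_imSize 1
  obtain ⟨D, hD, H'⟩ := exists_norm_primSum_decay (isTest_testFunction h) (N + 2)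
  refine (integrable_one_add_norm_sq_inv_sq.const_mul (C * D)).mono'
    ((hc.comp (continuous_vert _)).mul (continuous_primSum_convPlane h)).aestronglyMeasurable
    (Filter.Eventually.of_forall fun ξ => ?_)
  obtain ⟨h1, h2⟩ := convPlane_re ξ
  have hI := imSize_pos (convPlane ξ)
  have b1 := H (convPlane ξ) (by rw [h1]; norm_num) (by rw [h2]; norm_num)
  have b2 := H' (convPlane ξ) h1 h2
  have b3 : (1 + ‖ξ‖ ^ 2) ^ 2 ≤ imSize (convPlane ξ) ^ 2 :=
    pow_le_pow_left₀ (by positivity) (one_add_norm_sq_le_imSize_convPlane ξ) 2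
  rw [← div_eq_mul_inv, le_div_iff₀ (by positivity), norm_mul]
  calc ‖F (convPlane ξ)‖ * ‖primSum h (convPlane ξ)‖ * (1 + ‖ξ‖ ^ 2) ^ 2
      ≤ (C * imSize (convPlane ξ) ^ N) * ‖primSum h (convPlane ξ)‖ * imSize (convPlane ξ) ^ 2 := by
        gcongr
    _ = C * (imSize (convPlane ξ) ^ (N + 2) * ‖primSum h (convPlane ξ)‖) := by ring
    _ ≤ C * D := mul_le_mul_of_nonneg_left b2 hC

/-- A distribution whose Mellin transform satisfies the functional equation lies in the kernel: the
plane `Re s = (-1, 1)` is fibred by the lines on which `s₁ + s₂` is constant. -/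
theorem extHall_eq_zero {f : 𝓢'(LogPlane, ℂ)} {F : ℂ × ℂ → ℂ} (hF : IsMellinTransform f F)
    (hs : F ∈ functionalSolutions) (h : 𝓓(posForms, ℂ)) : extHall f h = 0 := by
  have hc := hs.1.continuous
  rw [extHall_eq hF hc hs.2.1 h]
  have hi := integrable_comp_logPlane (integrable_mul_primSum hc hs.2.1 h)
  set G : ℝ × ℝ → ℂ := fun p => F (convPlane !₂[p.1, p.2]) * primSum h (convPlane !₂[p.1, p.2])
    with hG
  have hsh := measurePreserving_prod_neg_add_swap (volume : Measure ℝ) (volume : Measure ℝ)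
  have hi' : Integrable (fun z : ℝ × ℝ => G (z.2, -z.2 + z.1)) (volume.prod volume) :=
    hsh.integrable_comp_of_integrable hi
  have e : ∫ z : ℝ × ℝ, G (z.2, -z.2 + z.1) = ∫ p, G p := by
    have := integral_map hsh.measurable.aemeasurable (f := G)
      (by rw [hsh.map_eq]; exact hi.aestronglyMeasurable)
    rw [hsh.map_eq] at this
    exact this.symm
  rw [integral_logPlane]
  change 1 / 8 * ∫ p, G p = 0
  rw [← e]
  have e2 : ∫ z : ℝ × ℝ, G (z.2, -z.2 + z.1) = ∫ t : ℝ, ∫ p : ℝ, G (p, -p + t) :=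
    integral_prod _ hi'
  rw [e2]
  have e3 : ∀ t : ℝ, ∫ p : ℝ, G (p, -p + t) = 0 := by
    intro t
    set κ : ℂ := -(2 * (Real.pi : ℂ) * Complex.I * t)
    have hκ : κ.re = 0 := by simp [κ]
    let g : ℝ → ℂ := fun y => F (spec κ (-2 + y * Complex.I)) *
      primSum h (spec κ (-2 + y * Complex.I))
    have hg : ∀ p : ℝ, G (p, -p + t) = g (2 * Real.pi * t - 4 * Real.pi * p) := by
      intro p
      have : convPlane !₂[p, -p + t] =
          spec κ (-2 + ((2 * Real.pi * t - 4 * Real.pi * p : ℝ) : ℂ) * Complex.I) := by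
        refine Prod.ext ?_ ?_
        · simp [convPlane, vert, spec, κ]
          ring
        · simp [convPlane, vert, spec, κ]
          ring
      simp only [hG, g]
      rw [this]
    simp only [hg]
    rw [Measure.integral_comp_mul_left (fun x => g (2 * Real.pi * t - x)) (4 * Real.pi),
      integral_sub_left_eq_self g volume (2 * Real.pi * t)]
    have := integral_mul_primSum_eq_zero (isTest_testFunction h) hs hκ
    rw [show ∫ y, g y = 0 from this, smul_zero]
  simp [e3]

/-! ### An Euler integral and a smooth partition of unity -/

theorem sqrt_pi_div {t : ℝ} (ht : 0 < t) : √(Real.pi / t) = √Real.pi * t ^ (-(1 / 2) : ℝ) := by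
  rw [Real.sqrt_div Real.pi_pos.le, Real.rpow_neg ht.le, ← Real.sqrt_eq_rpow, div_eq_mul_inv]

/-- The beta integral in terms of Gamma functions: write `Γ(w) (1 + v²)^(-w)` as a Laplace integral
and integrate the Gaussian in `v` first. -/
theorem Gamma_mul_integral_one_add_sq {w : ℂ} (hw : 1 / 2 < w.re) :
    Complex.Gamma w * ∫ v : ℝ, Complex.exp (-w * Real.log (1 + v ^ 2)) =
      √Real.pi * Complex.Gamma (w - 1 / 2) := by
  let f : ℝ × ℝ → ℂ := fun p => (p.1 : ℂ) ^ (w - 1) * Real.exp (-p.1) *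
    (Real.exp (-p.1 * p.2 ^ 2) : ℂ)
  have hw2 : 0 < (w - 1 / 2).re := by
    have : (w - 1 / 2).re = w.re - 1 / 2 := by simp
    linarith
  have hf : Integrable f ((volume.restrict (Ioi (0 : ℝ))).prod volume) := by
    have hm : Measurable f := by
      have h1 : Measurable fun p : ℝ × ℝ => (p.1 : ℂ) ^ (w - 1) := by fun_prop
      exact (h1.mul (by fun_prop)).mul (by fun_prop)
    rw [integrable_prod_iff hm.aestronglyMeasurable]
    constructor
    · refine (ae_restrict_iff' measurableSet_Ioi).2 (Filter.Eventually.of_forall fun t ht => ?_)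
      have : Integrable fun v : ℝ => (Real.exp (-t * v ^ 2) : ℂ) :=
        (integrable_exp_neg_mul_sq ht).ofReal
      exact this.const_mul ((t : ℂ) ^ (w - 1) * Real.exp (-t))
    · refine IntegrableOn.congr_fun ((Real.GammaIntegral_convergent hw2).mul_const √Real.pi)
        (fun t ht => ?_) measurableSet_Ioi
      have ht : 0 < t := ht
      have e : ∀ v : ℝ, ‖f (t, v)‖ =
          t ^ (w.re - 1) * Real.exp (-t) * Real.exp (-t * v ^ 2) := fun v => by
        simp only [f, norm_mul, Complex.norm_cpow_eq_rpow_re_of_pos ht, Complex.norm_real,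
          Real.norm_of_nonneg (Real.exp_pos _).le]
        simp
      simp only [e]
      rw [integral_const_mul, integral_gaussian, sqrt_pi_div ht]
      have e2 : (w - 1 / 2).re - 1 = (w.re - 1) + -(1 / 2) := by
        simp
        ring
      rw [e2, Real.rpow_add ht]
      ring
  have hswap := integral_integral_swap (f := fun t v => f (t, v)) hf
  have e1 : ∀ v : ℝ, ∫ t in Ioi (0 : ℝ), f (t, v) =
      Complex.Gamma w * Complex.exp (-w * Real.log (1 + v ^ 2)) := fun v => by
    have hr : 0 < 1 + v ^ 2 := by positivity
    have := Complex.integral_cpow_mul_exp_neg_mul_Ioi (a := w) (r := 1 + v ^ 2) (by linarith) hr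
    have e : (1 / ((1 + v ^ 2 : ℝ) : ℂ)) ^ w = Complex.exp (-w * Real.log (1 + v ^ 2)) := by
      rw [one_div, ← Complex.ofReal_inv, Complex.cpow_def_of_ne_zero
        (Complex.ofReal_ne_zero.2 (inv_pos.2 hr).ne'), ← Complex.ofReal_log (inv_pos.2 hr).le,
        Real.log_inv]
      congr 1
      push_cast
      ring
    rw [e] at this
    rw [mul_comm, ← this]
    refine setIntegral_congr_fun measurableSet_Ioi fun t ht => ?_
    simp only [f]
    rw [mul_assoc, ← Complex.ofReal_mul, ← Real.exp_add, Complex.ofReal_exp]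
    congr 2
    push_cast
    ring
  have e2 : ∀ t ∈ Ioi (0 : ℝ), ∫ v : ℝ, f (t, v) =
      √Real.pi * ((Real.exp (-t) : ℂ) * (t : ℂ) ^ (w - 1 / 2 - 1)) := fun t ht => by
    have ht : 0 < t := ht
    simp only [f]
    rw [integral_const_mul, integral_complex_ofReal, integral_gaussian, sqrt_pi_div ht,
      show w - 1 / 2 - 1 = (w - 1) + ((-(1 / 2) : ℝ) : ℂ) by push_cast; ring,
      Complex.cpow_add _ _ (Complex.ofReal_ne_zero.2 ht.ne'), ← Complex.ofReal_cpow ht.le]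
    push_cast
    ring
  rw [Complex.Gamma_eq_integral hw2, Complex.GammaIntegral, ← integral_const_mul,
    ← integral_const_mul, ← setIntegral_congr_fun measurableSet_Ioi e2]
  rw [hswap]
  exact integral_congr_ae (Filter.Eventually.of_forall fun v => (e1 v).symm)

/-- A telescoping sum: `a` is `1` far to the left and `0` far to the right. -/
theorem hasSum_sub_shift {a : ℤ → ℝ} {L U : ℤ} (hL : ∀ m ≤ L, a m = 1) (hU : ∀ m, U ≤ m → a m = 0)
    (n : ℕ) : HasSum (fun m => a (m - n) - a m) n := by
  -- `c` is the Heaviside sequence; `d` has finite support, and its contribution cancels.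
  let c : ℤ → ℝ := fun m => if m < 0 then 1 else 0
  let d : ℤ → ℝ := fun m => a m - c m
  have hd : Summable d := by
    refine summable_of_ne_finset_zero (s := Finset.Icc (min L (-1)) (max U 0)) fun m hm => ?_
    rw [Finset.mem_Icc, not_and_or, not_le, not_le] at hm
    simp only [d, c]
    rcases hm with hm | hm
    · rw [hL m (by omega), if_pos (by omega), sub_self]
    · rw [hU m (by omega), if_neg (by omega), sub_self]
  have h1 : HasSum (fun m : ℤ => d (m - n)) (∑' m, d m) :=
    (Equiv.hasSum_iff (Equiv.subRight (n : ℤ)) (f := d)).2 hd.hasSum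
  have h2 : HasSum (fun m : ℤ => c (m - n) - c m) n := by
    have e : ∀ m ∉ Finset.Ico (0 : ℤ) n, c (m - n) - c m = 0 := fun m hm => by
      rw [Finset.mem_Ico, not_and_or, not_le, not_lt] at hm
      simp only [c]
      rcases hm with hm | hm
      · rw [if_pos (by omega), if_pos (by omega), sub_self]
      · rw [if_neg (by omega), if_neg (by omega), sub_self]
    have e' : ∑ m ∈ Finset.Ico (0 : ℤ) n, (c (m - n) - c m) = n := by
      have : ∀ m ∈ Finset.Ico (0 : ℤ) n, c (m - n) - c m = 1 := fun m hm => by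
        rw [Finset.mem_Ico] at hm
        simp only [c]
        rw [if_pos (by omega), if_neg (by omega), sub_zero]
      rw [Finset.sum_congr rfl this, Finset.sum_const, Int.card_Ico]
      simp
    rw [← e']
    exact hasSum_sum_of_ne_finset_zero e
  have := (h1.sub hd.hasSum).add h2
  rw [sub_self, zero_add] at this
  exact this.congr_fun fun m => by simp only [d]; ring

/-- A smooth function with compact support whose integral translates add up to `1`. -/
def unitBump (t : ℝ) : ℝ := Real.smoothTransition (t + 1) - Real.smoothTransition t

theorem contDiff_unitBump : ContDiff ℝ ∞ unitBump := by
  unfold unitBump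
  exact (Real.smoothTransition.contDiff.comp (contDiff_id.add contDiff_const)).sub
    Real.smoothTransition.contDiff

theorem unitBump_eq_zero {t : ℝ} (ht : t ∉ Icc (-1 : ℝ) 1) : unitBump t = 0 := by
  rw [unitBump]
  rcases lt_or_ge t (-1) with h | h
  · rw [Real.smoothTransition.zero_of_nonpos (by linarith),
      Real.smoothTransition.zero_of_nonpos (by linarith), sub_self]
  · have h1 : 1 < t := by
      by_contra! hc
      exact ht ⟨h, hc⟩
    rw [Real.smoothTransition.one_of_one_le (by linarith),
      Real.smoothTransition.one_of_one_le (by linarith), sub_self]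

theorem hasCompactSupport_unitBump : HasCompactSupport unitBump :=
  HasCompactSupport.intro isCompact_Icc fun _ => unitBump_eq_zero

/-- Along `ℤ / n` the translates of the bump add up to the constant `n`. -/
theorem hasSum_unitBump {n : ℕ} (hn : 0 < n) (t : ℝ) :
    HasSum (fun m : ℤ => unitBump (t - m / n)) n := by
  have hn' : (0 : ℝ) < n := by exact_mod_cast hn
  have := hasSum_sub_shift (a := fun m : ℤ => Real.smoothTransition (t - m / n))
    (L := ⌊(t - 1) * n⌋) (U := ⌈t * n⌉) (fun m hm => ?_) (fun m hm => ?_) n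
  · convert! this using 1
    funext m
    rw [unitBump]
    congr 2
    push_cast
    field_simp
    ring
  · refine Real.smoothTransition.one_of_one_le ?_
    have h1 : (m : ℝ) ≤ (t - 1) * n := Int.le_floor.1 hm
    have := (div_le_iff₀ hn').2 h1
    linarith
  · refine Real.smoothTransition.zero_of_nonpos ?_
    have h1 : t * n ≤ m := Int.ceil_le.1 hm
    have := (le_div_iff₀ hn').2 h1
    linarith

theorem integral_unitBump : ∫ t, unitBump t = 1 := by
  have hi : Integrable unitBump :=
    contDiff_unitBump.continuous.integrable_of_hasCompactSupport hasCompactSupport_unitBump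
  have h1 : ∫ t, unitBump t = ∫ t in (-1 : ℝ)..1, unitBump t := by
    rw [intervalIntegral.integral_of_le (by norm_num), ← integral_Icc_eq_integral_Ioc]
    exact (setIntegral_eq_integral_of_forall_compl_eq_zero fun t ht => unitBump_eq_zero ht).symm
  have hc := Real.smoothTransition.continuous
  have hii : ∀ a b : ℝ, IntervalIntegrable Real.smoothTransition volume a b :=
    fun a b => hc.intervalIntegrable a b
  rw [h1]
  unfold unitBump
  rw [intervalIntegral.integral_sub (Continuous.intervalIntegrable (by fun_prop) _ _) (hii _ _),
    intervalIntegral.integral_comp_add_right (fun t => Real.smoothTransition t)]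
  have h2 : ∫ t in (-1 : ℝ) + 1..1 + 1, Real.smoothTransition t =
      (∫ t in (0 : ℝ)..1, Real.smoothTransition t) + 1 := by
    norm_num
    rw [← intervalIntegral.integral_add_adjacent_intervals (hii 0 1) (hii 1 2)]
    congr 1
    rw [intervalIntegral.integral_congr (g := fun _ => (1 : ℝ)) fun t ht => ?_]
    · norm_num
    · rw [uIcc_of_le (by norm_num)] at ht
      exact Real.smoothTransition.one_of_one_le ht.1
  have h3 : ∫ t in (-1 : ℝ)..1, Real.smoothTransition t = ∫ t in (0 : ℝ)..1,
    Real.smoothTransition t := by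
    rw [← intervalIntegral.integral_add_adjacent_intervals (hii (-1) 0) (hii 0 1),
      intervalIntegral.integral_congr (g := fun _ => (0 : ℝ)) fun t ht => ?_]
    · simp
    · rw [uIcc_of_le (by norm_num)] at ht
      exact Real.smoothTransition.zero_of_nonpos ht.2
  rw [h2, h3]
  ring

/-! ### Test functions with prescribed constant term -/

/-- The primitive vector `(1, 0)`. -/
def firstVec : PrimVec := ⟨(1, 0), isCoprime_one_left⟩

theorem fibreForm_firstVec (y : LogPlane × ℝ) : fibreForm firstVec y =
    (Real.exp (-2 * y.1 0), Real.exp (-2 * y.1 0) * y.2,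
      Real.exp (-2 * y.1 0) * y.2 ^ 2 + Real.exp (-2 * y.1 1)) := by
  simp [fibreForm, firstVec]

theorem fibreCoord_firstVec (q : Form) : fibreCoord firstVec q =
    (!₂[-Real.log q.1 / 2, (Real.log q.1 - Real.log q.disc) / 2], q.2.1 / q.1) := by
  simp [fibreCoord, firstVec, Form.eval]

theorem contDiffAt_fibreCoord_firstVec {q : Form} (hq : q ∈ posForms) :
    ContDiffAt ℝ ∞ (fibreCoord firstVec) q := by
  have e : fibreCoord firstVec = fun q => (!₂[-Real.log q.1 / 2,
    (Real.log q.1 - Real.log q.disc) / 2], q.2.1 / q.1) := funext fibreCoord_firstVec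
  rw [e]
  have h1 : ContDiffAt ℝ ∞ (fun q : Form => Real.log q.1) q := contDiffAt_fst.log hq.1.ne'
  have h2 : ContDiffAt ℝ ∞ (fun q : Form => Real.log q.disc) q :=
    contDiff_disc.contDiffAt.log (ne_of_gt hq.2)
  refine ContDiffAt.prodMk ?_ ?_
  · refine (contDiffAt_piLp 2).2 fun i => ?_
    fin_cases i
    · exact h1.neg.div_const 2
    · exact (h1.sub h2).div_const 2
  · exact (contDiffAt_snd.fst).div contDiffAt_fst hq.1.ne'

section

variable {ψ : LogPlane → ℂ} (hψ : ContDiff ℝ ∞ ψ) (hc : HasCompactSupport ψ)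

/-- The function on the space of forms that is, in the fibre coordinates of `(1, 0)`, the product
of a function of the two degrees and a bump function along the fibre. -/
def fibreProd (y : LogPlane × ℝ) : ℂ :=
  ψ y.1 * (Real.exp ((y.1 0 - y.1 1) / 2) * unitBump y.2 : ℝ)

include hψ in
theorem contDiff_fibreProd : ContDiff ℝ ∞ (fibreProd (ψ := ψ)) := by
  unfold fibreProd
  refine (hψ.comp contDiff_fst).mul (Complex.ofRealCLM.contDiff.comp ?_)
  refine ContDiff.mul ?_ (contDiff_unitBump.comp contDiff_snd)
  fun_prop

include hc in
theorem hasCompactSupport_fibreProd : HasCompactSupport (fibreProd (ψ := ψ)) := by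
  refine HasCompactSupport.intro (hc.isCompact.prod (isCompact_Icc (a := (-1 : ℝ)) (b := 1)))
    fun y hy => ?_
  rw [mem_prod, not_and_or] at hy
  rcases hy with hy | hy
  · simp [fibreProd, image_eq_zero_of_notMem_tsupport hy]
  · simp [fibreProd, unitBump_eq_zero hy]

open Classical in
/-- The test function on the space of forms given by `fibreProd`. -/
def fibreTest : 𝓓(posForms, ℂ) :=
  let f : Form → ℂ := fun q => if q ∈ posForms then fibreProd (ψ := ψ) (fibreCoord firstVec q) else
    0
  let K : Set Form := fibreForm firstVec '' tsupport (fibreProd (ψ := ψ))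
  have hK : IsCompact K := (hasCompactSupport_fibreProd hc).isCompact.image
    (contDiff_fibreForm firstVec).continuous
  have hKp : K ⊆ posForms := by
    rintro _ ⟨y, -, rfl⟩
    exact fibreForm_mem firstVec y
  have hf : ∀ q ∉ K, f q = 0 := fun q hq => by
    by_cases hp : q ∈ posForms
    · simp only [f, if_pos hp]
      by_contra hne
      exact hq ⟨fibreCoord firstVec q, subset_tsupport _ hne, fibreForm_fibreCoord firstVec hp⟩
    · simp only [f, if_neg hp]
  { toFun := f
    contDiff' := by
      refine contDiff_iff_contDiffAt.2 fun q => ?_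
      by_cases hp : q ∈ posForms
      · have h1 : ContDiffAt ℝ ∞ (fun q => fibreProd (ψ := ψ) (fibreCoord firstVec q)) q :=
          (contDiff_fibreProd hψ).contDiffAt.comp q (contDiffAt_fibreCoord_firstVec hp)
        refine h1.congr_of_eventuallyEq ?_
        filter_upwards [posForms.isOpen.mem_nhds hp] with q' hq'
        exact if_pos hq'
      · have h1 : f =ᶠ[nhds q] fun _ => 0 := by
          filter_upwards [hK.isClosed.isOpen_compl.mem_nhds fun hq => hp (hKp hq)] with q' hq'
          exact hf q' hq'
        exact contDiffAt_const.congr_of_eventuallyEq h1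
    hasCompactSupport' := HasCompactSupport.intro hK hf
    tsupport_subset' := (closure_minimal (fun q hq => by
      by_contra hn
      exact hq (hf q hn)) hK.isClosed).trans hKp }

open Classical in
theorem fibreTest_fibreForm (y : LogPlane × ℝ) :
    fibreTest hψ hc (fibreForm firstVec y) = fibreProd (ψ := ψ) y := by
  change (if fibreForm firstVec y ∈ posForms then _ else _) = _
  rw [if_pos (fibreForm_mem firstVec y), fibreCoord_fibreForm]

theorem fibreIntegral_fibreTest : fibreIntegral firstVec (fibreTest hψ hc) = ψ := by
  funext x
  simp only [fibreIntegral, fibreTest_fibreForm, fibreProd]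
  rw [integral_const_mul, integral_complex_ofReal, integral_const_mul, integral_unitBump, mul_one,
    mul_left_comm _ (ψ x), mul_left_comm _ (ψ x), ← Complex.ofReal_mul, ← Complex.ofReal_mul,
    ← Real.exp_add, ← Real.exp_add, ← Real.exp_add, ← Real.exp_add]
  rw [show x 0 / 2 + -x 1 / 2 + (-x 0 + x 1 + (x 0 - x 1) / 2) = 0 by ring]
  simp

theorem formInt_fibreTest_firstVec (s : ℂ × ℂ) :
    formInt 1 0 (fibreTest hψ hc) s = 4 * Lap ψ s := by
  have := lap_fibreIntegral firstVec (fibreTest hψ hc) s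
  rw [fibreIntegral_fibreTest] at this
  rw [this]
  simp [firstVec]

/-- The contribution of the vector `(0, 1)` without the factor along the fibre. -/
def fibreKernel (s : ℂ × ℂ) (p : ℝ × ℝ × ℝ) : ℂ :=
  4 * Real.exp (-4 * p.1 - 2 * p.2.1) * (ψ !₂[p.1, p.2.1] * Real.exp ((p.1 - p.2.1) / 2)) *
    zetaKernel 0 1 s (fibreParam firstVec p)

/-- A unipotent change of basis translates the fibre coordinate. -/
theorem zetaKernel_shift (s : ℂ × ℂ) (a x y u : ℝ) :
    zetaKernel a 1 s (fibreParam firstVec (x, y, u)) =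
      zetaKernel 0 1 s (fibreParam firstVec (x, y, u + a)) := by
  have e : (fibreParam firstVec (x, y, u)).eval a 1 =
      (fibreParam firstVec (x, y, u + a)).eval 0 1 := by
    simp only [fibreParam, fibreForm_firstVec, Form.eval]
    ring
  rw [zetaKernel, zetaKernel, e, fibreParam, fibreParam, fibreForm_disc, fibreForm_disc]

theorem formInt_fibreTest (s : ℂ × ℂ) (a : ℝ) : formInt a 1 (fibreTest hψ hc) s =
    ∫ p : ℝ × ℝ × ℝ, fibreKernel (ψ := ψ) s p * unitBump (p.2.2 - a) := by
  have hh := isTest_testFunction (fibreTest hψ hc)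
  rw [formInt, ← hh.setIntegral, setIntegral_posForms firstVec,
    ← integral_add_right_eq_self (fun p : ℝ × ℝ × ℝ =>
      fibreKernel (ψ := ψ) s p * unitBump (p.2.2 - a)) ((0, 0, a) : ℝ × ℝ × ℝ)]
  refine integral_congr_ae (Filter.Eventually.of_forall fun p => ?_)
  obtain ⟨x, y, u⟩ := p
  simp only [Prod.mk_add_mk, add_zero, add_sub_cancel_right]
  rw [zetaKernel_shift, fibreKernel, fibreParam, fibreTest_fibreForm, fibreProd, Complex.real_smul]
  simp only [fibreParam, Matrix.cons_val_zero, Matrix.cons_val_one]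
  push_cast
  ring

/-- The beta integral `∫ (1 + v²)^{-w} dv`. -/
def betaInt (w : ℂ) : ℂ := ∫ v : ℝ, Complex.exp (-w * Real.log (1 + v ^ 2))

theorem integrable_betaInt {w : ℂ} (hw : 1 / 2 < w.re) :
    Integrable fun v : ℝ => Complex.exp (-w * Real.log (1 + v ^ 2)) := by
  have h := integrable_rpow_neg_one_add_norm_sq (E := ℝ) (μ := volume) (r := 2 * w.re)
    (by simp; linarith)
  refine h.mono' (Measurable.aestronglyMeasurable (by fun_prop))
    (Filter.Eventually.of_forall fun v => ?_)
  have hv : 0 < 1 + v ^ 2 := by positivity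
  rw [Complex.norm_exp, Complex.re_mul_ofReal, Complex.neg_re, Real.norm_eq_abs, sq_abs,
    Real.rpow_def_of_pos hv]
  refine le_of_eq (congrArg Real.exp ?_)
  ring

/-- The factor of `fibreKernel` that depends on the two degrees only. -/
def fibreWeight (s : ℂ × ℂ) (p : ℝ × ℝ) : ℂ :=
  4 * ψ !₂[p.1, p.2] * Complex.exp ((-7 / 2 - 2 * expDisc s) * p.1 +
    (-5 / 2 - 2 * expDisc s + 2 * expVal s) * p.2)

theorem fibreKernel_eq (s : ℂ × ℂ) (p : ℝ × ℝ × ℝ) : fibreKernel (ψ := ψ) s p =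
    fibreWeight (ψ := ψ) s (p.1, p.2.1) *
      Complex.exp (-expVal s * Real.log (1 + (Real.exp (p.2.1 - p.1) * p.2.2) ^ 2)) := by
  obtain ⟨x, y, u⟩ := p
  have e1 : (fibreParam firstVec (x, y, u)).eval 0 1 =
      Real.exp (-2 * y) * (1 + (Real.exp (y - x) * u) ^ 2) := by
    simp only [fibreParam, fibreForm_firstVec, Form.eval, Matrix.cons_val_zero,
      Matrix.cons_val_one]
    rw [mul_pow, ← Real.exp_nat_mul, mul_add, ← mul_assoc (Real.exp (-2 * y)), ← Real.exp_add,
      show -2 * y + (2 : ℕ) * (y - x) = -2 * x by push_cast; ring]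
    ring
  have e2 : (fibreParam firstVec (x, y, u)).disc = Real.exp (-2 * x + -2 * y) := by
    rw [fibreParam, fibreForm_disc, Real.exp_add]
    simp
  have hp : 0 < 1 + (Real.exp (y - x) * u) ^ 2 := by positivity
  rw [fibreKernel, zetaKernel, e1, e2, Real.log_exp, Real.log_mul (Real.exp_pos _).ne' hp.ne',
    Real.log_exp, fibreWeight]
  simp only [Complex.ofReal_exp]
  generalize Real.log (1 + (Real.exp (y - x) * u) ^ 2) = l
  rw [show ∀ a b c d : ℂ, 4 * a * (b * c) * d = 4 * b * (a * c * d) by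
    intros; ring, mul_assoc (4 * _),
    ← Complex.exp_add, ← Complex.exp_add, ← Complex.exp_add]
  congr 2
  push_cast
  ring

include hψ hc in
theorem integrable_fibreWeight (s : ℂ × ℂ) :
    Integrable fun p : ℝ × ℝ => fibreWeight (ψ := ψ) s p * Complex.exp (p.1 - p.2) := by
  refine Continuous.integrable_of_hasCompactSupport ?_ ?_
  · have : Continuous fun p : ℝ × ℝ => ψ !₂[p.1, p.2] := by
      refine hψ.continuous.comp ((PiLp.continuous_toLp 2 _).comp (continuous_pi fun i => ?_))
      fin_cases i
      · exact continuous_fst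
      · exact continuous_snd
    unfold fibreWeight
    fun_prop
  · refine HasCompactSupport.intro (hc.isCompact.image
      (f := fun x : LogPlane => (x 0, x 1)) (by fun_prop)) fun p hp => ?_
    have : ψ !₂[p.1, p.2] = 0 := by
      by_contra hne
      exact hp ⟨!₂[p.1, p.2], subset_tsupport ψ hne, rfl⟩
    simp [fibreWeight, this]

include hψ in
theorem continuous_fibreKernel (s : ℂ × ℂ) : Continuous (fibreKernel (ψ := ψ) s) := by
  have h1 : Continuous fun p : ℝ × ℝ × ℝ => ψ !₂[p.1, p.2.1] := by
    refine hψ.continuous.comp ((PiLp.continuous_toLp 2 _).comp (continuous_pi fun i => ?_))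
    fin_cases i
    · exact continuous_fst
    · exact continuous_snd.fst
  rw [show fibreKernel (ψ := ψ) s = _ from funext (fibreKernel_eq s)]
  unfold fibreWeight
  have h2 : Continuous fun p : ℝ × ℝ × ℝ =>
      Real.log (1 + (Real.exp (p.2.1 - p.1) * p.2.2) ^ 2) :=
    Continuous.log (by fun_prop) fun p => by positivity
  fun_prop

theorem integral_comp_exp_mul (D : ℝ → ℂ) (p : ℝ × ℝ) :
    ∫ u : ℝ, D (Real.exp (p.2 - p.1) * u) = Complex.exp (p.1 - p.2) * ∫ v, D v := by
  rw [Measure.integral_comp_mul_left, abs_of_pos (inv_pos.2 (Real.exp_pos _)), ← Real.exp_neg,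
    Complex.real_smul]
  push_cast
  congr 2
  ring

include hψ hc in
theorem integrable_fibreKernel_assoc {s : ℂ × ℂ} (hs : 1 / 2 < (expVal s).re) :
    Integrable fun y : (ℝ × ℝ) × ℝ => fibreKernel (ψ := ψ) s (y.1.1, y.1.2, y.2) := by
  have hcont : Continuous fun y : (ℝ × ℝ) × ℝ => fibreKernel (ψ := ψ) s (y.1.1, y.1.2, y.2) :=
    (continuous_fibreKernel hψ s).comp (by fun_prop)
  have hb := integrable_betaInt hs
  refine (integrable_prod_iff hcont.aestronglyMeasurable).2
    ⟨Filter.Eventually.of_forall fun p => ?_, ?_⟩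
  · simp only [fibreKernel_eq]
    exact (hb.comp_mul_left' (Real.exp_pos (p.2 - p.1)).ne').const_mul _
  · simp only [fibreKernel_eq, norm_mul]
    refine ((integrable_fibreWeight hψ hc s).norm.mul_const
      (∫ v : ℝ, ‖Complex.exp (-expVal s * Real.log (1 + v ^ 2))‖)).congr
      (Filter.Eventually.of_forall fun p => ?_)
    simp only
    rw [integral_const_mul, norm_mul, mul_assoc]
    congr 1
    rw [Measure.integral_comp_mul_left
      (fun v : ℝ => ‖Complex.exp (-expVal s * Real.log (1 + v ^ 2))‖),
      abs_of_pos (inv_pos.2 (Real.exp_pos _)), ← Real.exp_neg, smul_eq_mul, neg_sub,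
      ← Complex.ofReal_sub, Complex.norm_exp_ofReal]

include hψ hc in
theorem integrable_fibreKernel {s : ℂ × ℂ} (hs : 1 / 2 < (expVal s).re) :
    Integrable (fibreKernel (ψ := ψ) s) := by
  have h := integrable_fibreKernel_assoc hψ hc hs
  exact ((volume_preserving_prodAssoc (α₁ := ℝ) (β₁ := ℝ) (γ₁ := ℝ)).integrable_comp
    (continuous_fibreKernel hψ s).aestronglyMeasurable).1 h

include hψ hc in
/-- The integral over the whole fibre produces the beta integral and exchanges the two degrees. -/
theorem integral_fibreKernel {s : ℂ × ℂ} (hs : 1 / 2 < (expVal s).re) :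
    ∫ p, fibreKernel (ψ := ψ) s p = 4 * betaInt (expVal s) * Lap ψ (s.2, s.1) := by
  rw [← (volume_preserving_prodAssoc (α₁ := ℝ) (β₁ := ℝ) (γ₁ := ℝ)).integral_comp']
  refine (integral_prod _ (integrable_fibreKernel_assoc hψ hc hs)).trans ?_
  rw [Lap, integral_logPlane, ← integral_const_mul]
  refine integral_congr_ae (Filter.Eventually.of_forall fun p => ?_)
  simp only [fibreKernel_eq]
  rw [integral_const_mul, integral_comp_exp_mul
    (fun v => Complex.exp (-expVal s * Real.log (1 + v ^ 2))), ← betaInt, fibreWeight, character]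
  rw [show ∀ a b c d : ℂ, 4 * a * b * (c * d) = 4 * d * (a * (b * c)) by intros; ring,
    ← Complex.exp_add]
  congr 3
  simp only [expVal, expDisc, Matrix.cons_val_zero, Matrix.cons_val_one,
    Prod.neg_mk]
  ring

end

/-! ### The constant term of the sum over primitive vectors -/

theorem unitBump_nonneg (t : ℝ) : 0 ≤ unitBump t :=
  sub_nonneg.2 (Real.smoothTransition.monotone (by linarith))

section

variable {ψ : LogPlane → ℂ} (hψ : ContDiff ℝ ∞ ψ) (hc : HasCompactSupport ψ)

/-- The translates of the bump function along the fibres add up to a constant, so the sum over a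
row of the lattice unfolds to the integral over whole fibres. -/
theorem hasSum_formInt_row {s : ℂ × ℂ} (hs : 1 / 2 < (expVal s).re) {n : ℕ} (hn : 0 < n) :
    HasSum (fun m : ℤ => formInt m n (fibreTest hψ hc) s)
      (n * ((n : ℂ) ^ (2 * expVal s))⁻¹ * (4 * betaInt (expVal s) * Lap ψ (s.2, s.1))) := by
  have hh := isTest_testFunction (fibreTest hψ hc)
  have hn' : (0 : ℝ) < n := by exact_mod_cast hn
  have hi := integrable_fibreKernel hψ hc hs
  have h1 : HasSum (fun m : ℤ => ∫ p : ℝ × ℝ × ℝ, fibreKernel (ψ := ψ) s p *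
      unitBump (p.2.2 - m / n)) (∫ p, fibreKernel (ψ := ψ) s p * n) := by
    refine hasSum_integral_of_dominated_convergence
      (fun m p => ‖fibreKernel (ψ := ψ) s p‖ * unitBump (p.2.2 - m / n)) (fun m => ?_) (fun m => ?_)
      (Filter.Eventually.of_forall fun p => ((hasSum_unitBump hn p.2.2).summable.mul_left _))
      ?_ (Filter.Eventually.of_forall fun p => ?_)
    · refine hi.aestronglyMeasurable.mul (Continuous.aestronglyMeasurable ?_)
      exact Complex.continuous_ofReal.comp (contDiff_unitBump.continuous.comp (by fun_prop))
    · refine Filter.Eventually.of_forall fun p => ?_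
      rw [norm_mul, Complex.norm_real, Real.norm_of_nonneg (unitBump_nonneg _)]
    · refine (hi.norm.mul_const (n : ℝ)).congr (Filter.Eventually.of_forall fun p => ?_)
      exact (((hasSum_unitBump hn p.2.2).mul_left _).tsum_eq).symm
    · refine HasSum.mul_left _ ?_
      have := Complex.hasSum_ofReal.2 (hasSum_unitBump hn p.2.2)
      simpa using this
  rw [integral_mul_const, integral_fibreKernel hψ hc hs] at h1
  have h2 := h1.mul_left (((n : ℂ) ^ (2 * expVal s))⁻¹)
  have e : ∀ m : ℤ, formInt m n (fibreTest hψ hc) s = ((n : ℂ) ^ (2 * expVal s))⁻¹ *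
      ∫ p : ℝ × ℝ × ℝ, fibreKernel (ψ := ψ) s p * unitBump (p.2.2 - m / n) := fun m => by
    rw [← formInt_fibreTest hψ hc]
    have := formInt_smul hh hn' (m := m / n) (n := 1) (by simp) s
    rw [mul_div_cancel₀ _ hn'.ne', mul_one] at this
    simpa using this
  rw [show (fun m : ℤ => formInt m n (fibreTest hψ hc) s) = _ from funext e]
  convert! h2 using 1
  ring

theorem formInt_neg (m n : ℝ) (h : Form → ℂ) (s : ℂ × ℂ) :
    formInt (-m) (-n) h s = formInt m n h s := by
  simp [formInt, zetaKernel, Form.eval]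

theorem riemannZeta_eq_tsum_pnat {w : ℂ} (hw : 1 < w.re) :
    riemannZeta w = ∑' d : ℕ+, ((d : ℂ) ^ w)⁻¹ := by
  have h0 : w ≠ 0 := ne_of_re_ne (by simp; linarith)
  rw [zeta_eq_tsum_one_div_nat_cpow hw,
    ← tsum_zero_pnat_eq_tsum_nat (Complex.summable_one_div_nat_cpow.2 hw)]
  simp [Complex.zero_cpow h0]

/-- The sum over all nonzero vectors of the lattice, row by row. -/
theorem riemannZeta_mul_primSum {s : ℂ × ℂ} (hs : 1 < (expVal s).re) :
    riemannZeta (2 * expVal s) * primSum (fibreTest hψ hc) s =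
      8 * (riemannZeta (2 * expVal s) * Lap ψ s +
        riemannZeta (2 * expVal s - 1) * betaInt (expVal s) * Lap ψ (s.2, s.1)) := by
  have hh := isTest_testFunction (fibreTest hψ hc)
  have hs2 : 1 < (2 * expVal s).re := by
    have : (2 * expVal s).re = 2 * (expVal s).re := by simp
    linarith
  have hs3 : 1 < (2 * expVal s - 1).re := by
    have : (2 * expVal s - 1).re = 2 * (expVal s).re - 1 := by simp
    linarith
  rw [← tsum_lattice hh s hs]
  -- `a` extends the terms of the sum by zero to the zero vector.
  let a : ℤ × ℤ → ℂ := indicator {v | v ≠ 0} fun v => formInt v.1 v.2 (fibreTest hψ hc) s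
  have ha : ∑' v : {v : ℤ × ℤ // v ≠ 0}, formInt v.1.1 v.1.2 (fibreTest hψ hc) s = ∑' v, a v :=
    tsum_subtype {v : ℤ × ℤ | v ≠ 0} fun v => formInt v.1 v.2 (fibreTest hψ hc) s
  have a0 : a 0 = 0 := indicator_of_notMem (show (0 : ℤ × ℤ) ∉ {v : ℤ × ℤ | v ≠ 0} from fun h =>
    h rfl) _
  have a1 : ∀ v, v ≠ 0 → a v = formInt v.1 v.2 (fibreTest hψ hc) s := fun v hv =>
    indicator_of_mem (show v ∈ {v : ℤ × ℤ | v ≠ 0} from hv) _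
  have hsum : Summable a := by
    obtain ⟨C, hC, H⟩ := exists_norm_formInt_le hh (expDisc s).re (b := (expVal s).re) (by linarith)
    refine Summable.of_norm_bounded ((summable_sq_add_sq_rpow hs).mul_left C) fun v => ?_
    by_cases hv : v = 0
    · rw [hv, a0, norm_zero]
      positivity
    · rw [a1 v hv]
      exact H s rfl rfl _ _ (intCast_ne_zero hv)
  have hswap : Summable fun p : ℤ × ℤ => a (p.2, p.1) := (Equiv.prodComm ℤ ℤ).summable_iff.2 hsum
  have hrow : ∀ n : ℕ+, ∑' m : ℤ, a (m, n) = ((n : ℂ) ^ (2 * expVal s - 1))⁻¹ *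
      (4 * betaInt (expVal s) * Lap ψ (s.2, s.1)) := fun n => by
    have hn : (n : ℂ) ≠ 0 := by exact_mod_cast n.ne_zero
    have h1 := (hasSum_formInt_row hψ hc (s := s) (by linarith) n.pos).tsum_eq
    rw [Complex.cpow_sub _ _ hn, Complex.cpow_one, inv_div, div_eq_mul_inv, ← h1]
    refine tsum_congr fun m => ?_
    rw [a1 (m, (n : ℤ)) fun h0 => by
      have := congrArg Prod.snd h0
      simp at this]
    simp
  -- the multiples of `(1, 0)` give the first term, the other rows the second
  have hzero : ∑' m : ℤ, a (m, 0) = 8 * (riemannZeta (2 * expVal s) * Lap ψ s) := by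
    have hs0 : Summable fun m : ℤ => a (m, 0) := hsum.comp_injective fun x y h => by simpa using h
    have heven : Function.Even fun m : ℤ => a (m, 0) := fun m => by
      by_cases hm : m = 0
      · simp [hm]
      · simp only
        rw [a1 (m, 0) (by simpa using hm), a1 (-m, 0) (by simpa using hm)]
        have := formInt_neg m 0 (fibreTest hψ hc) s
        simpa using this
    rw [tsum_int_eq_zero_add_two_mul_tsum_pnat heven hs0, riemannZeta_eq_tsum_pnat hs2]
    have h0 : a (0, 0) = 0 := a0
    have h1 : ∀ d : ℕ+, a (d, 0) = ((d : ℂ) ^ (2 * expVal s))⁻¹ * (4 * Lap ψ s) := fun d => by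
      have hd : (0 : ℝ) < (d : ℕ) := by exact_mod_cast d.pos
      have := formInt_smul hh hd (m := 1) (n := 0) (by simp) s
      rw [mul_one, mul_zero, formInt_fibreTest_firstVec] at this
      rw [a1 ((d : ℤ), 0) (by simp)]
      simpa using this
    rw [h0]
    simp only [h1]
    rw [tsum_mul_right]
    ring
  rw [ha, ← (Equiv.prodComm ℤ ℤ).tsum_eq]
  change ∑' p : ℤ × ℤ, a (p.2, p.1) = _
  rw [hswap.tsum_prod]
  simp only
  have heven : Function.Even fun n : ℤ => ∑' m : ℤ, a (m, n) := fun n => by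
    refine ((Equiv.neg ℤ).tsum_eq fun m => a (m, -n)).symm.trans (tsum_congr fun m => ?_)
    change a (-m, -n) = a (m, n)
    by_cases hm : (m, n) = 0
    · have : (-m, -n) = (0 : ℤ × ℤ) := by simpa using hm
      rw [hm, this]
    · rw [a1 (m, n) hm, a1 (-m, -n) (by simpa using hm)]
      have := formInt_neg m n (fibreTest hψ hc) s
      simpa using this
  rw [tsum_int_eq_zero_add_two_mul_tsum_pnat heven hswap.prod, hzero]
  simp only [hrow]
  rw [tsum_mul_right, ← riemannZeta_eq_tsum_pnat hs3]
  ring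

end

/-- The quotient of zeta functions in the functional equation. -/
theorem Phi_eq {z : ℂ} (hz : 1 < z.re) : riemannZeta z * betaInt ((z + 1) / 2) =
    Phi z * riemannZeta (z + 1) := by
  have z0 : z ≠ 0 := ne_of_re_ne (by simp; linarith)
  have z1 : z + 1 ≠ 0 := ne_of_re_ne (by simp; linarith)
  have hpi : (Real.pi : ℂ) ≠ 0 := Complex.ofReal_ne_zero.2 Real.pi_ne_zero
  have hw : 1 / 2 < ((z + 1) / 2).re := by
    have : ((z + 1) / 2).re = (z.re + 1) / 2 := by simp
    linarith
  have hb := Gamma_mul_integral_one_add_sq hw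
  rw [← betaInt, show (z + 1) / 2 - 1 / 2 = z / 2 by ring] at hb
  have hΓ : Complex.Gamma ((z + 1) / 2) ≠ 0 := Complex.Gamma_ne_zero_of_re_pos (by linarith)
  have hG1 : Complex.Gammaℝ z ≠ 0 := Complex.Gammaℝ_ne_zero_of_re_pos (by linarith)
  have hG2 : Complex.Gammaℝ (z + 1) ≠ 0 :=
    Complex.Gammaℝ_ne_zero_of_re_pos (by simp; linarith)
  have hζ : riemannZeta (z + 1) ≠ 0 := riemannZeta_ne_zero_of_one_le_re (by simp; linarith)
  have e1 : completedRiemannZeta z = Complex.Gammaℝ z * riemannZeta z := by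
    rw [riemannZeta_def_of_ne_zero z0, mul_div_cancel₀ _ hG1]
  have e2 : completedRiemannZeta (z + 1) = Complex.Gammaℝ (z + 1) * riemannZeta (z + 1) := by
    rw [riemannZeta_def_of_ne_zero z1, mul_div_cancel₀ _ hG2]
  have hbeta : betaInt ((z + 1) / 2) = Complex.Gammaℝ z / Complex.Gammaℝ (z + 1) := by
    rw [eq_div_iff hG2, Complex.Gammaℝ, Complex.Gammaℝ, mul_left_comm,
      mul_comm (betaInt _), hb, Real.sqrt_eq_rpow, Complex.ofReal_cpow Real.pi_pos.le, ← mul_assoc,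
      ← Complex.cpow_add _ _ hpi]
    congr 2
    push_cast
    ring
  rw [hbeta, Phi, e1, e2]
  field_simp

/-- The sum over primitive vectors for the test functions that are products in fibre coordinates. -/
theorem primSum_fibreTest {ψ : LogPlane → ℂ} (hψ : ContDiff ℝ ∞ ψ) (hc : HasCompactSupport ψ)
    {s : ℂ × ℂ} (hs : (s.1 - s.2).re < -1) : primSum (fibreTest hψ hc) s =
      8 * (Lap ψ s + Phi (s.2 - s.1) * Lap ψ (s.2, s.1)) := by
  have e : (s.2 - s.1).re = -(s.1 - s.2).re := by simp
  have hz : 1 < (s.2 - s.1).re := by linarith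
  have hw : 1 < (expVal s).re := by
    have : (expVal s).re = (1 - (s.1 - s.2).re) / 2 := by simp [expVal]
    linarith
  have h1 := riemannZeta_mul_primSum hψ hc hw
  have e1 : 2 * expVal s = (s.2 - s.1) + 1 := by
    simp only [expVal]
    ring
  have e2 : expVal s = ((s.2 - s.1) + 1) / 2 := by rw [← e1]; ring
  have hζ : riemannZeta (s.2 - s.1 + 1) ≠ 0 :=
    riemannZeta_ne_zero_of_one_le_re (by rw [Complex.add_re, Complex.one_re]; linarith)
  rw [e1, add_sub_cancel_right, e2, Phi_eq hz] at h1
  refine mul_left_cancel₀ hζ ?_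
  rw [h1]
  ring

/-! ### The kernel satisfies the functional equation -/

/-- Interchange of the two coordinates. -/
def coordSwap : LogPlane ≃ₗᵢ[ℝ] LogPlane :=
  LinearIsometryEquiv.piLpCongrLeft 2 ℝ ℝ (Equiv.swap 0 1)

theorem coordSwap_apply (ξ : LogPlane) :
    coordSwap ξ 0 = ξ 1 ∧ coordSwap ξ 1 = ξ 0 := by
  constructor <;> simp [coordSwap, LinearIsometryEquiv.piLpCongrLeft_apply]

theorem vert_coordSwap (a b : ℂ) (ξ : LogPlane) :
    vert (a, b) (coordSwap ξ) = ((vert (b, a) ξ).2, (vert (b, a) ξ).1) := by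
  simp [vert, coordSwap_apply]

theorem HasVerticalPolyGrowth.comp_swap {F : ℂ × ℂ → ℂ} (hF : HasVerticalPolyGrowth F) :
    HasVerticalPolyGrowth fun s => F (s.2, s.1) := fun R => by
  obtain ⟨C, N, h⟩ := hF R
  refine ⟨C, N, fun s h1 h2 => (h (s.2, s.1) h2 h1).trans_eq ?_⟩
  rw [add_right_comm]

theorem HasPolyGrowth.add {K L : LogPlane → ℂ} (hK : HasPolyGrowth K) (hL : HasPolyGrowth L) :
    HasPolyGrowth fun ξ => K ξ + L ξ := by
  obtain ⟨C, N, h⟩ := hK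
  obtain ⟨D, M, h'⟩ := hL
  refine ⟨|C| + |D|, max N M, fun ξ => (norm_add_le _ _).trans ?_⟩
  have h1 : (1 : ℝ) ≤ 1 + ‖ξ‖ := by linarith [norm_nonneg ξ]
  rw [add_mul]
  refine add_le_add ((h ξ).trans ?_) ((h' ξ).trans ?_)
  · exact mul_le_mul (le_abs_self C) (pow_le_pow_right₀ h1 (le_max_left _ _)) (by positivity)
      (abs_nonneg C)
  · exact mul_le_mul (le_abs_self D) (pow_le_pow_right₀ h1 (le_max_right _ _)) (by positivity)
      (abs_nonneg D)

theorem HasPolyGrowth.bounded_mul {K m : LogPlane → ℂ} (hK : HasPolyGrowth K) {B : ℝ}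
    (hm : ∀ ξ, ‖m ξ‖ ≤ B) : HasPolyGrowth fun ξ => m ξ * K ξ := by
  obtain ⟨C, N, h⟩ := hK
  refine ⟨B * C, N, fun ξ => ?_⟩
  rw [norm_mul, mul_assoc]
  exact mul_le_mul (hm ξ) (h ξ) (norm_nonneg _) ((norm_nonneg _).trans (hm 0))

/-- `Φ` is bounded on vertical lines to the right of `1`. -/
theorem exists_norm_Phi_le {σ : ℝ} (hσ : 1 < σ) : ∃ B, ∀ z : ℂ, z.re = σ → ‖Phi z‖ ≤ B := by
  refine ⟨(∑' n : ℕ, 1 / (n : ℝ) ^ σ) *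
    (∫ v : ℝ, Real.exp (-((σ + 1) / 2) * Real.log (1 + v ^ 2))) *
    ∑' n : ℕ, 1 / (n : ℝ) ^ (σ + 1), fun z hz => ?_⟩
  have e1 : (z + 1).re = σ + 1 := by simp [hz]
  have hζ : riemannZeta (z + 1) ≠ 0 := riemannZeta_ne_zero_of_one_le_re (by rw [e1]; linarith)
  have e : Phi z = riemannZeta z * betaInt ((z + 1) / 2) * (riemannZeta (z + 1))⁻¹ := by
    rw [Phi_eq (by rwa [hz]), mul_inv_cancel_right₀ hζ]
  have h1 := norm_riemannZeta_le (s := z) (by rwa [hz])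
  have h2 := norm_inv_riemannZeta_le (s := z + 1) (by rw [e1]; linarith)
  have h3 : ‖betaInt ((z + 1) / 2)‖ ≤
      ∫ v : ℝ, Real.exp (-((σ + 1) / 2) * Real.log (1 + v ^ 2)) := by
    refine (norm_integral_le_integral_norm _).trans_eq ?_
    refine integral_congr_ae (Filter.Eventually.of_forall fun v => ?_)
    simp only
    rw [Complex.norm_exp, Complex.re_mul_ofReal, Complex.neg_re, Complex.div_ofNat_re, e1]
  rw [hz] at h1
  rw [e1] at h2
  rw [e, norm_mul, norm_mul]
  have := norm_nonneg (riemannZeta z)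
  have := norm_nonneg (betaInt ((z + 1) / 2))
  gcongr

theorem continuousAt_Phi {z : ℂ} (hz : PhiRegular z) : ContinuousAt Phi z := by
  obtain ⟨z0, z1, z2, hζ⟩ := hz
  have z3 : z + 1 ≠ 0 := fun h0 => z2 (eq_neg_of_add_eq_zero_left h0)
  have z4 : z + 1 ≠ 1 := fun h0 => z0 (by simpa using h0)
  have h1 := (differentiableAt_completedZeta z0 z1).continuousAt
  have h2 : ContinuousAt (fun z => completedRiemannZeta (z + 1)) z :=
    ContinuousAt.comp (g := completedRiemannZeta) (f := fun z : ℂ => z + 1)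
      (differentiableAt_completedZeta z3 z4).continuousAt (by fun_prop)
  exact h1.div h2 hζ

/-- The vertical plane `Re s = (1, -1)`, the mirror image of `convPlane`. -/
def mirrorPlane (ξ : LogPlane) : ℂ × ℂ := vert (((1 : ℝ) : ℂ), ((-1 : ℝ) : ℂ)) ξ

theorem convPlane_coordSwap (ξ : LogPlane) :
    convPlane (coordSwap ξ) = ((mirrorPlane ξ).2, (mirrorPlane ξ).1) := vert_coordSwap _ _ ξ

theorem mirrorPlane_sub_re (ξ : LogPlane) : ((mirrorPlane ξ).1 - (mirrorPlane ξ).2).re = 2 := by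
  rw [Complex.sub_re, mirrorPlane, (vert_re _ ξ).1, (vert_re _ ξ).2, Complex.ofReal_re,
    Complex.ofReal_re]
  norm_num

theorem continuous_Phi_mirrorPlane :
    Continuous fun ξ => Phi ((mirrorPlane ξ).1 - (mirrorPlane ξ).2) := by
  have hc : Continuous fun ξ => (mirrorPlane ξ).1 - (mirrorPlane ξ).2 :=
    (continuous_vert _).fst.sub (continuous_vert _).snd
  refine continuous_iff_continuousAt.2 fun ξ => ?_
  exact ContinuousAt.comp (g := Phi) (f := fun ξ => (mirrorPlane ξ).1 - (mirrorPlane ξ).2)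
    (continuousAt_Phi (phiRegular_of_one_lt_re (by rw [mirrorPlane_sub_re]; norm_num)))
    hc.continuousAt

/-- The left side of the functional equation of a function in the kernel, paired with the Laplace
transform of a test function on the plane `Re s = (1, -1)`. -/
theorem integral_functional_mul_lap {f : 𝓢'(LogPlane, ℂ)} {F : ℂ × ℂ → ℂ}
    (hF : IsMellinTransform f F) (hd : Differentiable ℂ F) (hg : HasVerticalPolyGrowth F)
    (hz : ∀ h : 𝓓(posForms, ℂ), extHall f h = 0) {B : ℝ}
    (hB : ∀ z : ℂ, z.re = 2 → ‖Phi z‖ ≤ B)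
    {ψ : LogPlane → ℂ} (hψ : ContDiff ℝ ∞ ψ) (hc : HasCompactSupport ψ) :
    ∫ ξ, (F (mirrorPlane ξ) + Phi ((mirrorPlane ξ).1 - (mirrorPlane ξ).2) *
      F ((mirrorPlane ξ).2, (mirrorPlane ξ).1)) * Lap ψ (mirrorPlane ξ) = 0 := by
  set s₀ : ℂ × ℂ := (((1 : ℝ) : ℂ), ((-1 : ℝ) : ℂ))
  set s₁ : ℂ × ℂ := (((-1 : ℝ) : ℂ), ((1 : ℝ) : ℂ))
  have hint : ∀ (K : LogPlane → ℂ) (s : ℂ × ℂ), Continuous K → HasPolyGrowth K →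
      Integrable fun ξ => K ξ * Lap ψ (vert s ξ) := fun K s h1 h2 => by
    simp only [lap_vert hψ hc]
    exact h2.integrable_mul h1 _
  have i1 : Integrable fun ξ => F (convPlane ξ) * Lap ψ (convPlane ξ) :=
    hint _ s₁ (hd.continuous.comp (continuous_vert s₁)) (hg.hasPolyGrowth_vert s₁)
  have i2 : Integrable fun ξ => F (mirrorPlane ξ) * Lap ψ (mirrorPlane ξ) :=
    hint _ s₀ (hd.continuous.comp (continuous_vert s₀)) (hg.hasPolyGrowth_vert s₀)
  have i3 : Integrable fun ξ => Phi ((mirrorPlane ξ).1 - (mirrorPlane ξ).2) *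
      F ((mirrorPlane ξ).2, (mirrorPlane ξ).1) * Lap ψ (mirrorPlane ξ) :=
    hint _ s₀ (continuous_Phi_mirrorPlane.mul (hd.continuous.comp
      ((continuous_vert s₀).snd.prodMk (continuous_vert s₀).fst)))
      ((hg.comp_swap.hasPolyGrowth_vert s₀).bounded_mul
        fun ξ => hB _ (mirrorPlane_sub_re ξ))
  set G : LogPlane → ℂ := fun ξ => F (convPlane ξ) *
    (Phi ((convPlane ξ).2 - (convPlane ξ).1) * Lap ψ ((convPlane ξ).2, (convPlane ξ).1)) with hG
  have eG : ∀ ξ, G (coordSwap ξ) = Phi ((mirrorPlane ξ).1 - (mirrorPlane ξ).2) *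
      F ((mirrorPlane ξ).2, (mirrorPlane ξ).1) * Lap ψ (mirrorPlane ξ) := fun ξ => by
    simp only [hG, convPlane_coordSwap]
    ring
  have hemb := coordSwap.toHomeomorph.measurableEmbedding
  have hmp : MeasurePreserving coordSwap := coordSwap.measurePreserving
  have i4 : Integrable G := (hmp.integrable_comp_emb hemb).1 (i3.congr
    (Filter.Eventually.of_forall fun ξ => (eG ξ).symm))
  have e1 : ∫ ξ, G ξ = ∫ ξ, Phi ((mirrorPlane ξ).1 - (mirrorPlane ξ).2) *
      F ((mirrorPlane ξ).2, (mirrorPlane ξ).1) * Lap ψ (mirrorPlane ξ) := by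
    rw [← hmp.integral_comp hemb G]
    exact integral_congr_ae (Filter.Eventually.of_forall eG)
  have e2 : ∫ ξ, F (convPlane ξ) * Lap ψ (convPlane ξ) =
      ∫ ξ, F (mirrorPlane ξ) * Lap ψ (mirrorPlane ξ) :=
    integral_vert_eq (H := fun s => F s * Lap ψ s) (hd.mul (differentiable_lap hψ.continuous hc))
      (exists_norm_mul_lap_le hg hψ hc) s₁ s₀
  have e3 := hz (fibreTest hψ hc)
  rw [extHall_eq hF hd.continuous hg] at e3
  have e4 : ∀ ξ, F (convPlane ξ) * primSum (fibreTest hψ hc) (convPlane ξ) =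
      8 * (F (convPlane ξ) * Lap ψ (convPlane ξ) + G ξ) := fun ξ => by
    obtain ⟨h1, h2⟩ := convPlane_re ξ
    rw [primSum_fibreTest hψ hc (by rw [Complex.sub_re, h1, h2]; norm_num)]
    simp only [hG]
    ring
  simp only [e4] at e3
  rw [integral_const_mul, integral_add i1 i4, e1, e2, ← integral_add i2 i3] at e3
  simp only [add_mul]
  simpa using e3

/-- The functional equation on the plane `Re s = (1, -1)`. -/
theorem functional_mirrorPlane {f : 𝓢'(LogPlane, ℂ)} {F : ℂ × ℂ → ℂ}
    (hF : IsMellinTransform f F) (hd : Differentiable ℂ F) (hg : HasVerticalPolyGrowth F)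
    (hz : ∀ h : 𝓓(posForms, ℂ), extHall f h = 0) (ξ : LogPlane) :
    F (mirrorPlane ξ) + Phi ((mirrorPlane ξ).1 - (mirrorPlane ξ).2) *
      F ((mirrorPlane ξ).2, (mirrorPlane ξ).1) = 0 := by
  obtain ⟨B, hB⟩ := exists_norm_Phi_le (σ := 2) (by norm_num)
  set s₀ : ℂ × ℂ := (((1 : ℝ) : ℂ), ((-1 : ℝ) : ℂ))
  refine congrFun (eq_zero_of_forall_integral_mul_fourierInv
    (K := fun ξ => F (mirrorPlane ξ) + Phi ((mirrorPlane ξ).1 - (mirrorPlane ξ).2) *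
      F ((mirrorPlane ξ).2, (mirrorPlane ξ).1)) ?_ ?_ fun φ hφ => ?_) ξ
  · exact (hd.continuous.comp (continuous_vert s₀)).add (continuous_Phi_mirrorPlane.mul
      (hd.continuous.comp ((continuous_vert s₀).snd.prodMk (continuous_vert s₀).fst)))
  · exact (hg.hasPolyGrowth_vert s₀).add ((hg.comp_swap.hasPolyGrowth_vert s₀).bounded_mul
      fun ξ => hB _ (mirrorPlane_sub_re ξ))
  · have hψ : ContDiff ℝ ∞ fun x => character s₀ x * φ x :=
      (contDiff_character s₀).mul (φ.smooth ⊤)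
    have hc := HasCompactSupport.character_mul hφ s₀
    have e : twistTest s₀ hψ hc = φ := by
      ext x
      change character (-s₀) x * (character s₀ x * φ x) = φ x
      rw [← mul_assoc, ← character_add, neg_add_cancel, character_zero, one_mul]
    have eL : ∀ ξ, Lap (fun x => character s₀ x * φ x) (mirrorPlane ξ) = 𝓕⁻ φ ξ := fun ξ => by
      refine (lap_vert hψ hc s₀ ξ).trans ?_
      rw [e]
    have := integral_functional_mul_lap hF hd hg hz hB hψ hc
    simpa only [eL] using this

/-- An entire function that vanishes on a vertical plane is zero. -/
theorem eq_zero_of_vertical {R : ℂ × ℂ → ℂ} (hR : Differentiable ℂ R) {s₀ : ℂ × ℂ}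
    (h : ∀ ξ, R (vert s₀ ξ) = 0) : R = 0 := by
  have hpi : (Real.pi : ℂ) ≠ 0 := Complex.ofReal_ne_zero.2 Real.pi_ne_zero
  have key : ∀ (g : ℂ → ℂ), Differentiable ℂ g → ∀ a : ℂ,
      (∀ x : ℝ, g (a - 2 * (Real.pi : ℂ) * Complex.I * x) = 0) → ∀ z, g z = 0 := by
    intro g hg a ha z
    refine congrFun ((hg.differentiableOn.analyticOnNhd isOpen_univ).eq_of_frequently_eq (z₀ := a)
      (g := fun _ => (0 : ℂ)) analyticOnNhd_const ?_) z
    have ht : Filter.Tendsto (fun x : ℝ => a - 2 * (Real.pi : ℂ) * Complex.I * x)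
        (nhdsWithin 0 {0}ᶜ) (nhdsWithin a {a}ᶜ) := by
      refine tendsto_nhdsWithin_iff.2 ⟨?_, ?_⟩
      · have : Continuous fun x : ℝ => a - 2 * (Real.pi : ℂ) * Complex.I * x := by fun_prop
        have := this.tendsto 0
        simp only [Complex.ofReal_zero, mul_zero, sub_zero] at this
        exact this.mono_left nhdsWithin_le_nhds
      · filter_upwards [self_mem_nhdsWithin] with x hx
        have hx : x ≠ 0 := hx
        simp [hpi, hx]
    exact ht.frequently (Filter.Frequently.of_forall ha)
  have h1 : ∀ (z : ℂ) (y : ℝ), R (z, s₀.2 - 2 * (Real.pi : ℂ) * Complex.I * y) = 0 := by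
    intro z y
    refine key (fun z => R (z, _)) (hR.comp (by fun_prop)) s₀.1 (fun x => ?_) z
    simpa [vert] using h !₂[x, y]
  funext s
  exact key (fun w => R (s.1, w)) (hR.comp (by fun_prop)) s₀.2 (fun y => h1 s.1 y) s.2

/-- The Mellin transform of a distribution in the kernel satisfies the functional equation. -/
theorem mem_functionalSolutions {f : 𝓢'(LogPlane, ℂ)} {F : ℂ × ℂ → ℂ}
    (hF : IsMellinTransform f F) (hd : Differentiable ℂ F) (hg : HasVerticalPolyGrowth F)
    (hz : ∀ h : 𝓓(posForms, ℂ), extHall f h = 0) : F ∈ functionalSolutions := by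
  refine ⟨hd, hg, fun s hs => ?_⟩
  -- the functional equation with its denominators cleared is an identity of entire functions
  set R : ℂ × ℂ → ℂ := fun s => (s.1 - s.2 - 1) * xiFun (-(s.1 - s.2)) * F s +
    (s.1 - s.2 + 1) * xiFun (s.1 - s.2) * F (s.2, s.1) with hR
  have hRd : Differentiable ℂ R := by
    have hs : Differentiable ℂ fun s : ℂ × ℂ => s.1 - s.2 := by fun_prop
    have h1 : Differentiable ℂ fun s : ℂ × ℂ => xiFun (-(s.1 - s.2)) :=
      differentiable_xiFun.comp hs.neg
    have h2 : Differentiable ℂ fun s : ℂ × ℂ => xiFun (s.1 - s.2) := differentiable_xiFun.comp hs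
    have h3 : Differentiable ℂ fun s : ℂ × ℂ => F (s.2, s.1) :=
      hd.comp (differentiable_snd.prodMk differentiable_fst)
    exact (((hs.sub_const 1).mul h1).mul hd).add (((hs.add_const 1).mul h2).mul h3)
  have h0 : R = 0 := eq_zero_of_vertical hRd (s₀ := (((1 : ℝ) : ℂ), ((-1 : ℝ) : ℂ))) fun ξ => by
    change R (mirrorPlane ξ) = 0
    simp only [hR]
    rw [xiFun_relation (phiRegular_of_one_lt_re (by rw [mirrorPlane_sub_re]; norm_num)),
      functional_mirrorPlane hF hd hg hz, mul_zero]
  have h1 := congrFun h0 s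
  simp only [hR, Pi.zero_apply] at h1
  rw [xiFun_relation hs] at h1
  obtain ⟨z0, z1, z2, hζ⟩ := hs
  refine (mul_eq_zero.1 h1).resolve_left (mul_ne_zero (mul_ne_zero (mul_ne_zero ?_ ?_) z0) hζ)
  · exact sub_ne_zero.2 z1
  · exact fun h => z2 (eq_neg_of_add_eq_zero_left h)

/-! ### The Mellin transform as a linear isomorphism -/

theorem IsTwist.add {f₁ f₂ g₁ g₂ : 𝓢'(LogPlane, ℂ)} {s : ℂ × ℂ} (h₁ : IsTwist f₁ s g₁)
    (h₂ : IsTwist f₂ s g₂) : IsTwist (f₁ + f₂) s (g₁ + g₂) := fun φ ψ hφ hψ => by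
  change g₁ φ + g₂ φ = f₁ ψ + f₂ ψ
  rw [h₁ φ ψ hφ hψ, h₂ φ ψ hφ hψ]

theorem IsTwist.smul {f g : 𝓢'(LogPlane, ℂ)} {s : ℂ × ℂ} (h : IsTwist f s g) (c : ℂ) :
    IsTwist (c • f) s (c • g) := fun φ ψ hφ hψ => by
  change c • g φ = c • f ψ
  rw [h φ ψ hφ hψ]

theorem IsMellinTransform.add {f₁ f₂ : 𝓢'(LogPlane, ℂ)} {F₁ F₂ : ℂ × ℂ → ℂ}
    (h₁ : IsMellinTransform f₁ F₁) (h₂ : IsMellinTransform f₂ F₂) (c₁ : Continuous F₁)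
    (c₂ : Continuous F₂) (p₁ : HasVerticalPolyGrowth F₁) (p₂ : HasVerticalPolyGrowth F₂) :
    IsMellinTransform (f₁ + f₂) (F₁ + F₂) := fun σ => by
  obtain ⟨g₁, t₁, e₁⟩ := h₁ σ
  obtain ⟨g₂, t₂, e₂⟩ := h₂ σ
  refine ⟨g₁ + g₂, t₁.add t₂, fun φ => ?_⟩
  have i₁ := (p₁.hasPolyGrowth_vert (σ.1, σ.2)).integrable_mul (c₁.comp (continuous_vert _)) φ
  have i₂ := (p₂.hasPolyGrowth_vert (σ.1, σ.2)).integrable_mul (c₂.comp (continuous_vert _)) φ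
  have e₁ := e₁ φ
  have e₂ := e₂ φ
  rw [TemperedDistribution.fourier_apply] at e₁ e₂ ⊢
  change g₁ (𝓕 φ) + g₂ (𝓕 φ) = _
  rw [e₁, e₂]
  refine (integral_add i₁ i₂).symm.trans (integral_congr_ae
    (Filter.Eventually.of_forall fun ξ => ?_))
  exact (add_mul _ _ _).symm

theorem IsMellinTransform.smul {f : 𝓢'(LogPlane, ℂ)} {F : ℂ × ℂ → ℂ}
    (h : IsMellinTransform f F) (c : ℂ) : IsMellinTransform (c • f) (c • F) := fun σ => by
  obtain ⟨g, t, e⟩ := h σ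
  refine ⟨c • g, t.smul c, fun φ => ?_⟩
  have e := e φ
  rw [TemperedDistribution.fourier_apply] at e ⊢
  change c • g (𝓕 φ) = _
  rw [e, smul_eq_mul, ← integral_const_mul]
  refine integral_congr_ae (Filter.Eventually.of_forall fun ξ => ?_)
  exact (mul_assoc _ _ _).symm

/-- A distribution is determined by its Mellin transform. -/
theorem IsMellinTransform.injective {f₁ f₂ : 𝓢'(LogPlane, ℂ)} {F : ℂ × ℂ → ℂ}
    (h₁ : IsMellinTransform f₁ F) (h₂ : IsMellinTransform f₂ F) : f₁ = f₂ :=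
  temperedDistribution_ext fun φ hc => by rw [h₁.apply_eq 0 φ hc, h₂.apply_eq 0 φ hc]

theorem exists_mem_functionalSolutions (f : completedRelations) :
    ∃ F : functionalSolutions, IsMellinTransform (f : 𝓢'(LogPlane, ℂ)) (F : ℂ × ℂ → ℂ) := by
  obtain ⟨F, hd, hg, hF⟩ := exists_isMellinTransform f.2.1
  exact ⟨⟨F, mem_functionalSolutions hF hd hg fun h => (f.2.2 h).2⟩, hF⟩

theorem functionalSolutions_unique {f : 𝓢'(LogPlane, ℂ)} {F₁ F₂ : functionalSolutions}
    (h₁ : IsMellinTransform f F₁) (h₂ : IsMellinTransform f F₂) : F₁ = F₂ :=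
  Subtype.ext (h₁.unique h₂ F₁.2.1.continuous F₂.2.1.continuous F₁.2.2.1 F₂.2.2.1)

/-- The Mellin transform on the kernel of the extended Hall product. -/
def mellinMap : completedRelations →ₗ[ℂ] functionalSolutions where
  toFun f := (exists_mem_functionalSolutions f).choose
  map_add' f g := by
    have hf := (exists_mem_functionalSolutions f).choose_spec
    have hg := (exists_mem_functionalSolutions g).choose_spec
    set F := (exists_mem_functionalSolutions f).choose
    set G := (exists_mem_functionalSolutions g).choose
    exact functionalSolutions_unique (exists_mem_functionalSolutions (f + g)).choose_spec
      (hf.add hg F.2.1.continuous G.2.1.continuous F.2.2.1 G.2.2.1)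
  map_smul' c f := functionalSolutions_unique (exists_mem_functionalSolutions (c • f)).choose_spec
    ((exists_mem_functionalSolutions f).choose_spec.smul c)

theorem isMellinTransform_mellinMap (f : completedRelations) :
    IsMellinTransform (f : 𝓢'(LogPlane, ℂ)) (mellinMap f : ℂ × ℂ → ℂ) :=
  (exists_mem_functionalSolutions f).choose_spec

theorem bijective_mellinMap : Function.Bijective mellinMap := by
  refine ⟨fun f g h => Subtype.ext ?_, fun F => ?_⟩
  · have hf := isMellinTransform_mellinMap f
    rw [h] at hf
    exact hf.injective (isMellinTransform_mellinMap g)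
  · obtain ⟨f, hf, hF⟩ := exists_isMellinTransform_of_entire F.2.1 F.2.2.1
    refine ⟨⟨f, hf, fun h => ⟨(hasSum_hallTerm hF F.2.1.continuous F.2.2.1 h).summable,
      extHall_eq_zero hF F.2 h⟩⟩, ?_⟩
    exact functionalSolutions_unique (isMellinTransform_mellinMap _) hF

end HallQuad

end

theorem mainTheorem5 :
    (∀ f ∈ HallQuad.absTempered, ∀ h : TestFunction HallQuad.posForms ℂ ⊤,
      Summable (HallQuad.hallTerm f h)) ∧
    ∃ e : HallQuad.completedRelations ≃ₗ[ℂ] HallQuad.functionalSolutions,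
      ∀ f : HallQuad.completedRelations,
        HallQuad.IsMellinTransform (f : TemperedDistribution HallQuad.LogPlane ℂ) (e f : ℂ × ℂ → ℂ) := by
  refine ⟨fun f hf h => ?_, LinearEquiv.ofBijective HallQuad.mellinMap HallQuad.bijective_mellinMap,
    HallQuad.isMellinTransform_mellinMap⟩
  obtain ⟨F, hd, hg, hF⟩ := HallQuad.exists_isMellinTransform hf
  exact (HallQuad.hasSum_hallTerm hF hd.continuous hg h).summable
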